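/- Let $\nu\ge 1$, $\omega_1,\dots,\omega_\nu,T>0$, and let $\mu$ be a $\mathbb C$-valued Borel measure on $\mathbb R^\nu$ with total variation $|\mu|$ such that $\int e^{R|\xi|}\,d|\mu|(\xi)<\infty$ for every $R>0$. Put $M_\mu=\int e^{5|\xi|}\,d|\mu|(\xi)$, $c(x)=\int e^{ix\cdot\xi}\,d\mu(\xi)$ for $x\in\mathbb C^\nu$, $D=\{a+ib : a,b\in\mathbb R^\nu,\ |b|<2\}\subset\mathbb C^\nu$ and $\mathbb C^+=\{h\in\mathbb C:\operatorname{Re}h>0\}$. For $m\ge1$ let $\mathcal T_m$ be the set of trees on the vertex set $\{1,\dots,m\}$. Edges are written $[j,k]$ with $j<k$. For $g\in\mathcal T_m$, $\theta\in[0,1]^g$ and $j<k$ let $\theta_{j,k,g}$ be the minimum of $\theta$ over the edges of the path joining $j$ and $k$ in $g$. For $s\in[0,1]^m$ and $\xi=(\xi_1,\dots,\xi_m)\in\mathbb R^{\nu m}$ put $$K_t^{j,k}=\sum_{\upsilon=1}^\nu\frac{\operatorname{sh}(\omega_\upsilon ts_j)\operatorname{sh}(\omega_\upsilon t(1-s_k))}{\omega_\upsilon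 t\operatorname{sh}(\omega_\upsilon t)}\,\xi_{j,\upsilon}\xi_{k,\upsilon},\qquad \Upsilon_t^{g,\xi}=\prod_{[j,k]\in g}K_t^{j,k},\qquad \Omega_t^{g,\theta}=\sum_{j=1}^m tK_t^{j,j}+2\sum_{j<k}\theta_{j,k,g}\,tK_t^{j,k},$$ $$q_{t,\upsilon}(s)=\frac{\operatorname{sh}(\omega_\upsilon ts)\,x_\upsilon+\operatorname{sh}(\omega_\upsilon t(1-s))\,y_\upsilon}{\operatorname{sh}(\omega_\upsilon t)},\qquad q_t^m(s)\cdot\xi=\sum_{j=1}^m q_t(s_j)\cdot\xi_j,$$ where the quotients are extended by continuity to $t=0$. With $d\mu^{\otimes m}(\xi)=d\mu(\xi_m)\cdots d\mu(\xi_1)$, define for $m\ge1$ $$Q_m(t,x,y)=(-2)^{m-1}\sum_{g\in\mathcal T_m}\int_{0<s_1<\dots<s_m<1}\int_{\mathbb R^{\nu m}}\Upsilon_t^{g,\xi}\,e^{iq_t^m(s)\cdot\xi}\,d\mu^{\otimes m}(\xi)\,ds,$$ $$w_m(t,x,y,h)=2^{m-1}(-1)^mt^{2m-1}\sum_{g\in\mathcal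 T_m}\int_{0<s_1<\dots<s_m<1}\int_{\mathbb R^{\nu m}}\int_{[0,1]^g\times[0,1]}\Upsilon_t^{g,\xi}\,\Omega_t^{g,\theta}\,e^{-h\vartheta\Omega_t^{g,\theta}}\,e^{iq_t^m(s)\cdot\xi}\,d\vartheta\,d\theta\,d\mu^{\otimes m}(\xi)\,ds$$ (for $m=1$ the only tree has no edge, so $\Upsilon=1$ and there is no integration over $\theta$). **Proposition.** Assume $4T^2M_\mu<1$. Then: 1. The series $\varphi(t,x,y)=\sum_{m\ge1}t^{2m-2}Q_m(t,x,y)$ converges (absolutely) for $t\in\,]-T,T[$, $x,y\in D$, and the series $w(t,x,y,h)=\sum_{m\ge1}w_m(t,x,y,h)$ converges (absolutely) for $t\in[0,T[$, $x,y\in D$, $h\in\mathbb C^+$. 2. $\varphi\in\mathcal C^1(]-T,T[,\mathcal A(D^2))$ and $w\in\mathcal C^1([0,T[,\mathcal A(D^2\times\mathbb C^+))$, where $\mathcal A(\Omega)$ is the Fréchet space of analytic functions on the open set $\Omega$ with the topology of uniform convergence on compact sets. 3. Let $$\phi(t,x,y)=\frac14\sum_{\upsilon=1}^\nu\frac{\omega_\upsilon}{\operatorname{sh}(\omega_\upsilon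 t)}\Big(\operatorname{ch}(\omega_\upsilon t)(x_\upsilon^2+y_\upsilon^2)-2x_\upsilon y_\upsilon\Big)-t\,\varphi(t,x,y)\qquad(0<t<T).$$ The function $$u(t,x,y,h)=(4\pi h)^{-\nu/2}\prod_{\upsilon=1}^\nu\frac{\omega_\upsilon^{1/2}}{\operatorname{sh}^{1/2}(\omega_\upsilon t)}\;e^{-\phi(t,x,y)/h+w(t,x,y,h)}$$ (principal branch of the power) is analytic in $x\in D$ and satisfies, for $0<t<T$, $x,y\in D$, $h\in\mathbb C^+$, $$h\,\partial_tu=h^2\sum_{\upsilon=1}^\nu\partial_{x_\upsilon}^2u-\tfrac14\Big(\sum_{\upsilon=1}^\nu\omega_\upsilon^2x_\upsilon^2\Big)u+c(x)\,u,$$ together with the initial condition $u|_{t=0^+}=\delta_{x=y}$ on $\mathbb R^\nu\times\mathbb R^\nu$ for every $h\in\mathbb C^+$. That is, for $0<t<T$ the integrals below converge absolutely (also with the test function $f$ replaced by $1$), and as $t\to0^+$: $\int u(t,x,y,h)f(x)\,dx\to f(y)$ for every $y\in\mathbb R^\nu$ and $\int u(t,x,y,h)f(y)\,dy\to f(x)$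 for every $x\in\mathbb R^\nu$, for all bounded continuous $f$ on $\mathbb R^\nu$; and $\iint u(t,x,y,h)F(x,y)\,dx\,dy\to\int F(x,x)\,dx$ for all compactly supported continuous $F$ on $\mathbb R^{2\nu}$. -/

import Mathlib

open MeasureTheory Set Filter Topology

noncomputable section

namespace HeatKernelExpansion

/-- The integral `∫ f dμ` of a complex function against a complex measure. -/
def cintegral {X : Type*} [MeasurableSpace X] (μ : ComplexMeasure X) (f : X → ℂ) : ℂ :=
  VectorMeasure.integral μ f (ContinuousLinearMap.mul ℝ ℂ)

/-- The iterated integral `∫ ⋯ ∫ f (ξ₁, …, ξₘ) dμ(ξₘ) ⋯ dμ(ξ₁)`. -/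
def iterIntegral {X : Type*} [MeasurableSpace X] (μ : ComplexMeasure X) :
    (m : ℕ) → ((Fin m → X) → ℂ) → ℂ
  | 0, f => f Fin.elim0
  | m + 1, f =>
      cintegral μ fun ξ₁ => iterIntegral μ m fun ξ => f (Fin.cons ξ₁ ξ)

/-- `M_μ = ∫ e^{5|ξ|} d|μ|(ξ)`, where `|μ|` is the total variation measure. -/
def Mnorm {ν : ℕ} (μ : ComplexMeasure (EuclideanSpace ℝ (Fin ν))) : ℝ :=
  ∫ ξ, Real.exp (5 * ‖ξ‖) ∂(VectorMeasure.variation μ)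

/-- The potential `c(x) = ∫ exp(i x·ξ) dμ(ξ)`, for complex `x` as well. -/
def potential {ν : ℕ} (μ : ComplexMeasure (EuclideanSpace ℝ (Fin ν))) (x : Fin ν → ℂ) : ℂ :=
  cintegral μ fun ξ => Complex.exp (Complex.I * ∑ υ, x υ * (ξ υ : ℂ))

/-- The strip `{a + i b | a, b ∈ ℝ^ν, |b| < R}` of `ℂ^ν` (Euclidean norm of `b`). -/
def strip (ν : ℕ) (R : ℝ) : Set (Fin ν → ℂ) :=
  {z | ‖(WithLp.toLp 2 fun υ => (z υ).im : EuclideanSpace ℝ (Fin ν))‖ < R}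

/-- The open right half plane. -/
def rightHalfPlane : Set ℂ := {h | 0 < h.re}

/-- `sh(ωts) / sh(ωt)`, extended by continuity (value `s`) where `ωt = 0`. -/
def shRatio (ω t s : ℝ) : ℝ :=
  if ω * t = 0 then s else Real.sinh (ω * t * s) / Real.sinh (ω * t)

/-- `sh(ωts) sh(ωt(1-s')) / (ωt sh(ωt))`, extended by continuity (value `s(1-s')`)
where `ωt = 0`. -/
def shKernel (ω t s s' : ℝ) : ℝ :=
  if ω * t = 0 then s * (1 - s')
  else Real.sinh (ω * t * s) * Real.sinh (ω * t * (1 - s')) / (ω * t * Real.sinh (ω * t))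

/-- `q_t(s)`, with coordinates `(sh(ω_υ t s) x_υ + sh(ω_υ t (1-s)) y_υ) / sh(ω_υ t)`. -/
def qPath {ν : ℕ} (ω : Fin ν → ℝ) (t : ℝ) (x y : Fin ν → ℂ) (s : ℝ) (υ : Fin ν) : ℂ :=
  (shRatio (ω υ) t s : ℂ) * x υ + (shRatio (ω υ) t (1 - s) : ℂ) * y υ

/-- `q_t^m(s) · ξ = q_t(s₁)·ξ₁ + ⋯ + q_t(sₘ)·ξₘ`. -/
def qDot {ν m : ℕ} (ω : Fin ν → ℝ) (t : ℝ) (x y : Fin ν → ℂ) (s : Fin m → ℝ)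
    (ξ : Fin m → EuclideanSpace ℝ (Fin ν)) : ℂ :=
  ∑ j, ∑ υ, qPath ω t x y (s j) υ * (ξ j υ : ℂ)

/-- The open simplex `0 < s₁ < ⋯ < sₘ < 1`. -/
def simplex (m : ℕ) : Set (Fin m → ℝ) :=
  {s | StrictMono s ∧ ∀ j, s j ∈ Ioo (0 : ℝ) 1}

/-- `∑_υ sh(ω_υ t s_j) sh(ω_υ t (1-s_k)) / (ω_υ t sh(ω_υ t)) ξ_{j,υ} ξ_{k,υ}`. -/
def pairing {ν m : ℕ} (ω : Fin ν → ℝ) (t : ℝ) (s : Fin m → ℝ)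
    (ξ : Fin m → EuclideanSpace ℝ (Fin ν)) (j k : Fin m) : ℝ :=
  ∑ υ, shKernel (ω υ) t (s j) (s k) * ξ j υ * ξ k υ

open Classical in
/-- `Υ_t^{g,ξ}`: the product of the pairings over the edges `[j,k]`, `j < k`, of `g`. -/
def treeProduct {ν m : ℕ} (ω : Fin ν → ℝ) (t : ℝ) (g : SimpleGraph (Fin m)) (s : Fin m → ℝ)
    (ξ : Fin m → EuclideanSpace ℝ (Fin ν)) : ℝ :=
  ∏ p : Fin m × Fin m with p.1 < p.2 ∧ g.Adj p.1 p.2, pairing ω t s ξ p.1 p.2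

/-- `θ_{j,k,g}`: the minimum of `θ` over the edges of the path joining `j ≠ k` in the tree `g`. -/
def pathMin {m : ℕ} (g : SimpleGraph (Fin m)) (θ : g.edgeSet → ℝ) (j k : Fin m) : ℝ :=
  sInf (θ '' {e | ∃ p : g.Walk j k, p.IsPath ∧ (e : Sym2 (Fin m)) ∈ p.edges})

open Classical in
/-- The quadratic form `Ω_t^{g,θ} . ξ ⊗ₘ ξ`; for `m = 1` it is `Ω_t . ξ ⊗₁ ξ`. -/
def treeForm {ν m : ℕ} (ω : Fin ν → ℝ) (t : ℝ) (g : SimpleGraph (Fin m)) (θ : g.edgeSet → ℝ)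
    (s : Fin m → ℝ) (ξ : Fin m → EuclideanSpace ℝ (Fin ν)) : ℝ :=
  (∑ j, t * pairing ω t s ξ j j) +
    2 * ∑ p : Fin m × Fin m with p.1 < p.2, pathMin g θ p.1 p.2 * (t * pairing ω t s ξ p.1 p.2)

open Classical in
/-- `Q_m(t,x,y)` for `m ≥ 1`. For `m = 1` the only tree has no edge, and the formula reads
`∫_{0<s<1} ∫ e^{i q_t(s)·ξ} dμ(ξ) ds`. -/
def Q {ν : ℕ} (ω : Fin ν → ℝ) (μ : ComplexMeasure (EuclideanSpace ℝ (Fin ν))) (m : ℕ)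
    (t : ℝ) (x y : Fin ν → ℂ) : ℂ :=
  (-2) ^ (m - 1) * ∑ g : SimpleGraph (Fin m) with g.IsTree,
    ∫ s in simplex m, iterIntegral μ m fun ξ =>
      (treeProduct ω t g s ξ : ℂ) * Complex.exp (Complex.I * qDot ω t x y s ξ)

open Classical in
/-- `w_m(t,x,y,h)` for `m ≥ 1`. For `m = 1` the only tree has no edge, and the formula reads
`-t ∫_{0<s<1} ∫ ∫_0^1 (Ω_t . ξ ⊗₁ ξ) e^{-hϑ Ω_t . ξ ⊗₁ ξ} e^{i q_t(s)·ξ} dϑ dμ(ξ) ds`. -/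
def wTerm {ν : ℕ} (ω : Fin ν → ℝ) (μ : ComplexMeasure (EuclideanSpace ℝ (Fin ν))) (m : ℕ)
    (t : ℝ) (x y : Fin ν → ℂ) (h : ℂ) : ℂ :=
  2 ^ (m - 1) * (-1) ^ m * (t : ℂ) ^ (2 * m - 1) * ∑ g : SimpleGraph (Fin m) with g.IsTree,
    ∫ s in simplex m, iterIntegral μ m fun ξ =>
      ∫ θ in Icc (0 : g.edgeSet → ℝ) 1, ∫ ϑ in Icc (0 : ℝ) 1,
        (treeProduct ω t g s ξ : ℂ) * (treeForm ω t g θ s ξ : ℂ) *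
          Complex.exp (-h * ϑ * (treeForm ω t g θ s ξ : ℂ)) *
            Complex.exp (Complex.I * qDot ω t x y s ξ)

/-- The terms `t^{2m-2} Q_m`, with `m = n + 1`, of the series `φ`. -/
def phiTerm {ν : ℕ} (ω : Fin ν → ℝ) (μ : ComplexMeasure (EuclideanSpace ℝ (Fin ν)))
    (t : ℝ) (x y : Fin ν → ℂ) (n : ℕ) : ℂ :=
  (t : ℂ) ^ (2 * n) * Q ω μ (n + 1) t x y

/-- `φ(t,x,y) = ∑_{m ≥ 1} t^{2m-2} Q_m(t,x,y)`. -/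
def phiSeries {ν : ℕ} (ω : Fin ν → ℝ) (μ : ComplexMeasure (EuclideanSpace ℝ (Fin ν)))
    (t : ℝ) (x y : Fin ν → ℂ) : ℂ :=
  ∑' n : ℕ, phiTerm ω μ t x y n

/-- `w(t,x,y,h) = ∑_{m ≥ 1} w_m(t,x,y,h)`. -/
def wSeries {ν : ℕ} (ω : Fin ν → ℝ) (μ : ComplexMeasure (EuclideanSpace ℝ (Fin ν)))
    (t : ℝ) (x y : Fin ν → ℂ) (h : ℂ) : ℂ :=
  ∑' n : ℕ, wTerm ω μ (n + 1) t x y h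

/-- The phase: harmonic phase minus `t` times the series `φ` (used for `t > 0`). -/
def phase {ν : ℕ} (ω : Fin ν → ℝ) (μ : ComplexMeasure (EuclideanSpace ℝ (Fin ν)))
    (t : ℝ) (x y : Fin ν → ℂ) : ℂ :=
  (1 / 4) * (∑ υ, ((ω υ / Real.sinh (ω υ * t) : ℝ) : ℂ) *
      ((Real.cosh (ω υ * t) : ℂ) * (x υ ^ 2 + y υ ^ 2) - 2 * x υ * y υ)) -
    t * phiSeries ω μ t x y

/-- `u = (4πh)^{-ν/2} ∏_υ (ω_υ / sh(ω_υ t))^{1/2} e^{-phase/h + w}` (used for `t > 0`). -/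
def kernelU {ν : ℕ} (ω : Fin ν → ℝ) (μ : ComplexMeasure (EuclideanSpace ℝ (Fin ν)))
    (t : ℝ) (x y : Fin ν → ℂ) (h : ℂ) : ℂ :=
  (4 * (Real.pi : ℂ) * h) ^ (-(ν : ℂ) / 2) *
    (∏ υ, ((Real.sqrt (ω υ) / Real.sqrt (Real.sinh (ω υ * t)) : ℝ) : ℂ)) *
      Complex.exp (-phase ω μ t x y / h + wSeries ω μ t x y h)

/-- `f ∈ C¹(I, 𝒜(Ω))`: each `f t` is analytic on `Ω`, and `f` is continuously differentiable in
`t ∈ I` with values in the Fréchet space of analytic functions on `Ω`, whose topology is that of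
uniform convergence on the compact subsets of `Ω` (one-sided at the end points of `I`). -/
def IsC1Analytic {E : Type*} [NormedAddCommGroup E] [NormedSpace ℂ E]
    (I : Set ℝ) (Ω : Set E) (f : ℝ → E → ℂ) : Prop :=
  (∀ t ∈ I, AnalyticOnNhd ℂ (f t) Ω) ∧
  ∃ f' : ℝ → E → ℂ, (∀ t ∈ I, AnalyticOnNhd ℂ (f' t) Ω) ∧
    ∀ t ∈ I, ∀ K ⊆ Ω, IsCompact K →
      TendstoUniformlyOn f (f t) (𝓝[I] t) K ∧
      TendstoUniformlyOn (fun r z => (f r z - f t z) / ((r - t : ℝ) : ℂ)) (f' t)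
        (𝓝[I \ {t}] t) K ∧
      TendstoUniformlyOn f' (f' t) (𝓝[I] t) K

/-- `h ∂_t u = h² ∂_x² u - (1/4) (ω x)² u + c(x) u` for `t ∈ ]0,T[`, `Re h > 0` and `x, y` in the
strip of width `2`; `u` is analytic in `x` and the space derivatives are complex ones, so that at
real points they are the real partial derivatives. -/
def SolvesHeatEquation {ν : ℕ} (ω : Fin ν → ℝ)
    (μ : ComplexMeasure (EuclideanSpace ℝ (Fin ν))) (T : ℝ)
    (u : ℝ → (Fin ν → ℂ) → (Fin ν → ℂ) → ℂ → ℂ) : Prop :=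
  ∀ t ∈ Ioo 0 T, ∀ y ∈ strip ν 2, ∀ h ∈ rightHalfPlane,
    AnalyticOnNhd ℂ (fun x => u t x y h) (strip ν 2) ∧
    ∀ x ∈ strip ν 2,
      DifferentiableAt ℝ (fun r => u r x y h) t ∧
      h * deriv (fun r => u r x y h) t =
        h ^ 2 * (∑ υ, iteratedDeriv 2 (fun z => u t (Function.update x υ z) y h) (x υ))
          - (1 / 4) * (∑ υ, (ω υ : ℂ) ^ 2 * x υ ^ 2) * u t x y h
          + potential μ x * u t x y h

/-- The inclusion of `ℝ^ν` in `ℂ^ν`. -/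
def toComplex {ν : ℕ} (x : Fin ν → ℝ) : Fin ν → ℂ := fun υ => (x υ : ℂ)

/-- `u|_{t = 0⁺} = δ_{x = y}` on `ℝ^ν × ℝ^ν`, for every `h` with `Re h > 0`: in the variable `x`
for fixed `y`, in the variable `y` for fixed `x` (both tested against bounded continuous
functions), and as distributions in `(x, y)` (tested against compactly supported continuous
functions). -/
def HasDeltaInitialValue {ν : ℕ} (T : ℝ)
    (u : ℝ → (Fin ν → ℂ) → (Fin ν → ℂ) → ℂ → ℂ) : Prop :=
  ∀ h ∈ rightHalfPlane,
    (∀ y : Fin ν → ℝ,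
      (∀ t ∈ Ioo 0 T, Integrable fun x : Fin ν → ℝ => u t (toComplex x) (toComplex y) h) ∧
      ∀ f : BoundedContinuousFunction (Fin ν → ℝ) ℂ,
        Tendsto (fun t => ∫ x : Fin ν → ℝ, u t (toComplex x) (toComplex y) h * f x)
          (𝓝[>] 0) (𝓝 (f y))) ∧
    (∀ x : Fin ν → ℝ,
      (∀ t ∈ Ioo 0 T, Integrable fun y : Fin ν → ℝ => u t (toComplex x) (toComplex y) h) ∧
      ∀ f : BoundedContinuousFunction (Fin ν → ℝ) ℂ,
        Tendsto (fun t => ∫ y : Fin ν → ℝ, u t (toComplex x) (toComplex y) h * f y)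
          (𝓝[>] 0) (𝓝 (f x))) ∧
    (∀ F : (Fin ν → ℝ) × (Fin ν → ℝ) → ℂ, Continuous F → HasCompactSupport F →
      (∀ t ∈ Ioo 0 T, Integrable fun p : (Fin ν → ℝ) × (Fin ν → ℝ) =>
        u t (toComplex p.1) (toComplex p.2) h * F p) ∧
      Tendsto (fun t => ∫ p : (Fin ν → ℝ) × (Fin ν → ℝ),
          u t (toComplex p.1) (toComplex p.2) h * F p)
        (𝓝[>] 0) (𝓝 (∫ x : Fin ν → ℝ, F (x, x))))

end HeatKernelExpansion

end

/-! The kernel is the Mehler kernel of the harmonic oscillator times a correction, `gasSum`.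
Expanding in powers of the potential (Dyson or Feynman–Kac series) presents the correction as the
partition function of a classical gas: a particle carries a time s_j in [0,1] and a frequency ξ_j
distributed by μ, has an activity of size t/|h|, and interacts with another particle through
exp(-2ht K^{j,k}), where K is the Dirichlet Green function of the oscillator in rescaled times. For
Re h ≥ 0 positive definiteness of K bounds each Boltzmann factor by (t/|h|)^n exp(2 ∑ |ξ_j|) in the
strips, and the factor 1/n! makes this series converge for every t ≥ 0.

The substance of the theorem is an explicit logarithm of this partition function. The
Brydges–Kennedy formula `sum_forestWeight` writes exp(-∑ V_{jk}) as a sum over forests. The weights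
are multiplicative over disjoint unions (`IsSplitting.forestWeight_joinGraph`), so splitting off the
component of a marked particle (`pairExp_eq_sum_treeSum`) leaves a sum over trees times a smaller
gas. After integration this is the recursion between the coefficients of a series and those of its
exponential (`tsum_eq_exp_tsum`), whence `exp_treeSeries`: `gasSum` is exp((t/h) `treeSeries`(h)). A
tree on n+1 vertices has n edges, each with a factor -2ht, against n+1 activities t/h, so a single
negative power of h survives. The value of `treeSeries` at h = 0 is φ, and t/h times the difference
of its values at h and at 0 is w (`phiTerm_eq`, `wTerm_eq`); the variable ϑ only writes that
difference as an integral.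

Convergence rests on `sum_trees_weight_le`: trees are dominated by arbitrary parent maps, which
gives n! times an exponential in ∑ |ξ_j|. The volume of the simplex supplies 1/(n+1)!, and a
geometric series of ratio 2T²M_μ remains, even after one differentiation in t. For Re h > 0 one also
needs the tree forms Ω ≥ 0: interpolation by path minima is a nonnegative combination of
restrictions of a positive form to blocks (`pairMin_form_nonneg`). Sums and integrals are merged
into one integral over a disjoint union, so dominated convergence, together with Osgood's lemma,
yields C¹ dependence with analytic values (`C1Family.isC1Analytic`).

The heat equation is checked on `gasSum` (`hasDerivAt_gasSum`). In the unscaled times τ = ts the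
derivative of an integral over [0,t]^n has a bulk part, which is drift times first derivatives plus
h times second derivatives in x because the t-derivative of the Green function has rank one
(`hasDerivAt_green`), and a boundary part, where a particle at τ = t decouples and contributes
c(x)/h (`flow_consAt`). The Hamilton–Jacobi and transport equations of the harmonic factor do the
rest. For the initial value, at real points |`gasSum` - 1| ≤ exp(t|μ|/|h|) - 1 uniformly, with |μ|
the total mass, and the Mehler kernel is an approximate identity after x = y + √t z. -/

noncomputable section

namespace HeatKernelExpansion

/-! ### Holomorphic functions of several variables -/

/-- `f` is continuous on `U` and complex differentiable along complex lines. -/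
def LineHolomorphic {E F : Type} [NormedAddCommGroup E] [NormedSpace ℂ E]
    [NormedAddCommGroup F] [NormedSpace ℂ F] (f : E → F) (U : Set E) : Prop :=
  ContinuousOn f U ∧ ∀ z ∈ U, ∀ v, DifferentiableAt ℂ (fun l : ℂ => f (z + l • v)) 0

section Osgood

variable {S : Type} [TopologicalSpace S] [CompactSpace S]
  {F : Type} [NormedCommRing F] [NormedAlgebra ℂ F] [CompleteSpace F]

/-- The functional `φ ↦ ∫ c(θ) φ(γ(θ)) dθ` on continuous functions. -/
def pathFunctional (γ : C(ℝ, S)) (c : C(ℝ, ℂ)) (a b : ℝ) : C(S, F) →L[ℂ] F := by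
  have hint : ∀ φ : C(S, F), IntervalIntegrable (fun θ => c θ • φ (γ θ)) volume a b := fun φ =>
    (by fun_prop : Continuous fun θ => c θ • φ (γ θ)).intervalIntegrable _ _
  have hc : ∃ M, ∀ θ ∈ uIcc a b, ‖c θ‖ ≤ M :=
    isCompact_uIcc.exists_bound_of_continuousOn c.continuous.continuousOn
  refine LinearMap.mkContinuous
    { toFun := fun φ => ∫ θ in a..b, c θ • φ (γ θ)
      map_add' := fun φ ψ => by
        simp only [ContinuousMap.add_apply, smul_add]
        exact intervalIntegral.integral_add (hint φ) (hint ψ)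
      map_smul' := fun k φ => by
        simp only [ContinuousMap.smul_apply, RingHom.id_apply]
        rw [← intervalIntegral.integral_smul]
        simp only [smul_comm k] } (hc.choose * |b - a|) fun φ => ?_
  have : ∀ θ ∈ uIoc a b, ‖c θ • φ (γ θ)‖ ≤ hc.choose * ‖φ‖ := fun θ hθ => by
    rw [norm_smul]
    have h1 := hc.choose_spec θ (uIoc_subset_uIcc hθ)
    exact mul_le_mul h1 (φ.norm_coe_le_norm _) (norm_nonneg _) ((norm_nonneg _).trans h1)
  have h2 := intervalIntegral.norm_integral_le_of_norm_le_const this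
  simp only [LinearMap.coe_mk, AddHom.coe_mk]
  linarith

omit [CompleteSpace F] in
theorem pathFunctional_apply (γ : C(ℝ, S)) (c : C(ℝ, ℂ)) (a b : ℝ) (φ : C(S, F)) :
    pathFunctional γ c a b φ = ∫ θ in a..b, c θ • φ (γ θ) := rfl

end Osgood

/-- The space `E` satisfies Osgood's lemma. -/
def OsgoodProperty (E : Type) [NormedAddCommGroup E] [NormedSpace ℂ E] : Prop :=
  ∀ (F : Type) [NormedCommRing F] [NormedAlgebra ℂ F] [CompleteSpace F] (f : E → F) (U : Set E),
    IsOpen U → LineHolomorphic f U → AnalyticOnNhd ℂ f U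

theorem OsgoodProperty.of_equiv {E E' : Type} [NormedAddCommGroup E] [NormedSpace ℂ E]
    [NormedAddCommGroup E'] [NormedSpace ℂ E'] (e : E ≃L[ℂ] E') (h : OsgoodProperty E) :
    OsgoodProperty E' := by
  intro F _ _ _ f U hU hf
  have h1 : LineHolomorphic (f ∘ e) (e ⁻¹' U) :=
    ⟨hf.1.comp e.continuous.continuousOn fun _ hx => hx, fun z hz v => by
      simpa using hf.2 (e z) hz (e v)⟩
  have h2 := h F (f ∘ e) (e ⁻¹' U) (hU.preimage e.continuous) h1
  intro z hz
  have h3 := (h2 (e.symm z) (by simpa using hz)).comp_of_eq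
    ((e.symm : E' →L[ℂ] E).analyticAt z) rfl
  refine h3.congr (Eventually.of_forall fun y => by simp)

theorem LineHolomorphic.differentiableOn_line {E F : Type} [NormedAddCommGroup E] [NormedSpace ℂ E]
    [NormedAddCommGroup F] [NormedSpace ℂ F] {f : E → F} {U : Set E} (hf : LineHolomorphic f U)
    (z v : E) : DifferentiableOn ℂ (fun l : ℂ => f (z + l • v)) {l | z + l • v ∈ U} := by
  intro l hl
  have h1 := hf.2 _ hl v
  have h2 : DifferentiableAt ℂ (fun k : ℂ => k - l) l := by fun_prop
  have h3 := DifferentiableAt.comp (f := fun k : ℂ => k - l) l (by simpa using h1) h2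
  refine (h3.congr_of_eventuallyEq (Eventually.of_forall fun k => ?_)).differentiableWithinAt
  simp only [Function.comp]
  congr 1
  rw [add_assoc, ← add_smul]; simp

/-- Pointwise holomorphy becomes norm holomorphy once continuity in the sup norm is known. The
Cauchy integral of the `C(S, F)`-valued map over a small circle is analytic, evaluation at each
point of `S` commutes with it, and Cauchy's formula for the evaluated map identifies it with the map
itself. -/
theorem lineHolomorphic_curry {E : Type} [NormedAddCommGroup E] [NormedSpace ℂ E]
    {S : Type} [TopologicalSpace S] [CompactSpace S]
    {F : Type} [NormedCommRing F] [NormedAlgebra ℂ F] [CompleteSpace F]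
    {U : Set E} (hU : IsOpen U) (Ψ : E → C(S, F)) (hΨ : ContinuousOn Ψ U)
    (h : ∀ z ∈ U, ∀ v s, DifferentiableAt ℂ (fun l : ℂ => Ψ (z + l • v) s) 0) :
    LineHolomorphic Ψ U := by
  refine ⟨hΨ, fun z hz v => ?_⟩
  have hcl : Continuous fun l : ℂ => z + l • v := by fun_prop
  have hn : {l : ℂ | z + l • v ∈ U} ∈ 𝓝 (0 : ℂ) :=
    (hU.preimage hcl).mem_nhds (by simpa using hz)
  obtain ⟨δ, hδ, hδU⟩ := Metric.nhds_basis_closedBall.mem_iff.1 hn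
  have hcont : ContinuousOn (fun l : ℂ => Ψ (z + l • v)) (Metric.closedBall 0 δ) :=
    hΨ.comp hcl.continuousOn fun l hl => hδU hl
  lift δ to NNReal using hδ.le
  have hci : CircleIntegrable (fun l : ℂ => Ψ (z + l • v)) 0 δ :=
    (hcont.mono Metric.sphere_subset_closedBall).circleIntegrable δ.2
  have hps := hasFPowerSeriesOn_cauchy_integral hci (by simpa using hδ)
  refine (hps.analyticAt.differentiableAt).congr_of_eventuallyEq ?_
  filter_upwards [Metric.ball_mem_nhds (0 : ℂ) hδ] with l hl
  ext s
  have hd : DifferentiableOn ℂ (fun k : ℂ => Ψ (z + k • v) s) (Metric.closedBall 0 δ) := by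
    have hl' : LineHolomorphic (fun y => Ψ y s) U :=
      ⟨fun y hy => ((ContinuousMap.evalCLM ℂ s : C(S, F) →L[ℂ] F).continuous.continuousAt.comp_continuousWithinAt
        (hΨ y hy)), fun y hy w => h y hy w s⟩
    exact (hl'.differentiableOn_line z v).mono hδU
  have hc := hd.circleIntegral_sub_inv_smul hl
  have hcomm := (ContinuousMap.evalCLM ℂ s : C(S, F) →L[ℂ] F).intervalIntegral_comp_comm
    (μ := volume) (a := 0) (b := 2 * Real.pi)
    (f := fun θ => deriv (circleMap 0 δ) θ • (circleMap 0 δ θ - l)⁻¹ •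
      Ψ (z + circleMap 0 δ θ • v)) (by
      refine ContinuousOn.intervalIntegrable (Continuous.continuousOn ?_)
      simp only [deriv_circleMap]
      refine Continuous.fun_smul ((continuous_circleMap 0 _).mul continuous_const)
        (Continuous.fun_smul ?_ ?_)
      · refine Continuous.inv₀ ((continuous_circleMap 0 _).sub continuous_const) fun θ hθ => ?_
        rw [sub_eq_zero] at hθ
        rw [← hθ] at hl
        simp [abs_of_pos hδ] at hl
      · exact hcont.comp_continuous (continuous_circleMap 0 δ) fun θ => by simp)
  simp only [circleIntegral, ContinuousMap.smul_apply, ContinuousMap.evalCLM_apply] at hc hcomm ⊢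
  rw [← hcomm, hc, smul_smul, inv_mul_cancel₀ Complex.two_pi_I_ne_zero, one_smul]

/-- Cauchy's formula in the last variable over a circle `S`: z ↦ f(z, ·) is line-holomorphic into
the Banach algebra `C(S, F)`, hence analytic by hypothesis, and the Cauchy kernel is analytic in w
as an inverse in the same algebra. This is why the Osgood property quantifies over all commutative
Banach algebra targets: the induction changes the target. -/
theorem OsgoodProperty.prod {E : Type} [NormedAddCommGroup E] [NormedSpace ℂ E]
    (h : OsgoodProperty E) : OsgoodProperty (E × ℂ) := by
  intro F _ _ _ f U hU hf
  rintro ⟨z₀, w₀⟩ hz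
  obtain ⟨r, hr, hrU⟩ := Metric.nhds_basis_closedBall.mem_iff.1 (hU.mem_nhds hz)
  have hsub : ∀ z ∈ Metric.closedBall z₀ r, ∀ w ∈ Metric.closedBall w₀ r, (z, w) ∈ U :=
    fun z hz w hw => hrU (by rw [← closedBall_prod_same]; exact ⟨hz, hw⟩)
  let S := Metric.sphere w₀ r
  have hS : ∀ s : S, (s : ℂ) ∈ Metric.closedBall w₀ r := fun s =>
    Metric.sphere_subset_closedBall s.2
  let g : C(Metric.closedBall z₀ r × S, F) := ⟨fun p => f (p.1, p.2),
    hf.1.comp_continuous (by fun_prop) fun p => hsub _ p.1.2 _ (hS p.2)⟩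
  classical
  let Ψ : E → C(S, F) := fun z => if hz : z ∈ Metric.closedBall z₀ r then g.curry ⟨z, hz⟩ else 0
  have hΨv : ∀ z ∈ Metric.closedBall z₀ r, ∀ s, Ψ z s = f (z, s) := fun z hz s => by
    simp only [Ψ, dif_pos hz]; rfl
  have hΨc : ContinuousOn Ψ (Metric.ball z₀ r) := by
    refine ContinuousOn.mono (s := Metric.closedBall z₀ r) ?_ Metric.ball_subset_closedBall
    rw [continuousOn_iff_continuous_domRestrict]
    refine g.curry.continuous.congr fun z => ?_
    simp only [Set.domRestrict_apply, Ψ, dif_pos z.2]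
  have hΨ : LineHolomorphic Ψ (Metric.ball z₀ r) := by
    refine lineHolomorphic_curry Metric.isOpen_ball Ψ hΨc fun z hz v s => ?_
    have h1 := hf.2 (z, s) (hsub _ (Metric.ball_subset_closedBall hz) _ (hS s)) (v, 0)
    refine h1.congr_of_eventuallyEq ?_
    have : ∀ᶠ l : ℂ in 𝓝 0, z + l • v ∈ Metric.ball z₀ r := by
      have hc : ContinuousAt (fun l : ℂ => z + l • v) 0 := by fun_prop
      exact hc (Metric.isOpen_ball.mem_nhds (by simpa using hz))
    filter_upwards [this] with l hl
    rw [hΨv _ (Metric.ball_subset_closedBall hl)]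
    simp
  have hΨa := h C(S, F) Ψ _ Metric.isOpen_ball hΨ z₀ (Metric.mem_ball_self hr)
  let γ : C(ℝ, S) := ⟨fun θ => ⟨circleMap w₀ r θ, circleMap_mem_sphere _ hr.le _⟩, by fun_prop⟩
  let c : C(ℝ, ℂ) := ⟨fun θ => (2 * Real.pi * Complex.I : ℂ)⁻¹ * deriv (circleMap w₀ r) θ, by
    simp only [deriv_circleMap]; fun_prop⟩
  let idS : C(S, F) := ⟨fun s => algebraMap ℂ F s, by fun_prop⟩
  have hinv : ∀ w ∈ Metric.ball w₀ r, ∀ s : S, (s : ℂ) - w ≠ 0 := fun w hw s hs => by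
    rw [sub_eq_zero] at hs
    rw [← hs] at hw
    have := s.2
    simp only [S, Metric.mem_sphere] at this
    simp [this] at hw
  let kinv : ∀ w ∈ Metric.ball w₀ r, C(S, F) := fun w hw =>
    ⟨fun s => algebraMap ℂ F ((s : ℂ) - w)⁻¹, by
      have : Continuous fun s : S => ((s : ℂ) - w)⁻¹ :=
        Continuous.inv₀ (by fun_prop) (hinv w hw)
      fun_prop⟩
  -- s ↦ s - w is a unit of `C(S, F)` for w inside the circle, so analyticity of the Cauchy kernel
  -- in w is analyticity of inversion at a unit.
  let K : ∀ w ∈ Metric.ball w₀ r, C(S, F)ˣ := fun w hw =>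
    ⟨idS - algebraMap ℂ C(S, F) w, kinv w hw, by
      ext s
      have : (algebraMap ℂ F s - algebraMap ℂ F w) * algebraMap ℂ F ((s : ℂ) - w)⁻¹ = 1 := by
        rw [← map_sub, ← map_mul, mul_inv_cancel₀ (hinv w hw s), map_one]
      exact this, by
      ext s
      have : algebraMap ℂ F ((s : ℂ) - w)⁻¹ * (algebraMap ℂ F s - algebraMap ℂ F w) = 1 := by
        rw [← map_sub, ← map_mul, inv_mul_cancel₀ (hinv w hw s), map_one]
      exact this⟩
  have hka : AnalyticAt ℂ (fun w : ℂ => Ring.inverse (idS - algebraMap ℂ C(S, F) w)) w₀ := by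
    have h1 : AnalyticAt ℂ (fun w : ℂ => idS - algebraMap ℂ C(S, F) w) w₀ :=
      analyticAt_const.sub ((Algebra.linearMap ℂ C(S, F)).toContinuousLinearMap.analyticAt w₀)
    exact (analyticAt_inverse (K w₀ (Metric.mem_ball_self hr))).comp_of_eq h1 rfl
  have hfin : AnalyticAt ℂ (fun p : E × ℂ => pathFunctional γ c 0 (2 * Real.pi)
      (Ring.inverse (idS - algebraMap ℂ C(S, F) p.2) * Ψ p.1)) (z₀, w₀) := by
    have h1 : AnalyticAt ℂ (fun p : E × ℂ => Ring.inverse (idS - algebraMap ℂ C(S, F) p.2))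
        (z₀, w₀) := hka.comp_of_eq analyticAt_snd rfl
    have h2 : AnalyticAt ℂ (fun p : E × ℂ => Ψ p.1) (z₀, w₀) := hΨa.comp_of_eq analyticAt_fst rfl
    exact (ContinuousLinearMap.analyticAt _ _).comp (h1.mul h2)
  refine hfin.congr ?_
  filter_upwards [prod_mem_nhds (Metric.ball_mem_nhds z₀ hr) (Metric.ball_mem_nhds w₀ hr)]
    with p hp
  obtain ⟨z, w⟩ := p
  obtain ⟨hz, hw⟩ := hp
  have hz' := Metric.ball_subset_closedBall hz
  simp only [pathFunctional_apply]
  have hki : Ring.inverse (idS - algebraMap ℂ C(S, F) w) = kinv w hw := Ring.inverse_unit (K w hw)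
  rw [hki]
  have hd : DifferentiableOn ℂ (fun k : ℂ => f (z, k)) (Metric.closedBall w₀ r) := by
    have := (hf.differentiableOn_line (z, 0) (0, 1)).mono
      (show Metric.closedBall w₀ r ⊆ _ from fun k hk => by simpa using hsub z hz' k hk)
    simpa using this
  have hc := hd.circleIntegral_sub_inv_smul hw
  have h3 : f (z, w) = (2 * Real.pi * Complex.I : ℂ)⁻¹ •
      ∮ k in C(w₀, r), (k - w)⁻¹ • f (z, k) := by
    rw [hc, smul_smul, inv_mul_cancel₀ Complex.two_pi_I_ne_zero, one_smul]
  rw [h3, circleIntegral, ← intervalIntegral.integral_smul]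
  refine intervalIntegral.integral_congr fun θ _ => ?_
  simp only [ContinuousMap.mul_apply, hΨv z hz', c, γ, kinv, ContinuousMap.coe_mk,
    Algebra.smul_def, map_mul, mul_assoc]

/-- Induction on the dimension: a space of dimension n+1 is isomorphic to ℂⁿ × ℂ, and one complex
coordinate is split off each time. -/
theorem osgoodProperty_of_finrank (n : ℕ) : ∀ (E : Type) [NormedAddCommGroup E] [NormedSpace ℂ E]
    [FiniteDimensional ℂ E], Module.finrank ℂ E = n → OsgoodProperty E := by
  induction n with
  | zero =>
    intro E _ _ _ hE F _ _ _ f U hU hf z hz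
    have := Module.finrank_zero_iff.1 hE
    exact (analyticAt_const (v := f z)).congr (Eventually.of_forall fun y => by
      simp [Subsingleton.elim y z])
  | succ n ih =>
    intro E _ _ _ hE
    have h1 := (ih (Fin n → ℂ) (by simp)).prod
    exact h1.of_equiv (ContinuousLinearEquiv.ofFinrankEq (by simp [hE]))

/-- **Osgood's lemma**: a continuous function which is holomorphic along complex lines is
analytic. -/
theorem LineHolomorphic.analyticOnNhd {E : Type} [NormedAddCommGroup E] [NormedSpace ℂ E]
    [FiniteDimensional ℂ E] {f : E → ℂ} {U : Set E} (hf : LineHolomorphic f U) (hU : IsOpen U) :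
    AnalyticOnNhd ℂ f U :=
  osgoodProperty_of_finrank _ E rfl ℂ f U hU hf

/-! ### Integrals depending on a real and on complex parameters -/

section Parametric

variable {A : Type} [MeasurableSpace A] {ρ : Measure A}
  {E : Type} [NormedAddCommGroup E] [NormedSpace ℂ E]

/-- Continuity of `∫ F t z a dρ(a)` in `(t, z)` under local domination. -/
theorem continuousOn_integral_of_dominated {X : Type} [TopologicalSpace X]
    [FirstCountableTopology X] {s : Set X} {F : X → A → ℂ}
    (hm : ∀ x ∈ s, AEStronglyMeasurable (F x) ρ)
    (hc : ∀ᵐ a ∂ρ, ContinuousOn (fun x => F x a) s)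
    (hb : ∀ x ∈ s, ∃ U ∈ 𝓝[s] x, ∃ B : A → ℝ, Integrable B ρ ∧ ∀ᵐ a ∂ρ, ∀ y ∈ U, ‖F y a‖ ≤ B a) :
    ContinuousOn (fun x => ∫ a, F x a ∂ρ) s := by
  intro x hx
  obtain ⟨U, hU, B, hB, hb⟩ := hb x hx
  refine continuousWithinAt_of_dominated (bound := B) ?_ ?_ hB ?_
  · filter_upwards [self_mem_nhdsWithin] with y hy using hm y hy
  · filter_upwards [hU] with y hy
    filter_upwards [hb] with a ha using ha y hy
  · filter_upwards [hc] with a ha using ha x hx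

/-- Only the integrand has to be dominated. For |l| < δ/2 the circle of radius δ/2 about l stays in
the disc of radius δ, so the Cauchy estimate bounds the derivative along the line by B/(δ/2), and
differentiation under the integral sign applies. -/
theorem lineHolomorphic_integral {Ω : Set E} (hΩ : IsOpen Ω) {F : E → A → ℂ}
    (hm : ∀ z ∈ Ω, AEStronglyMeasurable (F z) ρ)
    (hd : ∀ᵐ a ∂ρ, DifferentiableOn ℂ (fun z => F z a) Ω)
    (hb : ∀ z ∈ Ω, ∃ U ∈ 𝓝 z, ∃ B : A → ℝ, Integrable B ρ ∧
      ∀ᵐ a ∂ρ, ∀ y ∈ U ∩ Ω, ‖F y a‖ ≤ B a) :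
    LineHolomorphic (fun z => ∫ a, F z a ∂ρ) Ω := by
  refine ⟨continuousOn_integral_of_dominated hm (hd.mono fun a ha => ha.continuousOn)
    fun z hz => ?_, fun z hz v => ?_⟩
  · obtain ⟨U, hU, B, hB, h⟩ := hb z hz
    exact ⟨U ∩ Ω, inter_mem (mem_nhdsWithin_of_mem_nhds hU) self_mem_nhdsWithin, B, hB, h⟩
  obtain ⟨U, hU, B, hB, h⟩ := hb z hz
  have hcl : Continuous fun l : ℂ => z + l • v := by fun_prop
  have hn : {l : ℂ | z + l • v ∈ U ∩ Ω} ∈ 𝓝 (0 : ℂ) :=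
    hcl.continuousAt (by simpa using inter_mem hU (hΩ.mem_nhds hz))
  obtain ⟨δ, hδ, hδU⟩ := Metric.nhds_basis_closedBall.mem_iff.1 hn
  have hline : ∀ a, DifferentiableOn ℂ (fun z => F z a) Ω →
      DifferentiableOn ℂ (fun l : ℂ => F (z + l • v) a) (Metric.closedBall 0 δ) := fun a ha =>
    ha.comp (f := fun l : ℂ => z + l • v) (by fun_prop) fun l hl => (hδU hl).2
  have hlineAt : ∀ a, DifferentiableOn ℂ (fun z => F z a) Ω → ∀ l ∈ Metric.ball (0 : ℂ) δ,
      DifferentiableAt ℂ (fun l : ℂ => F (z + l • v) a) l := fun a ha l hl =>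
    (hline a ha).differentiableAt
      (mem_of_superset (Metric.isOpen_ball.mem_nhds hl) Metric.ball_subset_closedBall)
  have hm' : ∀ l ∈ Metric.ball (0 : ℂ) δ, AEStronglyMeasurable (F (z + l • v)) ρ := fun l hl =>
    hm _ (hδU (Metric.ball_subset_closedBall hl)).2
  have h0 : (0 : ℂ) ∈ Metric.ball (0 : ℂ) δ := Metric.mem_ball_self hδ
  refine (hasDerivAt_integral_of_dominated_loc_of_deriv_le (μ := ρ)
    (F := fun (l : ℂ) a => F (z + l • v) a)
    (F' := fun l a => deriv (fun l : ℂ => F (z + l • v) a) l)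
    (bound := fun a => B a / (δ / 2)) (s := Metric.ball 0 (δ / 2))
    (Metric.ball_mem_nhds _ (by positivity)) ?_ ?_ ?_ ?_ (hB.div_const _) ?_).2.differentiableAt
  · filter_upwards [Metric.ball_mem_nhds (0 : ℂ) hδ] with l hl using hm' l hl
  · refine hB.mono' (hm' 0 h0) ?_
    filter_upwards [h] with a ha
    exact ha _ (hδU (Metric.ball_subset_closedBall h0))
  -- The derivative at 0 is measurable in the parameter as the limit of difference quotients along
  -- one fixed sequence tending to 0 inside the disc.
  · let l : ℕ → ℂ := fun n => ((δ / 2) / (n + 1 : ℝ) : ℝ)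
    have hl0 : Tendsto l atTop (𝓝[≠] 0) := by
      refine tendsto_nhdsWithin_iff.2 ⟨?_, Eventually.of_forall fun n => ?_⟩
      · have := (tendsto_one_div_add_atTop_nhds_zero_nat (𝕜 := ℝ)).const_mul (δ / 2)
        rw [mul_zero] at this
        have h2 := (Complex.continuous_ofReal.tendsto 0).comp this
        refine h2.congr fun n => ?_
        simp only [l, Function.comp]; push_cast; ring
      · simp only [l, mem_compl_iff, mem_singleton_iff, Complex.ofReal_eq_zero]; positivity
    refine aestronglyMeasurable_of_tendsto_ae atTop
      (f := fun n a => (l n)⁻¹ * (F (z + l n • v) a - F (z + (0 : ℂ) • v) a)) (fun n => ?_) ?_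
    · refine AEStronglyMeasurable.const_mul ((hm' _ ?_).sub (hm' 0 h0)) _
      simp only [l, Metric.mem_ball, dist_zero_right, Complex.norm_real, Real.norm_eq_abs]
      rw [abs_of_pos (by positivity), div_div, div_lt_iff₀ (by positivity)]
      have : (0 : ℝ) ≤ n := n.cast_nonneg
      nlinarith
    · filter_upwards [hd] with a ha
      have := (hlineAt a ha 0 h0).hasDerivAt.tendsto_slope.comp hl0
      refine this.congr fun n => ?_
      simp [slope, Function.comp]
  · filter_upwards [hd, h] with a ha hba l hl
    refine Complex.norm_deriv_le_of_forall_mem_sphere_norm_le (by positivity) ?_ ?_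
    · refine ((hline a ha).mono ?_).diffContOnCl_ball subset_rfl
      intro k hk
      simp only [Metric.mem_closedBall, Metric.mem_ball, dist_eq_norm, sub_zero] at hk hl ⊢
      calc ‖k‖ = ‖k - l + l‖ := by ring_nf
        _ ≤ δ := (norm_add_le _ _).trans (by linarith)
    · intro k hk
      refine hba _ (hδU ?_)
      simp only [Metric.mem_closedBall, mem_sphere_iff_norm, Metric.mem_ball, dist_zero_right] at *
      calc ‖k‖ = ‖k - l + l‖ := by ring_nf
        _ ≤ δ := (norm_add_le _ _).trans (by linarith)
  · filter_upwards [hd] with a ha l hl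
    exact (hlineAt a ha l (Metric.ball_subset_ball (by linarith) hl)).hasDerivAt

theorem tendstoUniformlyOn_of_continuousOn {X : Type} [TopologicalSpace X] {I : Set ℝ} {Ω : Set X}
    {g : ℝ → X → ℂ}
    (hg : ContinuousOn (fun p : ℝ × X => g p.1 p.2) (I ×ˢ Ω)) {t : ℝ} (ht : t ∈ I) {K : Set X}
    (hK : K ⊆ Ω) (hKc : IsCompact K) : TendstoUniformlyOn g (g t) (𝓝[I] t) K := by
  rw [← tendstoLocallyUniformlyOn_iff_tendstoUniformlyOn_of_compact hKc,
    Metric.tendstoLocallyUniformlyOn_iff]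
  intro ε hε z hz
  have h1 := Metric.tendsto_nhds.1 (hg (t, z) ⟨ht, hK hz⟩) (ε / 2) (by positivity)
  rw [nhdsWithin_prod_eq] at h1
  obtain ⟨p, hp, q, hq, hpq⟩ := eventually_prod_iff.1 h1
  refine ⟨{x | q x} ∩ K, inter_mem (nhdsWithin_mono _ hK hq) self_mem_nhdsWithin, ?_⟩
  filter_upwards [hp] with r hr y hy
  have e1 := hpq hr hy.1
  have e2 := hpq (hp.self_of_nhdsWithin ht) hy.1
  simp only at e1 e2
  calc dist (g t y) (g r y) ≤ dist (g t y) (g t z) + dist (g r y) (g t z) := dist_triangle_right _ _ _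
    _ < ε := by linarith

/-- Hypotheses for `C¹` dependence of `∫ F t z a dρ(a)` on `t`, with values in the analytic
functions of `z`. -/
structure C1Family (ρ : Measure A) (I : Set ℝ) (Ω : Set E) (F F' : ℝ → E → A → ℂ) : Prop where
  meas : ∀ t ∈ I, ∀ z ∈ Ω, AEStronglyMeasurable (F t z) ρ ∧ AEStronglyMeasurable (F' t z) ρ
  cont : ∀ᵐ a ∂ρ, ContinuousOn (fun p : ℝ × E => F' p.1 p.2 a) (I ×ˢ Ω)
  cont₀ : ∀ᵐ a ∂ρ, ContinuousOn (fun p : ℝ × E => F p.1 p.2 a) (I ×ˢ Ω)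
  deriv : ∀ᵐ a ∂ρ, ∀ t ∈ I, ∀ z ∈ Ω, HasDerivWithinAt (fun r => F r z a) (F' t z a) I t
  hol : ∀ᵐ a ∂ρ, ∀ t ∈ I, DifferentiableOn ℂ (fun z => F t z a) Ω
  hol' : ∀ᵐ a ∂ρ, ∀ t ∈ I, DifferentiableOn ℂ (fun z => F' t z a) Ω
  bound : ∀ z ∈ Ω, ∃ U ∈ 𝓝 z, ∃ B : A → ℝ, Integrable B ρ ∧
    ∀ᵐ a ∂ρ, ∀ t ∈ I, ∀ y ∈ U ∩ Ω, ‖F t y a‖ ≤ B a ∧ ‖F' t y a‖ ≤ B a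

/-- Joint continuity on a compact set gives the locally uniform limits of f and f'. For the
difference quotients, the mean value inequality is applied to r ↦ f r z - r f' t z, whose derivative
f' r z - f' t z is small uniformly in z ∈ K when r is near t. -/
theorem isC1Analytic_of_hasDerivWithinAt [FiniteDimensional ℂ E] {I : Set ℝ} (hI : Convex ℝ I)
    {Ω : Set E} {f f' : ℝ → E → ℂ}
    (hf : ∀ t ∈ I, AnalyticOnNhd ℂ (f t) Ω) (hf' : ∀ t ∈ I, AnalyticOnNhd ℂ (f' t) Ω)
    (hc : ContinuousOn (fun p : ℝ × E => f p.1 p.2) (I ×ˢ Ω))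
    (hc' : ContinuousOn (fun p : ℝ × E => f' p.1 p.2) (I ×ˢ Ω))
    (hd : ∀ t ∈ I, ∀ z ∈ Ω, HasDerivWithinAt (fun r => f r z) (f' t z) I t) :
    IsC1Analytic I Ω f := by
  refine ⟨hf, f', hf', fun t ht K hK hKc => ?_⟩
  have hu := tendstoUniformlyOn_of_continuousOn hc' ht hK hKc
  refine ⟨tendstoUniformlyOn_of_continuousOn hc ht hK hKc, ?_, hu⟩
  rw [Metric.tendstoUniformlyOn_iff] at hu ⊢
  intro ε hε
  obtain ⟨δ, hδ, h⟩ := Metric.mem_nhdsWithin_iff.1 (hu (ε / 2) (by positivity))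
  have : Metric.ball t δ ∈ 𝓝[I \ {t}] t := mem_nhdsWithin_of_mem_nhds (Metric.ball_mem_nhds t hδ)
  filter_upwards [this, self_mem_nhdsWithin] with r hr hrI z hz
  have hr0 : r - t ≠ 0 := sub_ne_zero.2 hrI.2
  have hr0' : ((r - t : ℝ) : ℂ) ≠ 0 := by exact_mod_cast hr0
  have hcv : Convex ℝ (I ∩ Metric.ball t δ) := hI.inter (convex_ball _ _)
  have key := hcv.norm_image_sub_le_of_norm_hasDerivWithin_le (C := ε / 2)
    (f := fun r => f r z - (r : ℂ) * f' t z) (f' := fun r => f' r z - f' t z) (x := t) (y := r)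
    (fun s hs => by
      have h1 : HasDerivWithinAt (fun s : ℝ => (s : ℂ) * f' t z) (1 * f' t z)
        (I ∩ Metric.ball t δ) s := (Complex.ofRealCLM.hasDerivWithinAt).mul_const _
      simpa [one_mul] using ((hd s hs.1 z (hK hz)).mono inter_subset_left).fun_sub h1)
    (fun s hs => by
      have := h ⟨hs.2, hs.1⟩ z hz
      rw [dist_comm, dist_eq_norm] at this
      exact this.le) ⟨ht, Metric.mem_ball_self hδ⟩ ⟨hrI.1, hr⟩
  rw [dist_comm, dist_eq_norm]
  have e : (f r z - f t z) / ((r - t : ℝ) : ℂ) - f' t z =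
      ((f r z - (r : ℂ) * f' t z) - (f t z - (t : ℂ) * f' t z)) / ((r - t : ℝ) : ℂ) := by
    field_simp; push_cast; ring
  rw [e, norm_div, Complex.norm_real, div_lt_iff₀ (norm_pos_iff.2 hr0)]
  have : 0 < ‖r - t‖ := norm_pos_iff.2 hr0
  nlinarith

variable {I : Set ℝ} {Ω : Set E} {F F' : ℝ → E → A → ℂ}

/-- By the mean value inequality on the convex set `I` the dominating function of F' also dominates
the slopes of F, so dominated convergence gives the derivative. Working within `I` includes the end
point t = 0 needed for w. -/
theorem C1Family.hasDerivWithinAt (h : C1Family ρ I Ω F F') (hI : Convex ℝ I) {t : ℝ} (ht : t ∈ I)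
    {z : E} (hz : z ∈ Ω) :
    HasDerivWithinAt (fun r => ∫ a, F r z a ∂ρ) (∫ a, F' t z a ∂ρ) I t := by
  obtain ⟨U, hU, B, hB, hb⟩ := h.bound z hz
  have hzU : z ∈ U ∩ Ω := ⟨mem_of_mem_nhds hU, hz⟩
  have hint : ∀ r ∈ I, Integrable (F r z) ρ := fun r hr =>
    hB.mono' (h.meas r hr z hz).1 (hb.mono fun a ha => (ha r hr z hzU).1)
  rw [hasDerivWithinAt_iff_tendsto_slope]
  have key : Tendsto (fun r => ∫ a, slope (fun r => F r z a) t r ∂ρ) (𝓝[I \ {t}] t)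
      (𝓝 (∫ a, F' t z a ∂ρ)) := by
    refine tendsto_integral_filter_of_dominated_convergence B ?_ ?_ hB ?_
    · filter_upwards [self_mem_nhdsWithin] with r hr
      simp only [slope, vsub_eq_sub]
      exact ((hint r hr.1).aestronglyMeasurable.sub (hint t ht).aestronglyMeasurable).const_smul _
    · filter_upwards [self_mem_nhdsWithin] with r hr
      filter_upwards [hb, h.deriv] with a ha hda
      have := hI.norm_image_sub_le_of_norm_hasDerivWithin_le (fun s hs => hda s hs z hz)
        (fun s hs => (ha s hs z hzU).2) ht hr.1
      simp only [slope, vsub_eq_sub, norm_smul, norm_inv]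
      have h0 : 0 < ‖r - t‖ := norm_pos_iff.2 (sub_ne_zero.2 hr.2)
      rw [inv_mul_le_iff₀ h0]
      linarith
    · filter_upwards [h.deriv] with a ha
      exact hasDerivWithinAt_iff_tendsto_slope.1 (ha t ht z hz)
  refine key.congr' ?_
  filter_upwards [self_mem_nhdsWithin] with r hr
  simp only [slope, vsub_eq_sub]
  rw [integral_smul, integral_sub (hint r hr.1) (hint t ht)]

theorem C1Family.continuousOn (h : C1Family ρ I Ω F F') :
    ContinuousOn (fun p : ℝ × E => ∫ a, F p.1 p.2 a ∂ρ) (I ×ˢ Ω) ∧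
    ContinuousOn (fun p : ℝ × E => ∫ a, F' p.1 p.2 a ∂ρ) (I ×ˢ Ω) := by
  have hn : ∀ x : ℝ × E, ∀ U ∈ 𝓝 x.2, I ×ˢ (U ∩ Ω) ∈ 𝓝[I ×ˢ Ω] x := fun x U hU => by
    rw [← Prod.mk.eta (p := x), nhdsWithin_prod_eq]
    exact prod_mem_prod self_mem_nhdsWithin
      (inter_mem (mem_nhdsWithin_of_mem_nhds hU) self_mem_nhdsWithin)
  constructor
  · refine continuousOn_integral_of_dominated (fun p hp => (h.meas _ hp.1 _ hp.2).1) h.cont₀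
      fun p hp => ?_
    obtain ⟨U, hU, B, hB, hb⟩ := h.bound p.2 hp.2
    exact ⟨_, hn p U hU, B, hB, hb.mono fun a ha y hy => (ha _ hy.1 _ hy.2).1⟩
  · refine continuousOn_integral_of_dominated (fun p hp => (h.meas _ hp.1 _ hp.2).2) h.cont
      fun p hp => ?_
    obtain ⟨U, hU, B, hB, hb⟩ := h.bound p.2 hp.2
    exact ⟨_, hn p U hU, B, hB, hb.mono fun a ha y hy => (ha _ hy.1 _ hy.2).2⟩

theorem C1Family.isC1Analytic [FiniteDimensional ℂ E] (h : C1Family ρ I Ω F F') (hI : Convex ℝ I)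
    (hΩ : IsOpen Ω) : IsC1Analytic I Ω (fun t z => ∫ a, F t z a ∂ρ) := by
  refine isC1Analytic_of_hasDerivWithinAt hI (f' := fun t z => ∫ a, F' t z a ∂ρ)
    (fun t ht => ?_) (fun t ht => ?_) h.continuousOn.1 h.continuousOn.2
    fun t ht z hz => h.hasDerivWithinAt hI ht hz
  · refine (lineHolomorphic_integral hΩ (fun z hz => (h.meas t ht z hz).1)
      (h.hol.mono fun a ha => ha t ht) fun z hz => ?_).analyticOnNhd hΩ
    obtain ⟨U, hU, B, hB, hb⟩ := h.bound z hz
    exact ⟨U, hU, B, hB, hb.mono fun a ha y hy => (ha t ht y hy).1⟩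
  · refine (lineHolomorphic_integral hΩ (fun z hz => (h.meas t ht z hz).2)
      (h.hol'.mono fun a ha => ha t ht) fun z hz => ?_).analyticOnNhd hΩ
    obtain ⟨U, hU, B, hB, hb⟩ := h.bound z hz
    exact ⟨U, hU, B, hB, hb.mono fun a ha y hy => (ha t ht y hy).2⟩

end Parametric

/-! ### The sum of a family of measures on a disjoint union -/

section SigmaMeasure

variable {ι : Type} [Countable ι] {X : ι → Type} [∀ i, MeasurableSpace (X i)]

/-- The measure on `Σ i, X i` which restricts to `ρ i` on `X i`. -/
def sigmaMeasure (ρ : ∀ i, Measure (X i)) : Measure (Σ i, X i) :=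
  Measure.sum fun i => (ρ i).map (Sigma.mk i)

omit [Countable ι] in
theorem measurableSet_sigma {s : Set (Σ i, X i)} :
    MeasurableSet s ↔ ∀ i, MeasurableSet (Sigma.mk i ⁻¹' s) := by
  simp only [MeasurableSpace.measurableSet_iInf]
  rfl

omit [Countable ι] in
theorem measurableEmbedding_sigmaMk (i : ι) : MeasurableEmbedding (Sigma.mk i : X i → Σ i, X i) where
  injective := sigma_mk_injective
  measurable := fun _ hs => measurableSet_sigma.1 hs i
  measurableSet_image' := fun {s} hs => measurableSet_sigma.2 fun j => by
    by_cases h : j = i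
    · subst h; rwa [preimage_image_eq _ sigma_mk_injective]
    · convert MeasurableSet.empty
      ext x
      simp only [mem_preimage, mem_image, mem_empty_iff_false, iff_false, not_exists, not_and]
      intro y _ hy
      exact h (congrArg Sigma.fst hy).symm

variable {ρ : ∀ i, Measure (X i)}

theorem ae_sigmaMeasure {p : (Σ i, X i) → Prop} :
    (∀ᵐ a ∂sigmaMeasure ρ, p a) ↔ ∀ i, ∀ᵐ a ∂ρ i, p ⟨i, a⟩ := by
  rw [sigmaMeasure, Measure.ae_sum_iff]
  exact forall_congr' fun i => (measurableEmbedding_sigmaMk i).ae_map_iff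

theorem aestronglyMeasurable_sigmaMeasure {f : (Σ i, X i) → ℂ}
    (h : ∀ i, AEStronglyMeasurable (fun a => f ⟨i, a⟩) (ρ i)) :
    AEStronglyMeasurable f (sigmaMeasure ρ) :=
  AEStronglyMeasurable.sum_measure fun i =>
    ((measurableEmbedding_sigmaMk i).aestronglyMeasurable_map_iff).2 (h i)

theorem integrable_sigmaMeasure {F : Type} [NormedAddCommGroup F] {f : (Σ i, X i) → F}
    (h : ∀ i, Integrable (fun a => f ⟨i, a⟩) (ρ i)) (hs : Summable fun i => ∫ a, ‖f ⟨i, a⟩‖ ∂ρ i) :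
    Integrable f (sigmaMeasure ρ) := by
  refine integrable_sum_measure (fun i =>
    ((measurableEmbedding_sigmaMk i).integrable_map_iff).2 (h i)) (hs.congr fun i => ?_)
  rw [(measurableEmbedding_sigmaMk i).integral_map]

omit [Countable ι] in
-- A series of integrals is one integral over a disjoint union. One dominating function then
-- controls summation and integration together, and a series is differentiated like a single
-- integral.
theorem hasSum_integral_sigmaMeasure {f : (Σ i, X i) → ℂ} (h : Integrable f (sigmaMeasure ρ)) :
    HasSum (fun i => ∫ a, f ⟨i, a⟩ ∂ρ i) (∫ a, f a ∂sigmaMeasure ρ) := by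
  have := hasSum_integral_measure h
  simp only [(measurableEmbedding_sigmaMk _).integral_map] at this
  exact this

end SigmaMeasure

/-! ### Integrals over cubes -/

theorem ae_apply_ne {ι : Type} [Fintype ι] {i j : ι} (h : i ≠ j) :
    ∀ᵐ θ : ι → ℝ, θ i ≠ θ j := by
  classical
  let L : (ι → ℝ) →ₗ[ℝ] ℝ := LinearMap.proj (R := ℝ) (φ := fun _ : ι => ℝ) i - LinearMap.proj j
  have hL : LinearMap.ker L ≠ ⊤ := fun h0 => by
    have : Pi.single i (1 : ℝ) ∈ LinearMap.ker L := h0 ▸ Submodule.mem_top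
    simp [L, h.symm] at this
  rw [ae_iff]
  refine measure_mono_null (fun θ hθ => ?_) (Measure.addHaar_submodule volume _ hL)
  simp only [ne_eq, not_not, mem_ofPred_eq] at hθ
  simp [L, hθ]

theorem setIntegral_cube_reindex {ι κ : Type} [Fintype ι] [Fintype κ] (e : ι ≃ κ) (c : ℝ)
    (g : (ι → ℝ) → ℂ) :
    ∫ θ in Icc (0 : ι → ℝ) (fun _ => c), g θ = ∫ θ in Icc (0 : κ → ℝ) (fun _ => c), g (θ ∘ e) := by
  have h := (volume_measurePreserving_piCongrLeft (fun _ : κ => ℝ) e).symm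
  rw [← h.setIntegral_preimage_emb (MeasurableEquiv.measurableEmbedding _)]
  have h1 : ∀ θ : κ → ℝ, (MeasurableEquiv.piCongrLeft (fun _ : κ => ℝ) e).symm θ = θ ∘ e := by
    intro θ; rfl
  have h2 : (MeasurableEquiv.piCongrLeft (fun _ : κ => ℝ) e).symm ⁻¹'
      (Icc (0 : ι → ℝ) fun _ => c) = Icc (0 : κ → ℝ) fun _ => c := by
    ext θ
    simp only [mem_preimage, h1, mem_Icc, Pi.le_def, Function.comp, Pi.zero_apply]
    exact ⟨fun h => ⟨fun i => by simpa using h.1 (e.symm i), fun i => by simpa using h.2 (e.symm i)⟩,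
      fun h => ⟨fun i => h.1 _, fun i => h.2 _⟩⟩
  rw [h2]
  rfl

/-- The point of `ℝ^ι` with `e`-th coordinate `r` and other coordinates `η`. -/
def consAt {ι : Type} [DecidableEq ι] (e : ι) (r : ℝ) (η : {i // i ≠ e} → ℝ) : ι → ℝ :=
  fun i => if h : i = e then r else η ⟨i, h⟩

/-- `consAt` as a measure preserving equivalence. -/
def consAtEquiv {ι : Type} [DecidableEq ι] (e : ι) : ℝ × ({i // i ≠ e} → ℝ) ≃ᵐ (ι → ℝ) :=
  ((MeasurableEquiv.funUnique {i // i = e} ℝ).symm.prodCongr (MeasurableEquiv.refl _)).trans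
    (MeasurableEquiv.piEquivPiSubtypeProd (fun _ : ι => ℝ) (fun i => i = e)).symm

theorem measurePreserving_consAtEquiv {ι : Type} [Fintype ι] [DecidableEq ι] (e : ι) :
    MeasurePreserving (consAtEquiv e) volume volume := by
  have h1 := (volume_preserving_funUnique {i // i = e} ℝ).symm
  have h2 : MeasurePreserving (MeasurableEquiv.piEquivPiSubtypeProd (fun _ : ι => ℝ)
      (fun i => i = e)).symm (volume : Measure (({i // i = e} → ℝ) × ({i // i ≠ e} → ℝ)))
      volume := by
    convert (volume_preserving_piEquivPiSubtypeProd (fun _ : ι => ℝ) (fun i => i = e)).symm <;> rfl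
  have h3 : MeasurePreserving ((MeasurableEquiv.funUnique {i // i = e} ℝ).symm.prodCongr
      (MeasurableEquiv.refl ({i // i ≠ e} → ℝ))) volume volume := by
    rw [Measure.volume_eq_prod, Measure.volume_eq_prod]
    exact h1.prod (MeasurePreserving.id _)
  exact h3.trans h2

/-- Fubini's theorem for the `e`-th coordinate against the others. -/
theorem integral_consAt {ι : Type} [Fintype ι] [DecidableEq ι] (e : ι) {f : (ι → ℝ) → ℂ}
    (hf : Integrable f) : ∫ θ, f θ = ∫ r, ∫ η, f (consAt e r η) := by
  rw [← (measurePreserving_consAtEquiv e).integral_comp' f, Measure.volume_eq_prod, integral_prod]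
  · rfl
  · exact ((measurePreserving_consAtEquiv e).integrable_comp_emb
      (MeasurableEquiv.measurableEmbedding _)).2 hf

/-- The integral over a cube, split according to the coordinate at which `R` is extremal. -/
theorem setIntegral_cube_eq_sum_extremal {ι : Type} [Fintype ι] [DecidableEq ι] [Nonempty ι]
    {C : Set (ι → ℝ)} (hC : MeasurableSet C) {f : (ι → ℝ) → ℂ} (hf : IntegrableOn f C) :
    ∫ θ in C, f θ = ∑ e, ∫ r, ∫ η, (C ∩ {θ | ∀ i, θ e ≤ θ i}).indicator f (consAt e r η) := by
  have hm : ∀ e : ι, MeasurableSet (C ∩ {θ : ι → ℝ | ∀ i, θ e ≤ θ i}) := fun e => by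
    refine hC.inter ?_
    rw [ofPred_forall]
    exact MeasurableSet.iInter fun i =>
      measurableSet_le (measurable_pi_apply e) (measurable_pi_apply i)
  have hU : C = ⋃ e, C ∩ {θ : ι → ℝ | ∀ i, θ e ≤ θ i} := by
    rw [← inter_iUnion]
    refine (inter_eq_left.2 fun θ _ => ?_).symm
    obtain ⟨e, -, he⟩ := Finset.univ.exists_min_image θ Finset.univ_nonempty
    exact mem_iUnion.2 ⟨e, fun i => he i (Finset.mem_univ _)⟩
  have key := integral_iUnion_ae (μ := volume) (f := f) (fun e => (hm e).nullMeasurableSet)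
    (fun e e' hee => ?_) (hU ▸ hf)
  · rw [← hU, tsum_fintype] at key
    rw [key]
    refine Finset.sum_congr rfl fun e _ => ?_
    rw [← integral_indicator (hm e), integral_consAt e]
    exact (hf.mono_set inter_subset_left).integrable_indicator (hm e)
  · refine measure_mono_null (fun θ hθ => ?_) (ae_iff.1 (ae_apply_ne hee))
    simp only [mem_ofPred_eq, not_not]
    exact le_antisymm (hθ.1.2 _) (hθ.2.2 _)

/-- The integral over a cube, split according to the smallest coordinate. -/
theorem setIntegral_cube_eq_sum_min {ι : Type} [Fintype ι] [DecidableEq ι] [Nonempty ι]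
    {f : (ι → ℝ) → ℂ} {s : ℝ} (hs : 0 ≤ s) (hf : IntegrableOn f (Icc (0 : ι → ℝ) fun _ => s)) :
    ∫ θ in Icc (0 : ι → ℝ) (fun _ => s), f θ = ∑ e, ∫ r in (0 : ℝ)..s,
      ∫ η in Icc (0 : {i // i ≠ e} → ℝ) (fun _ => s - r), f (consAt e r (fun i => r + η i)) := by
  rw [setIntegral_cube_eq_sum_extremal measurableSet_Icc hf]
  refine Finset.sum_congr rfl fun e _ => ?_
  rw [intervalIntegral.integral_of_le hs, ← integral_Icc_eq_integral_Ioc,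
    ← integral_indicator measurableSet_Icc]
  refine integral_congr_ae (Eventually.of_forall fun r => ?_)
  simp only
  by_cases hr : r ∈ Icc 0 s
  -- On the cell where the coordinate e is the smallest one and equals r, the others are r + η with
  -- η in a cube of side s - r; the translation by r makes this explicit.
  · rw [indicator_of_mem hr, ← integral_indicator measurableSet_Icc,
      ← integral_add_left_eq_self _ (fun _ => r)]
    refine integral_congr_ae (Eventually.of_forall fun η => ?_)
    refine indicator_eq_indicator ?_ rfl
    simp only [mem_inter_iff, mem_Icc, Pi.le_def, mem_ofPred_eq, Pi.zero_apply, Pi.add_apply, consAt, dif_pos]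
    constructor
    · rintro ⟨⟨h1, h2⟩, h3⟩
      refine ⟨fun i => ?_, fun i => ?_⟩
      · have := h3 i; simp only [i.2, dif_neg, not_false_eq_true] at this; linarith
      · have := h2 i; simp only [i.2, dif_neg, not_false_eq_true] at this; linarith
    · rintro ⟨h1, h2⟩
      refine ⟨⟨fun i => ?_, fun i => ?_⟩, fun i => ?_⟩ <;> by_cases h : i = e <;>
        simp only [h, dif_pos, dif_neg, not_false_eq_true]
      all_goals first | exact hr.1 | exact hr.2 | exact le_rfl | skip
      · have := h1 ⟨i, h⟩; linarith [hr.1]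
      · have := h2 ⟨i, h⟩; linarith [hr.1]
      · have := h1 ⟨i, h⟩; linarith [hr.1]
  · rw [indicator_of_notMem hr]
    refine (integral_congr_ae (Eventually.of_forall fun η => ?_)).trans (integral_zero _ _)
    refine indicator_of_notMem (fun h => hr ?_) _
    have h1 := h.1.1 e
    have h2 := h.1.2 e
    simp only [consAt, dif_pos, Pi.zero_apply] at h1 h2
    exact ⟨h1, h2⟩

/-- The integral over a cube, split according to the largest coordinate. -/
theorem setIntegral_cube_eq_sum_max {ι : Type} [Fintype ι] [DecidableEq ι] [Nonempty ι]
    {f : (ι → ℝ) → ℂ} {s : ℝ} (hs : 0 ≤ s) (hf : IntegrableOn f (Icc (0 : ι → ℝ) fun _ => s)) :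
    ∫ θ in Icc (0 : ι → ℝ) (fun _ => s), f θ = ∑ e, ∫ r in (0 : ℝ)..s,
      ∫ η in Icc (0 : {i // i ≠ e} → ℝ) (fun _ => r), f (consAt e r η) := by
  have hpre : ∀ (κ : Type) [Fintype κ] (r : ℝ), (fun θ : κ → ℝ => (fun _ => s) - θ) ⁻¹'
      (Icc (0 : κ → ℝ) fun _ => r) = Icc (fun _ => s - r) (fun _ => s) := fun κ _ r => by
    ext θ
    simp only [mem_preimage, mem_Icc, Pi.le_def, Pi.zero_apply, Pi.sub_apply]
    exact ⟨fun h => ⟨fun i => by linarith [h.2 i], fun i => by linarith [h.1 i]⟩,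
      fun h => ⟨fun i => by linarith [h.2 i], fun i => by linarith [h.1 i]⟩⟩
  -- The reflection θ ↦ s - θ of the cube exchanges largest and smallest coordinates and reduces the
  -- claim to the splitting by the minimum.
  have hrefl : ∀ (κ : Type) [Fintype κ] (g : (κ → ℝ) → ℂ) (a b : ℝ),
      ∫ θ in Icc (0 : κ → ℝ) (fun _ => b), g ((fun _ => a) + θ) =
        ∫ θ in Icc (0 : κ → ℝ) (fun _ => b), g ((fun _ => a + b) - θ) := fun κ _ g a b => by
    rw [← integral_indicator measurableSet_Icc, ← integral_indicator measurableSet_Icc,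
      ← integral_sub_left_eq_self (μ := volume) _ (fun _ => b)]
    refine integral_congr_ae (Eventually.of_forall fun θ => ?_)
    refine indicator_eq_indicator ?_ (congrArg g (by ext i; simp; ring))
    simp only [mem_Icc, Pi.le_def, Pi.zero_apply, Pi.sub_apply]
    exact ⟨fun h => ⟨fun i => by linarith [h.2 i], fun i => by linarith [h.1 i]⟩,
      fun h => ⟨fun i => by linarith [h.2 i], fun i => by linarith [h.1 i]⟩⟩
  have hf' : IntegrableOn (fun θ => f ((fun _ => s) - θ)) (Icc (0 : ι → ℝ) fun _ => s) := by
    have h1 := hf.integrable_indicator measurableSet_Icc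
    have h2 := h1.comp_sub_left (fun _ => s)
    rw [← integrable_indicator_iff measurableSet_Icc]
    refine h2.congr (Eventually.of_forall fun θ => ?_)
    refine indicator_eq_indicator ?_ rfl
    have := hpre ι s
    rw [sub_self] at this
    exact (Set.ext_iff.1 this θ)
  have h0 := hrefl ι f 0 s
  simp only [zero_add] at h0
  have e0 : (fun θ : ι → ℝ => f ((fun _ => (0 : ℝ)) + θ)) = f := by
    ext θ; congr 1; ext i; simp
  rw [e0] at h0
  rw [h0, setIntegral_cube_eq_sum_min hs hf']
  refine Finset.sum_congr rfl fun e _ => ?_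
  have h1 := intervalIntegral.integral_comp_sub_left (a := 0) (b := s)
    (fun r => ∫ η in Icc (0 : {i // i ≠ e} → ℝ) (fun _ => r), f (consAt e r η)) s
  rw [sub_self, sub_zero] at h1
  rw [← h1]
  refine intervalIntegral.integral_congr fun r _ => ?_
  have h2 := hrefl {i // i ≠ e} (fun η => f (consAt e (s - r) η)) 0 (s - r)
  simp only [zero_add] at h2
  have e2 : (fun θ : {i // i ≠ e} → ℝ => f (consAt e (s - r) ((fun _ => (0 : ℝ)) + θ))) =
      fun θ => f (consAt e (s - r) θ) := by
    ext θ; congr 2; ext i; simp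
  rw [e2] at h2
  rw [h2]
  refine setIntegral_congr_fun measurableSet_Icc fun η _ => ?_
  refine congrArg f ?_
  ext i
  by_cases h : i = e <;> simp [consAt, h]
  ring

/-! ### Path minima in forests -/

section PathMin

variable {S : Type}

/-- The minimum of `θ` over the edges of a path joining `j` and `k`. -/
def pmin (g : SimpleGraph S) (θ : g.edgeSet → ℝ) (j k : S) : ℝ :=
  sInf (θ '' {e | ∃ p : g.Walk j k, p.IsPath ∧ (e : Sym2 S) ∈ p.edges})

theorem pmin_comm (g : SimpleGraph S) (θ : g.edgeSet → ℝ) (j k : S) :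
    pmin g θ j k = pmin g θ k j := by
  unfold pmin
  congr 2
  ext e
  exact ⟨fun ⟨p, hp, he⟩ => ⟨p.reverse, hp.reverse, by simpa using he⟩,
    fun ⟨p, hp, he⟩ => ⟨p.reverse, hp.reverse, by simpa using he⟩⟩

theorem pmin_eq_of_isPath {g : SimpleGraph S} (hg : g.IsAcyclic) (θ : g.edgeSet → ℝ) {j k : S}
    {p : g.Walk j k} (hp : p.IsPath) :
    pmin g θ j k = sInf (θ '' {e | (e : Sym2 S) ∈ p.edges}) := by
  unfold pmin
  congr 2
  ext e
  refine ⟨fun ⟨q, hq, he⟩ => ?_, fun he => ⟨p, hp, he⟩⟩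
  have := congrArg Subtype.val ((hg.subsingleton_path j k).elim ⟨q, hq⟩ ⟨p, hp⟩)
  simp only at this
  rwa [this] at he

theorem continuous_sInf_image {ι : Type} [Finite ι] (s : Set ι) :
    Continuous fun θ : ι → ℝ => sInf (θ '' s) := by
  classical
  have := Fintype.ofFinite ι
  rcases s.eq_empty_or_nonempty with rfl | hs
  · simp only [image_empty]; exact continuous_const
  · have hs' : s.toFinset.Nonempty := by simpa using hs
    have : ∀ θ : ι → ℝ, sInf (θ '' s) = s.toFinset.inf' hs' θ := fun θ => by
      rw [Finset.inf'_eq_csInf_image, coe_toFinset]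
    simp only [this]
    exact Continuous.finset_inf'_apply hs' fun i _ => continuous_apply i

theorem continuous_pmin [Finite S] (g : SimpleGraph S) (j k : S) :
    Continuous fun θ : g.edgeSet → ℝ => pmin g θ j k :=
  continuous_sInf_image _

/-- The inclusion of the edges of `g` without `e` in the edges of `g`. -/
def delIncl (g : SimpleGraph S) (e : Sym2 S) (i : (g.deleteEdges {e}).edgeSet) : g.edgeSet :=
  ⟨i, SimpleGraph.edgeSet_mono (g.deleteEdges_le _) i.2⟩

/-- The path is unique in a forest, so the path that survives the deletion is the original one and
all its values are shifted by r. The case j = k must be excluded: the empty path has infimum 0 by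
convention and would not shift. -/
theorem pmin_deleteEdges_of_reachable [Finite S] {g : SimpleGraph S} (hg : g.IsAcyclic) (e : Sym2 S)
    {θ : g.edgeSet → ℝ} {θ' : (g.deleteEdges {e}).edgeSet → ℝ} {r : ℝ}
    (h : ∀ i, θ (delIncl g e i) = r + θ' i) {j k : S} (hjk : j ≠ k)
    (hr : (g.deleteEdges {e}).Reachable j k) :
    pmin g θ j k = r + pmin (g.deleteEdges {e}) θ' j k := by
  obtain ⟨p, hp⟩ := hr.exists_isPath
  have hle := g.deleteEdges_le {e}
  rw [pmin_eq_of_isPath hg θ (hp.mapLe hle), pmin_eq_of_isPath (hg.anti hle) θ' hp]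
  have e1 : θ '' {i | (i : Sym2 S) ∈ (p.mapLe hle).edges} =
      OrderIso.addLeft r '' (θ' '' {i | (i : Sym2 S) ∈ p.edges}) := by
    ext x
    simp only [mem_image, mem_ofPred_eq, SimpleGraph.Walk.edges_mapLe_eq_edges, OrderIso.addLeft_apply,
      exists_exists_and_eq_and]
    constructor
    · rintro ⟨i, hi, rfl⟩
      exact ⟨⟨i, p.edges_subset_edgeSet hi⟩, hi, (h ⟨i, p.edges_subset_edgeSet hi⟩).symm⟩
    · rintro ⟨i, hi, rfl⟩
      exact ⟨delIncl g e i, hi, h i⟩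
  rw [e1, ← OrderIso.map_csInf']
  · rfl
  · have : ∃ x, x ∈ p.edges := List.exists_mem_of_ne_nil _ fun h0 => hjk (by
      have : p.length = 0 := by rw [← p.length_edges, h0]; rfl
      exact SimpleGraph.Walk.eq_of_length_eq_zero this)
    obtain ⟨x, hx⟩ := this
    exact ⟨_, ⟨x, p.edges_subset_edgeSet hx⟩, hx, rfl⟩
  · exact (Set.toFinite _).bddBelow

/-- Once the deletion disconnects j from k, their path runs through e, which carries the smallest
value of all. -/
theorem pmin_deleteEdges_of_not_reachable [Finite S] {g : SimpleGraph S} (hg : g.IsAcyclic)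
    (e : g.edgeSet) {θ : g.edgeSet → ℝ} (h : ∀ i, θ e ≤ θ i) {j k : S}
    (hr : g.Reachable j k) (hn : ¬ (g.deleteEdges {(e : Sym2 S)}).Reachable j k) :
    pmin g θ j k = θ e := by
  obtain ⟨p, hp⟩ := hr.exists_isPath
  rw [pmin_eq_of_isPath hg θ hp]
  refine IsLeast.csInf_eq ⟨⟨e, ?_, rfl⟩, ?_⟩
  · by_contra hne
    exact hn ⟨p.toDeleteEdges {(e : Sym2 S)} fun i hi hie => hne (by
      rw [mem_singleton_iff] at hie; subst hie; exact hi)⟩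
  · rintro _ ⟨i, -, rfl⟩
    exact h i

end PathMin

/-! ### The forest formula -/

section Forest

open scoped Classical

variable {S : Type} [Fintype S]

/-- The two elements of a pair are joined by a path of `F`. -/
def connPair (F : SimpleGraph S) : Sym2 S → Prop :=
  Sym2.lift ⟨fun j k => F.Reachable j k, fun _ _ => propext ⟨fun h => h.symm, fun h => h.symm⟩⟩

/-- `pmin` on unordered pairs. -/
def pairMin (F : SimpleGraph S) (θ : F.edgeSet → ℝ) : Sym2 S → ℝ :=
  Sym2.lift ⟨fun j k => pmin F θ j k, pmin_comm F θ⟩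

/-- The pairs of distinct points. -/
def offPairs (S : Type) [Fintype S] : Finset (Sym2 S) := Finset.univ.filter fun e => ¬ e.IsDiag

/-- The pairs of distinct points joined by `F`. -/
def connPairs (F : SimpleGraph S) : Finset (Sym2 S) := (offPairs S).filter fun e => connPair F e

/-- The edges of `F`. -/
def edges (F : SimpleGraph S) : Finset (Sym2 S) := Finset.univ.filter fun e => e ∈ F.edgeSet

omit [Fintype S] in
@[simp] theorem connPair_mk (F : SimpleGraph S) (j k : S) :
    connPair F s(j, k) ↔ F.Reachable j k := Iff.rfl

omit [Fintype S] in
@[simp] theorem pairMin_mk (F : SimpleGraph S) (θ : F.edgeSet → ℝ) (j k : S) :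
    pairMin F θ s(j, k) = pmin F θ j k := rfl

@[simp] theorem mem_edges {F : SimpleGraph S} {e : Sym2 S} : e ∈ edges F ↔ e ∈ F.edgeSet := by
  simp [edges]

@[simp] theorem mem_offPairs {e : Sym2 S} : e ∈ offPairs S ↔ ¬ e.IsDiag := by
  simp [offPairs]

@[simp] theorem mem_connPairs {F : SimpleGraph S} {e : Sym2 S} :
    e ∈ connPairs F ↔ ¬ e.IsDiag ∧ connPair F e := by
  simp [connPairs]

omit [Fintype S] in
theorem connPair.mono {F F' : SimpleGraph S} (h : F ≤ F') {e : Sym2 S} (he : connPair F e) :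
    connPair F' e := by
  induction e with
  | _ j k => exact SimpleGraph.Reachable.mono h he

/-- Self-similarity of path minima. If e carries the smallest value r, pairs that it separates have
minimum exactly r, and the others have r plus the minimum of the shifted values in the forest
without e. The recursion for forest integrals and the positivity of the tree forms both come from
this identity. -/
theorem sum_pairMin_deleteEdges {M : Type} [AddCommGroup M] [Module ℝ M] {F : SimpleGraph S}
    (hF : F.IsAcyclic) (e : F.edgeSet) {θ : F.edgeSet → ℝ}
    {θ' : (F.deleteEdges {(e : Sym2 S)}).edgeSet → ℝ} {r : ℝ} (hr : θ e = r)
    (h : ∀ i, θ (delIncl F e i) = r + θ' i) (hpos : ∀ i, 0 ≤ θ' i) (V : Sym2 S → M) :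
    ∑ p ∈ connPairs F, pairMin F θ p • V p = r • ∑ p ∈ connPairs F, V p +
      ∑ p ∈ connPairs (F.deleteEdges {(e : Sym2 S)}),
        pairMin (F.deleteEdges {(e : Sym2 S)}) θ' p • V p := by
  have hle := F.deleteEdges_le {(e : Sym2 S)}
  have hsub : connPairs (F.deleteEdges {(e : Sym2 S)}) ⊆ connPairs F := fun p hp => by
    simp only [mem_connPairs] at hp ⊢
    exact ⟨hp.1, hp.2.mono hle⟩
  have hmin : ∀ i, θ e ≤ θ i := fun i => by
    by_cases hi : (i : Sym2 S) = e
    · rw [Subtype.ext hi]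
    · have := h ⟨i, by rw [SimpleGraph.edgeSet_deleteEdges]; exact ⟨i.2, hi⟩⟩
      rw [hr, show i = delIncl F e ⟨i, by rw [SimpleGraph.edgeSet_deleteEdges]; exact ⟨i.2, hi⟩⟩
        from rfl, this]
      linarith [hpos ⟨i, by rw [SimpleGraph.edgeSet_deleteEdges]; exact ⟨i.2, hi⟩⟩]
  rw [← Finset.sum_filter_add_sum_filter_not (connPairs F)
    (fun p => p ∈ connPairs (F.deleteEdges {(e : Sym2 S)})),
    ← Finset.sum_filter_add_sum_filter_not (connPairs F)
    (fun p => p ∈ connPairs (F.deleteEdges {(e : Sym2 S)})) V]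
  have e1 : (connPairs F).filter (fun p => p ∈ connPairs (F.deleteEdges {(e : Sym2 S)})) =
      connPairs (F.deleteEdges {(e : Sym2 S)}) := by
    ext p; simp only [Finset.mem_filter]; exact ⟨fun h => h.2, fun h => ⟨hsub h, h⟩⟩
  rw [e1, smul_add, add_right_comm]
  congr 1
  · rw [Finset.smul_sum, ← Finset.sum_add_distrib]
    refine Finset.sum_congr rfl fun p hp => ?_
    rw [← add_smul]
    congr 1
    induction p with
    | _ j k =>
      simp only [mem_connPairs, Sym2.mk_isDiag_iff, connPair_mk] at hp
      exact pmin_deleteEdges_of_reachable hF e h hp.1 hp.2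
  · rw [Finset.smul_sum]
    refine Finset.sum_congr rfl fun p hp => ?_
    congr 1
    induction p with
    | _ j k =>
      simp only [Finset.mem_filter, mem_connPairs, Sym2.mk_isDiag_iff, connPair_mk, not_and] at hp
      rw [← hr]
      exact pmin_deleteEdges_of_not_reachable hF e hmin hp.1.2 (hp.2 hp.1.1)

/-- `∫_{[0,s]^F} exp (-∑ θ_{jk} V_{jk}) dθ`, the sum over the pairs joined by `F`. -/
def forestInt (F : SimpleGraph S) (V : Sym2 S → ℂ) (s : ℝ) : ℂ :=
  ∫ θ in Icc (0 : F.edgeSet → ℝ) (fun _ => s),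
    Complex.exp (-∑ p ∈ connPairs F, pairMin F θ p • V p)

omit [Fintype S] in
theorem continuous_pairMin [Finite S] (F : SimpleGraph S) (p : Sym2 S) :
    Continuous fun θ : F.edgeSet → ℝ => pairMin F θ p := by
  induction p with
  | _ j k => exact continuous_pmin F j k

theorem continuous_forestIntegrand (F : SimpleGraph S) (V : Sym2 S → ℂ) :
    Continuous fun θ : F.edgeSet → ℝ =>
      Complex.exp (-∑ p ∈ connPairs F, pairMin F θ p • V p) := by
  refine Complex.continuous_exp.comp (continuous_finsetSum _ fun p _ => ?_).neg
  exact (continuous_pairMin F p).smul continuous_const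

/-- The edges of `F` other than `e` are the edges of `F` without `e`. -/
def delEquiv (F : SimpleGraph S) (e : F.edgeSet) :
    {i : F.edgeSet // i ≠ e} ≃ (F.deleteEdges {(e : Sym2 S)}).edgeSet where
  toFun i := ⟨i.1, by
    rw [SimpleGraph.edgeSet_deleteEdges]; exact ⟨i.1.2, fun h => i.2 (Subtype.ext h)⟩⟩
  invFun i := ⟨delIncl F e i, fun h => by
    have h2 : (i : Sym2 S) ∈ F.edgeSet \ {(e : Sym2 S)} := by
      rw [← SimpleGraph.edgeSet_deleteEdges]; exact i.2
    exact h2.2 (congrArg Subtype.val h)⟩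
  left_inv i := rfl
  right_inv i := rfl

/-- The cube is cut according to the edge e with the smallest value r. By the self-similarity of
path minima the exponent splits into r times the full sum over connected pairs and the exponent of
the forest without e on a cube of side s - r. -/
theorem forestInt_eq_sum {F : SimpleGraph S} (hF : F.IsAcyclic) [Nonempty F.edgeSet]
    (V : Sym2 S → ℂ) {s : ℝ} (hs : 0 ≤ s) :
    forestInt F V s = ∑ e : F.edgeSet, ∫ r in (0 : ℝ)..s,
      Complex.exp (-(r • ∑ p ∈ connPairs F, V p)) *
        forestInt (F.deleteEdges {(e : Sym2 S)}) V (s - r) := by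
  rw [forestInt, setIntegral_cube_eq_sum_min hs
    ((continuous_forestIntegrand F V).continuousOn.integrableOn_compact isCompact_Icc)]
  refine Finset.sum_congr rfl fun e _ => intervalIntegral.integral_congr fun r _ => ?_
  rw [setIntegral_cube_reindex (delEquiv F e), forestInt]
  refine Eq.trans (setIntegral_congr_fun (g := fun θ => Complex.exp (-(r • ∑ p ∈ connPairs F, V p)) *
    Complex.exp (-∑ p ∈ connPairs (F.deleteEdges {(e : Sym2 S)}),
      pairMin (F.deleteEdges {(e : Sym2 S)}) θ p • V p)) measurableSet_Icc fun θ hθ => ?_)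
    (by rw [integral_const_mul]; congr!)
  simp only
  rw [← Complex.exp_add, ← neg_add]
  congr 2
  refine sum_pairMin_deleteEdges hF e (by simp [consAt]) (fun i => ?_) hθ.1 V
  have : delIncl F e i ≠ e := ((delEquiv F e).symm i).2
  simp only [consAt, this, dif_neg, not_false_eq_true, Function.comp]
  rfl

theorem connPairs_bot : connPairs (⊥ : SimpleGraph S) = ∅ := by
  ext p
  induction p with
  | _ j k => simp [SimpleGraph.reachable_bot]

theorem edges_bot : edges (⊥ : SimpleGraph S) = ∅ := by
  ext p; simp

omit [Fintype S] in
theorem eq_bot_of_isEmpty {F : SimpleGraph S} (h : IsEmpty F.edgeSet) : F = ⊥ := by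
  rw [← SimpleGraph.edgeSet_eq_empty]; exact isEmpty_coe_sort.1 h

theorem forestInt_bot (V : Sym2 S → ℂ) (s : ℝ) : forestInt ⊥ V s = 1 := by
  have hE : IsEmpty (⊥ : SimpleGraph S).edgeSet := by simp
  have h1 : Icc (0 : (⊥ : SimpleGraph S).edgeSet → ℝ) (fun _ => s) = univ := by
    ext θ; simp
  simp only [forestInt, connPairs_bot, Finset.sum_empty, neg_zero, Complex.exp_zero, h1]
  simp [Measure.real, volume_pi]

theorem forestInt_zero {F : SimpleGraph S} (hF : F.IsAcyclic) (V : Sym2 S → ℂ) :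
    forestInt F V 0 = if F = ⊥ then 1 else 0 := by
  split_ifs with h
  · rw [h, forestInt_bot]
  · have : Nonempty F.edgeSet := by
      rw [← not_isEmpty_iff]; exact fun h' => h (eq_bot_of_isEmpty h')
    rw [forestInt_eq_sum hF V le_rfl]
    simp

theorem sum_edges {M : Type} [AddCommMonoid M] (F : SimpleGraph S) (f : Sym2 S → M) :
    ∑ e : F.edgeSet, f e = ∑ e ∈ edges F, f e :=
  (Finset.sum_subtype (edges F) (fun _ => mem_edges) f).symm

theorem card_edges_deleteEdges {F : SimpleGraph S} {e : Sym2 S} (he : e ∈ F.edgeSet) :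
    (edges (F.deleteEdges {e})).card < (edges F).card := by
  refine Finset.card_lt_card ⟨fun p hp => ?_, fun h => ?_⟩
  · simp only [mem_edges] at hp ⊢
    exact SimpleGraph.edgeSet_mono (F.deleteEdges_le _) hp
  · have := h (mem_edges.2 he)
    simp [SimpleGraph.edgeSet_deleteEdges] at this

/-- The substitution r ↦ s - r turns the recursion into Duhamel's formula for Z' = -CZ + G with Z(0)
= 0. The source G is prescribed only for r ≥ 0, so that a continuous extension to the whole line can
be inserted. -/
theorem forestInt_formula {F : SimpleGraph S} (hF : F.IsAcyclic) [Nonempty F.edgeSet]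
    (V : Sym2 S → ℂ) {G : ℝ → ℂ}
    (h : ∀ r, 0 ≤ r → G r = ∑ e ∈ edges F, forestInt (F.deleteEdges {e}) V r)
    (hc : ∀ e ∈ F.edgeSet, ContinuousOn (forestInt (F.deleteEdges {e}) V) (Ici 0))
    {s : ℝ} (hs : 0 ≤ s) :
    forestInt F V s = Complex.exp (-(s • ∑ p ∈ connPairs F, V p)) *
      ∫ r in (0 : ℝ)..s, Complex.exp (r • ∑ p ∈ connPairs F, V p) * G r := by
  rw [forestInt_eq_sum hF V hs, ← intervalIntegral.integral_finsetSum]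
  · have h1 := intervalIntegral.integral_comp_sub_left (a := 0) (b := s) (fun r =>
      Complex.exp (-((s - r) • ∑ p ∈ connPairs F, V p)) * G r) s
    rw [sub_self, sub_zero] at h1
    rw [← intervalIntegral.integral_const_mul]
    have h2 : ∀ r : ℝ, Complex.exp (-((s - r) • ∑ p ∈ connPairs F, V p)) * G r =
        Complex.exp (-(s • ∑ p ∈ connPairs F, V p)) *
          (Complex.exp (r • ∑ p ∈ connPairs F, V p) * G r) := fun r => by
      rw [← mul_assoc, ← Complex.exp_add]
      congr 2
      rw [sub_smul]; ring
    simp only [← h2]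
    rw [← h1]
    refine intervalIntegral.integral_congr fun r hr => ?_
    rw [uIcc_of_le hs] at hr
    rw [← Finset.mul_sum, h _ (by linarith [hr.2]),
      sum_edges F (fun e => forestInt (F.deleteEdges {e}) V (s - r)), sub_sub_cancel]
  · intro e _
    refine ContinuousOn.intervalIntegrable (ContinuousOn.mul (by fun_prop) ?_)
    refine (hc e e.2).comp (by fun_prop) fun r hr => ?_
    rw [uIcc_of_le hs] at hr
    simp only [mem_Ici]; linarith [hr.2]

theorem continuousOn_forestInt (n : ℕ) : ∀ {F : SimpleGraph S} (_ : F.IsAcyclic) (V : Sym2 S → ℂ),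
    (edges F).card = n → ContinuousOn (forestInt F V) (Ici 0) := by
  induction n using Nat.strong_induction_on with
  | _ n ih =>
    intro F hF V hn
    rcases isEmpty_or_nonempty F.edgeSet with hE | hE
    · rw [eq_bot_of_isEmpty hE]
      exact continuousOn_const.congr fun s _ => forestInt_bot V s
    · have hc : ∀ e ∈ F.edgeSet, ContinuousOn (forestInt (F.deleteEdges {e}) V) (Ici 0) :=
        fun e he => ih _ (hn ▸ card_edges_deleteEdges he) (hF.anti (F.deleteEdges_le _)) V rfl
      -- Composing with max r 0 gives a source continuous on all of ℝ, as the continuity of the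
      -- primitive requires; only its values at r ≥ 0 enter.
      have hG : Continuous fun r : ℝ =>
          ∑ e ∈ edges F, forestInt (F.deleteEdges {e}) V (max r 0) :=
        continuous_finsetSum _ fun e he => (hc e (mem_edges.1 he)).comp_continuous (by fun_prop)
          fun r => mem_Ici.2 (le_max_right _ _)
      have hf := fun s (hs : s ∈ Ici (0 : ℝ)) => forestInt_formula hF V (G := fun r => ∑ e ∈ edges F, forestInt (F.deleteEdges {e}) V (max r 0))
        (fun r hr => by simp only [max_eq_left hr]) hc hs
      refine ContinuousOn.congr (Continuous.continuousOn ?_) hf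
      refine Continuous.mul (by fun_prop) ?_
      exact intervalIntegral.continuous_primitive (fun a b =>
        (Continuous.intervalIntegrable (by fun_prop) _ _)) 0

/-- The Brydges–Kennedy flow equation, read off from Duhamel's formula. Right derivatives suffice,
because the constancy arguments below use only those. -/
theorem hasDerivWithinAt_forestInt {F : SimpleGraph S} (hF : F.IsAcyclic) (V : Sym2 S → ℂ)
    {s : ℝ} (hs : 0 ≤ s) :
    HasDerivWithinAt (forestInt F V) (-(∑ p ∈ connPairs F, V p) * forestInt F V s +
      ∑ e ∈ edges F, forestInt (F.deleteEdges {e}) V s) (Ici s) s := by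
  rcases isEmpty_or_nonempty F.edgeSet with hE | hE
  · rw [eq_bot_of_isEmpty hE, connPairs_bot, edges_bot]
    simp only [Finset.sum_empty, neg_zero, zero_mul, add_zero]
    exact (hasDerivWithinAt_const s _ (1 : ℂ)).congr (fun r _ => forestInt_bot V r)
      (forestInt_bot V s)
  · have hc : ∀ e ∈ F.edgeSet, ContinuousOn (forestInt (F.deleteEdges {e}) V) (Ici 0) :=
      fun e he => continuousOn_forestInt _ (hF.anti (F.deleteEdges_le _)) V rfl
    have hG : Continuous fun r : ℝ =>
        ∑ e ∈ edges F, forestInt (F.deleteEdges {e}) V (max r 0) :=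
      continuous_finsetSum _ fun e he => (hc e (mem_edges.1 he)).comp_continuous (by fun_prop)
        fun r => mem_Ici.2 (le_max_right _ _)
    have hf := fun s (hs : s ∈ Ici (0 : ℝ)) => forestInt_formula hF V (G := fun r => ∑ e ∈ edges F, forestInt (F.deleteEdges {e}) V (max r 0))
      (fun r hr => by simp only [max_eq_left hr]) hc hs
    set C := ∑ p ∈ connPairs F, V p with hC
    have h1 : HasDerivAt (fun s : ℝ => Complex.exp (-(s • C))) (Complex.exp (-(s • C)) * (-C)) s := by
      have : HasDerivAt (fun s : ℝ => -(s • C)) (-((1 : ℝ) • C)) s :=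
        ((hasDerivAt_id s).smul_const C).neg
      simpa using this.cexp
    have hcont : Continuous fun r : ℝ => Complex.exp (r • C) *
        ∑ e ∈ edges F, forestInt (F.deleteEdges {e}) V (max r 0) := by fun_prop
    have h2 := intervalIntegral.integral_hasDerivAt_right (a := 0) (b := s)
      (hcont.intervalIntegrable _ _) (hcont.stronglyMeasurableAtFilter _ _) hcont.continuousAt
    have h3 := (h1.mul h2).hasDerivWithinAt (s := Ici s)
    refine (h3.congr (fun r hr => hf r (hs.trans hr)) (hf s hs)).congr_deriv ?_
    rw [hf s hs, max_eq_left hs]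
    rw [← mul_assoc (Complex.exp (-(s • C))), ← Complex.exp_add, neg_add_cancel, Complex.exp_zero,
      one_mul]
    ring

/-- The sum over forests of the products of the edge weights. -/
def forestWeight (F : SimpleGraph S) (V : Sym2 S → ℂ) (s : ℝ) : ℂ :=
  (∏ e ∈ edges F, -V e) * forestInt F V s

/-- The forests on `S`. -/
def forests (S : Type) [Fintype S] : Finset (SimpleGraph S) :=
  Finset.univ.filter fun F => F.IsAcyclic

@[simp] theorem mem_forests {F : SimpleGraph S} : F ∈ forests S ↔ F.IsAcyclic := by simp [forests]

omit [Fintype S] in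
theorem deleteEdges_sup_fromEdgeSet {F : SimpleGraph S} {e : Sym2 S} (he : e ∈ F.edgeSet) :
    F.deleteEdges {e} ⊔ SimpleGraph.fromEdgeSet {e} = F := by
  rw [← SimpleGraph.edgeSet_inj]
  ext p
  simp only [SimpleGraph.edgeSet_sup, SimpleGraph.edgeSet_deleteEdges,
    SimpleGraph.edgeSet_fromEdgeSet, mem_union, Set.mem_sdiff, mem_singleton_iff]
  constructor
  · rintro (h | h)
    · exact h.1
    · rw [h.1]; exact he
  · intro h
    by_cases hp : p = e
    · exact Or.inr ⟨hp, by rw [hp]; exact F.not_isDiag_of_mem_edgeSet he⟩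
    · exact Or.inl ⟨h, hp⟩

omit [Fintype S] in
theorem sup_fromEdgeSet_deleteEdges {F : SimpleGraph S} {e : Sym2 S} (he : ¬ connPair F e) :
    (F ⊔ SimpleGraph.fromEdgeSet {e}).deleteEdges {e} = F := by
  have : e ∉ F.edgeSet := fun h => he (by
    induction e with
    | _ j k => exact SimpleGraph.Adj.reachable h)
  rw [← SimpleGraph.edgeSet_inj]
  ext p
  simp only [SimpleGraph.edgeSet_sup, SimpleGraph.edgeSet_deleteEdges,
    SimpleGraph.edgeSet_fromEdgeSet, mem_union, Set.mem_sdiff, mem_singleton_iff]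
  constructor
  · rintro ⟨h | h, h'⟩
    · exact h
    · exact absurd h.1 h'
  · intro h
    exact ⟨Or.inl h, fun hp => this (hp ▸ h)⟩

/-- Forests with a marked edge correspond to forests with a marked pair of disconnected points. -/
theorem sum_forests_edges (f : SimpleGraph S → Sym2 S → ℂ) :
    ∑ F ∈ forests S, ∑ e ∈ edges F, f (F.deleteEdges {e}) e =
      ∑ F ∈ forests S, ∑ e ∈ (offPairs S).filter (fun e => ¬ connPair F e), f F e := by
  rw [Finset.sum_sigma', Finset.sum_sigma']
  refine Finset.sum_bij' (fun x _ => ⟨x.1.deleteEdges {x.2}, x.2⟩)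
    (fun x _ => ⟨x.1 ⊔ SimpleGraph.fromEdgeSet {x.2}, x.2⟩) ?_ ?_ ?_ ?_ ?_
  · rintro ⟨F, e⟩ h
    simp only [Finset.mem_sigma, mem_forests, mem_edges, Finset.mem_filter, mem_offPairs] at h ⊢
    refine ⟨h.1.anti (F.deleteEdges_le _), F.not_isDiag_of_mem_edgeSet h.2, ?_⟩
    have := SimpleGraph.isAcyclic_iff_forall_isBridge.1 h.1 h.2
    induction e with
    | _ j k => exact this
  · rintro ⟨F, e⟩ h
    simp only [Finset.mem_sigma, mem_forests, mem_edges, Finset.mem_filter, mem_offPairs] at h ⊢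
    refine ⟨?_, ?_⟩
    · induction e with
      | _ j k => exact h.1.sup_edge_of_not_reachable h.2.2
    · simp [SimpleGraph.edgeSet_sup, h.2.1]
  · rintro ⟨F, e⟩ h
    simp only [Finset.mem_sigma, mem_edges] at h
    simp only [deleteEdges_sup_fromEdgeSet h.2]
  · rintro ⟨F, e⟩ h
    simp only [Finset.mem_sigma, Finset.mem_filter] at h
    simp only [sup_fromEdgeSet_deleteEdges h.2.2]
  · rintro ⟨F, e⟩ h
    rfl

theorem edges_eq_insert {F : SimpleGraph S} {e : Sym2 S} (he : e ∈ F.edgeSet) :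
    edges F = insert e (edges (F.deleteEdges {e})) ∧ e ∉ edges (F.deleteEdges {e}) := by
  constructor
  · ext p
    simp only [mem_edges, SimpleGraph.edgeSet_deleteEdges, Finset.mem_insert, Set.mem_sdiff,
      mem_singleton_iff]
    by_cases hp : p = e
    · simp [hp, he]
    · simp [hp]
  · simp [SimpleGraph.edgeSet_deleteEdges]

/-- The **forest formula** of Brydges and Kennedy. -/
theorem sum_forestWeight (V : Sym2 S → ℂ) :
    ∑ F ∈ forests S, forestWeight F V 1 = Complex.exp (-∑ p ∈ offPairs S, V p) := by
  set C := ∑ p ∈ offPairs S, V p with hC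
  let Z : ℝ → ℂ := fun s => ∑ F ∈ forests S, forestWeight F V s
  -- The sum over forests solves Z' = -CZ. The damping terms carry the pairs already joined by the
  -- forest. The source terms, reindexed by `sum_forests_edges`, carry the pairs not yet joined,
  -- since removing a marked edge from a forest is inverse to adding an edge between two components.
  -- Together all pairs occur.
  have hZ : ∀ s ∈ Ico (0 : ℝ) 1, HasDerivWithinAt Z (-C * Z s) (Ici s) s := by
    intro s hs
    have h1 : HasDerivWithinAt Z (∑ F ∈ forests S, (∏ e ∈ edges F, -V e) *
        (-(∑ p ∈ connPairs F, V p) * forestInt F V s +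
          ∑ e ∈ edges F, forestInt (F.deleteEdges {e}) V s)) (Ici s) s :=
      HasDerivWithinAt.fun_sum fun F hF =>
        (hasDerivWithinAt_forestInt (mem_forests.1 hF) V hs.1).const_mul _
    refine h1.congr_deriv ?_
    have h2 := sum_forests_edges (S := S) fun F e => -V e * forestWeight F V s
    have h3 : ∑ F ∈ forests S, ∑ e ∈ edges F, -V e * forestWeight (F.deleteEdges {e}) V s =
        ∑ F ∈ forests S, (∏ e ∈ edges F, -V e) *
          ∑ e ∈ edges F, forestInt (F.deleteEdges {e}) V s := by
      refine Finset.sum_congr rfl fun F _ => ?_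
      rw [Finset.mul_sum]
      refine Finset.sum_congr rfl fun e he => ?_
      obtain ⟨h4, h5⟩ := edges_eq_insert (mem_edges.1 he)
      rw [h4, Finset.prod_insert h5, forestWeight, mul_assoc]
    simp only [mul_add, Finset.sum_add_distrib]
    rw [← h3, h2, ← Finset.sum_add_distrib]
    simp only [Z, Finset.mul_sum]
    refine Finset.sum_congr rfl fun F _ => ?_
    have h6 := Finset.sum_filter_add_sum_filter_not (offPairs S) (fun e => connPair F e) V
    rw [← Finset.sum_mul, hC, ← h6, Finset.sum_neg_distrib, connPairs, forestWeight]
    ring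
  have hZc : ContinuousOn Z (Icc 0 1) := by
    refine continuousOn_finsetSum _ fun F hF => ContinuousOn.mul continuousOn_const ?_
    exact (continuousOn_forestInt _ (mem_forests.1 hF) V rfl).mono Icc_subset_Ici_self
  -- At s = 0 the cube is a point of measure zero unless there are no edges, so only the empty
  -- forest contributes.
  have hZ0 : Z 0 = 1 := by
    simp only [Z]
    rw [Finset.sum_eq_single (⊥ : SimpleGraph S)]
    · simp [forestWeight, edges_bot, forestInt_bot]
    · intro F hF hne
      rw [forestWeight, forestInt_zero (mem_forests.1 hF), if_neg hne, mul_zero]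
    · intro h
      exact absurd (mem_forests.2 SimpleGraph.isAcyclic_bot) h
  have hexp : ∀ s : ℝ, HasDerivAt (fun s : ℝ => Complex.exp (s • C)) (Complex.exp (s • C) * C) s :=
    fun s => by simpa using (((hasDerivAt_id s).smul_const C)).cexp
  have key := constant_of_has_deriv_right_zero (f := fun s => Complex.exp (s • C) * Z s)
    (a := 0) (b := 1) (ContinuousOn.mul (by fun_prop) hZc) (fun s hs => by
      refine ((hexp s).hasDerivWithinAt.mul (hZ s hs)).congr_deriv ?_
      ring) 1 ⟨zero_le_one, le_rfl⟩
  simp only [one_smul, zero_smul, Complex.exp_zero, hZ0, mul_one] at key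
  change Z 1 = _
  rw [Complex.exp_neg]
  exact eq_inv_of_mul_eq_one_right key

end Forest

/-! ### Forests on a disjoint union -/

section Join

open scoped Classical

variable {S α β : Type} [Fintype S] [Fintype α] [Fintype β]

/-- The union of the images of two graphs. -/
def joinGraph (φ : α ↪ S) (ψ : β ↪ S) (A : SimpleGraph α) (B : SimpleGraph β) : SimpleGraph S :=
  A.map φ ⊔ B.map ψ

/-- The embeddings `φ` and `ψ` split `S` into two parts. -/
structure IsSplitting (φ : α ↪ S) (ψ : β ↪ S) : Prop where
  disj : ∀ a b, φ a ≠ ψ b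
  cover : ∀ s, (∃ a, φ a = s) ∨ ∃ b, ψ b = s

variable {φ : α ↪ S} {ψ : β ↪ S} {A : SimpleGraph α} {B : SimpleGraph β}

omit [Fintype S] [Fintype α] [Fintype β] in
theorem IsSplitting.symm (h : IsSplitting φ ψ) : IsSplitting ψ φ :=
  ⟨fun b a hab => h.disj a b hab.symm, fun s => (h.cover s).symm⟩

omit [Fintype S] [Fintype α] [Fintype β] in
theorem joinGraph_comm (φ : α ↪ S) (ψ : β ↪ S) (A : SimpleGraph α) (B : SimpleGraph β) :
    joinGraph φ ψ A B = joinGraph ψ φ B A := sup_comm _ _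

omit [Fintype S] [Fintype α] [Fintype β] in
theorem edgeSet_joinGraph : (joinGraph φ ψ A B).edgeSet =
    Sym2.map φ '' A.edgeSet ∪ Sym2.map ψ '' B.edgeSet := by
  rw [joinGraph, SimpleGraph.edgeSet_sup, SimpleGraph.edgeSet_map, SimpleGraph.edgeSet_map]
  rfl

omit [Fintype S] [Fintype α] [Fintype β] in
theorem IsSplitting.sym2_ne (h : IsSplitting φ ψ) (p : Sym2 α) (q : Sym2 β) :
    Sym2.map φ p ≠ Sym2.map ψ q := by
  induction p with | _ a a' =>
  induction q with | _ b b' =>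
  simp only [Sym2.map_mk, ne_eq, Sym2.eq_iff, not_or, not_and]
  exact ⟨fun h1 => absurd h1 (h.disj _ _), fun h1 => absurd h1 (h.disj _ _)⟩

omit [Fintype S] [Fintype α] [Fintype β] in
theorem IsSplitting.deleteEdges_joinGraph (h : IsSplitting φ ψ) (e : Sym2 α) :
    (joinGraph φ ψ A B).deleteEdges {Sym2.map φ e} = joinGraph φ ψ (A.deleteEdges {e}) B := by
  rw [← SimpleGraph.edgeSet_inj, SimpleGraph.edgeSet_deleteEdges, edgeSet_joinGraph,
    edgeSet_joinGraph, SimpleGraph.edgeSet_deleteEdges, union_sdiff_distrib,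
    image_sdiff (Sym2.map.injective φ.injective), image_singleton]
  congr 1
  rw [sdiff_eq_left, disjoint_singleton_right]
  rintro ⟨q, -, hq⟩
  exact h.sym2_ne e q hq.symm

omit [Fintype S] [Fintype α] [Fintype β] in
theorem IsSplitting.adj_left (h : IsSplitting φ ψ) {a : α} {s : S}
    (hs : (joinGraph φ ψ A B).Adj (φ a) s) : ∃ a', φ a' = s ∧ A.Adj a a' := by
  rw [joinGraph, SimpleGraph.sup_adj, SimpleGraph.map_adj, SimpleGraph.map_adj] at hs
  rcases hs with ⟨a1, a2, h1, h2, h3⟩ | ⟨b1, b2, h1, h2, h3⟩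
  · exact ⟨a2, h3, φ.injective h2 ▸ h1⟩
  · exact absurd h2.symm (h.disj _ _)

omit [Fintype S] [Fintype α] [Fintype β] in
theorem IsSplitting.reachable_left (h : IsSplitting φ ψ) {a : α} {s : S}
    (hs : (joinGraph φ ψ A B).Reachable (φ a) s) : ∃ a', φ a' = s ∧ A.Reachable a a' := by
  rw [SimpleGraph.reachable_iff_reflTransGen] at hs
  induction hs with
  | refl => exact ⟨a, rfl, SimpleGraph.Reachable.refl _⟩
  | tail _ hadj ih =>
    obtain ⟨a1, rfl, h2⟩ := ih
    obtain ⟨a2, h3, h4⟩ := h.adj_left hadj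
    exact ⟨a2, h3, h2.trans h4.reachable⟩

omit [Fintype S] [Fintype α] [Fintype β] in
theorem reachable_joinGraph {a a' : α} (h : A.Reachable a a') :
    (joinGraph φ ψ A B).Reachable (φ a) (φ a') :=
  (h.map (SimpleGraph.Embedding.map φ A).toHom).mono le_sup_left

omit [Fintype S] [Fintype α] [Fintype β] in
theorem IsSplitting.reachable_iff (h : IsSplitting φ ψ) {a a' : α} :
    (joinGraph φ ψ A B).Reachable (φ a) (φ a') ↔ A.Reachable a a' := by
  refine ⟨fun h1 => ?_, reachable_joinGraph⟩
  obtain ⟨a2, h2, h3⟩ := h.reachable_left h1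
  exact φ.injective h2 ▸ h3

theorem IsSplitting.connPairs_joinGraph (h : IsSplitting φ ψ) :
    connPairs (joinGraph φ ψ A B) = (connPairs A).map ⟨_, Sym2.map.injective φ.injective⟩ ∪
      (connPairs B).map ⟨_, Sym2.map.injective ψ.injective⟩ := by
  ext p
  simp only [Finset.mem_union, Finset.mem_map, Function.Embedding.coeFn_mk]
  constructor
  · intro hp
    induction p with | _ j k =>
    simp only [mem_connPairs, Sym2.mk_isDiag_iff, connPair_mk] at hp
    rcases h.cover j with ⟨a, rfl⟩ | ⟨b, rfl⟩
    · obtain ⟨a', rfl, h1⟩ := h.reachable_left hp.2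
      exact Or.inl ⟨s(a, a'), by simpa using ⟨fun h2 => hp.1 (by rw [h2]), h1⟩, rfl⟩
    · rw [joinGraph_comm] at hp
      obtain ⟨a', rfl, h1⟩ := h.symm.reachable_left hp.2
      exact Or.inr ⟨s(b, a'), by simpa using ⟨fun h2 => hp.1 (by rw [h2]), h1⟩, rfl⟩
  · rintro (⟨q, hq, rfl⟩ | ⟨q, hq, rfl⟩)
    · induction q with | _ j k =>
      simp only [mem_connPairs, Sym2.mk_isDiag_iff, connPair_mk, Sym2.map_mk] at hq ⊢
      exact ⟨fun h1 => hq.1 (φ.injective h1), reachable_joinGraph hq.2⟩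
    · induction q with | _ j k =>
      simp only [mem_connPairs, Sym2.mk_isDiag_iff, connPair_mk, Sym2.map_mk] at hq ⊢
      rw [joinGraph_comm]
      exact ⟨fun h1 => hq.1 (ψ.injective h1), reachable_joinGraph hq.2⟩

theorem IsSplitting.edges_joinGraph :
    edges (joinGraph φ ψ A B) = (edges A).map ⟨_, Sym2.map.injective φ.injective⟩ ∪
      (edges B).map ⟨_, Sym2.map.injective ψ.injective⟩ := by
  ext p
  simp [edgeSet_joinGraph]

omit [Fintype S] [Fintype α] [Fintype β] in
theorem IsSplitting.disjoint_map (h : IsSplitting φ ψ) (P : Finset (Sym2 α)) (P' : Finset (Sym2 β)) :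
    Disjoint (P.map ⟨_, Sym2.map.injective φ.injective⟩)
      (P'.map ⟨_, Sym2.map.injective ψ.injective⟩) := by
  rw [Finset.disjoint_left]
  intro p hp hp'
  obtain ⟨q, -, rfl⟩ := Finset.mem_map.1 hp
  obtain ⟨q', -, h1⟩ := Finset.mem_map.1 hp'
  exact h.sym2_ne q q' h1.symm

omit [Fintype S] [Fintype α] [Fintype β] in
theorem IsSplitting.isAcyclic (h : IsSplitting φ ψ) (hA : A.IsAcyclic) (hB : B.IsAcyclic) :
    (joinGraph φ ψ A B).IsAcyclic := by
  rw [SimpleGraph.isAcyclic_iff_forall_isBridge] at hA hB ⊢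
  intro e he
  rw [edgeSet_joinGraph] at he
  rcases he with ⟨q, hq, rfl⟩ | ⟨q, hq, rfl⟩
  · have h1 := hA hq
    induction q with | _ j k =>
    change ¬ ((joinGraph φ ψ A B).deleteEdges {Sym2.map φ s(j, k)}).Reachable (φ j) (φ k)
    rw [h.deleteEdges_joinGraph]
    exact fun h2 => h1 (h.reachable_iff.1 h2)
  · have h1 := hB hq
    induction q with | _ j k =>
    change ¬ ((joinGraph φ ψ A B).deleteEdges {Sym2.map ψ s(j, k)}).Reachable (ψ j) (ψ k)
    rw [joinGraph_comm, h.symm.deleteEdges_joinGraph]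
    exact fun h2 => h1 (h.symm.reachable_iff.1 h2)

omit [Fintype S] [Fintype α] [Fintype β] in
theorem joinGraph_eq_bot : joinGraph φ ψ A B = ⊥ ↔ A = ⊥ ∧ B = ⊥ := by
  rw [joinGraph, sup_eq_bot_iff]
  simp only [← SimpleGraph.edgeSet_eq_empty, SimpleGraph.edgeSet_map, image_eq_empty]

/-- No path crosses between the two parts, so both sides solve the same linear equation in s: the
damping constant is the sum of the two constants, and the sources have one edge fewer and agree by
induction. They also agree at s = 0. The differential equation replaces a Fubini argument on the
product of the two cubes. -/
theorem IsSplitting.forestInt_joinGraph (h : IsSplitting φ ψ) (V : Sym2 S → ℂ) (n : ℕ) :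
    ∀ {A : SimpleGraph α} {B : SimpleGraph β}, A.IsAcyclic → B.IsAcyclic →
      (edges A).card + (edges B).card = n → ∀ {s : ℝ}, 0 ≤ s →
      forestInt (joinGraph φ ψ A B) V s =
        forestInt A (V ∘ Sym2.map φ) s * forestInt B (V ∘ Sym2.map ψ) s := by
  induction n using Nat.strong_induction_on with
  | _ n ih =>
    intro A B hA hB hn s hs
    set C := ∑ p ∈ connPairs (joinGraph φ ψ A B), V p with hC
    have hCe : C = ∑ p ∈ connPairs A, V (Sym2.map φ p) + ∑ p ∈ connPairs B, V (Sym2.map ψ p) := by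
      rw [hC, h.connPairs_joinGraph, Finset.sum_union (h.disjoint_map _ _), Finset.sum_map,
        Finset.sum_map]
      rfl
    have hJ := h.isAcyclic hA hB
    have hd : ∀ r ∈ Ico (0 : ℝ) s, HasDerivWithinAt (fun r => forestInt (joinGraph φ ψ A B) V r -
        forestInt A (V ∘ Sym2.map φ) r * forestInt B (V ∘ Sym2.map ψ) r)
        (-C * (forestInt (joinGraph φ ψ A B) V r -
        forestInt A (V ∘ Sym2.map φ) r * forestInt B (V ∘ Sym2.map ψ) r)) (Ici r) r := by
      intro r hr
      refine ((hasDerivWithinAt_forestInt hJ V hr.1).fun_sub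
        ((hasDerivWithinAt_forestInt hA (V ∘ Sym2.map φ) hr.1).fun_mul
          (hasDerivWithinAt_forestInt hB (V ∘ Sym2.map ψ) hr.1))).congr_deriv ?_
      have h1 : ∑ e ∈ edges (joinGraph φ ψ A B), forestInt ((joinGraph φ ψ A B).deleteEdges {e}) V r
          = (∑ e ∈ edges A, forestInt (A.deleteEdges {e}) (V ∘ Sym2.map φ) r) *
            forestInt B (V ∘ Sym2.map ψ) r + forestInt A (V ∘ Sym2.map φ) r *
            (∑ e ∈ edges B, forestInt (B.deleteEdges {e}) (V ∘ Sym2.map ψ) r) := by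
        rw [IsSplitting.edges_joinGraph, Finset.sum_union (h.disjoint_map _ _), Finset.sum_map,
          Finset.sum_map, Finset.sum_mul, Finset.mul_sum]
        congr 1
        · refine Finset.sum_congr rfl fun e he => ?_
          simp only [Function.Embedding.coeFn_mk]
          rw [h.deleteEdges_joinGraph]
          refine ih _ ?_ (hA.anti (A.deleteEdges_le _)) hB rfl hr.1
          have := card_edges_deleteEdges (mem_edges.1 he)
          omega
        · refine Finset.sum_congr rfl fun e he => ?_
          simp only [Function.Embedding.coeFn_mk]
          rw [joinGraph_comm, h.symm.deleteEdges_joinGraph, joinGraph_comm]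
          refine ih _ ?_ hA (hB.anti (B.deleteEdges_le _)) rfl hr.1
          have := card_edges_deleteEdges (mem_edges.1 he)
          omega
      rw [h1, ← hC, hCe]
      simp only [Function.comp]
      ring
    have hcont : ∀ {γ : Type} [Fintype γ] {F : SimpleGraph γ} (_ : F.IsAcyclic) (W : Sym2 γ → ℂ),
        ContinuousOn (forestInt F W) (Icc 0 s) := fun hF W =>
      (continuousOn_forestInt _ hF W rfl).mono Icc_subset_Ici_self
    have hexp : ∀ s : ℝ, HasDerivAt (fun s : ℝ => Complex.exp (s • C)) (Complex.exp (s • C) * C) s :=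
      fun s => by simpa using (((hasDerivAt_id s).smul_const C)).cexp
    have key := constant_of_has_deriv_right_zero (f := fun r => Complex.exp (r • C) *
        (forestInt (joinGraph φ ψ A B) V r -
        forestInt A (V ∘ Sym2.map φ) r * forestInt B (V ∘ Sym2.map ψ) r))
      (a := 0) (b := s) (ContinuousOn.mul (by fun_prop)
        ((hcont hJ V).sub ((hcont hA _).mul (hcont hB _)))) (fun r hr => by
        refine ((hexp r).hasDerivWithinAt.mul (hd r hr)).congr_deriv ?_
        ring) s ⟨hs, le_rfl⟩
    have h0 : forestInt (joinGraph φ ψ A B) V 0 -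
        forestInt A (V ∘ Sym2.map φ) 0 * forestInt B (V ∘ Sym2.map ψ) 0 = 0 := by
      rw [forestInt_zero hJ, forestInt_zero hA, forestInt_zero hB]
      simp only [joinGraph_eq_bot]
      by_cases h1 : A = ⊥ <;> by_cases h2 : B = ⊥ <;> simp [h1, h2]
    simp only [h0, mul_zero, mul_eq_zero, Complex.exp_ne_zero, false_or] at key
    exact sub_eq_zero.1 key

theorem IsSplitting.forestWeight_joinGraph (h : IsSplitting φ ψ) (V : Sym2 S → ℂ)
    (hA : A.IsAcyclic) (hB : B.IsAcyclic) {s : ℝ} (hs : 0 ≤ s) :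
    forestWeight (joinGraph φ ψ A B) V s =
      forestWeight A (V ∘ Sym2.map φ) s * forestWeight B (V ∘ Sym2.map ψ) s := by
  rw [forestWeight, forestWeight, forestWeight, h.forestInt_joinGraph V _ hA hB rfl hs,
    IsSplitting.edges_joinGraph, Finset.prod_union (h.disjoint_map _ _), Finset.prod_map,
    Finset.prod_map]
  simp only [Function.comp, Function.Embedding.coeFn_mk]
  ring

/-- The sum over trees of the products of the edge factors `K` and of the integrals `forestInt`. -/
def treeSum (S : Type) [Fintype S] (K V : Sym2 S → ℂ) : ℂ :=
  ∑ F : SimpleGraph S with F.IsTree, (∏ e ∈ edges F, K e) * forestInt F V 1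

/-- `exp (-∑ V_{jk})`, the sum over all pairs. -/
def pairExp (S : Type) [Fintype S] (V : Sym2 S → ℂ) : ℂ := Complex.exp (-∑ p ∈ offPairs S, V p)

omit [Fintype S] [Fintype α] in
theorem joinGraph_empty (e : α ≃ S) :
    joinGraph e.toEmbedding (⟨Empty.elim, fun a => a.elim⟩ : Empty ↪ S) A ⊥ =
      A.map e.toEmbedding := by
  rw [← SimpleGraph.edgeSet_inj, edgeSet_joinGraph, SimpleGraph.edgeSet_map]
  simp

/-- A bijection is a splitting whose second part is empty, so invariance under relabelling is a case
of multiplicativity. -/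
theorem forestInt_iso (e : α ≃ S) (V : Sym2 S → ℂ) (hA : A.IsAcyclic) :
    forestInt (A.map e.toEmbedding) V 1 = forestInt A (V ∘ Sym2.map e) 1 := by
  have h : IsSplitting e.toEmbedding (⟨Empty.elim, fun a => a.elim⟩ : Empty ↪ S) :=
    ⟨fun _ b => b.elim, fun s => Or.inl ⟨e.symm s, by simp⟩⟩
  have h1 := h.forestInt_joinGraph V _ hA SimpleGraph.isAcyclic_bot rfl zero_le_one
  rw [joinGraph_empty, forestInt_bot, mul_one] at h1
  exact h1

theorem edges_map (e : α ↪ S) :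
    edges (A.map e) = (edges A).map ⟨_, Sym2.map.injective e.injective⟩ := by
  ext p
  simp only [mem_edges, SimpleGraph.edgeSet_map, Finset.mem_map]
  rfl

theorem treeSum_equiv (e : α ≃ S) (K V : Sym2 S → ℂ) :
    treeSum S K V = treeSum α (K ∘ Sym2.map e) (V ∘ Sym2.map e) := by
  symm
  refine Finset.sum_bij' (fun A _ => A.map e.toEmbedding) (fun F _ => F.comap e) ?_ ?_ ?_ ?_ ?_
  · intro A hA
    simp only [Finset.mem_filter, Finset.mem_univ, true_and] at hA ⊢
    exact (SimpleGraph.Iso.map e A).isTree_iff.1 hA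
  · intro F hF
    simp only [Finset.mem_filter, Finset.mem_univ, true_and] at hF ⊢
    exact (SimpleGraph.Iso.comap e F).isTree_iff.2 hF
  · intro A _
    ext a b
    exact SimpleGraph.map_adj_apply (f := e.toEmbedding)
  · intro F _
    ext a b
    refine (SimpleGraph.map_adj e.toEmbedding _ _ _).trans ?_
    constructor
    · rintro ⟨u, v, h, rfl, rfl⟩; exact h
    · intro h; exact ⟨e.symm a, e.symm b, by simpa using h, by simp, by simp⟩
  · intro A hA
    simp only [Finset.mem_filter, Finset.mem_univ, true_and] at hA
    rw [forestInt_iso e V hA.isAcyclic, edges_map, Finset.prod_map]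
    rfl

theorem pairExp_equiv (e : α ≃ S) (V : Sym2 S → ℂ) :
    pairExp S V = pairExp α (V ∘ Sym2.map e) := by
  rw [pairExp, pairExp]
  congr 2
  have h : offPairs S = (offPairs α).map ⟨_, Sym2.map.injective e.injective⟩ := by
    ext p
    induction p with | _ j k =>
    simp only [mem_offPairs, Sym2.mk_isDiag_iff, Finset.mem_map, Function.Embedding.coeFn_mk]
    constructor
    · intro hjk
      exact ⟨s(e.symm j, e.symm k), by simpa using hjk, by simp⟩
    · rintro ⟨q, hq, h⟩ rfl
      induction q with | _ a b =>
      simp only [Sym2.mk_isDiag_iff, Sym2.map_mk, Sym2.eq_iff] at hq h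
      rcases h with h | h <;> exact hq (e.injective (h.1.trans h.2.symm))
  rw [h, Finset.sum_map]
  rfl

/-- Splitting off the component of a point. -/
theorem pairExp_eq_sum_treeSum (V : Sym2 S → ℂ) (i0 : S) :
    pairExp S V = ∑ I : Finset S with i0 ∈ I,
      treeSum {i // i ∈ I} (-V ∘ Sym2.map Subtype.val) (V ∘ Sym2.map Subtype.val) *
        pairExp {i // i ∉ I} (V ∘ Sym2.map Subtype.val) := by
  have hV : ∀ I : Finset S, pairExp {i // i ∉ I} (V ∘ Sym2.map Subtype.val) =
      ∑ B ∈ forests {i // i ∉ I}, forestWeight B (V ∘ Sym2.map Subtype.val) 1 :=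
    fun I => (sum_forestWeight _).symm
  have hsp : ∀ I : Finset S, IsSplitting (Function.Embedding.subtype (fun i => i ∈ I))
      (Function.Embedding.subtype (fun i => i ∉ I)) := fun I =>
    ⟨fun a b h => b.2 (by have := a.2; rwa [show (a : S) = b from h] at this), fun s => by
      by_cases hs : s ∈ I
      · exact Or.inl ⟨⟨s, hs⟩, rfl⟩
      · exact Or.inr ⟨⟨s, hs⟩, rfl⟩⟩
  -- Forests are fibred over the vertex set I of the component of i0. A forest in the fibre of I is
  -- a tree on I joined to an arbitrary forest on the complement, and its weight is the product of
  -- the two weights.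
  let comp : SimpleGraph S → Finset S := fun F => Finset.univ.filter fun i => F.Reachable i0 i
  rw [pairExp, ← sum_forestWeight, ← Finset.sum_fiberwise_of_maps_to (g := comp)
    (t := Finset.univ.filter fun I : Finset S => i0 ∈ I) (fun F _ => by simp [comp])]
  refine Finset.sum_congr rfl fun I hI => ?_
  simp only [Finset.mem_filter, Finset.mem_univ, true_and] at hI
  rw [hV, treeSum, Finset.sum_mul_sum, ← Finset.sum_product']
  symm
  refine Finset.sum_bij' (fun x _ => joinGraph (Function.Embedding.subtype (fun i => i ∈ I))
      (Function.Embedding.subtype (fun i => i ∉ I)) x.1 x.2)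
    (fun F _ => (F.comap Subtype.val, F.comap Subtype.val)) ?_ ?_ ?_ ?_ ?_
  · rintro ⟨A, B⟩ h
    simp only [Finset.mem_product, Finset.mem_filter, Finset.mem_univ, true_and, mem_forests] at h ⊢
    refine ⟨(hsp I).isAcyclic h.1.isAcyclic h.2, ?_⟩
    ext i
    simp only [comp, Finset.mem_filter, Finset.mem_univ, true_and]
    constructor
    · intro hi
      obtain ⟨a, rfl, -⟩ := (hsp I).reachable_left (a := ⟨i0, hI⟩) hi
      exact a.2
    · intro hi
      exact (hsp I).reachable_iff (a := ⟨i0, hI⟩) (a' := ⟨i, hi⟩) |>.2 (h.1.connected _ _)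
  · intro F hF
    simp only [Finset.mem_product, Finset.mem_filter, Finset.mem_univ, true_and, mem_forests] at hF ⊢
    have hc : ∀ i, F.Reachable i0 i → i ∈ I := fun i hi => by rw [← hF.2]; simp [comp, hi]
    refine ⟨⟨?_, hF.1.comap ⟨Subtype.val, fun h => h⟩ Subtype.val_injective⟩,
      hF.1.comap ⟨Subtype.val, fun h => h⟩ Subtype.val_injective⟩
    have hr : ∀ i (hi : F.Reachable i0 i), (F.comap (Subtype.val : {i // i ∈ I} → S)).Reachable
        ⟨i0, hI⟩ ⟨i, hc i hi⟩ := by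
      intro i hi
      have hi' := hi
      rw [SimpleGraph.reachable_iff_reflTransGen] at hi'
      induction hi' with
      | refl => exact SimpleGraph.Reachable.refl _
      | tail h1 h2 ih =>
        have h3 := (SimpleGraph.reachable_iff_reflTransGen _ _).2 h1
        refine (ih h3).trans (SimpleGraph.Adj.reachable ?_)
        exact h2
    have : Nonempty {i // i ∈ I} := ⟨⟨i0, hI⟩⟩
    refine ⟨fun a b => ?_⟩
    have h4 : ∀ a : {i // i ∈ I}, F.Reachable i0 a := fun a => by
      have : (a : S) ∈ comp F := hF.2 ▸ a.2
      simpa [comp] using this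
    exact (hr a (h4 a)).symm.trans (hr b (h4 b))
  · rintro ⟨A, B⟩ h
    refine Prod.ext ?_ ?_
    · ext a b
      constructor
      · intro h
        obtain ⟨a', h1, h2⟩ := (hsp I).adj_left (a := a) h
        rwa [← Subtype.ext h1]
      · intro h
        exact Or.inl ((SimpleGraph.map_adj (Function.Embedding.subtype _) _ _ _).2 ⟨a, b, h, rfl, rfl⟩)
    · ext a b
      constructor
      · intro h
        rw [joinGraph_comm] at h
        obtain ⟨a', h1, h2⟩ := (hsp I).symm.adj_left (a := a) h
        rwa [← Subtype.ext h1]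
      · intro h
        exact Or.inr ((SimpleGraph.map_adj (Function.Embedding.subtype _) _ _ _).2 ⟨a, b, h, rfl, rfl⟩)
  · intro F hF
    simp only [Finset.mem_filter, mem_forests] at hF
    have hc : ∀ i, F.Reachable i0 i ↔ i ∈ I := fun i => by rw [← hF.2]; simp [comp]
    ext j k
    simp only [joinGraph, SimpleGraph.sup_adj, SimpleGraph.map_adj, SimpleGraph.comap_adj]
    constructor
    · rintro (⟨a, b, h, rfl, rfl⟩ | ⟨a, b, h, rfl, rfl⟩) <;> exact h
    · intro h
      have hjk : j ∈ I ↔ k ∈ I := by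
        rw [← hc, ← hc]
        exact ⟨fun h1 => h1.trans h.reachable, fun h1 => h1.trans h.symm.reachable⟩
      by_cases hj : j ∈ I
      · exact Or.inl ⟨⟨j, hj⟩, ⟨k, hjk.1 hj⟩, h, rfl, rfl⟩
      · exact Or.inr ⟨⟨j, hj⟩, ⟨k, fun hk => hj (hjk.2 hk)⟩, h, rfl, rfl⟩
  · rintro ⟨A, B⟩ h
    simp only [Finset.mem_product, Finset.mem_filter, Finset.mem_univ, true_and, mem_forests] at h
    exact ((hsp I).forestWeight_joinGraph V h.1.isAcyclic h.2 zero_le_one).symm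

end Join

/-! ### Sums over pairs and positivity of the interpolated quadratic forms -/

section TreeForm

open scoped Classical

variable {S : Type} [Fintype S]

theorem connPairs_of_isTree {F : SimpleGraph S} (hF : F.IsTree) : connPairs F = offPairs S := by
  ext p
  induction p with | _ j k =>
  simp [hF.connected j k]

theorem sum_offPairs_fin {M : Type} [AddCommMonoid M] {m : ℕ} (f : Sym2 (Fin m) → M) :
    ∑ p ∈ offPairs (Fin m), f p = ∑ p : Fin m × Fin m with p.1 < p.2, f s(p.1, p.2) := by
  have h := Finset.sum_sym2_filter_not_isDiag (Finset.univ : Finset (Fin m)) f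
  have h1 : (Finset.univ : Finset (Fin m)).offDiag.filter (fun i => i.1 < i.2) =
      Finset.univ.filter fun p : Fin m × Fin m => p.1 < p.2 := by
    ext p
    simp only [Finset.mem_filter, Finset.mem_offDiag, Finset.mem_univ, true_and]
    exact ⟨fun h => h.2, fun h => ⟨h.ne, h⟩⟩
  rw [h1] at h
  rw [← h, offPairs, Finset.sym2_univ]
  congr!

theorem prod_edges_fin {m : ℕ} {M : Type} [CommMonoid M] (g : SimpleGraph (Fin m))
    (f : Sym2 (Fin m) → M) :
    ∏ e ∈ edges g, f e = ∏ p : Fin m × Fin m with p.1 < p.2 ∧ g.Adj p.1 p.2, f s(p.1, p.2) := by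
  have h1 : edges g = (offPairs (Fin m)).filter (fun e => e ∈ g.edgeSet) := by
    ext p
    simp only [mem_edges, Finset.mem_filter, mem_offPairs]
    exact ⟨fun h => ⟨g.not_isDiag_of_mem_edgeSet h, h⟩, fun h => h.2⟩
  -- The product is a sum in `Additive M`; pairs that are not edges contribute the neutral element.
  have h2 := sum_offPairs_fin (M := Additive M)
    (fun e => if e ∈ g.edgeSet then Additive.ofMul (f e) else 0)
  rw [← Finset.sum_filter, ← Finset.sum_filter, ← h1, Finset.filter_filter] at h2
  exact h2

theorem sum_sum_eq_diag_add_offPairs {M : Type} [AddCommGroup M] [Module ℝ M] (c : S → S → M)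
    (d : S → M) (f : Sym2 S → M) (hd : ∀ j, c j j = d j)
    (hf : ∀ j k, j ≠ k → c j k = f s(j, k)) :
    ∑ j, ∑ k, c j k = ∑ j, d j + (2 : ℝ) • ∑ p ∈ offPairs S, f p := by
  -- Any linear order will do: it selects one ordered representative of each unordered pair.
  let e := Fintype.equivFin S
  let _ : LinearOrder S := LinearOrder.lift' e e.injective
  have h := Finset.sum_sym2_filter_not_isDiag (Finset.univ : Finset S) f
  have h0 : (Finset.univ : Finset S).sym2.filter (fun i => ¬ i.IsDiag) = offPairs S := by
    rw [offPairs, Finset.sym2_univ]; congr!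
  have h1 : ∀ c : S → S → M, ∑ j, ∑ k, c j k = ∑ j, c j j +
      ∑ p ∈ (Finset.univ : Finset S).offDiag, c p.1 p.2 := fun c => by
    rw [← Finset.sum_product', ← Finset.diag_union_offDiag, Finset.sum_union
      (Finset.disjoint_diag_offDiag _)]
    simp [Finset.sum_diag]
  rw [h1]
  congr 1
  · exact Finset.sum_congr rfl fun j _ => hd j
  rw [← h0, h, two_smul, ← Finset.sum_filter_add_sum_filter_not _ (fun p : S × S => p.1 < p.2)]
  congr 1
  · refine Finset.sum_congr rfl fun p hp => ?_
    simp only [Finset.mem_filter, Finset.mem_offDiag] at hp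
    exact hf _ _ hp.1.2.2
  · refine Finset.sum_bij' (fun p _ => p.swap) (fun p _ => p.swap) ?_ ?_ ?_ ?_ ?_
    · intro p hp
      simp only [Finset.mem_filter, Finset.mem_offDiag, Finset.mem_univ, true_and, not_lt,
        Prod.fst_swap, Prod.snd_swap] at hp ⊢
      exact ⟨hp.1.symm, lt_of_le_of_ne hp.2 hp.1.symm⟩
    · intro p hp
      simp only [Finset.mem_filter, Finset.mem_offDiag, Finset.mem_univ, true_and, not_lt,
        Prod.fst_swap, Prod.snd_swap] at hp ⊢
      exact ⟨hp.1.symm, hp.2.le⟩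
    · intro p _; rfl
    · intro p _; rfl
    · intro p hp
      simp only [Finset.mem_filter, Finset.mem_offDiag] at hp
      rw [hf _ _ hp.1.2.2]
      simp [Sym2.eq_swap]

/-- A form with values `q j` on the diagonal and `f s(j, k)` off the diagonal, nonnegative on the
indicator functions of sets, is nonnegative when restricted to the components of a graph. -/
theorem connPairs_form_nonneg {q : S → ℝ} {f : Sym2 S → ℝ}
    (h : ∀ I : Finset S, 0 ≤ ∑ j ∈ I, ∑ k ∈ I, if j = k then q j else f s(j, k))
    (F : SimpleGraph S) : 0 ≤ ∑ j, q j + 2 * ∑ p ∈ connPairs F, f p := by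
  have h1 := sum_sum_eq_diag_add_offPairs
    (fun j k => if F.Reachable j k then (if j = k then q j else f s(j, k)) else 0) q
    (fun p => if connPair F p then f p else 0) (fun j => by simp)
    (fun j k hjk => by simp [hjk])
  rw [← Finset.sum_filter] at h1
  rw [connPairs, ← smul_eq_mul, ← h1]
  rw [← Finset.sum_fiberwise_of_maps_to (g := F.connectedComponentMk) (t := Finset.univ)
    (fun _ _ => Finset.mem_univ _)]
  refine Finset.sum_nonneg fun c _ => ?_
  refine (h (Finset.univ.filter fun j => F.connectedComponentMk j = c)).trans_eq ?_
  refine Finset.sum_congr rfl fun j hj => ?_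
  rw [Finset.sum_filter]
  refine Finset.sum_congr rfl fun k _ => ?_
  simp only [Finset.mem_filter, Finset.mem_univ, true_and] at hj
  refine if_congr ?_ rfl rfl
  rw [← hj, SimpleGraph.ConnectedComponent.eq]
  exact ⟨fun h => h.symm, fun h => h.symm⟩

/-- With θ_e the smallest value, the form is θ_e times its restriction to the components of F, plus
the form of the same kind for F without e, with the shifted values and with c - θ_e on the diagonal.
Both are nonnegative, the second by induction on the number of edges. The bound c is a variable
precisely because it changes in this step. -/
theorem pairMin_form_nonneg {q : S → ℝ} {f : Sym2 S → ℝ}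
    (h : ∀ I : Finset S, 0 ≤ ∑ j ∈ I, ∑ k ∈ I, if j = k then q j else f s(j, k)) (n : ℕ) :
    ∀ {F : SimpleGraph S} (_ : F.IsAcyclic) (_ : (edges F).card = n) {c : ℝ} (_ : 0 ≤ c)
      {θ : F.edgeSet → ℝ} (_ : ∀ i, 0 ≤ θ i) (_ : ∀ i, θ i ≤ c),
      0 ≤ c * ∑ j, q j + 2 * ∑ p ∈ connPairs F, pairMin F θ p * f p := by
  induction n using Nat.strong_induction_on with
  | _ n ih =>
    intro F hF hn c hc θ h0 hθ
    rcases isEmpty_or_nonempty F.edgeSet with hE | hE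
    · obtain rfl := eq_bot_of_isEmpty hE
      have := connPairs_form_nonneg h ⊥
      simp only [connPairs_bot, Finset.sum_empty, mul_zero, add_zero] at this ⊢
      exact mul_nonneg hc this
    · obtain ⟨e, he⟩ := Finite.exists_min θ
      have h1 := sum_pairMin_deleteEdges hF e rfl (θ' := fun i => θ (delIncl F e i) - θ e)
        (fun i => by ring) (fun i => sub_nonneg.2 (he _)) f
      have h2 := ih _ (hn ▸ card_edges_deleteEdges e.2) (hF.anti (F.deleteEdges_le _)) rfl
        (sub_nonneg.2 (hθ e)) (θ := fun i => θ (delIncl F e i) - θ e)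
        (fun i => sub_nonneg.2 (he _)) (fun i => sub_le_sub_right (hθ _) _)
      have h3 := mul_nonneg (h0 e) (connPairs_form_nonneg h F)
      simp only [smul_eq_mul] at h1
      rw [h1]
      linarith

end TreeForm

/-! ### Hyperbolic kernels: bounds, and smoothness through t = 0 -/

section Sinh

/-- `sinh x / x`. -/
def sinhc (x : ℝ) : ℝ := dslope Real.sinh 0 x

theorem sinhc_zero : sinhc 0 = 1 := by simp [sinhc]

theorem mul_sinhc (x : ℝ) : x * sinhc x = Real.sinh x := by
  simpa [sinhc] using sub_smul_dslope Real.sinh 0 x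

theorem sinhc_of_ne {x : ℝ} (hx : x ≠ 0) : sinhc x = Real.sinh x / x := by
  rw [← mul_sinhc]; field_simp

theorem sinhc_pos (x : ℝ) : 0 < sinhc x := by
  rcases eq_or_ne x 0 with rfl | hx
  · rw [sinhc_zero]; exact one_pos
  · rw [sinhc_of_ne hx]
    rcases hx.lt_or_gt with h | h
    · exact div_pos_of_neg_of_neg (Real.sinh_neg_iff.2 h) h
    · exact div_pos (Real.sinh_pos_iff.2 h) h

theorem sinhc_neg (x : ℝ) : sinhc (-x) = sinhc x := by
  rcases eq_or_ne x 0 with rfl | hx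
  · simp
  · rw [sinhc_of_ne hx, sinhc_of_ne (neg_ne_zero.2 hx), Real.sinh_neg, neg_div_neg_eq]

theorem contDiff_sinhc : ContDiff ℝ 2 sinhc := by
  rw [contDiff_iff_contDiffAt]
  intro x
  rcases eq_or_ne x 0 with rfl | hx
  · obtain ⟨p, hp⟩ := (Real.contDiff_sinh (n := ⊤)).contDiffAt.analyticAt (x := (0 : ℝ))
    exact (AnalyticAt.contDiffAt ⟨_, hp.has_fpower_series_dslope_fslope⟩)
  · have h : ContDiffAt ℝ 2 (fun x => Real.sinh x / x) x :=
      Real.contDiff_sinh.contDiffAt.div contDiffAt_id hx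
    refine h.congr_of_eventuallyEq ?_
    filter_upwards [isOpen_ne.mem_nhds hx] with y hy using sinhc_of_ne hy

/-- In terms of `sinhc` the removable singularity at ωt = 0 disappears: the quotient is one of
smooth functions with positive denominator, and no case distinction remains. -/
theorem shRatio_eq (ω t s : ℝ) : shRatio ω t s = s * sinhc (ω * t * s) / sinhc (ω * t) := by
  rw [shRatio]
  split_ifs with h
  · simp [h, sinhc_zero]
  · rw [← mul_sinhc, ← mul_sinhc (ω * t)]
    have := (sinhc_pos (ω * t)).ne'
    generalize ω * t = a at *
    field_simp

theorem shKernel_eq (ω t s s' : ℝ) : shKernel ω t s s' =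
    s * (1 - s') * sinhc (ω * t * s) * sinhc (ω * t * (1 - s')) / sinhc (ω * t) := by
  rw [shKernel]
  split_ifs with h
  · simp [h, sinhc_zero]
  · rw [← mul_sinhc, ← mul_sinhc (ω * t), ← mul_sinhc (ω * t * (1 - s'))]
    have := (sinhc_pos (ω * t)).ne'
    generalize ω * t = a at *
    field_simp

theorem sinh_le_mul_cosh {y : ℝ} (hy : 0 ≤ y) : Real.sinh y ≤ y * Real.cosh y := by
  have h : MonotoneOn (fun y => y * Real.cosh y - Real.sinh y) (Ici 0) := by
    refine monotoneOn_of_deriv_nonneg (convex_Ici 0) (by fun_prop) (by fun_prop) fun x hx => ?_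
    rw [interior_Ici] at hx
    have : HasDerivAt (fun y => y * Real.cosh y - Real.sinh y)
        (1 * Real.cosh x + x * Real.sinh x - Real.cosh x) x :=
      ((hasDerivAt_id x).fun_mul (Real.hasDerivAt_cosh x)).fun_sub (Real.hasDerivAt_sinh x)
    rw [this.deriv]
    have := mul_nonneg (le_of_lt hx) (Real.sinh_nonneg_iff.2 (le_of_lt hx))
    linarith
  have := h (mem_Ici.2 le_rfl) (mem_Ici.2 hy) hy
  simp only [zero_mul, Real.sinh_zero, sub_zero] at this
  linarith

theorem sinh_mul_le {a s : ℝ} (ha : 0 ≤ a) (hs : s ∈ Icc (0 : ℝ) 1) :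
    Real.sinh (a * s) ≤ s * Real.sinh a := by
  have h : ConvexOn ℝ (Ici 0) Real.sinh := by
    refine MonotoneOn.convexOn_of_deriv (convex_Ici 0) (by fun_prop) (by fun_prop) ?_
    rw [Real.deriv_sinh, interior_Ici]
    intro x hx y hy hxy
    rw [Real.cosh_le_cosh, abs_of_pos hx, abs_of_pos hy]
    exact hxy
  have := h.2 (mem_Ici.2 ha) (mem_Ici.2 le_rfl) hs.1 (sub_nonneg.2 hs.2) (by ring)
  simpa [mul_comm] using this

/-- `sinhc` is even, so bounds for negative t reduce to a nonnegative argument. -/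
theorem shRatio_abs (ω t s : ℝ) : shRatio ω t s = s * sinhc (|ω * t| * s) / sinhc |ω * t| := by
  rw [shRatio_eq]
  rcases abs_cases (ω * t) with h | h <;> rw [h.1]
  rw [neg_mul, sinhc_neg, sinhc_neg]

theorem shKernel_abs (ω t s s' : ℝ) : shKernel ω t s s' =
    s * (1 - s') * sinhc (|ω * t| * s) * sinhc (|ω * t| * (1 - s')) / sinhc |ω * t| := by
  rw [shKernel_eq]
  rcases abs_cases (ω * t) with h | h <;> rw [h.1]
  rw [neg_mul, neg_mul, sinhc_neg, sinhc_neg, sinhc_neg]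

theorem shRatio_mem (ω t : ℝ) {s : ℝ} (hs : s ∈ Icc (0 : ℝ) 1) : shRatio ω t s ∈ Icc 0 s := by
  rw [shRatio_abs]
  set a := |ω * t| with ha
  refine ⟨div_nonneg (mul_nonneg hs.1 (sinhc_pos _).le) (sinhc_pos _).le, ?_⟩
  rw [div_le_iff₀ (sinhc_pos _)]
  refine mul_le_mul_of_nonneg_left ?_ hs.1
  rcases eq_or_ne a 0 with h0 | h0
  · simp [h0]
  rcases eq_or_ne s 0 with h1 | h1
  · rw [h1, mul_zero, sinhc_zero, sinhc_of_ne h0, one_le_div (lt_of_le_of_ne (abs_nonneg _) h0.symm)]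
    exact Real.self_le_sinh_iff.2 (abs_nonneg _)
  have ha' : 0 < a := lt_of_le_of_ne (abs_nonneg _) h0.symm
  have hs' : 0 < s := lt_of_le_of_ne hs.1 h1.symm
  rw [sinhc_of_ne h0, sinhc_of_ne (mul_ne_zero h0 h1), div_le_div_iff₀ (by positivity) ha']
  nlinarith [mul_le_mul_of_nonneg_left (sinh_mul_le ha'.le hs) ha'.le]

/-- With a = |ωt|, x = as and y = a(1 - s') one has x + y ≤ a, and the upper bound amounts to sinh x
sinh y ≤ a sinh a. The inequality sinh u ≤ u cosh u, used for x and for y, gives (x + y) sinh x sinh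
y ≤ xy sinh(x + y); then sinh(x + y) ≤ sinh a and xy ≤ (x + y)a conclude. -/
theorem shKernel_mem (ω t : ℝ) {s s' : ℝ} (hs : 0 ≤ s) (hss : s ≤ s') (hs' : s' ≤ 1) :
    shKernel ω t s s' ∈ Icc 0 1 := by
  rw [shKernel_abs]
  set a := |ω * t| with ha
  have h1 : 0 ≤ 1 - s' := by linarith
  refine ⟨div_nonneg (mul_nonneg (mul_nonneg (mul_nonneg hs h1) (sinhc_pos _).le) (sinhc_pos _).le)
    (sinhc_pos _).le, ?_⟩
  rw [div_le_iff₀ (sinhc_pos _), one_mul]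
  rcases eq_or_ne a 0 with h0 | h0
  · simp only [h0, zero_mul, sinhc_zero, mul_one]
    nlinarith
  have ha' : 0 < a := lt_of_le_of_ne (abs_nonneg _) h0.symm
  have h2 : s * (1 - s') * sinhc (a * s) * sinhc (a * (1 - s')) =
      Real.sinh (a * s) * Real.sinh (a * (1 - s')) / (a * a) := by
    rw [← mul_sinhc, ← mul_sinhc (a * (1 - s'))]; field_simp
  rw [h2, div_le_iff₀ (by positivity), mul_comm (sinhc a), mul_assoc, mul_sinhc]
  set x := a * s with hx
  set y := a * (1 - s') with hy
  have hx0 : 0 ≤ x := mul_nonneg ha'.le hs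
  have hy0 : 0 ≤ y := mul_nonneg ha'.le h1
  have hxy : x + y ≤ a := by nlinarith
  have hsx := Real.sinh_nonneg_iff.2 hx0
  have hsy := Real.sinh_nonneg_iff.2 hy0
  have hsa := Real.sinh_nonneg_iff.2 ha'.le
  rcases eq_or_lt_of_le (add_nonneg hx0 hy0) with h | h
  · have : x = 0 := by linarith
    rw [this, Real.sinh_zero, zero_mul]
    positivity
  have h3 : (x + y) * (Real.sinh x * Real.sinh y) ≤ x * y * Real.sinh (x + y) := by
    rw [Real.sinh_add]
    have e1 := mul_le_mul_of_nonneg_left (sinh_le_mul_cosh hy0) (mul_nonneg hx0 hsx)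
    have e2 := mul_le_mul_of_nonneg_left (sinh_le_mul_cosh hx0) (mul_nonneg hy0 hsy)
    nlinarith
  have h4 : x * y * Real.sinh (x + y) ≤ x * y * Real.sinh a :=
    mul_le_mul_of_nonneg_left (Real.sinh_le_sinh.2 hxy) (mul_nonneg hx0 hy0)
  have h5 : x * y * Real.sinh a ≤ (x + y) * (a * Real.sinh a) := by
    have : x * y ≤ (x + y) * a := by nlinarith
    nlinarith [mul_le_mul_of_nonneg_right this hsa]
  exact le_of_mul_le_mul_left (h3.trans (h4.trans h5)) h

theorem contDiff_shRatio (ω : ℝ) : ContDiff ℝ 1 fun p : ℝ × ℝ => shRatio ω p.1 p.2 := by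
  have h : ContDiff ℝ 1 sinhc := contDiff_sinhc.of_le (by norm_num)
  simp only [shRatio_eq]
  exact (contDiff_snd.mul (h.comp (by fun_prop))).div (h.comp (by fun_prop))
    fun p => (sinhc_pos _).ne'

theorem contDiff_shKernel (ω : ℝ) :
    ContDiff ℝ 1 fun p : ℝ × ℝ × ℝ => shKernel ω p.1 p.2.1 p.2.2 := by
  have h : ContDiff ℝ 1 sinhc := contDiff_sinhc.of_le (by norm_num)
  simp only [shKernel_eq]
  exact (((contDiff_snd.fst.mul (contDiff_const.sub contDiff_snd.snd)).mul
    (h.comp (by fun_prop))).mul (h.comp (by fun_prop))).div (h.comp (by fun_prop))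
    fun p => (sinhc_pos _).ne'

/-- A `C¹` function of `(t, x)` has a continuous partial derivative in `t`. -/
theorem exists_partial_deriv {X : Type} [NormedAddCommGroup X] [NormedSpace ℝ X] {f : ℝ × X → ℝ}
    (hf : ContDiff ℝ 1 f) :
    Continuous (fun p : ℝ × X => deriv (fun r => f (r, p.2)) p.1) ∧
      ∀ t x, HasDerivAt (fun r => f (r, x)) (deriv (fun r => f (r, x)) t) t := by
  have h1 : ∀ t x, HasDerivAt (fun r => f (r, x)) (fderiv ℝ f (t, x) (1, 0)) t := fun t x => by
    have h2 := (hf.differentiable one_ne_zero (t, x)).hasFDerivAt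
    exact h2.comp_hasDerivAt t ((hasDerivAt_id t).prodMk (hasDerivAt_const t x))
  refine ⟨?_, fun t x => (h1 t x).differentiableAt.hasDerivAt⟩
  have h3 : (fun p : ℝ × X => deriv (fun r => f (r, p.2)) p.1) =
      fun p => fderiv ℝ f p (1, 0) := by
    ext p; exact (h1 p.1 p.2).deriv
  rw [h3]
  exact (hf.continuous_fderiv one_ne_zero).clm_apply continuous_const

/-- The derivative of `shRatio` in `t`. -/
def shRatioD (ω t s : ℝ) : ℝ := deriv (fun r => shRatio ω r s) t

/-- The derivative of `shKernel` in `t`. -/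
def shKernelD (ω t s s' : ℝ) : ℝ := deriv (fun r => shKernel ω r s s') t

theorem hasDerivAt_shRatio (ω t s : ℝ) :
    HasDerivAt (fun r => shRatio ω r s) (shRatioD ω t s) t :=
  (exists_partial_deriv (contDiff_shRatio ω)).2 t s

theorem hasDerivAt_shKernel (ω t s s' : ℝ) :
    HasDerivAt (fun r => shKernel ω r s s') (shKernelD ω t s s') t :=
  (exists_partial_deriv (contDiff_shKernel ω)).2 t (s, s')

theorem continuous_shRatio {X : Type} [TopologicalSpace X] (ω : ℝ) {t s : X → ℝ}
    (ht : Continuous t) (hs : Continuous s) : Continuous fun x => shRatio ω (t x) (s x) :=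
  (contDiff_shRatio ω).continuous.comp (ht.prodMk hs)

theorem continuous_shRatioD {X : Type} [TopologicalSpace X] (ω : ℝ) {t s : X → ℝ}
    (ht : Continuous t) (hs : Continuous s) : Continuous fun x => shRatioD ω (t x) (s x) :=
  (exists_partial_deriv (contDiff_shRatio ω)).1.comp (ht.prodMk hs)

theorem continuous_shKernel {X : Type} [TopologicalSpace X] (ω : ℝ) {t s s' : X → ℝ}
    (ht : Continuous t) (hs : Continuous s) (hs' : Continuous s') :
    Continuous fun x => shKernel ω (t x) (s x) (s' x) :=
  (contDiff_shKernel ω).continuous.comp (ht.prodMk (hs.prodMk hs'))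

theorem continuous_shKernelD_uncurry (ω : ℝ) :
    Continuous fun p : ℝ × ℝ × ℝ => shKernelD ω p.1 p.2.1 p.2.2 :=
  (exists_partial_deriv (contDiff_shKernel ω)).1

theorem continuous_shKernelD {X : Type} [TopologicalSpace X] (ω : ℝ) {t s s' : X → ℝ}
    (ht : Continuous t) (hs : Continuous s) (hs' : Continuous s') :
    Continuous fun x => shKernelD ω (t x) (s x) (s' x) :=
  Continuous.comp (g := fun p : ℝ × ℝ × ℝ => shKernelD ω p.1 p.2.1 p.2.2)
    (f := fun x => (t x, s x, s' x)) (continuous_shKernelD_uncurry ω)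
    (ht.prodMk (hs.prodMk hs'))

end Sinh

/-! ### The pairing and the path of two points -/

section Pair

variable {ν : ℕ} (ω : Fin ν → ℝ)

/-- Points `(s, ξ)`. -/
abbrev Pt (ν : ℕ) : Type := ℝ × EuclideanSpace ℝ (Fin ν)

/-- The pairing of the points `p` and `p'`, symmetric in `p` and `p'`. -/
def kern (t : ℝ) (p p' : Pt ν) : ℝ :=
  ∑ υ, shKernel (ω υ) t (min p.1 p'.1) (max p.1 p'.1) * p.2 υ * p'.2 υ

/-- The derivative of `kern` in `t`. -/
def kernD (t : ℝ) (p p' : Pt ν) : ℝ :=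
  ∑ υ, shKernelD (ω υ) t (min p.1 p'.1) (max p.1 p'.1) * p.2 υ * p'.2 υ

/-- `q_t(s) · ξ`. -/
def path (t : ℝ) (x y : Fin ν → ℂ) (p : Pt ν) : ℂ := ∑ υ, qPath ω t x y p.1 υ * (p.2 υ : ℂ)

/-- The derivative of `path` in `t`. -/
def pathD (t : ℝ) (x y : Fin ν → ℂ) (p : Pt ν) : ℂ :=
  ∑ υ, ((shRatioD (ω υ) t p.1 : ℂ) * x υ + (shRatioD (ω υ) t (1 - p.1) : ℂ) * y υ) * (p.2 υ : ℂ)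

theorem kern_comm (t : ℝ) (p p' : Pt ν) : kern ω t p p' = kern ω t p' p := by
  simp only [kern, min_comm p.1, max_comm p.1]
  exact Finset.sum_congr rfl fun υ _ => by ring

theorem hasDerivAt_kern (t : ℝ) (p p' : Pt ν) :
    HasDerivAt (fun r => kern ω r p p') (kernD ω t p p') t :=
  HasDerivAt.fun_sum fun υ _ =>
    ((hasDerivAt_shKernel (ω υ) t _ _).mul_const _).mul_const _

theorem hasDerivAt_path (t : ℝ) (x y : Fin ν → ℂ) (p : Pt ν) :
    HasDerivAt (fun r => path ω r x y p) (pathD ω t x y p) t :=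
  HasDerivAt.fun_sum fun υ _ => by
    simp only [qPath]
    exact (((hasDerivAt_shRatio (ω υ) t _).ofReal_comp.mul_const _).fun_add
      ((hasDerivAt_shRatio (ω υ) t _).ofReal_comp.mul_const _)).mul_const _

variable {X : Type} [TopologicalSpace X]

theorem continuous_coord {υ : Fin ν} {p : X → Pt ν} (hp : Continuous p) :
    Continuous fun x => (p x).2 υ := by
  have : Continuous fun x => (p x).2 := hp.snd
  fun_prop

theorem continuous_kern {t : X → ℝ} {p p' : X → Pt ν} (ht : Continuous t) (hp : Continuous p)
    (hp' : Continuous p') : Continuous fun x => kern ω (t x) (p x) (p' x) :=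
  continuous_finsetSum _ fun _ _ => ((continuous_shKernel _ ht (hp.fst.min hp'.fst)
    (hp.fst.max hp'.fst)).mul (continuous_coord hp)).mul (continuous_coord hp')

theorem continuous_kernD {t : X → ℝ} {p p' : X → Pt ν} (ht : Continuous t) (hp : Continuous p)
    (hp' : Continuous p') : Continuous fun x => kernD ω (t x) (p x) (p' x) :=
  continuous_finsetSum _ fun _ _ => ((continuous_shKernelD _ ht (hp.fst.min hp'.fst)
    (hp.fst.max hp'.fst)).mul (continuous_coord hp)).mul (continuous_coord hp')

theorem continuous_path {t : X → ℝ} {x y : X → Fin ν → ℂ} {p : X → Pt ν} (ht : Continuous t)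
    (hx : Continuous x) (hy : Continuous y) (hp : Continuous p) :
    Continuous fun a => path ω (t a) (x a) (y a) (p a) := by
  refine continuous_finsetSum _ fun υ _ => Continuous.mul (Continuous.add (Continuous.mul
    (Complex.continuous_ofReal.comp (continuous_shRatio _ ht hp.fst)) (by fun_prop))
    (Continuous.mul (Complex.continuous_ofReal.comp
    (continuous_shRatio _ ht (continuous_const.sub hp.fst))) (by fun_prop)))
    (Complex.continuous_ofReal.comp (continuous_coord hp))

theorem continuous_pathD {t : X → ℝ} {x y : X → Fin ν → ℂ} {p : X → Pt ν} (ht : Continuous t)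
    (hx : Continuous x) (hy : Continuous y) (hp : Continuous p) :
    Continuous fun a => pathD ω (t a) (x a) (y a) (p a) := by
  refine continuous_finsetSum _ fun υ _ => Continuous.mul (Continuous.add (Continuous.mul
    (Complex.continuous_ofReal.comp (continuous_shRatioD _ ht hp.fst)) (by fun_prop))
    (Continuous.mul (Complex.continuous_ofReal.comp
    (continuous_shRatioD _ ht (continuous_const.sub hp.fst))) (by fun_prop)))
    (Complex.continuous_ofReal.comp (continuous_coord hp))

theorem abs_sum_mul_le {c : Fin ν → ℝ} {C : ℝ} (hC : ∀ υ, |c υ| ≤ C)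
    (ξ ξ' : EuclideanSpace ℝ (Fin ν)) : |∑ υ, c υ * ξ υ * ξ' υ| ≤ C * (‖ξ‖ * ‖ξ'‖) := by
  rcases isEmpty_or_nonempty (Fin ν) with h | ⟨⟨υ0⟩⟩
  · simp [EuclideanSpace.norm_eq]
  have hC0 : 0 ≤ C := (abs_nonneg _).trans (hC υ0)
  refine (Finset.abs_sum_le_sum_abs _ _).trans ?_
  have h1 : ∑ υ, |ξ υ| * |ξ' υ| ≤ ‖ξ‖ * ‖ξ'‖ := by
    have := Real.sum_mul_le_sqrt_mul_sqrt Finset.univ (fun υ => |ξ υ|) (fun υ => |ξ' υ|)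
    rw [EuclideanSpace.norm_eq, EuclideanSpace.norm_eq]
    simpa using this
  calc ∑ υ, |c υ * ξ υ * ξ' υ| ≤ ∑ υ, C * (|ξ υ| * |ξ' υ|) := by
        refine Finset.sum_le_sum fun υ _ => ?_
        rw [abs_mul, abs_mul, mul_assoc]
        exact mul_le_mul_of_nonneg_right (hC υ) (by positivity)
    _ = C * ∑ υ, |ξ υ| * |ξ' υ| := by rw [Finset.mul_sum]
    _ ≤ _ := mul_le_mul_of_nonneg_left h1 hC0

theorem abs_kern_le (t : ℝ) {p p' : Pt ν} (hp : p.1 ∈ Icc (0 : ℝ) 1) (hp' : p'.1 ∈ Icc (0 : ℝ) 1) :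
    |kern ω t p p'| ≤ ‖p.2‖ * ‖p'.2‖ := by
  rw [← one_mul (‖p.2‖ * ‖p'.2‖)]
  refine abs_sum_mul_le (fun υ => ?_) _ _
  have := shKernel_mem (ω υ) t (le_min hp.1 hp'.1) (min_le_max) (max_le hp.2 hp'.2)
  rw [abs_of_nonneg this.1]
  exact this.2

theorem exists_abs_kernD_le (T : ℝ) : ∃ C, 0 ≤ C ∧ ∀ t ∈ Icc (-T) T, ∀ p p' : Pt ν,
    p.1 ∈ Icc (0 : ℝ) 1 → p'.1 ∈ Icc (0 : ℝ) 1 → |kernD ω t p p'| ≤ C * (‖p.2‖ * ‖p'.2‖) := by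
  have h : ∀ υ, ∃ C, ∀ q ∈ Icc (-T) T ×ˢ Icc (0 : ℝ) 1 ×ˢ Icc (0 : ℝ) 1,
      ‖shKernelD (ω υ) q.1 q.2.1 q.2.2‖ ≤ C := fun υ =>
    (isCompact_Icc.prod (isCompact_Icc.prod isCompact_Icc)).exists_bound_of_continuousOn
      (continuous_shKernelD (ω υ) continuous_fst continuous_snd.fst
        continuous_snd.snd).continuousOn
  choose C hC using h
  refine ⟨∑ υ, |C υ|, Finset.sum_nonneg fun _ _ => abs_nonneg _, fun t ht p p' hp hp' =>
    abs_sum_mul_le (fun υ => ?_) _ _⟩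
  refine ((hC υ (t, min p.1 p'.1, max p.1 p'.1) ⟨ht, ⟨le_min hp.1 hp'.1, min_le_iff.2
    (Or.inl hp.2)⟩, ⟨le_max_iff.2 (Or.inl hp.1), max_le hp.2 hp'.2⟩⟩).trans (le_abs_self _)).trans ?_
  exact Finset.single_le_sum (f := fun υ => |C υ|) (fun _ _ => abs_nonneg _) (Finset.mem_univ υ)

/-- The coefficients of x and y are at most s and 1 - s, so the imaginary part of the path stays as
small as those of its end points, whatever t is. The width 2 of the strips is the constant 2 here.
-/
theorem abs_im_path_le (t : ℝ) {x y : Fin ν → ℂ} (hx : x ∈ strip ν 2) (hy : y ∈ strip ν 2)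
    {p : Pt ν} (hp : p.1 ∈ Icc (0 : ℝ) 1) : |(path ω t x y p).im| ≤ 2 * ‖p.2‖ := by
  have h1 : (path ω t x y p).im =
      ∑ υ, shRatio (ω υ) t p.1 * (WithLp.toLp 2 fun υ => (x υ).im : EuclideanSpace ℝ (Fin ν)) υ *
        p.2 υ + ∑ υ, shRatio (ω υ) t (1 - p.1) *
          (WithLp.toLp 2 fun υ => (y υ).im : EuclideanSpace ℝ (Fin ν)) υ * p.2 υ := by
    rw [path, Complex.im_sum, ← Finset.sum_add_distrib]
    refine Finset.sum_congr rfl fun υ _ => ?_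
    simp [qPath]
    ring
  have hp' : 1 - p.1 ∈ Icc (0 : ℝ) 1 := ⟨sub_nonneg.2 hp.2, by linarith [hp.1]⟩
  rw [h1]
  refine (abs_add_le _ _).trans ?_
  have e1 := abs_sum_mul_le (C := p.1) (c := fun υ => shRatio (ω υ) t p.1) (fun υ => by
    have := shRatio_mem (ω υ) t hp
    rw [abs_of_nonneg this.1]; exact this.2)
    (WithLp.toLp 2 fun υ => (x υ).im : EuclideanSpace ℝ (Fin ν)) p.2
  have e2 := abs_sum_mul_le (C := 1 - p.1) (c := fun υ => shRatio (ω υ) t (1 - p.1)) (fun υ => by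
    have := shRatio_mem (ω υ) t hp'
    rw [abs_of_nonneg this.1]; exact this.2)
    (WithLp.toLp 2 fun υ => (y υ).im : EuclideanSpace ℝ (Fin ν)) p.2
  have e3 := mul_le_mul_of_nonneg_right (le_of_lt hx) (norm_nonneg p.2)
  have e4 := mul_le_mul_of_nonneg_right (le_of_lt hy) (norm_nonneg p.2)
  have e5 := mul_le_mul_of_nonneg_left e3 hp.1
  have e6 := mul_le_mul_of_nonneg_left e4 hp'.1
  linarith

theorem exists_norm_pathD_le (T R : ℝ) : ∃ C, 0 ≤ C ∧ ∀ t ∈ Icc (-T) T, ∀ x y : Fin ν → ℂ,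
    ‖x‖ ≤ R → ‖y‖ ≤ R → ∀ p : Pt ν, p.1 ∈ Icc (0 : ℝ) 1 → ‖pathD ω t x y p‖ ≤ C * ‖p.2‖ := by
  have h : ∀ υ, ∃ C, ∀ q ∈ Icc (-T) T ×ˢ Icc (0 : ℝ) 1, ‖shRatioD (ω υ) q.1 q.2‖ ≤ C := fun υ =>
    (isCompact_Icc.prod isCompact_Icc).exists_bound_of_continuousOn
      (continuous_shRatioD (ω υ) continuous_fst continuous_snd).continuousOn
  choose C hC using h
  refine ⟨∑ υ, (|C υ| * |R| + |C υ| * |R|), Finset.sum_nonneg fun _ _ => by positivity,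
    fun t ht x y hx hy p hp => ?_⟩
  rw [pathD, Finset.sum_mul]
  refine (norm_sum_le _ _).trans (Finset.sum_le_sum fun υ _ => ?_)
  rw [norm_mul]
  have hp' : 1 - p.1 ∈ Icc (0 : ℝ) 1 := ⟨sub_nonneg.2 hp.2, by linarith [hp.1]⟩
  have h1 : ‖((p.2 υ : ℝ) : ℂ)‖ ≤ ‖p.2‖ := by
    rw [Complex.norm_real]; exact PiLp.norm_apply_le _ _
  refine mul_le_mul ?_ h1 (norm_nonneg _) (by positivity)
  refine (norm_add_le _ _).trans (add_le_add ?_ ?_) <;> rw [norm_mul, Complex.norm_real]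
  · exact mul_le_mul ((hC υ (t, p.1) ⟨ht, hp⟩).trans (le_abs_self _))
      (((norm_le_pi_norm x υ).trans hx).trans (le_abs_self _)) (norm_nonneg _) (abs_nonneg _)
  · exact mul_le_mul ((hC υ (t, 1 - p.1) ⟨ht, hp'⟩).trans (le_abs_self _))
      (((norm_le_pi_norm y υ).trans hy).trans (le_abs_self _)) (norm_nonneg _) (abs_nonneg _)

end Pair

/-! ### The Dirichlet Green function of the oscillator and its positivity -/

section Green

/-- The kernel `sh(ω τ) sh(ω (t - τ')) / (ω sh(ω t))`, for `τ ≤ τ'`, made symmetric. -/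
def green (ω t τ τ' : ℝ) : ℝ :=
  Real.sinh (ω * min τ τ') * Real.sinh (ω * (t - max τ τ')) / (ω * Real.sinh (ω * t))

theorem sinh_pos_of_pos {ω t : ℝ} (hω : 0 < ω) (ht : 0 < t) : 0 < Real.sinh (ω * t) :=
  Real.sinh_pos_iff.2 (mul_pos hω ht)

theorem mul_shKernel_eq_green {ω t : ℝ} (hω : 0 < ω) (ht : 0 < t) (s s' : ℝ) :
    t * shKernel ω t (min s s') (max s s') = green ω t (t * s) (t * s') := by
  rw [shKernel, if_neg (mul_pos hω ht).ne', green, ← mul_min_of_nonneg _ _ ht.le,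
    ← mul_max_of_nonneg _ _ ht.le]
  have := (sinh_pos_of_pos hω ht).ne'
  rw [show ω * (t * min s s') = ω * t * min s s' by ring,
    show ω * (t - t * max s s') = ω * t * (1 - max s s') by ring]
  field_simp

/-- In unscaled times the derivative in the length t of the interval factors into a function of τ
and a function of τ' (a Hadamard variation formula). Integrated in t it proves positive
definiteness; squared out it becomes the second-order term of the heat equation. -/
theorem hasDerivAt_green {ω t : ℝ} (hω : 0 < ω) (ht : 0 < t) (τ τ' : ℝ) :
    HasDerivAt (fun r => green ω r τ τ')
      (Real.sinh (ω * τ) * Real.sinh (ω * τ') / Real.sinh (ω * t) ^ 2) t := by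
  have h0 := (sinh_pos_of_pos hω ht).ne'
  have h1 : HasDerivAt (fun r => Real.sinh (ω * min τ τ') * Real.sinh (ω * (r - max τ τ')))
      (Real.sinh (ω * min τ τ') * (Real.cosh (ω * (t - max τ τ')) * (ω * 1))) t :=
    (((hasDerivAt_id t).sub_const _).const_mul ω).sinh.const_mul _
  have h2 : HasDerivAt (fun r => ω * Real.sinh (ω * r)) (ω * (Real.cosh (ω * t) * (ω * 1))) t :=
    (((hasDerivAt_id t).const_mul ω).sinh).const_mul _
  refine (h1.fun_div h2 (mul_ne_zero hω.ne' h0)).congr_deriv ?_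
  have h3 : Real.sinh (ω * max τ τ') = Real.sinh (ω * t) * Real.cosh (ω * (t - max τ τ')) -
      Real.cosh (ω * t) * Real.sinh (ω * (t - max τ τ')) := by
    rw [← Real.sinh_sub]; congr 1; ring
  have h4 : Real.sinh (ω * τ) * Real.sinh (ω * τ') =
      Real.sinh (ω * min τ τ') * Real.sinh (ω * max τ τ') := by
    rcases le_total τ τ' with h | h
    · rw [min_eq_left h, max_eq_right h]
    · rw [min_eq_right h, max_eq_left h, mul_comm]
  rw [h4, h3]
  field_simp

theorem green_max (ω τ τ' : ℝ) : green ω (max τ τ') τ τ' = 0 := by simp [green]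

/-- The Green function vanishes when t = max τ τ', so it is the integral of its rank-one derivative
from there on. The truncations τ < r and τ' < r extend the integrand to ]0,t] while keeping it a
product. -/
theorem green_eq_integral {ω t : ℝ} (hω : 0 < ω) {τ τ' : ℝ} (hτ : 0 ≤ τ) (hτ' : 0 ≤ τ')
    (hτt : τ ≤ t) (hτt' : τ' ≤ t) :
    IntegrableOn (fun r => (if τ < r then Real.sinh (ω * τ) / Real.sinh (ω * r) else 0) *
      (if τ' < r then Real.sinh (ω * τ') / Real.sinh (ω * r) else 0)) (Ioc 0 t) ∧
    green ω t τ τ' = ∫ r in Ioc 0 t,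
      (if τ < r then Real.sinh (ω * τ) / Real.sinh (ω * r) else 0) *
      (if τ' < r then Real.sinh (ω * τ') / Real.sinh (ω * r) else 0) := by
  -- If τ or τ' vanishes both sides are 0. Otherwise max τ τ' > 0, and the singularity of the
  -- integrand at r = 0 is avoided.
  by_cases h0 : Real.sinh (ω * τ) * Real.sinh (ω * τ') = 0
  · have h1 : (fun r => (if τ < r then Real.sinh (ω * τ) / Real.sinh (ω * r) else 0) *
      (if τ' < r then Real.sinh (ω * τ') / Real.sinh (ω * r) else 0)) = fun _ => 0 := by
      ext r
      rcases mul_eq_zero.1 h0 with h | h <;> simp [h]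
    rw [h1]
    refine ⟨integrableOn_zero, ?_⟩
    have : min τ τ' = 0 := by
      simp only [mul_eq_zero, Real.sinh_eq_zero, hω.ne', false_or] at h0
      rcases h0 with h | h
      · rw [h, min_eq_left hτ']
      · rw [h, min_eq_right hτ]
    simp [green, this]
  · have hm : 0 < max τ τ' := by
      rw [lt_max_iff]
      rcases hτ.eq_or_lt with h | h
      · exact absurd (by simp [← h]) h0
      · exact Or.inl h
    have h1 : (fun r => (if τ < r then Real.sinh (ω * τ) / Real.sinh (ω * r) else 0) *
        (if τ' < r then Real.sinh (ω * τ') / Real.sinh (ω * r) else 0)) = (Ioi (max τ τ')).indicator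
        fun r => Real.sinh (ω * τ) * Real.sinh (ω * τ') / Real.sinh (ω * r) ^ 2 := by
      ext r
      by_cases hr : max τ τ' < r
      · rw [indicator_of_mem (mem_Ioi.2 hr), if_pos (max_lt_iff.1 hr).1, if_pos (max_lt_iff.1 hr).2]
        ring
      · rw [indicator_of_notMem (s := Ioi (max τ τ')) (a := r) (fun h => hr h)]
        rw [max_lt_iff, not_and_or] at hr
        rcases hr with h | h <;> simp [h]
    have hc : ContinuousOn (fun r => Real.sinh (ω * τ) * Real.sinh (ω * τ') / Real.sinh (ω * r) ^ 2)
        (Icc (max τ τ') t) := by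
      refine ContinuousOn.div (by fun_prop) (by fun_prop) fun r hr => ?_
      exact pow_ne_zero _ (sinh_pos_of_pos hω (hm.trans_le hr.1)).ne'
    have hmt : max τ τ' ≤ t := max_le hτt hτt'
    have hI : Ioc 0 t ∩ Ioi (max τ τ') = Ioc (max τ τ') t := by
      ext r; simp only [mem_inter_iff, mem_Ioc, mem_Ioi]
      exact ⟨fun h => ⟨h.2, h.1.2⟩, fun h => ⟨⟨hm.trans h.1, h.2⟩, h.1⟩⟩
    rw [h1]
    constructor
    · rw [IntegrableOn, integrable_indicator_iff measurableSet_Ioi, IntegrableOn,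
        Measure.restrict_restrict measurableSet_Ioi, inter_comm, hI]
      exact (hc.integrableOn_compact isCompact_Icc).mono_set Ioc_subset_Icc_self
    · have h2 : IntervalIntegrable (fun r => Real.sinh (ω * τ) * Real.sinh (ω * τ') /
          Real.sinh (ω * r) ^ 2) volume (max τ τ') t :=
        ContinuousOn.intervalIntegrable (by rwa [uIcc_of_le hmt])
      rw [setIntegral_indicator measurableSet_Ioi, hI, ← intervalIntegral.integral_of_le hmt,
        intervalIntegral.integral_eq_sub_of_hasDerivAt (f := fun r => green ω r τ τ')
          (fun r hr => hasDerivAt_green hω (hm.trans_le (uIcc_of_le hmt ▸ hr).1) _ _) h2,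
        green_max, sub_zero]

/-- The integral representation makes the quadratic form the integral of a square. -/
theorem green_sum_nonneg {ι : Type} (I : Finset ι) {ω t : ℝ} (hω : 0 < ω) {τ : ι → ℝ}
    (hτ : ∀ i, τ i ∈ Icc 0 t) (c : ι → ℝ) :
    0 ≤ ∑ j ∈ I, ∑ k ∈ I, green ω t (τ j) (τ k) * c j * c k := by
  have h : ∑ j ∈ I, ∑ k ∈ I, green ω t (τ j) (τ k) * c j * c k =
      ∫ r in Ioc 0 t, (∑ j ∈ I, (if τ j < r then Real.sinh (ω * τ j) / Real.sinh (ω * r) else 0) *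
        c j) ^ 2 := by
    simp only [sq, Finset.sum_mul_sum]
    rw [integral_finsetSum]
    · refine Finset.sum_congr rfl fun j _ => ?_
      rw [integral_finsetSum]
      · refine Finset.sum_congr rfl fun k _ => ?_
        rw [(green_eq_integral hω (hτ j).1 (hτ k).1 (hτ j).2 (hτ k).2).2, mul_assoc,
          ← integral_mul_const]
        exact integral_congr_ae (Eventually.of_forall fun r => by simp only; ring)
      · intro k _
        refine ((green_eq_integral hω (hτ j).1 (hτ k).1 (hτ j).2 (hτ k).2).1.mul_const
          (c j * c k)).congr (Eventually.of_forall fun r => by simp only; ring)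
    · intro j _
      refine integrable_finsetSum _ fun k _ => ?_
      refine ((green_eq_integral hω (hτ j).1 (hτ k).1 (hτ j).2 (hτ k).2).1.mul_const
          (c j * c k)).congr (Eventually.of_forall fun r => by simp only; ring)
  rw [h]
  exact integral_nonneg fun r => sq_nonneg _

theorem kern_sum_nonneg {ι : Type} (I : Finset ι) {ν : ℕ} {ω : Fin ν → ℝ} (hω : ∀ υ, 0 < ω υ)
    {t : ℝ} (ht : 0 ≤ t) {p : ι → Pt ν} (hp : ∀ i, (p i).1 ∈ Icc (0 : ℝ) 1) :
    0 ≤ ∑ j ∈ I, ∑ k ∈ I, t * kern ω t (p j) (p k) := by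
  rcases ht.eq_or_lt with rfl | ht
  · simp
  have h : ∑ j ∈ I, ∑ k ∈ I, t * kern ω t (p j) (p k) = ∑ υ, ∑ j ∈ I, ∑ k ∈ I,
      green (ω υ) t (t * (p j).1) (t * (p k).1) * (p j).2 υ * (p k).2 υ := by
    rw [Finset.sum_comm (s := Finset.univ)]
    refine Finset.sum_congr rfl fun j _ => ?_
    rw [Finset.sum_comm (s := Finset.univ)]
    refine Finset.sum_congr rfl fun k _ => ?_
    rw [kern, Finset.mul_sum]
    refine Finset.sum_congr rfl fun υ _ => ?_
    rw [← mul_shKernel_eq_green (hω υ) ht]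
    ring
  rw [h]
  exact Finset.sum_nonneg fun υ _ => green_sum_nonneg I (hω υ) (fun i =>
    ⟨mul_nonneg ht.le (hp i).1, mul_le_of_le_one_right ht.le (hp i).2⟩) _

end Green

/-! ### A density of the complex measure with respect to its variation -/

section Density

variable {X : Type} [MeasurableSpace X]

/-- Radon–Nikodym for the real and imaginary parts, each absolutely continuous because the norm of μ
on a set is at most its variation. -/
theorem withDensityV_exists (μ : ComplexMeasure X) [IsFiniteMeasure (VectorMeasure.variation μ)] :
    ∃ σ : X → ℂ, Measurable σ ∧ Integrable σ (VectorMeasure.variation μ) ∧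
      (VectorMeasure.variation μ).withDensityᵥ σ = μ := by
  set m := VectorMeasure.variation μ with hm
  have hac : ∀ s : SignedMeasure X, (∀ i, |s i| ≤ ‖μ i‖) → s ≪ᵥ m.toENNRealVectorMeasure := by
    intro s hs
    refine VectorMeasure.AbsolutelyContinuous.mk fun i hi h0 => ?_
    rw [Measure.toENNRealVectorMeasure_apply_measurable hi] at h0
    have h1 := VectorMeasure.enorm_measure_le_variation μ i
    rw [← hm, h0, nonpos_iff_eq_zero, enorm_eq_zero] at h1
    have := hs i
    rw [h1, norm_zero] at this
    exact abs_nonpos_iff.1 this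
  have hre := SignedMeasure.withDensityᵥ_rnDeriv_eq (ComplexMeasure.re μ) m
    (hac _ fun i => Complex.abs_re_le_norm _)
  have him := SignedMeasure.withDensityᵥ_rnDeriv_eq (ComplexMeasure.im μ) m
    (hac _ fun i => Complex.abs_im_le_norm _)
  set a := (ComplexMeasure.re μ).rnDeriv m
  set b := (ComplexMeasure.im μ).rnDeriv m
  have ha : Integrable a m := SignedMeasure.integrable_rnDeriv _ _
  have hb : Integrable b m := SignedMeasure.integrable_rnDeriv _ _
  have hi : Integrable (fun x => (a x : ℂ) + (b x : ℂ) * Complex.I) m :=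
    ha.ofReal.add (hb.ofReal.mul_const _)
  refine ⟨fun x => (a x : ℂ) + (b x : ℂ) * Complex.I, ?_, hi, ?_⟩
  · exact (Complex.measurable_ofReal.comp (SignedMeasure.measurable_rnDeriv _ _)).add
      ((Complex.measurable_ofReal.comp (SignedMeasure.measurable_rnDeriv _ _)).mul_const _)
  · ext1 s hs
    have hadd : ∫ x in s, ((a x : ℂ) + (b x : ℂ) * Complex.I) ∂m =
        ∫ x in s, (a x : ℂ) ∂m + ∫ x in s, (b x : ℂ) * Complex.I ∂m :=
      integral_add ha.ofReal.integrableOn (hb.ofReal.mul_const _).integrableOn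
    rw [withDensityᵥ_apply hi hs, hadd, integral_mul_const, integral_complex_ofReal, integral_complex_ofReal,
      ← withDensityᵥ_apply ha hs, ← withDensityᵥ_apply hb hs, hre, him]
    exact Complex.re_add_im _

/-- The variation of the measure with density τ has density |τ|, so |τ| = 1 almost everywhere, and
cutting τ off where it exceeds 1 makes the bound hold everywhere. The formula for integrals is
checked on indicators and extended by linearity and continuity in L¹. From here on only a finite
positive measure and a bounded weight occur. -/
theorem exists_density (μ : ComplexMeasure X) [IsFiniteMeasure (VectorMeasure.variation μ)] :
    ∃ σ : X → ℂ, Measurable σ ∧ (∀ x, ‖σ x‖ ≤ 1) ∧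
      ∀ f : X → ℂ, Integrable f (VectorMeasure.variation μ) →
        cintegral μ f = ∫ x, f x * σ x ∂(VectorMeasure.variation μ) := by
  obtain ⟨τ, hτm, hτi, hτ⟩ := withDensityV_exists μ
  have hn : ∀ᵐ x ∂(VectorMeasure.variation μ), ‖τ x‖ₑ = 1 := by
    have h1 := Measure.variation_withDensityᵥ hτi
    rw [hτ] at h1
    have h2 : (VectorMeasure.variation μ).withDensity (fun x => ‖τ x‖ₑ) =
        (VectorMeasure.variation μ).withDensity 1 := by rw [← h1, withDensity_one]
    exact (withDensity_eq_iff_of_sigmaFinite hτm.enorm.aemeasurable aemeasurable_one).1 h2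
  set m := VectorMeasure.variation μ with hm
  have hs : MeasurableSet {x | ‖τ x‖ ≤ 1} := measurableSet_le hτm.norm measurable_const
  refine ⟨{x | ‖τ x‖ ≤ 1}.indicator τ, hτm.indicator hs, fun x => ?_, ?_⟩
  · by_cases hx : ‖τ x‖ ≤ 1
    · rw [indicator_of_mem (s := {x | ‖τ x‖ ≤ 1}) hx]; exact hx
    · rw [indicator_of_notMem (s := {x | ‖τ x‖ ≤ 1}) hx]; simp
  have hae : ∀ᵐ x ∂m, {x | ‖τ x‖ ≤ 1}.indicator τ x = τ x := by
    filter_upwards [hn] with x hx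
    refine indicator_of_mem (s := {x | ‖τ x‖ ≤ 1}) ?_ _
    rw [mem_ofPred_eq, ← toReal_enorm, hx]; simp
  have hbd : ∀ᵐ x ∂m, ‖τ x‖ ≤ 1 := by
    filter_upwards [hn] with x hx
    rw [← toReal_enorm, hx]; simp
  suffices h : ∀ f : X → ℂ, Integrable f m → cintegral μ f = ∫ x, f x * τ x ∂m by
    intro f hf
    rw [h f hf]
    refine integral_congr_ae ?_
    filter_upwards [hae] with x hx
    rw [hx]
  have hmul : ∀ {f : X → ℂ}, Integrable f m → Integrable (fun x => f x * τ x) m := fun hf =>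
    hf.mul_bdd (c := 1) hτm.aestronglyMeasurable hbd
  intro f hf
  refine Integrable.induction (fun f => cintegral μ f = ∫ x, f x * τ x ∂m) ?_ ?_ ?_ ?_ hf
  · intro c s hs hμs
    rw [cintegral, VectorMeasure.integral_eq_setToFun, setToFun_indicator_const _ hs hμs.ne]
    have h1 : ∀ x, s.indicator (fun _ => c) x * τ x = s.indicator (fun x => c * τ x) x := fun x => by
      by_cases hx : x ∈ s <;> simp [hx]
    simp only [h1]
    rw [integral_indicator hs, integral_const_mul, ← withDensityᵥ_apply hτi hs, hτ]
    rfl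
  · intro f g _ hf hg h1 h2
    have h3 : cintegral μ (f + g) = cintegral μ f + cintegral μ g :=
      VectorMeasure.integral_add hf hg
    rw [h3, h1, h2, ← integral_add (hmul hf) (hmul hg)]
    exact integral_congr_ae (Eventually.of_forall fun x => by simp [add_mul])
  · refine isClosed_eq (VectorMeasure.continuous_integral) ?_
    refine (LipschitzWith.of_dist_le_mul (K := 1) fun f g => ?_).continuous
    rw [L1.dist_eq_integral_dist, NNReal.coe_one, one_mul, dist_eq_norm,
      ← integral_sub (hmul (L1.integrable_coeFn f)) (hmul (L1.integrable_coeFn g))]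
    refine norm_integral_le_of_norm_le
      (((L1.integrable_coeFn f).sub (L1.integrable_coeFn g)).norm) ?_ |>.trans_eq ?_
    · filter_upwards [hbd] with x hx
      rw [← sub_mul, norm_mul]
      exact mul_le_of_le_one_right (norm_nonneg _) hx
    · simp only [dist_eq_norm, Pi.sub_apply]
  · intro f g hfg hf h
    have h1 : cintegral μ f = cintegral μ g := VectorMeasure.integral_congr_ae hfg
    rw [← h1, h]
    refine integral_congr_ae ?_
    filter_upwards [hfg] with x hx
    rw [hx]

/-- Fubini, one variable at a time. The inner formula holds for almost every ξ₁ only, those with an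
integrable slice, which suffices under the outer integral. -/
theorem iterIntegral_eq_integral {μ : ComplexMeasure X}
    [IsFiniteMeasure (VectorMeasure.variation μ)] {σ : X → ℂ} (hσ : Measurable σ)
    (hσ1 : ∀ x, ‖σ x‖ ≤ 1) (h : ∀ f : X → ℂ, Integrable f (VectorMeasure.variation μ) →
        cintegral μ f = ∫ x, f x * σ x ∂(VectorMeasure.variation μ)) (m : ℕ) :
    ∀ f : (Fin m → X) → ℂ, Integrable f (Measure.pi fun _ => VectorMeasure.variation μ) →
      iterIntegral μ m f =
        ∫ ξ, f ξ * ∏ j, σ (ξ j) ∂(Measure.pi fun _ => VectorMeasure.variation μ) := by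
  set ρ := VectorMeasure.variation μ with hρ
  induction m with
  | zero =>
    intro f _
    rw [Measure.pi_of_empty]
    simp only [iterIntegral, Finset.univ_eq_empty, Finset.prod_empty, mul_one]
    rw [integral_dirac]
    congr 1
  | succ m ih =>
    intro f hf
    have hmp := (measurePreserving_piFinSuccAbove (fun _ : Fin (m + 1) => ρ) 0).symm
    have hcons : ∀ p : X × (Fin m → X),
        (MeasurableEquiv.piFinSuccAbove (fun _ => X) (0 : Fin (m + 1))).symm p =
          Fin.cons p.1 p.2 := fun p => Fin.insertNth_zero' _ _
    have hprod : Measurable fun ξ : Fin (m + 1) → X => ∏ j, σ (ξ j) :=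
      Finset.measurable_fun_prod _ fun j _ => hσ.comp (measurable_pi_apply j)
    have hf1 : Integrable (fun ξ => f ξ * ∏ j, σ (ξ j)) (Measure.pi fun _ => ρ) := by
      refine hf.mul_bdd (c := 1) hprod.aestronglyMeasurable (Eventually.of_forall fun ξ => ?_)
      rw [norm_prod]
      exact Finset.prod_le_one (fun _ _ => norm_nonneg _) fun _ _ => hσ1 _
    rw [← hmp.integral_comp (MeasurableEquiv.measurableEmbedding _)]
    have hf2 := (hmp.integrable_comp_emb (MeasurableEquiv.measurableEmbedding _)).2 hf
    have hf3 := (hmp.integrable_comp_emb (MeasurableEquiv.measurableEmbedding _)).2 hf1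
    simp only [Function.comp_def, hcons] at hf2 hf3
    simp only [hcons, Fin.prod_univ_succ, Fin.cons_zero, Fin.cons_succ] at hf3 ⊢
    rw [integral_prod _ hf3]
    simp only [iterIntegral]
    have h1 : ∀ᵐ ξ₁ ∂ρ, iterIntegral μ m (fun ξ => f (Fin.cons ξ₁ ξ)) =
        ∫ ξ, f (Fin.cons ξ₁ ξ) * ∏ j, σ (ξ j) ∂(Measure.pi fun _ => ρ) := by
      filter_upwards [hf2.prod_right_ae] with ξ₁ hξ₁
      exact ih _ hξ₁
    have h2 : cintegral μ (fun ξ₁ => iterIntegral μ m fun ξ => f (Fin.cons ξ₁ ξ)) =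
        cintegral μ fun ξ₁ => ∫ ξ, f (Fin.cons ξ₁ ξ) * ∏ j, σ (ξ j) ∂(Measure.pi fun _ => ρ) :=
      VectorMeasure.integral_congr_ae h1
    have hf4 : Integrable (fun p : X × (Fin m → X) => f (Fin.cons p.1 p.2) * ∏ j, σ (p.2 j))
        (ρ.prod (Measure.pi fun _ => ρ)) := by
      refine hf2.mul_bdd (c := 1) (Measurable.aestronglyMeasurable ?_)
        (Eventually.of_forall fun ξ => ?_)
      · exact Finset.measurable_fun_prod _ fun j _ =>
          hσ.comp ((measurable_pi_apply j).comp measurable_snd)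
      · rw [norm_prod]
        exact Finset.prod_le_one (fun _ _ => norm_nonneg _) fun _ _ => hσ1 _
    rw [h2, h _ hf4.integral_prod_left]
    refine integral_congr_ae (Eventually.of_forall fun ξ₁ => ?_)
    simp only
    rw [← integral_mul_const]
    refine integral_congr_ae (Eventually.of_forall fun ξ => ?_)
    simp only
    ring

end Density

/-! ### Symmetric functions on the cube and the simplex -/

section Simplex

theorem measurableSet_simplex (m : ℕ) : MeasurableSet (simplex m) := by
  have h : simplex m = (⋂ j, ⋂ k, ⋂ (_ : j < k), {s | s j < s k}) ∩
      ⋂ j, {s | s j ∈ Ioo (0 : ℝ) 1} := by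
    ext s
    simp only [simplex, mem_inter_iff, mem_iInter, mem_ofPred_eq]
    exact Iff.and ⟨fun h j k hjk => h hjk, fun h j k hjk => h j k hjk⟩ Iff.rfl
  rw [h]
  refine MeasurableSet.inter (MeasurableSet.iInter fun j => MeasurableSet.iInter fun k =>
    MeasurableSet.iInter fun _ => measurableSet_lt (measurable_pi_apply j) (measurable_pi_apply k))
    (MeasurableSet.iInter fun j => measurable_pi_apply j measurableSet_Ioo)

/-- The integral of a symmetric function over a cube. -/
theorem setIntegral_cube_eq_factorial_mul (m : ℕ) {G : (Fin m → ℝ) → ℂ}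
    (hG : ∀ (π : Equiv.Perm (Fin m)) s, G (s ∘ π) = G s)
    (hi : IntegrableOn G (Icc (0 : Fin m → ℝ) 1)) :
    ∫ s in Icc (0 : Fin m → ℝ) 1, G s = m.factorial * ∫ s in simplex m, G s := by
  have hsub : ∀ π : Equiv.Perm (Fin m), ∀ s : Fin m → ℝ, s ∘ π ∈ simplex m →
      s ∈ Icc (0 : Fin m → ℝ) 1 := fun π s hs => by
    have := fun j => hs.2 (π.symm j)
    simp only [Function.comp, Equiv.apply_symm_apply] at this
    exact ⟨fun j => (this j).1.le, fun j => (this j).2.le⟩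
  have hmeas : ∀ π : Equiv.Perm (Fin m), MeasurableSet {s : Fin m → ℝ | s ∘ π ∈ simplex m} :=
    fun π => measurableSet_preimage (by fun_prop) (measurableSet_simplex m)
  have h1 : ∀ π : Equiv.Perm (Fin m), ∫ s, {s : Fin m → ℝ | s ∘ π ∈ simplex m}.indicator G s =
      ∫ s in simplex m, G s := fun π => by
    have h := (volume_measurePreserving_piCongrLeft (fun _ : Fin m => ℝ) π).symm
    rw [← integral_indicator (measurableSet_simplex m),
      ← h.integral_comp (MeasurableEquiv.measurableEmbedding _) ((simplex m).indicator G)]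
    refine integral_congr_ae (Eventually.of_forall fun s => ?_)
    have h2 : (MeasurableEquiv.piCongrLeft (fun _ : Fin m => ℝ) π).symm s = s ∘ π := rfl
    simp only [h2]
    exact Set.indicator_eq_indicator Iff.rfl (hG π s).symm
  -- Almost every point of the cube has distinct coordinates in ]0,1[, and then lies in exactly one
  -- of the m! permuted simplices, the one given by its sorting permutation.
  have h2 : ∀ᵐ s : Fin m → ℝ, (Icc (0 : Fin m → ℝ) 1).indicator G s =
      ∑ π : Equiv.Perm (Fin m), {s : Fin m → ℝ | s ∘ π ∈ simplex m}.indicator G s := by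
    have h3 : ∀ᵐ s : Fin m → ℝ, ∀ i j, i ≠ j → s i ≠ s j := by
      rw [ae_all_iff]; intro i
      rw [ae_all_iff]; intro j
      by_cases hij : i = j
      · simp [hij]
      · filter_upwards [ae_apply_ne hij] with s hs _ using hs
    have h4 : ∀ᵐ s : Fin m → ℝ, ∀ i, s i ≠ 0 ∧ s i ≠ 1 := by
      rw [ae_all_iff]; intro i
      have : ∀ c : ℝ, ∀ᵐ s : Fin m → ℝ, s i ≠ c := fun c => by
        have := (Measure.quasiMeasurePreserving_eval (fun _ : Fin m => (volume : Measure ℝ)) i)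
        exact this.ae (Measure.ae_ne volume c)
      filter_upwards [this 0, this 1] with s h h' using ⟨h, h'⟩
    filter_upwards [h3, h4] with s hs hs'
    by_cases hc : s ∈ Icc (0 : Fin m → ℝ) 1
    · have hst : s ∘ Tuple.sort s ∈ simplex m := by
        refine ⟨(Tuple.monotone_sort s).strictMono_of_injective ?_, fun j => ?_⟩
        · intro i j hij
          by_contra hne
          exact hs _ _ (fun h => hne ((Tuple.sort s).injective h)) hij
        · exact ⟨lt_of_le_of_ne (hc.1 _) (hs' _).1.symm, lt_of_le_of_ne (hc.2 _) (hs' _).2⟩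
      rw [indicator_of_mem hc, Finset.sum_eq_single (Tuple.sort s)]
      · exact (indicator_of_mem (s := {s' : Fin m → ℝ | s' ∘ Tuple.sort s ∈ simplex m}) hst G).symm
      · intro π _ hπ
        refine indicator_of_notMem (s := {s : Fin m → ℝ | s ∘ π ∈ simplex m}) (fun h => hπ ?_) G
        have h5 := Tuple.comp_sort_eq_comp_iff_monotone (f := s) (σ := π)
        have h6 := h5.2 h.1.monotone
        ext1 j
        have h7 := congrFun h6 j
        by_contra hne
        exact hs _ _ hne h7
      · intro h; exact absurd (Finset.mem_univ _) h
    · rw [indicator_of_notMem hc]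
      refine (Finset.sum_eq_zero fun π _ => ?_).symm
      exact indicator_of_notMem (s := {s : Fin m → ℝ | s ∘ π ∈ simplex m})
        (fun h => hc (hsub π s h)) G
  rw [← integral_indicator measurableSet_Icc, integral_congr_ae h2, integral_finsetSum]
  · simp only [h1, Finset.sum_const, Finset.card_univ, Fintype.card_perm, Fintype.card_fin,
      nsmul_eq_mul]
  · intro π _
    rw [integrable_indicator_iff (hmeas π)]
    exact hi.mono_set fun s hs => hsub π s hs

end Simplex

/-! ### Counting trees with weights -/

section TreeBound

open scoped Classical

/-- With the root at 0, every other vertex has a neighbour closer to the root. The n edges to these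
parents are distinct, since the distance drops strictly along each of them, and a tree on n+1
vertices has no further edge. -/
theorem exists_parent {n : ℕ} {g : SimpleGraph (Fin (n + 1))} (hg : g.IsTree) :
    ∃ f : Fin n → Fin (n + 1), Function.Injective (fun j => s(j.succ, f j)) ∧
      edges g = Finset.univ.image fun j => s(j.succ, f j) := by
  have hex : ∀ j : Fin n, ∃ k, g.Adj j.succ k ∧ g.dist k 0 < g.dist j.succ 0 := by
    intro j
    obtain ⟨p, hp⟩ := hg.connected.exists_walk_length_eq_dist j.succ 0
    cases p with
    | cons h q =>
      refine ⟨_, h, ?_⟩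
      rw [← hp, SimpleGraph.Walk.length_cons]
      exact Nat.lt_succ_of_le (SimpleGraph.dist_le q)
  choose f hf hd using hex
  have hinj : Function.Injective (fun j => s(j.succ, f j)) := by
    intro j k hjk
    simp only [Sym2.eq_iff] at hjk
    rcases hjk with h | h
    · exact Fin.succ_injective _ h.1
    · have h1 := hd j
      have h2 := hd k
      rw [h.2] at h1
      rw [← h.1] at h2
      omega
  refine ⟨f, hinj, (Finset.eq_of_subset_of_card_le (fun e he => ?_) ?_).symm⟩
  · obtain ⟨j, -, rfl⟩ := Finset.mem_image.1 he
    exact mem_edges.2 (hf j)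
  · rw [Finset.card_image_of_injective _ hinj, Finset.card_univ, Fintype.card_fin]
    have h1 := hg.card_edgeFinset
    have h2 : edges g = g.edgeFinset := by ext e; simp
    rw [h2]
    simp only [Fintype.card_fin] at h1
    omega

/-- The product of the weights of the end points. -/
def pairWeight {S : Type} (a : S → ℝ) : Sym2 S → ℝ :=
  Sym2.lift ⟨fun j k => a j * a k, fun _ _ => mul_comm _ _⟩

@[simp] theorem pairWeight_mk {S : Type} (a : S → ℝ) (j k : S) :
    pairWeight a s(j, k) = a j * a k := rfl

theorem pairWeight_nonneg {S : Type} {a : S → ℝ} (ha : ∀ j, 0 ≤ a j) (e : Sym2 S) :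
    0 ≤ pairWeight a e := by
  induction e with | _ j k => exact mul_nonneg (ha j) (ha k)

/-- A tree is determined by its parent map. Summing over all maps instead of those coming from trees
only increases the sum, and that larger sum factors. -/
theorem sum_trees_prod_le {n : ℕ} {a : Fin (n + 1) → ℝ} (ha : ∀ j, 0 ≤ a j) :
    ∑ g : SimpleGraph (Fin (n + 1)) with g.IsTree, ∏ e ∈ edges g, pairWeight a e ≤
      (∏ j : Fin n, a j.succ) * (∑ j, a j) ^ n := by
  have h : ∀ g : SimpleGraph (Fin (n + 1)), ∃ f : Fin n → Fin (n + 1), g.IsTree →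
      Function.Injective (fun j => s(j.succ, f j)) ∧
        edges g = Finset.univ.image fun j => s(j.succ, f j) := fun g => by
    by_cases hg : g.IsTree
    · obtain ⟨f, hf⟩ := exists_parent hg
      exact ⟨f, fun _ => hf⟩
    · exact ⟨fun _ => 0, fun h => absurd h hg⟩
  choose f hf using h
  have h2 : (∏ j : Fin n, a j.succ) * (∑ j, a j) ^ n =
      ∑ φ : Fin n → Fin (n + 1), ∏ j, (a j.succ * a (φ j)) := by
    have := Finset.prod_univ_sum (ι := Fin n) (fun _ => (Finset.univ : Finset (Fin (n + 1))))
      (fun _ k => a k)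
    rw [Finset.prod_const, Finset.card_univ, Fintype.card_fin, Fintype.piFinset_univ] at this
    rw [this, Finset.mul_sum]
    simp only [Finset.prod_mul_distrib]
  rw [h2]
  have h3 : ∀ g ∈ Finset.univ.filter fun g : SimpleGraph (Fin (n + 1)) => g.IsTree,
      ∏ e ∈ edges g, pairWeight a e = ∏ j, (a j.succ * a (f g j)) := fun g hg => by
    obtain ⟨h4, h5⟩ := hf g (Finset.mem_filter.1 hg).2
    rw [h5, Finset.prod_image fun x _ y _ h => h4 h]
    rfl
  rw [Finset.sum_congr rfl h3]
  refine (Finset.sum_image (s := Finset.univ.filter fun g : SimpleGraph (Fin (n + 1)) => g.IsTree)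
    (g := f) (f := fun φ => ∏ j, (a j.succ * a (φ j))) fun g hg g' hg' hgg => ?_).symm.trans_le
    (Finset.sum_le_sum_of_subset_of_nonneg (Finset.subset_univ _) fun φ _ _ =>
        Finset.prod_nonneg fun j _ => mul_nonneg (ha _) (ha _))
  have h1 : edges g = edges g' := by
    rw [(hf g (Finset.mem_filter.1 hg).2).2, (hf g' (Finset.mem_filter.1 hg').2).2, hgg]
  refine SimpleGraph.edgeSet_inj.1 ?_
  ext e
  rw [← mem_edges, ← mem_edges, h1]

theorem pow_le_factorial_mul_exp (n : ℕ) {x : ℝ} (hx : 0 ≤ x) :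
    x ^ n ≤ n.factorial * Real.exp x := by
  have := Real.pow_div_factorial_le_exp x hx n
  rwa [div_le_iff₀ (by positivity), mul_comm] at this

/-- Origin of the exponent 5. With N = ∑ a_j, one factor e^N bounds the product of the a_j, one
bounds N^n/n!, one bounds (1 + N)² up to the constant 2e (from x² ≤ 2e^x at x = 1 + N), and two are
the growth of the phase in the strips. The factor (1 + N)² is reserved for the t-derivative. -/
theorem sum_trees_weight_le {n : ℕ} {a : Fin (n + 1) → ℝ} (ha : ∀ j, 0 ≤ a j) :
    ∑ g : SimpleGraph (Fin (n + 1)) with g.IsTree, (∏ e ∈ edges g, pairWeight a e) *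
      ((1 + ∑ j, a j) ^ 2 * Real.exp (2 * ∑ j, a j)) ≤
      2 * Real.exp 1 * n.factorial * ∏ j, Real.exp (5 * a j) := by
  rw [← Finset.sum_mul]
  set N := ∑ j, a j with hN
  have hN0 : 0 ≤ N := Finset.sum_nonneg fun j _ => ha j
  have h1 := sum_trees_prod_le ha
  have h2 : ∏ j : Fin n, a j.succ ≤ Real.exp N := by
    rw [hN, Real.exp_sum, Fin.prod_univ_succ]
    have e1 : ∏ j : Fin n, a j.succ ≤ ∏ j : Fin n, Real.exp (a j.succ) :=
      Finset.prod_le_prod (fun j _ => ha _) fun j _ => by linarith [Real.add_one_le_exp (a j.succ)]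
    have e2 : 1 ≤ Real.exp (a 0) := Real.one_le_exp (ha 0)
    have e3 : 0 ≤ ∏ j : Fin n, Real.exp (a j.succ) := Finset.prod_nonneg fun _ _ => (Real.exp_pos _).le
    nlinarith
  have h3 := pow_le_factorial_mul_exp n hN0
  have h4 : (1 + N) ^ 2 ≤ 2 * Real.exp 1 * Real.exp N := by
    have := pow_le_factorial_mul_exp 2 (add_nonneg zero_le_one hN0)
    rw [Real.exp_add] at this
    simpa [mul_assoc] using this
  have h5 : ∏ j, Real.exp (5 * a j) = Real.exp N * Real.exp N * Real.exp N * Real.exp (2 * N) := by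
    rw [← Real.exp_sum, ← Finset.mul_sum, ← hN, ← Real.exp_add, ← Real.exp_add, ← Real.exp_add]
    congr 1; ring
  have hp : 0 ≤ ∏ j : Fin n, a j.succ := Finset.prod_nonneg fun j _ => ha _
  calc _ ≤ (Real.exp N * (n.factorial * Real.exp N)) *
        (2 * Real.exp 1 * Real.exp N * Real.exp (2 * N)) := by
        refine mul_le_mul (h1.trans ?_) ?_ (by positivity) (by positivity)
        · exact mul_le_mul h2 h3 (by positivity) (by positivity)
        · exact mul_le_mul_of_nonneg_right h4 (Real.exp_pos _).le
    _ = _ := by rw [h5]; ring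

end TreeBound

/-! ### The contribution of one tree, its derivative in t, and their bounds -/

section TreeTerm

open scoped Classical

variable {ν : ℕ} (ω : Fin ν → ℝ) {S : Type} [Fintype S]

/-- `kern` on unordered pairs. -/
def kernE (t : ℝ) (c : S → Pt ν) : Sym2 S → ℝ :=
  Sym2.lift ⟨fun j k => kern ω t (c j) (c k), fun _ _ => kern_comm ω t _ _⟩

/-- The derivative of `kernE` in `t`. -/
def kernED (t : ℝ) (c : S → Pt ν) (p : Sym2 S) : ℝ := deriv (fun r => kernE ω r c p) t

/-- The quadratic form of a tree. -/
def quadForm (t : ℝ) (F : SimpleGraph S) (θ : F.edgeSet → ℝ) (c : S → Pt ν) : ℝ :=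
  ∑ j, t * kern ω t (c j) (c j) + 2 * ∑ p ∈ offPairs S, pairMin F θ p * (t * kernE ω t c p)

/-- The derivative of `quadForm` in `t`. -/
def quadFormD (t : ℝ) (F : SimpleGraph S) (θ : F.edgeSet → ℝ) (c : S → Pt ν) : ℝ :=
  ∑ j, (1 * kern ω t (c j) (c j) + t * kernD ω t (c j) (c j)) +
    2 * ∑ p ∈ offPairs S, pairMin F θ p * (1 * kernE ω t c p + t * kernED ω t c p)

/-- The linear form `∑ q_t(s_j) · ξ_j`. -/
def linForm (t : ℝ) (x y : Fin ν → ℂ) (c : S → Pt ν) : ℂ := ∑ j, path ω t x y (c j)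

/-- The derivative of `linForm` in `t`. -/
def linFormD (t : ℝ) (x y : Fin ν → ℂ) (c : S → Pt ν) : ℂ := ∑ j, pathD ω t x y (c j)

/-- The contribution of a tree. -/
def treeTerm (t : ℝ) (x y : Fin ν → ℂ) (h : ℂ) (F : SimpleGraph S) (c : S → Pt ν)
    (θ : F.edgeSet → ℝ) : ℂ :=
  (∏ e ∈ edges F, (kernE ω t c e : ℂ)) *
    Complex.exp (-h * (quadForm ω t F θ c : ℂ) + Complex.I * linForm ω t x y c)

/-- The derivative of `treeTerm` in `t`. -/
def treeTermD (t : ℝ) (x y : Fin ν → ℂ) (h : ℂ) (F : SimpleGraph S) (c : S → Pt ν)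
    (θ : F.edgeSet → ℝ) : ℂ :=
  (∑ e ∈ edges F, (∏ e' ∈ (edges F).erase e, (kernE ω t c e' : ℂ)) * (kernED ω t c e : ℂ)) *
      Complex.exp (-h * (quadForm ω t F θ c : ℂ) + Complex.I * linForm ω t x y c) +
    (∏ e ∈ edges F, (kernE ω t c e : ℂ)) *
      (Complex.exp (-h * (quadForm ω t F θ c : ℂ) + Complex.I * linForm ω t x y c) *
        (-h * (quadFormD ω t F θ c : ℂ) + Complex.I * linFormD ω t x y c))

omit [Fintype S] in
@[simp] theorem kernE_mk (t : ℝ) (c : S → Pt ν) (j k : S) :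
    kernE ω t c s(j, k) = kern ω t (c j) (c k) := rfl

omit [Fintype S] in
@[simp] theorem kernED_mk (t : ℝ) (c : S → Pt ν) (j k : S) :
    kernED ω t c s(j, k) = kernD ω t (c j) (c k) := (hasDerivAt_kern ω t _ _).deriv

omit [Fintype S] in
theorem hasDerivAt_kernE (t : ℝ) (c : S → Pt ν) (p : Sym2 S) :
    HasDerivAt (fun r => kernE ω r c p) (kernED ω t c p) t := by
  induction p with | _ j k =>
  rw [kernED_mk]
  exact hasDerivAt_kern ω t _ _

theorem hasDerivAt_quadForm (t : ℝ) (F : SimpleGraph S) (θ : F.edgeSet → ℝ) (c : S → Pt ν) :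
    HasDerivAt (fun r => quadForm ω r F θ c) (quadFormD ω t F θ c) t := by
  refine HasDerivAt.fun_add (HasDerivAt.fun_sum fun j _ =>
    (hasDerivAt_id t).fun_mul (hasDerivAt_kern ω t _ _))
    (HasDerivAt.const_mul _ (HasDerivAt.fun_sum fun p _ => HasDerivAt.const_mul _
      ((hasDerivAt_id t).fun_mul (hasDerivAt_kernE ω t c p))))

theorem hasDerivAt_linForm (t : ℝ) (x y : Fin ν → ℂ) (c : S → Pt ν) :
    HasDerivAt (fun r => linForm ω r x y c) (linFormD ω t x y c) t :=
  HasDerivAt.fun_sum fun j _ => hasDerivAt_path ω t x y (c j)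

theorem hasDerivAt_treeTerm (t : ℝ) (x y : Fin ν → ℂ) (h : ℂ) (F : SimpleGraph S) (c : S → Pt ν)
    (θ : F.edgeSet → ℝ) :
    HasDerivAt (fun r => treeTerm ω r x y h F c θ) (treeTermD ω t x y h F c θ) t := by
  have h1 : HasDerivAt (fun r => ∏ e ∈ edges F, (kernE ω r c e : ℂ))
      (∑ e ∈ edges F, (∏ e' ∈ (edges F).erase e, (kernE ω t c e' : ℂ)) * (kernED ω t c e : ℂ)) t :=
    HasDerivAt.fun_finsetProd fun e _ => (hasDerivAt_kernE ω t c e).ofReal_comp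
  have h2 := (((hasDerivAt_quadForm ω t F θ c).ofReal_comp.const_mul (-h)).fun_add
    ((hasDerivAt_linForm ω t x y c).const_mul Complex.I)).cexp
  exact h1.fun_mul h2

variable {X : Type} [TopologicalSpace X]

omit [Fintype S] in
theorem continuous_kernE {t : X → ℝ} {c : X → S → Pt ν} (ht : Continuous t) (hc : Continuous c)
    (p : Sym2 S) : Continuous fun a => kernE ω (t a) (c a) p := by
  induction p with | _ j k =>
  exact continuous_kern ω ht ((continuous_apply j).comp hc) ((continuous_apply k).comp hc)

omit [Fintype S] in
theorem continuous_kernED {t : X → ℝ} {c : X → S → Pt ν} (ht : Continuous t) (hc : Continuous c)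
    (p : Sym2 S) : Continuous fun a => kernED ω (t a) (c a) p := by
  induction p with | _ j k =>
  simp only [kernED_mk]
  exact continuous_kernD ω ht ((continuous_apply j).comp hc) ((continuous_apply k).comp hc)

theorem continuous_quadForm {F : SimpleGraph S} {t : X → ℝ} {c : X → S → Pt ν}
    {θ : X → F.edgeSet → ℝ} (ht : Continuous t) (hc : Continuous c) (hθ : Continuous θ) :
    Continuous fun a => quadForm ω (t a) F (θ a) (c a) :=
  (continuous_finsetSum _ fun j _ => ht.mul (continuous_kern ω ht ((continuous_apply j).comp hc)
    ((continuous_apply j).comp hc))).add (continuous_const.mul (continuous_finsetSum _ fun p _ =>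
      ((continuous_pairMin F p).comp hθ).mul (ht.mul (continuous_kernE ω ht hc p))))

theorem continuous_quadFormD {F : SimpleGraph S} {t : X → ℝ} {c : X → S → Pt ν}
    {θ : X → F.edgeSet → ℝ} (ht : Continuous t) (hc : Continuous c) (hθ : Continuous θ) :
    Continuous fun a => quadFormD ω (t a) F (θ a) (c a) :=
  (continuous_finsetSum _ fun j _ => (continuous_const.mul (continuous_kern ω ht
    ((continuous_apply j).comp hc) ((continuous_apply j).comp hc))).add
    (ht.mul (continuous_kernD ω ht ((continuous_apply j).comp hc)
    ((continuous_apply j).comp hc)))).add (continuous_const.mul (continuous_finsetSum _ fun p _ =>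
      ((continuous_pairMin F p).comp hθ).mul ((continuous_const.mul (continuous_kernE ω ht hc p)).add
        (ht.mul (continuous_kernED ω ht hc p)))))

theorem continuous_linForm {t : X → ℝ} {x y : X → Fin ν → ℂ} {c : X → S → Pt ν}
    (ht : Continuous t) (hx : Continuous x) (hy : Continuous y) (hc : Continuous c) :
    Continuous fun a => linForm ω (t a) (x a) (y a) (c a) :=
  continuous_finsetSum _ fun j _ => continuous_path ω ht hx hy ((continuous_apply j).comp hc)

theorem continuous_linFormD {t : X → ℝ} {x y : X → Fin ν → ℂ} {c : X → S → Pt ν}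
    (ht : Continuous t) (hx : Continuous x) (hy : Continuous y) (hc : Continuous c) :
    Continuous fun a => linFormD ω (t a) (x a) (y a) (c a) :=
  continuous_finsetSum _ fun j _ => continuous_pathD ω ht hx hy ((continuous_apply j).comp hc)

theorem continuous_treeTerm {F : SimpleGraph S} {t : X → ℝ} {x y : X → Fin ν → ℂ} {h : X → ℂ}
    {c : X → S → Pt ν} {θ : X → F.edgeSet → ℝ} (ht : Continuous t) (hx : Continuous x)
    (hy : Continuous y) (hh : Continuous h) (hc : Continuous c) (hθ : Continuous θ) :
    Continuous fun a => treeTerm ω (t a) (x a) (y a) (h a) F (c a) (θ a) :=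
  (continuous_finsetProd _ fun e _ => Complex.continuous_ofReal.comp
    (continuous_kernE ω ht hc e)).mul (Complex.continuous_exp.comp
    ((hh.neg.mul (Complex.continuous_ofReal.comp (continuous_quadForm ω ht hc hθ))).add
      (continuous_const.mul (continuous_linForm ω ht hx hy hc))))

theorem continuous_treeTermD {F : SimpleGraph S} {t : X → ℝ} {x y : X → Fin ν → ℂ} {h : X → ℂ}
    {c : X → S → Pt ν} {θ : X → F.edgeSet → ℝ} (ht : Continuous t) (hx : Continuous x)
    (hy : Continuous y) (hh : Continuous h) (hc : Continuous c) (hθ : Continuous θ) :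
    Continuous fun a => treeTermD ω (t a) (x a) (y a) (h a) F (c a) (θ a) := by
  have hE : ∀ e, Continuous fun a => (kernE ω (t a) (c a) e : ℂ) := fun e =>
    Complex.continuous_ofReal.comp (continuous_kernE ω ht hc e)
  have hexp : Continuous fun a => Complex.exp (-h a * (quadForm ω (t a) F (θ a) (c a) : ℂ) +
      Complex.I * linForm ω (t a) (x a) (y a) (c a)) := Complex.continuous_exp.comp
    ((hh.neg.mul (Complex.continuous_ofReal.comp (continuous_quadForm ω ht hc hθ))).add
      (continuous_const.mul (continuous_linForm ω ht hx hy hc)))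
  exact ((continuous_finsetSum _ fun e _ => (continuous_finsetProd _ fun e' _ => hE e').mul
    (Complex.continuous_ofReal.comp (continuous_kernED ω ht hc e))).mul hexp).add
    ((continuous_finsetProd _ fun e _ => hE e).mul (hexp.mul
      ((hh.neg.mul (Complex.continuous_ofReal.comp (continuous_quadFormD ω ht hc hθ))).add
      (continuous_const.mul (continuous_linFormD ω ht hx hy hc)))))

variable {E : Type} [NormedAddCommGroup E] [NormedSpace ℂ E]

theorem differentiable_linForm (t : ℝ) {x y : E → Fin ν → ℂ} (c : S → Pt ν)
    (hx : Differentiable ℂ x) (hy : Differentiable ℂ y) :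
    Differentiable ℂ fun z => linForm ω t (x z) (y z) c := by
  simp only [linForm, path, qPath]
  fun_prop

theorem differentiable_linFormD (t : ℝ) {x y : E → Fin ν → ℂ} (c : S → Pt ν)
    (hx : Differentiable ℂ x) (hy : Differentiable ℂ y) :
    Differentiable ℂ fun z => linFormD ω t (x z) (y z) c := by
  simp only [linFormD, pathD]
  fun_prop

theorem differentiable_treeTerm (t : ℝ) {x y : E → Fin ν → ℂ} {h : E → ℂ} (F : SimpleGraph S)
    (c : S → Pt ν) (θ : F.edgeSet → ℝ) (hx : Differentiable ℂ x) (hy : Differentiable ℂ y)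
    (hh : Differentiable ℂ h) :
    Differentiable ℂ fun z => treeTerm ω t (x z) (y z) (h z) F c θ := by
  have := differentiable_linForm ω t c hx hy
  unfold treeTerm
  fun_prop

theorem differentiable_treeTermD (t : ℝ) {x y : E → Fin ν → ℂ} {h : E → ℂ} (F : SimpleGraph S)
    (c : S → Pt ν) (θ : F.edgeSet → ℝ) (hx : Differentiable ℂ x) (hy : Differentiable ℂ y)
    (hh : Differentiable ℂ h) :
    Differentiable ℂ fun z => treeTermD ω t (x z) (y z) (h z) F c θ := by
  have := differentiable_linForm ω t c hx hy
  have := differentiable_linFormD ω t c hx hy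
  unfold treeTermD
  fun_prop

/-- The sum of the norms `|ξ_j|`. -/
def totalNorm (c : S → Pt ν) : ℝ := ∑ j, ‖(c j).2‖

/-- Configurations with all `s_j` in `[0, 1]`. -/
def InBox (c : S → Pt ν) : Prop := ∀ j, (c j).1 ∈ Icc (0 : ℝ) 1

theorem totalNorm_nonneg (c : S → Pt ν) : 0 ≤ totalNorm c :=
  Finset.sum_nonneg fun _ _ => norm_nonneg _

omit [Fintype S] in
theorem abs_kernE_le (t : ℝ) {c : S → Pt ν} (hc : InBox c) (e : Sym2 S) :
    |kernE ω t c e| ≤ pairWeight (fun j => ‖(c j).2‖) e := by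
  induction e with | _ j k => exact abs_kern_le ω t (hc j) (hc k)

omit [Fintype S] in
theorem pairMin_mem (F : SimpleGraph S) {θ : F.edgeSet → ℝ} (hθ : ∀ i, θ i ∈ Icc (0 : ℝ) 1)
    (p : Sym2 S) : pairMin F θ p ∈ Icc (0 : ℝ) 1 := by
  induction p with | _ j k =>
  simp only [pairMin_mk, pmin]
  set A := θ '' {e | ∃ p : F.Walk j k, p.IsPath ∧ (e : Sym2 S) ∈ p.edges}
  have hA : ∀ a ∈ A, a ∈ Icc (0 : ℝ) 1 := by
    rintro a ⟨i, -, rfl⟩; exact hθ i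
  refine ⟨Real.sInf_nonneg fun a ha => (hA a ha).1, ?_⟩
  rcases A.eq_empty_or_nonempty with h | ⟨a, ha⟩
  · rw [h, Real.sInf_empty]; exact zero_le_one
  · exact (csInf_le ⟨0, fun b hb => (hA b hb).1⟩ ha).trans (hA a ha).2

/-- A tree joins all pairs, so this is the interpolated form with c = 1. The positivity on subsets
that the interpolation requires is that of the Green function. -/
theorem quadForm_nonneg {ω : Fin ν → ℝ} (hω : ∀ υ, 0 < ω υ) {t : ℝ} (ht : 0 ≤ t)
    {F : SimpleGraph S} (hF : F.IsTree) {θ : F.edgeSet → ℝ} (hθ : ∀ i, θ i ∈ Icc (0 : ℝ) 1)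
    {c : S → Pt ν} (hc : InBox c) : 0 ≤ quadForm ω t F θ c := by
  have h := pairMin_form_nonneg (q := fun j => t * kern ω t (c j) (c j))
    (f := fun p => t * kernE ω t c p) (fun I => by
      refine (kern_sum_nonneg I hω ht hc).trans_eq (Finset.sum_congr rfl fun j _ =>
        Finset.sum_congr rfl fun k _ => ?_)
      split_ifs with hjk
      · rw [hjk]
      · rfl) _ hF.isAcyclic rfl zero_le_one (fun i => (hθ i).1) (fun i => (hθ i).2)
  rw [connPairs_of_isTree hF, one_mul] at h
  exact h

theorem abs_diag_add_offPairs_le {d : S → ℝ} {f : Sym2 S → ℝ} {a : S → ℝ} {C : ℝ}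
    (hd : ∀ j, |d j| ≤ C * (a j * a j)) (hf : ∀ p, |f p| ≤ C * pairWeight a p) :
    |∑ j, d j + 2 * ∑ p ∈ offPairs S, f p| ≤ C * (∑ j, a j) ^ 2 := by
  have h := sum_sum_eq_diag_add_offPairs (fun j k => C * (a j * a k)) (fun j => C * (a j * a j))
    (fun p => C * pairWeight a p) (fun _ => rfl) (fun _ _ _ => rfl)
  have h1 : C * (∑ j, a j) ^ 2 = ∑ j, ∑ k, C * (a j * a k) := by
    rw [sq, Finset.sum_mul_sum, Finset.mul_sum]
    simp only [Finset.mul_sum]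
  rw [h1, h, smul_eq_mul]
  refine (abs_add_le _ _).trans (add_le_add ?_ ?_)
  · exact (Finset.abs_sum_le_sum_abs _ _).trans (Finset.sum_le_sum fun j _ => hd j)
  · rw [abs_mul, abs_two]
    exact mul_le_mul_of_nonneg_left ((Finset.abs_sum_le_sum_abs _ _).trans
      (Finset.sum_le_sum fun p _ => hf p)) zero_le_two

/-- The alternative in the hypothesis covers both series: φ has h = 0, the quadratic form drops out
and t may have either sign; w has t ≥ 0 and Re h ≥ 0, and positivity of the form lets its
exponential be discarded. -/
theorem norm_linForm_exp_le {ω : Fin ν → ℝ} (hω : ∀ υ, 0 < ω υ) {t : ℝ} {x y : Fin ν → ℂ} {h : ℂ}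
    (hh : h = 0 ∨ 0 ≤ t ∧ 0 ≤ h.re) (hx : x ∈ strip ν 2) (hy : y ∈ strip ν 2)
    {F : SimpleGraph S} (hF : F.IsTree) {θ : F.edgeSet → ℝ} (hθ : ∀ i, θ i ∈ Icc (0 : ℝ) 1)
    {c : S → Pt ν} (hc : InBox c) :
    ‖Complex.exp (-h * (quadForm ω t F θ c : ℂ) + Complex.I * linForm ω t x y c)‖ ≤
      Real.exp (2 * totalNorm c) := by
  rw [Complex.norm_exp, Real.exp_le_exp]
  have h1 : |(linForm ω t x y c).im| ≤ 2 * totalNorm c := by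
    rw [linForm, Complex.im_sum, totalNorm, Finset.mul_sum]
    exact (Finset.abs_sum_le_sum_abs _ _).trans (Finset.sum_le_sum fun j _ =>
      abs_im_path_le ω t hx hy (hc j))
  have h2 : 0 ≤ h.re * quadForm ω t F θ c := by
    rcases hh with rfl | ⟨ht, hh⟩
    · simp
    · exact mul_nonneg hh (quadForm_nonneg hω ht hF hθ hc)
  have h3 : (-h * (quadForm ω t F θ c : ℂ) + Complex.I * linForm ω t x y c).re =
      -(h.re * quadForm ω t F θ c) - (linForm ω t x y c).im := by
    simp
    ring
  rw [h3]
  linarith [neg_abs_le (linForm ω t x y c).im]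

omit [Fintype S] in
theorem norm_prod_kernE_le (t : ℝ) {c : S → Pt ν} (hc : InBox c) (I : Finset (Sym2 S)) :
    ‖∏ e ∈ I, (kernE ω t c e : ℂ)‖ ≤ ∏ e ∈ I, pairWeight (fun j => ‖(c j).2‖) e := by
  rw [norm_prod]
  exact Finset.prod_le_prod (fun _ _ => norm_nonneg _) fun e _ => by
    rw [Complex.norm_real]; exact abs_kernE_le ω t hc e

theorem norm_treeTerm_le {ω : Fin ν → ℝ} (hω : ∀ υ, 0 < ω υ) {t : ℝ} {x y : Fin ν → ℂ} {h : ℂ}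
    (hh : h = 0 ∨ 0 ≤ t ∧ 0 ≤ h.re) (hx : x ∈ strip ν 2) (hy : y ∈ strip ν 2)
    {F : SimpleGraph S} (hF : F.IsTree) {θ : F.edgeSet → ℝ} (hθ : ∀ i, θ i ∈ Icc (0 : ℝ) 1)
    {c : S → Pt ν} (hc : InBox c) :
    ‖treeTerm ω t x y h F c θ‖ ≤
      (∏ e ∈ edges F, pairWeight (fun j => ‖(c j).2‖) e) * Real.exp (2 * totalNorm c) := by
  rw [treeTerm, norm_mul]
  exact mul_le_mul (norm_prod_kernE_le ω t hc _) (norm_linForm_exp_le hω hh hx hy hF hθ hc)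
    (norm_nonneg _) (Finset.prod_nonneg fun e _ => pairWeight_nonneg (fun _ => norm_nonneg _) e)

/-- By the product rule the derivative hits either an edge factor, at the cost of the number of
edges, or the exponent, at the cost of a polynomial of degree two in the total norm. The constant
depends on ω, T, R and H only, so it is uniform over all trees and the later sum over trees is not
affected. -/
theorem exists_norm_treeTermD_le {ω : Fin ν → ℝ} (hω : ∀ υ, 0 < ω υ) (T R H : ℝ) (hT : 0 ≤ T)
    (hH : 0 ≤ H) :
    ∃ C, 0 ≤ C ∧ ∀ {S : Type} [Fintype S] {t : ℝ} {x y : Fin ν → ℂ} {h : ℂ},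
    t ∈ Icc (-T) T → (h = 0 ∨ 0 ≤ t ∧ 0 ≤ h.re) → ‖h‖ ≤ H → x ∈ strip ν 2 → y ∈ strip ν 2 →
    ‖x‖ ≤ R → ‖y‖ ≤ R →
    ∀ {F : SimpleGraph S} (_ : F.IsTree) {θ : F.edgeSet → ℝ} (_ : ∀ i, θ i ∈ Icc (0 : ℝ) 1)
    {c : S → Pt ν} (_ : InBox c),
    ‖treeTermD ω t x y h F c θ‖ ≤ C * ((edges F).card + 1) *
      ((∏ e ∈ edges F, pairWeight (fun j => ‖(c j).2‖) e) *
        ((1 + totalNorm c) ^ 2 * Real.exp (2 * totalNorm c))) := by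
  obtain ⟨C₁, hC₁, hk⟩ := exists_abs_kernD_le ω T
  obtain ⟨C₂, hC₂, hq⟩ := exists_norm_pathD_le ω T R
  refine ⟨C₁ + (H * (1 + T * C₁) + C₂), by positivity, fun {S} _ {t x y h} ht hh hhH hx hy hxR hyR
    {F} hF {θ} hθ {c} hc => ?_⟩
  set a : S → ℝ := fun j => ‖(c j).2‖ with ha
  have ha0 : ∀ j, 0 ≤ a j := fun _ => norm_nonneg _
  set W := ∏ e ∈ edges F, pairWeight a e with hW
  have hW0 : 0 ≤ W := Finset.prod_nonneg fun e _ => pairWeight_nonneg ha0 e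
  set N := totalNorm c with hN
  have hN0 : 0 ≤ N := totalNorm_nonneg c
  set X := Real.exp (2 * N) with hX
  have hX0 : 0 < X := Real.exp_pos _
  have hexp := norm_linForm_exp_le hω hh hx hy hF hθ hc
  have htT : |t| ≤ T := abs_le.2 ht
  have hkE : ∀ e, |kernED ω t c e| ≤ C₁ * pairWeight a e := fun e => by
    induction e with | _ j k => rw [kernED_mk]; exact hk t ht _ _ (hc j) (hc k)
  have h1 : ‖∑ e ∈ edges F, (∏ e' ∈ (edges F).erase e, (kernE ω t c e' : ℂ)) *
      (kernED ω t c e : ℂ)‖ ≤ (edges F).card * (C₁ * W) := by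
    refine (norm_sum_le _ _).trans ?_
    rw [← nsmul_eq_mul]
    refine Finset.sum_le_card_nsmul _ _ _ fun e he => ?_
    rw [norm_mul, Complex.norm_real, hW, ← Finset.prod_erase_mul _ _ he, mul_left_comm]
    exact mul_le_mul (norm_prod_kernE_le ω t hc _) (hkE e) (norm_nonneg _)
      (Finset.prod_nonneg fun e _ => pairWeight_nonneg ha0 e)
  have h2 : |quadFormD ω t F θ c| ≤ (1 + T * C₁) * N ^ 2 := by
    have hb : ∀ {u v w : ℝ}, 0 ≤ w → |u| ≤ w → |v| ≤ C₁ * w → |1 * u + t * v| ≤ (1 + T * C₁) * w := by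
      intro u v w hw hu hv
      refine (abs_add_le _ _).trans ?_
      rw [one_mul, abs_mul]
      have := mul_le_mul htT hv (abs_nonneg _) hT
      linarith
    refine abs_diag_add_offPairs_le (a := a) (fun j => ?_) fun p => ?_
    · exact hb (mul_nonneg (ha0 j) (ha0 j)) (abs_kern_le ω t (hc j) (hc j))
        (hk t ht _ _ (hc j) (hc j))
    · rw [abs_mul]
      have h3 := pairMin_mem F hθ p
      rw [abs_of_nonneg h3.1]
      refine (mul_le_of_le_one_left (abs_nonneg _) h3.2).trans ?_
      exact hb (pairWeight_nonneg ha0 p) (abs_kernE_le ω t hc p) (hkE p)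
  have h3 : ‖linFormD ω t x y c‖ ≤ C₂ * N := by
    rw [linFormD, hN, totalNorm, Finset.mul_sum]
    exact (norm_sum_le _ _).trans (Finset.sum_le_sum fun j _ => hq t ht x y hxR hyR _ (hc j))
  have h4 : ‖-h * (quadFormD ω t F θ c : ℂ) + Complex.I * linFormD ω t x y c‖ ≤
      H * ((1 + T * C₁) * N ^ 2) + C₂ * N := by
    refine (norm_add_le _ _).trans (add_le_add ?_ ?_)
    · rw [norm_mul, norm_neg, Complex.norm_real]
      exact mul_le_mul hhH h2 (norm_nonneg _) hH
    · rw [norm_mul, Complex.norm_I, one_mul]; exact h3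
  have hP := norm_prod_kernE_le ω t hc (edges F)
  have hn : (0 : ℝ) ≤ (edges F).card := Nat.cast_nonneg _
  have hNN : 1 ≤ (1 + N) ^ 2 := by nlinarith
  calc ‖treeTermD ω t x y h F c θ‖ ≤ (edges F).card * (C₁ * W) * X +
        W * (X * (H * ((1 + T * C₁) * N ^ 2) + C₂ * N)) := by
        refine (norm_add_le _ _).trans (add_le_add ?_ ?_)
        · rw [norm_mul]
          exact mul_le_mul h1 hexp (norm_nonneg _) (by positivity)
        · rw [norm_mul, norm_mul]
          exact mul_le_mul hP (mul_le_mul hexp h4 (norm_nonneg _) hX0.le) (by positivity) hW0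
    _ = ((edges F).card * C₁ + (H * ((1 + T * C₁) * N ^ 2) + C₂ * N)) * (W * X) := by ring
    _ ≤ ((C₁ + (H * (1 + T * C₁) + C₂)) * ((edges F).card + 1) * (1 + N) ^ 2) * (W * X) := by
        refine mul_le_mul_of_nonneg_right ?_ (by positivity)
        have e1 : ((edges F).card : ℝ) * C₁ ≤ C₁ * ((edges F).card + 1) * (1 + N) ^ 2 := by
          have : 0 ≤ C₁ * ((edges F).card + 1) := by positivity
          nlinarith [mul_le_mul_of_nonneg_left hNN this]
        have e2 : H * ((1 + T * C₁) * N ^ 2) + C₂ * N ≤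
            (H * (1 + T * C₁) + C₂) * ((edges F).card + 1) * (1 + N) ^ 2 := by
          have f1 : 0 ≤ H * (1 + T * C₁) := by positivity
          have f2 : H * ((1 + T * C₁) * N ^ 2) + C₂ * N ≤
              (H * (1 + T * C₁) + C₂) * (1 + N) ^ 2 := by nlinarith
          have f3 : 0 ≤ (H * (1 + T * C₁) + C₂) * (1 + N) ^ 2 := by positivity
          nlinarith [mul_nonneg f3 hn]
        linarith
    _ = _ := by ring

end TreeTerm

/-! ### Measures on configurations and integrated tree bounds -/

section PtMeasure

open scoped Classical

variable {ν : ℕ} (ρ : Measure (EuclideanSpace ℝ (Fin ν))) [IsFiniteMeasure ρ]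

/-- The measure `ds dρ(ξ)` on `[0, 1] × ℝ^ν`. -/
def ptMeasure : Measure (Pt ν) := ((volume : Measure ℝ).restrict (Icc 0 1)).prod ρ

instance : IsFiniteMeasure (ptMeasure ρ) := by unfold ptMeasure; infer_instance

/-- The product measure on configurations. -/
def confMeasure (S : Type) [Fintype S] : Measure (S → Pt ν) := Measure.pi fun _ => ptMeasure ρ

instance (S : Type) [Fintype S] : IsFiniteMeasure (confMeasure ρ S) := by
  unfold confMeasure; infer_instance

variable {S : Type} [Fintype S]

theorem ae_inBox : ∀ᵐ c ∂confMeasure ρ S, InBox c := by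
  have h : ∀ᵐ p ∂ptMeasure ρ, p.1 ∈ Icc (0 : ℝ) 1 := by
    have h1 : ∀ᵐ s ∂(volume : Measure ℝ).restrict (Icc 0 1), s ∈ Icc (0 : ℝ) 1 :=
      ae_restrict_mem measurableSet_Icc
    exact Measure.quasiMeasurePreserving_fst.ae h1
  unfold InBox
  rw [ae_all_iff]
  exact fun j => (Measure.quasiMeasurePreserving_eval (fun _ : S => ptMeasure ρ) j).ae h

theorem ae_cube {κ : Type} [Fintype κ] :
    ∀ᵐ θ : κ → ℝ ∂volume.restrict (Icc 0 1), ∀ i, θ i ∈ Icc (0 : ℝ) 1 := by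
  filter_upwards [ae_restrict_mem measurableSet_Icc] with θ hθ i
  exact ⟨hθ.1 i, hθ.2 i⟩

theorem volume_cube_univ {κ : Type} [Fintype κ] :
    (volume.restrict (Icc (0 : κ → ℝ) 1)).real univ = 1 := by
  simp [Measure.real, Real.volume_Icc_pi]

variable {ρ}

theorem integrable_expNorm (h : Integrable (fun ξ => Real.exp (5 * ‖ξ‖)) ρ) :
    Integrable (fun p : Pt ν => Real.exp (5 * ‖p.2‖)) (ptMeasure ρ) ∧
      ∫ p, Real.exp (5 * ‖p.2‖) ∂ptMeasure ρ = ∫ ξ, Real.exp (5 * ‖ξ‖) ∂ρ := by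
  constructor
  · have := (integrable_const (1 : ℝ) (μ := (volume : Measure ℝ).restrict (Icc 0 1))).mul_prod h
    simpa [ptMeasure] using this
  · have := integral_prod_mul (μ := (volume : Measure ℝ).restrict (Icc 0 1)) (ν := ρ)
      (fun _ => (1 : ℝ)) (fun ξ => Real.exp (5 * ‖ξ‖))
    simpa [ptMeasure] using this

theorem integrable_prod_expNorm (h : Integrable (fun ξ => Real.exp (5 * ‖ξ‖)) ρ) :
    Integrable (fun c : S → Pt ν => ∏ j, Real.exp (5 * ‖(c j).2‖)) (confMeasure ρ S) ∧
      ∫ c, ∏ j, Real.exp (5 * ‖(c j).2‖) ∂confMeasure ρ S =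
        (∫ ξ, Real.exp (5 * ‖ξ‖) ∂ρ) ^ Fintype.card S := by
  constructor
  · exact Integrable.fintype_prod (fun _ => (integrable_expNorm h).1)
  · rw [confMeasure, integral_fintype_prod_eq_prod (𝕜 := ℝ) (fun (_ : S) (p : Pt ν) => Real.exp (5 * ‖p.2‖)),
      Finset.prod_const, Finset.card_univ, (integrable_expNorm h).2]

/-- The bound for the contribution of a tree. -/
def treeBound (F : SimpleGraph S) (c : S → Pt ν) : ℝ :=
  (∏ e ∈ edges F, pairWeight (fun j => ‖(c j).2‖) e) *
    ((1 + totalNorm c) ^ 2 * Real.exp (2 * totalNorm c))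

theorem continuous_totalNorm : Continuous (totalNorm : (S → Pt ν) → ℝ) := by
  unfold totalNorm; fun_prop

omit [Fintype S] in
theorem continuous_pairWeight (e : Sym2 S) :
    Continuous fun c : S → Pt ν => pairWeight (fun j => ‖(c j).2‖) e := by
  induction e with | _ j k =>
  simp only [pairWeight_mk]
  fun_prop

theorem continuous_treeBound (F : SimpleGraph S) : Continuous (treeBound (ν := ν) F) := by
  have h := continuous_totalNorm (ν := ν) (S := S)
  exact (continuous_finsetProd _ fun e _ => continuous_pairWeight e).mul
    ((((continuous_const.add h).pow 2)).mul (by fun_prop))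

theorem treeBound_nonneg (F : SimpleGraph S) (c : S → Pt ν) : 0 ≤ treeBound F c :=
  mul_nonneg (Finset.prod_nonneg fun e _ => pairWeight_nonneg (fun _ => norm_nonneg _) e)
    (by positivity)

theorem integrable_treeBound (h : Integrable (fun ξ => Real.exp (5 * ‖ξ‖)) ρ) {n : ℕ}
    {g : SimpleGraph (Fin (n + 1))} (hg : g.IsTree) :
    Integrable (treeBound g) (confMeasure ρ (Fin (n + 1))) := by
  refine ((integrable_prod_expNorm h).1.const_mul (2 * Real.exp 1 * n.factorial)).mono'
    (continuous_treeBound g).aestronglyMeasurable (Eventually.of_forall fun c => ?_)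
  rw [Real.norm_of_nonneg (treeBound_nonneg g c)]
  refine le_trans ?_ (sum_trees_weight_le fun j => norm_nonneg (c j).2)
  exact Finset.single_le_sum (f := fun g => treeBound g c) (fun g _ => treeBound_nonneg g c)
    (Finset.mem_filter.2 ⟨Finset.mem_univ g, hg⟩)

theorem sum_integral_treeBound_le (h : Integrable (fun ξ => Real.exp (5 * ‖ξ‖)) ρ) (n : ℕ) :
    ∑ g : SimpleGraph (Fin (n + 1)) with g.IsTree,
      ∫ c, treeBound g c ∂confMeasure ρ (Fin (n + 1)) ≤
      2 * Real.exp 1 * n.factorial * (∫ ξ, Real.exp (5 * ‖ξ‖) ∂ρ) ^ (n + 1) := by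
  rw [← integral_finsetSum _ fun g hg => integrable_treeBound h (Finset.mem_filter.1 hg).2]
  have h1 := (integrable_prod_expNorm (S := Fin (n + 1)) h).2
  rw [Fintype.card_fin] at h1
  rw [← h1, ← integral_const_mul]
  exact integral_mono (integrable_finsetSum _ fun g hg =>
    integrable_treeBound h (Finset.mem_filter.1 hg).2)
    ((integrable_prod_expNorm h).1.const_mul _) fun c =>
      sum_trees_weight_le fun j => norm_nonneg (c j).2

end PtMeasure

/-! ### The tree expansion as one integral over a disjoint union -/

section TreeFamily

open scoped Classical

variable {ν : ℕ} (ω : Fin ν → ℝ) (ρ : Measure (EuclideanSpace ℝ (Fin ν)))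
  [IsFiniteMeasure ρ] (σ : EuclideanSpace ℝ (Fin ν) → ℂ)

/-- Indices: a number of edges and a tree. -/
abbrev TreeIdx : Type := Σ n : ℕ, {g : SimpleGraph (Fin (n + 1)) // g.IsTree}

/-- The configurations of the vertices and of the edges of a tree. -/
abbrev TreeSp (ν : ℕ) (i : TreeIdx) : Type := (Fin (i.1 + 1) → Pt ν) × (i.2.1.edgeSet → ℝ)

/-- The measure on the configurations of a tree. -/
def treeMeasure (i : TreeIdx) : Measure (TreeSp ν i) :=
  (confMeasure ρ (Fin (i.1 + 1))).prod (volume.restrict (Icc 0 1))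

instance (i : TreeIdx) : IsFiniteMeasure (volume.restrict (Icc (0 : i.2.1.edgeSet → ℝ) 1)) :=
  ⟨by simp [Real.volume_Icc_pi]⟩

/-- The integrand of the expansion. -/
def treeFun (t : ℝ) (x y : Fin ν → ℂ) (h : ℂ) (a : Σ i, TreeSp ν i) : ℂ :=
  ((-2 : ℂ) ^ a.1.1 / ((a.1.1 + 1).factorial : ℂ)) * (t : ℂ) ^ (2 * a.1.1) *
    (treeTerm ω t x y h a.1.2.1 a.2.1 a.2.2 * ∏ j, σ (a.2.1 j).2)

/-- The derivative of `treeFun` in `t`. -/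
def treeFunD (t : ℝ) (x y : Fin ν → ℂ) (h : ℂ) (a : Σ i, TreeSp ν i) : ℂ :=
  ((-2 : ℂ) ^ a.1.1 / ((a.1.1 + 1).factorial : ℂ)) *
    (((2 * a.1.1 : ℕ) : ℂ) * (t : ℂ) ^ (2 * a.1.1 - 1)) *
      (treeTerm ω t x y h a.1.2.1 a.2.1 a.2.2 * ∏ j, σ (a.2.1 j).2) +
    ((-2 : ℂ) ^ a.1.1 / ((a.1.1 + 1).factorial : ℂ)) * (t : ℂ) ^ (2 * a.1.1) *
    (treeTermD ω t x y h a.1.2.1 a.2.1 a.2.2 * ∏ j, σ (a.2.1 j).2)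

theorem hasDerivAt_treeFun (t : ℝ) (x y : Fin ν → ℂ) (h : ℂ) (a : Σ i, TreeSp ν i) :
    HasDerivAt (fun r => treeFun ω σ r x y h a) (treeFunD ω σ t x y h a) t := by
  have h1 : HasDerivAt (fun r : ℝ => ((-2 : ℂ) ^ a.1.1 / ((a.1.1 + 1).factorial : ℂ)) *
      (r : ℂ) ^ (2 * a.1.1)) (((-2 : ℂ) ^ a.1.1 / ((a.1.1 + 1).factorial : ℂ)) *
    (((2 * a.1.1 : ℕ) : ℂ) * (t : ℂ) ^ (2 * a.1.1 - 1))) t := by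
    have := ((hasDerivAt_pow (2 * a.1.1) (t : ℂ)).comp_ofReal).const_mul
      ((-2 : ℂ) ^ a.1.1 / ((a.1.1 + 1).factorial : ℂ))
    exact this
  exact h1.fun_mul ((hasDerivAt_treeTerm ω t x y h a.1.2.1 a.2.1 a.2.2).mul_const _)

variable {X : Type} [TopologicalSpace X]

theorem continuous_treeFun (a : Σ i, TreeSp ν i) {t : X → ℝ} {x y : X → Fin ν → ℂ} {h : X → ℂ}
    (ht : Continuous t) (hx : Continuous x) (hy : Continuous y) (hh : Continuous h) :
    Continuous (fun z => treeFun ω σ (t z) (x z) (y z) (h z) a) ∧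
    Continuous (fun z => treeFunD ω σ (t z) (x z) (y z) (h z) a) := by
  have h1 := continuous_treeTerm ω (F := a.1.2.1) ht hx hy hh (continuous_const (y := a.2.1))
    (continuous_const (y := a.2.2))
  have h2 := continuous_treeTermD ω (F := a.1.2.1) ht hx hy hh (continuous_const (y := a.2.1))
    (continuous_const (y := a.2.2))
  unfold treeFun treeFunD
  constructor <;> fun_prop

variable {E : Type} [NormedAddCommGroup E] [NormedSpace ℂ E]

theorem differentiable_treeFun (a : Σ i, TreeSp ν i) (t : ℝ) {x y : E → Fin ν → ℂ} {h : E → ℂ}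
    (hx : Differentiable ℂ x) (hy : Differentiable ℂ y) (hh : Differentiable ℂ h) :
    Differentiable ℂ (fun z => treeFun ω σ t (x z) (y z) (h z) a) ∧
    Differentiable ℂ (fun z => treeFunD ω σ t (x z) (y z) (h z) a) := by
  have h1 := differentiable_treeTerm ω t a.1.2.1 a.2.1 a.2.2 hx hy hh
  have h2 := differentiable_treeTermD ω t a.1.2.1 a.2.1 a.2.2 hx hy hh
  unfold treeFun treeFunD
  constructor <;> fun_prop

variable {σ}

omit [IsFiniteMeasure ρ] in
theorem aestronglyMeasurable_treeFun (hσ : Measurable σ) (t : ℝ) (x y : Fin ν → ℂ) (h : ℂ) :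
    AEStronglyMeasurable (treeFun ω σ t x y h) (sigmaMeasure (treeMeasure ρ)) ∧
    AEStronglyMeasurable (treeFunD ω σ t x y h) (sigmaMeasure (treeMeasure ρ)) := by
  have hs : ∀ i : TreeIdx, AEStronglyMeasurable (fun a : TreeSp ν i => ∏ j, σ (a.1 j).2)
      (treeMeasure ρ i) := fun i => Measurable.aestronglyMeasurable
    (Finset.measurable_fun_prod _ fun j _ => hσ.comp (by fun_prop))
  have h1 : ∀ i : TreeIdx, AEStronglyMeasurable
      (fun a : TreeSp ν i => treeTerm ω t x y h i.2.1 a.1 a.2) (treeMeasure ρ i) := fun i =>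
    (continuous_treeTerm ω continuous_const continuous_const continuous_const continuous_const
      continuous_fst continuous_snd).aestronglyMeasurable
  have h2 : ∀ i : TreeIdx, AEStronglyMeasurable
      (fun a : TreeSp ν i => treeTermD ω t x y h i.2.1 a.1 a.2) (treeMeasure ρ i) := fun i =>
    (continuous_treeTermD ω continuous_const continuous_const continuous_const continuous_const
      continuous_fst continuous_snd).aestronglyMeasurable
  constructor
  · refine aestronglyMeasurable_sigmaMeasure fun i => ?_
    exact ((h1 i).fun_mul (hs i)).const_mul
      (((-2 : ℂ) ^ i.1 / ((i.1 + 1).factorial : ℂ)) * (t : ℂ) ^ (2 * i.1))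
  · refine aestronglyMeasurable_sigmaMeasure fun i => ?_
    exact (((h1 i).fun_mul (hs i)).const_mul (((-2 : ℂ) ^ i.1 / ((i.1 + 1).factorial : ℂ)) *
        (((2 * i.1 : ℕ) : ℂ) * (t : ℂ) ^ (2 * i.1 - 1)))).fun_add
      (((h2 i).fun_mul (hs i)).const_mul
        (((-2 : ℂ) ^ i.1 / ((i.1 + 1).factorial : ℂ)) * (t : ℂ) ^ (2 * i.1)))

/-- The dominating function. -/
def treeDom (T : ℝ) (a : Σ i, TreeSp ν i) : ℝ :=
  (a.1.1 + 1) * ((2 * T ^ 2) ^ a.1.1 / (a.1.1 + 1).factorial) * treeBound a.1.2.1 a.2.1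

theorem integral_treeMeasure_fst (i : TreeIdx) (f : (Fin (i.1 + 1) → Pt ν) → ℝ) :
    ∫ a, f a.1 ∂treeMeasure ρ i = ∫ c, f c ∂confMeasure ρ (Fin (i.1 + 1)) := by
  have := integral_prod_mul (μ := confMeasure ρ (Fin (i.1 + 1)))
    (ν := volume.restrict (Icc (0 : i.2.1.edgeSet → ℝ) 1)) f (fun _ => (1 : ℝ))
  simp only [mul_one, integral_const, volume_cube_univ, smul_eq_mul] at this
  exact this

variable {ρ}

theorem integrable_treeBound_fst (h : Integrable (fun ξ => Real.exp (5 * ‖ξ‖)) ρ) (i : TreeIdx) :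
    Integrable (fun a : TreeSp ν i => treeBound i.2.1 a.1) (treeMeasure ρ i) :=
  (integrable_treeBound h i.2.2).comp_fst _

/-- The n! from the tree count and the factor n+1 from the derivative are cancelled exactly by
1/(n+1)!, and a geometric series of ratio 2T²M remains. This is the only place where the smallness
of T is used in the estimates. -/
theorem integrable_treeDom (h : Integrable (fun ξ => Real.exp (5 * ‖ξ‖)) ρ) {T : ℝ} 
    (hT : 2 * T ^ 2 * ∫ ξ, Real.exp (5 * ‖ξ‖) ∂ρ < 1) :
    Integrable (treeDom (ν := ν) T) (sigmaMeasure (treeMeasure ρ)) := by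
  set M := ∫ ξ, Real.exp (5 * ‖ξ‖) ∂ρ with hM
  have hM0 : 0 ≤ M := integral_nonneg fun _ => (Real.exp_pos _).le
  have h0 : ∀ n : ℕ, (0 : ℝ) ≤ (n + 1) * ((2 * T ^ 2) ^ n / (n + 1).factorial) := fun n => by
    positivity
  refine integrable_sigmaMeasure (fun i => (integrable_treeBound_fst h i).const_mul
    ((i.1 + 1) * ((2 * T ^ 2) ^ i.1 / (i.1 + 1).factorial))) ?_
  have h1 : ∀ i : TreeIdx, ∫ a : TreeSp ν i, ‖treeDom T ⟨i, a⟩‖ ∂treeMeasure ρ i =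
      (i.1 + 1) * ((2 * T ^ 2) ^ i.1 / (i.1 + 1).factorial) *
        ∫ c, treeBound i.2.1 c ∂confMeasure ρ (Fin (i.1 + 1)) := fun i => by
    rw [← integral_const_mul, ← integral_treeMeasure_fst]
    refine integral_congr_ae (Eventually.of_forall fun a => ?_)
    simp only [treeDom]
    exact Real.norm_of_nonneg (mul_nonneg (h0 _) (treeBound_nonneg _ _))
  have hb : ∀ i : TreeIdx, 0 ≤ ∫ c, treeBound i.2.1 c ∂confMeasure ρ (Fin (i.1 + 1)) := fun i =>
    integral_nonneg fun c => treeBound_nonneg _ c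
  simp only [h1]
  rw [summable_sigma_of_nonneg fun i => mul_nonneg (h0 _) (hb i)]
  refine ⟨fun n => Summable.of_finite, ?_⟩
  refine Summable.of_nonneg_of_le (fun n => tsum_nonneg fun g => mul_nonneg (h0 n) (hb ⟨n, g⟩))
    (fun n => ?_) ((summable_geometric_of_lt_one (by positivity) hT).mul_left (2 * Real.exp 1 * M))
  rw [tsum_fintype]
  have h2 := sum_integral_treeBound_le h n
  have h3 : ∑ g : {g : SimpleGraph (Fin (n + 1)) // g.IsTree},
      ∫ c, treeBound g.1 c ∂confMeasure ρ (Fin (n + 1)) ≤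
      2 * Real.exp 1 * n.factorial * M ^ (n + 1) := by
    refine le_trans (le_of_eq ?_) h2
    exact (Finset.sum_subtype (Finset.univ.filter fun g : SimpleGraph (Fin (n + 1)) => g.IsTree)
      (p := fun g : SimpleGraph (Fin (n + 1)) => g.IsTree) (fun g => by
        simp only [Finset.mem_filter, Finset.mem_univ, true_and])
      fun g => ∫ c, treeBound g c ∂confMeasure ρ (Fin (n + 1))).symm
  refine le_trans (Finset.mul_sum Finset.univ (fun g : {g : SimpleGraph (Fin (n + 1)) // g.IsTree} =>
      ∫ c, treeBound g.1 c ∂confMeasure ρ (Fin (n + 1)))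
    ((n + 1) * ((2 * T ^ 2) ^ n / (n + 1).factorial))).symm.le ?_
  refine (mul_le_mul_of_nonneg_left h3 (h0 n)).trans_eq ?_
  rw [Nat.factorial_succ, mul_pow (2 * T ^ 2) M n]
  push_cast
  field_simp
  ring

theorem norm_prod_density_le {S : Type} [Fintype S] (hσ1 : ∀ ξ, ‖σ ξ‖ ≤ 1) (c : S → Pt ν) :
    ‖∏ j, σ (c j).2‖ ≤ 1 := by
  rw [norm_prod]
  exact Finset.prod_le_one (fun _ _ => norm_nonneg _) fun _ _ => hσ1 _

theorem norm_mul_le_of_norm_le_one {a b : ℂ} (hb : ‖b‖ ≤ 1) : ‖a * b‖ ≤ ‖a‖ := by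
  rw [norm_mul]; exact mul_le_of_le_one_right (norm_nonneg _) hb

theorem ae_treeMeasure (i : TreeIdx) : ∀ᵐ a ∂treeMeasure (ν := ν) ρ i,
    InBox a.1 ∧ ∀ e, a.2 e ∈ Icc (0 : ℝ) 1 := by
  have h1 : ∀ᵐ a ∂treeMeasure (ν := ν) ρ i, InBox a.1 :=
    Measure.quasiMeasurePreserving_fst.ae (ae_inBox ρ)
  have h2 : ∀ᵐ a ∂treeMeasure (ν := ν) ρ i, ∀ e, a.2 e ∈ Icc (0 : ℝ) 1 :=
    Measure.quasiMeasurePreserving_snd.ae ae_cube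
  filter_upwards [h1, h2] with a ha ha' using ⟨ha, ha'⟩

theorem treeWeight_le_treeBound {S : Type} [Fintype S] (F : SimpleGraph S) (c : S → Pt ν) :
    (∏ e ∈ edges F, pairWeight (fun j => ‖(c j).2‖) e) * Real.exp (2 * totalNorm c) ≤
      treeBound F c := by
  refine mul_le_mul_of_nonneg_left ?_
    (Finset.prod_nonneg fun e _ => pairWeight_nonneg (fun _ => norm_nonneg _) e)
  have := totalNorm_nonneg c
  exact le_mul_of_one_le_left (Real.exp_pos _).le (by nlinarith)

variable {ω}

theorem integrable_treeTerm (hω : ∀ υ, 0 < ω υ) (h5 : Integrable (fun ξ => Real.exp (5 * ‖ξ‖)) ρ)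
    {t : ℝ} {x y : Fin ν → ℂ} {h : ℂ} (hh : h = 0 ∨ 0 ≤ t ∧ 0 ≤ h.re) (hx : x ∈ strip ν 2)
    (hy : y ∈ strip ν 2) (i : TreeIdx) :
    Integrable (fun a : TreeSp ν i => treeTerm ω t x y h i.2.1 a.1 a.2) (treeMeasure ρ i) := by
  refine (integrable_treeBound_fst h5 i).mono' (continuous_treeTerm ω continuous_const
    continuous_const continuous_const continuous_const continuous_fst
    continuous_snd).aestronglyMeasurable ?_
  filter_upwards [ae_treeMeasure i] with a ha
  exact (norm_treeTerm_le hω hh hx hy i.2.2 ha.2 ha.1).trans (treeWeight_le_treeBound _ _)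

theorem card_edges_of_isTree {n : ℕ} {g : SimpleGraph (Fin (n + 1))} (hg : g.IsTree) :
    (edges g).card = n := by
  have h1 := hg.card_edgeFinset
  have h2 : edges g = g.edgeFinset := by ext e; simp
  rw [h2]
  simp only [Fintype.card_fin] at h1
  omega

theorem exists_norm_treeFun_le (hω : ∀ υ, 0 < ω υ) (hσ1 : ∀ ξ, ‖σ ξ‖ ≤ 1) {T : ℝ} (hT : 0 < T)
    (R H : ℝ) (hH : 0 ≤ H) :
    ∃ C, 0 ≤ C ∧ ∀ᵐ a ∂sigmaMeasure (treeMeasure (ν := ν) ρ), ∀ {t : ℝ} {x y : Fin ν → ℂ} {h : ℂ},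
    t ∈ Icc (-T) T → (h = 0 ∨ 0 ≤ t ∧ 0 ≤ h.re) → ‖h‖ ≤ H → x ∈ strip ν 2 → y ∈ strip ν 2 →
    ‖x‖ ≤ R → ‖y‖ ≤ R →
    ‖treeFun ω σ t x y h a‖ ≤ C * treeDom T a ∧ ‖treeFunD ω σ t x y h a‖ ≤ C * treeDom T a := by
  obtain ⟨C, hC, hD⟩ := exists_norm_treeTermD_le hω T R H hT.le hH
  -- The three parts are for the function itself, for the derivative of the power t^{2n}, and for
  -- the derivative of the tree term.
  refine ⟨1 + 2 / T + C, by positivity, ?_⟩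
  rw [ae_sigmaMeasure]
  intro i
  filter_upwards [ae_treeMeasure i] with a ha t x y h ht hh hhH hx hy hxR hyR
  have h1 := norm_treeTerm_le hω hh hx hy i.2.2 ha.2 ha.1
  have h2 := hD ht hh hhH hx hy hxR hyR i.2.2 ha.2 ha.1
  rw [card_edges_of_isTree i.2.2] at h2
  have h3 := h1.trans (treeWeight_le_treeBound _ _)
  change _ ≤ C * (i.1 + 1) * treeBound i.2.1 a.1 at h2
  have hB := treeBound_nonneg i.2.1 a.1
  set B := treeBound i.2.1 a.1 with hBdef
  have hσp := norm_prod_density_le hσ1 a.1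
  have htT : |t| ≤ T := abs_le.2 ht
  have hcoef : ‖(-2 : ℂ) ^ i.1 / ((i.1 + 1).factorial : ℂ)‖ = 2 ^ i.1 / (i.1 + 1).factorial := by
    simp
  have hn : (0 : ℝ) ≤ i.1 := Nat.cast_nonneg _
  set D := (2 * T ^ 2) ^ i.1 / ((i.1 + 1).factorial : ℝ) with hDdef
  have hD0 : 0 ≤ D := by positivity
  have hDe : 2 ^ i.1 / ((i.1 + 1).factorial : ℝ) * T ^ (2 * i.1) = D := by
    rw [hDdef, mul_pow, pow_mul]; ring
  have htp : ‖(t : ℂ) ^ (2 * i.1)‖ ≤ T ^ (2 * i.1) := by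
    rw [norm_pow, Complex.norm_real]
    exact pow_le_pow_left₀ (abs_nonneg _) htT _
  have htp' : ‖((2 * i.1 : ℕ) : ℂ) * (t : ℂ) ^ (2 * i.1 - 1)‖ ≤ 2 * i.1 * (T ^ (2 * i.1) / T) := by
    rw [norm_mul, norm_pow, Complex.norm_real, Complex.norm_natCast]
    push_cast
    rcases Nat.eq_zero_or_pos i.1 with h0 | h0
    · simp [h0]
    refine mul_le_mul_of_nonneg_left ?_ (by positivity)
    rw [le_div_iff₀ hT]
    calc |t| ^ (2 * i.1 - 1) * T ≤ T ^ (2 * i.1 - 1) * T :=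
          mul_le_mul_of_nonneg_right (pow_le_pow_left₀ (abs_nonneg _) htT _) hT.le
      _ = T ^ (2 * i.1) := by rw [← pow_succ]; congr 1; omega
  have e1 : ‖treeFun ω σ t x y h ⟨i, a⟩‖ ≤ D * B := by
    rw [treeFun, norm_mul, norm_mul, hcoef, ← hDe]
    exact mul_le_mul (mul_le_mul_of_nonneg_left htp (by positivity))
      ((norm_mul_le_of_norm_le_one hσp).trans h3) (norm_nonneg _) (by positivity)
  have e2 : ‖treeFunD ω σ t x y h ⟨i, a⟩‖ ≤ D * (2 * i.1 / T) * B + D * (C * (i.1 + 1) * B) := by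
    rw [treeFunD]
    refine (norm_add_le _ _).trans (add_le_add ?_ ?_)
    · rw [norm_mul, norm_mul, hcoef]
      refine (mul_le_mul (mul_le_mul_of_nonneg_left htp' (by positivity))
        ((norm_mul_le_of_norm_le_one hσp).trans h3) (norm_nonneg _) (by positivity)).trans_eq ?_
      rw [← hDe]; ring
    · rw [norm_mul, norm_mul, hcoef, ← hDe]
      exact mul_le_mul (mul_le_mul_of_nonneg_left htp (by positivity))
        ((norm_mul_le_of_norm_le_one hσp).trans h2) (norm_nonneg _) (by positivity)
  have hdom : treeDom T ⟨i, a⟩ = (i.1 + 1) * D * B := rfl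
  have hDB : 0 ≤ D * B := mul_nonneg hD0 hB
  have hT2 : 0 ≤ 2 / T := by positivity
  rw [hdom]
  constructor
  · refine e1.trans ?_
    have : D * B ≤ (1 + 2 / T + C) * (i.1 + 1) * (D * B) := by
      refine le_mul_of_one_le_left hDB ?_
      nlinarith [mul_nonneg hT2 hn, mul_nonneg hC hn]
    linarith
  · refine e2.trans ?_
    have : D * (2 * i.1 / T) * B + D * (C * (i.1 + 1) * B) =
      (2 / T * i.1 + C * (i.1 + 1)) * (D * B) := by ring
    rw [this]
    have h6 : (2 / T * i.1 + C * (i.1 + 1)) ≤ (1 + 2 / T + C) * (i.1 + 1) := by nlinarith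
    nlinarith [mul_le_mul_of_nonneg_right h6 hDB]

end TreeFamily

/-! ### From ordered times with iterated integrals to symmetric configurations -/

section Simplex

open scoped Classical

variable {ν : ℕ}

/-- The configuration with times `s` and frequencies `ξ`. -/
def conf {S : Type} (s : S → ℝ) (ξ : S → EuclideanSpace ℝ (Fin ν)) : S → Pt ν :=
  fun j => (s j, ξ j)

theorem measurePreserving_conf (ρ : Measure (EuclideanSpace ℝ (Fin ν))) [IsFiniteMeasure ρ]
    (S : Type) [Fintype S] :
    MeasurePreserving (fun p : (S → ℝ) × (S → EuclideanSpace ℝ (Fin ν)) => conf p.1 p.2)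
      ((volume.restrict (Icc 0 1)).prod (Measure.pi fun _ => ρ)) (confMeasure ρ S) := by
  have h := (measurePreserving_arrowProdEquivProdArrow ℝ (EuclideanSpace ℝ (Fin ν)) S
    (fun _ => (volume : Measure ℝ).restrict (Icc 0 1)) (fun _ => ρ)).symm
  have h1 : (Measure.pi fun _ : S => (volume : Measure ℝ).restrict (Icc 0 1)) =
      volume.restrict (Icc 0 1) := by
    rw [← Measure.restrict_pi_pi, volume_pi, ← pi_univ_Icc]; rfl
  rw [h1] at h
  exact h

theorem integral_confMeasure_comp_equiv (ρ : Measure (EuclideanSpace ℝ (Fin ν))) [IsFiniteMeasure ρ]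
    {S : Type} [Fintype S] (π : Equiv.Perm S) (f : (S → EuclideanSpace ℝ (Fin ν)) → ℂ) :
    ∫ ξ, f (ξ ∘ π) ∂(Measure.pi fun _ => ρ) = ∫ ξ, f ξ ∂(Measure.pi fun _ => ρ) := by
  have h := (measurePreserving_piCongrLeft (fun _ : S => ρ) π).symm
  exact h.integral_comp (MeasurableEquiv.measurableEmbedding _) f

/-- A single tree is not invariant under relabelling the vertices, but the sum over all trees is;
therefore the symmetry hypothesis concerns the sum. The integral over the ordered simplex then
becomes 1/m! times the integral over the cube. The density weight is symmetric as well. -/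
theorem sum_setIntegral_simplex_iterIntegral
    {μ : ComplexMeasure (EuclideanSpace ℝ (Fin ν))}
    [IsFiniteMeasure (VectorMeasure.variation μ)] {σ : EuclideanSpace ℝ (Fin ν) → ℂ}
    (hσ : Measurable σ) (hσ1 : ∀ x, ‖σ x‖ ≤ 1)
    (h : ∀ f : EuclideanSpace ℝ (Fin ν) → ℂ, Integrable f (VectorMeasure.variation μ) →
        cintegral μ f = ∫ x, f x * σ x ∂(VectorMeasure.variation μ))
    {m : ℕ} {Γ : Type} (𝒢 : Finset Γ) (f : Γ → (Fin m → Pt ν) → ℂ)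
    (hf : ∀ g ∈ 𝒢, Integrable (f g) (confMeasure (VectorMeasure.variation μ) (Fin m)))
    (hsymm : ∀ (π : Equiv.Perm (Fin m)) c, ∑ g ∈ 𝒢, f g (c ∘ π) = ∑ g ∈ 𝒢, f g c) :
    ∑ g ∈ 𝒢, ∫ s in simplex m, iterIntegral μ m (fun ξ => f g (conf s ξ)) =
      (m.factorial : ℂ)⁻¹ * ∫ c, (∑ g ∈ 𝒢, f g c) * ∏ j, σ (c j).2
        ∂confMeasure (VectorMeasure.variation μ) (Fin m) := by
  set ρ := VectorMeasure.variation μ with hρ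
  have hmp := measurePreserving_conf ρ (Fin m)
  have hσm : Measurable fun ξ : Fin m → EuclideanSpace ℝ (Fin ν) => ∏ j, σ (ξ j) :=
    Finset.measurable_fun_prod _ fun j _ => hσ.comp (measurable_pi_apply j)
  have hσn : ∀ ξ : Fin m → EuclideanSpace ℝ (Fin ν), ‖∏ j, σ (ξ j)‖ ≤ 1 := fun ξ => by
    rw [norm_prod]
    exact Finset.prod_le_one (fun _ _ => norm_nonneg _) fun _ _ => hσ1 _
  have h1 : ∀ g ∈ 𝒢, Integrable (fun p : (Fin m → ℝ) × (Fin m → EuclideanSpace ℝ (Fin ν)) =>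
      f g (conf p.1 p.2)) ((volume.restrict (Icc 0 1)).prod (Measure.pi fun _ => ρ)) :=
    fun g hg => hmp.integrable_comp_of_integrable (hf g hg)
  have h2 : ∀ g ∈ 𝒢, Integrable (fun p : (Fin m → ℝ) × (Fin m → EuclideanSpace ℝ (Fin ν)) =>
      f g (conf p.1 p.2) * ∏ j, σ (p.2 j))
      ((volume.restrict (Icc 0 1)).prod (Measure.pi fun _ => ρ)) := fun g hg =>
    (h1 g hg).mul_bdd (c := 1) (hσm.comp measurable_snd).aestronglyMeasurable
      (Eventually.of_forall fun p => hσn p.2)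
  have hsub : simplex m ⊆ Icc (0 : Fin m → ℝ) 1 := fun s hs =>
    ⟨fun j => (hs.2 j).1.le, fun j => (hs.2 j).2.le⟩
  have h3 : ∀ g ∈ 𝒢, IntegrableOn (fun s => ∫ ξ, f g (conf s ξ) * ∏ j, σ (ξ j)
      ∂(Measure.pi fun _ => ρ)) (Icc 0 1) := fun g hg => (h2 g hg).integral_prod_left
  have h4 : ∀ g ∈ 𝒢, ∀ᵐ s ∂volume.restrict (Icc (0 : Fin m → ℝ) 1),
      iterIntegral μ m (fun ξ => f g (conf s ξ)) =
        ∫ ξ, f g (conf s ξ) * ∏ j, σ (ξ j) ∂(Measure.pi fun _ => ρ) := fun g hg => by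
    filter_upwards [(h1 g hg).prod_right_ae] with s hs
    exact iterIntegral_eq_integral hσ hσ1 h m _ hs
  have h5 : ∀ᵐ s ∂volume.restrict (Icc (0 : Fin m → ℝ) 1),
      ∑ g ∈ 𝒢, ∫ ξ, f g (conf s ξ) * ∏ j, σ (ξ j) ∂(Measure.pi fun _ => ρ) =
        ∫ ξ, (∑ g ∈ 𝒢, f g (conf s ξ)) * ∏ j, σ (ξ j) ∂(Measure.pi fun _ => ρ) := by
    have : ∀ᵐ s ∂volume.restrict (Icc (0 : Fin m → ℝ) 1), ∀ g ∈ 𝒢, Integrable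
        (fun ξ => f g (conf s ξ) * ∏ j, σ (ξ j)) (Measure.pi fun _ => ρ) := by
      rw [Finset.eventually_all]
      exact fun g hg => (h2 g hg).prod_right_ae
    filter_upwards [this] with s hs
    rw [← integral_finsetSum _ hs]
    simp only [Finset.sum_mul]
  set G : (Fin m → ℝ) → ℂ := fun s =>
    ∫ ξ, (∑ g ∈ 𝒢, f g (conf s ξ)) * ∏ j, σ (ξ j) ∂(Measure.pi fun _ => ρ) with hG
  have hGs : ∀ (π : Equiv.Perm (Fin m)) s, G (s ∘ π) = G s := fun π s => by
    rw [hG]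
    simp only
    rw [← integral_confMeasure_comp_equiv ρ π]
    refine integral_congr_ae (Eventually.of_forall fun ξ => ?_)
    simp only
    have e1 : ∏ j, σ ((ξ ∘ π) j) = ∏ j, σ (ξ j) := Equiv.prod_comp π fun j => σ (ξ j)
    rw [e1, ← hsymm π (conf s ξ)]
    rfl
  have hGi : IntegrableOn G (Icc 0 1) := (integrable_finsetSum 𝒢 h3).congr h5
  have e1 : ∑ g ∈ 𝒢, ∫ s in simplex m, iterIntegral μ m (fun ξ => f g (conf s ξ)) =
      ∫ s in simplex m, G s := by
    rw [← integral_congr_ae (ae_restrict_of_ae_restrict_of_subset hsub h5),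
      integral_finsetSum _ fun g hg => (h3 g hg).mono_set hsub]
    exact Finset.sum_congr rfl fun g hg =>
      integral_congr_ae (ae_restrict_of_ae_restrict_of_subset hsub (h4 g hg))
  have e2 : ∫ c, (∑ g ∈ 𝒢, f g c) * ∏ j, σ (c j).2 ∂confMeasure ρ (Fin m) =
      ∫ s in Icc (0 : Fin m → ℝ) 1, G s := by
    have hI : Integrable (fun p : (Fin m → ℝ) × (Fin m → EuclideanSpace ℝ (Fin ν)) =>
        (∑ g ∈ 𝒢, f g (conf p.1 p.2)) * ∏ j, σ (p.2 j))
        ((volume.restrict (Icc 0 1)).prod (Measure.pi fun _ => ρ)) := by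
      simp only [Finset.sum_mul]
      exact integrable_finsetSum _ h2
    rw [hG, ← integral_prod _ hI]
    exact (hmp.integral_comp
      (MeasurableEquiv.measurableEmbedding (MeasurableEquiv.arrowProdEquivProdArrow ℝ
        (EuclideanSpace ℝ (Fin ν)) (Fin m)).symm)
      (fun c => (∑ g ∈ 𝒢, f g c) * ∏ j, σ (c j).2)).symm
  rw [e1, e2, setIntegral_cube_eq_factorial_mul m hGs hGi, ← mul_assoc, inv_mul_cancel₀, one_mul]
  exact_mod_cast m.factorial_ne_zero

end Simplex

/-! ### Identification of the integrands of φ and w with tree terms -/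

section Identification

open scoped Classical

variable {ν : ℕ} (ω : Fin ν → ℝ)

/-- The contribution of the diagonal and of the linear form. -/
def diagExp {S : Type} [Fintype S] (t : ℝ) (x y : Fin ν → ℂ) (h : ℂ) (c : S → Pt ν) : ℂ :=
  Complex.exp (-h * ((∑ j, t * kern ω t (c j) (c j) : ℝ) : ℂ) + Complex.I * linForm ω t x y c)

/-- The sum of the contributions of the trees. -/
def treeTotal {S : Type} [Fintype S] (t : ℝ) (x y : Fin ν → ℂ) (h : ℂ) (c : S → Pt ν) : ℂ :=
  diagExp ω t x y h c * treeSum S (fun p => (kernE ω t c p : ℂ))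
    (fun p => 2 * h * t * (kernE ω t c p : ℂ))

theorem sum_integral_treeTerm {S : Type} [Fintype S] (t : ℝ) (x y : Fin ν → ℂ) (h : ℂ)
    (c : S → Pt ν) :
    ∑ F : SimpleGraph S with F.IsTree,
      ∫ θ in Icc (0 : F.edgeSet → ℝ) 1, treeTerm ω t x y h F c θ = treeTotal ω t x y h c := by
  rw [treeTotal, treeSum, Finset.mul_sum]
  refine Finset.sum_congr rfl fun F hF => ?_
  rw [← mul_assoc, mul_comm (diagExp ω t x y h c), mul_assoc, forestInt, ← integral_const_mul,
    ← integral_const_mul]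
  refine integral_congr_ae (Eventually.of_forall fun θ => ?_)
  simp only [treeTerm, diagExp]
  rw [← Complex.exp_add, connPairs_of_isTree (Finset.mem_filter.1 hF).2]
  congr 2
  simp only [quadForm, Complex.real_smul]
  push_cast
  have : ∑ p ∈ offPairs S, (pairMin F θ p : ℂ) * (2 * h * t * (kernE ω t c p : ℂ)) =
      2 * h * ∑ p ∈ offPairs S, (pairMin F θ p : ℂ) * (t * (kernE ω t c p : ℂ)) := by
    rw [Finset.mul_sum]
    exact Finset.sum_congr rfl fun p _ => by ring
  rw [this]
  ring

theorem sum_integral_treeTerm_fin {m : ℕ} (t : ℝ) (x y : Fin ν → ℂ) (h : ℂ) (c : Fin m → Pt ν) :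
    ∑ F : SimpleGraph (Fin m) with F.IsTree,
      ∫ θ in Icc (0 : F.edgeSet → ℝ) 1, treeTerm ω t x y h F c θ = treeTotal ω t x y h c := by
  convert sum_integral_treeTerm ω t x y h c

theorem kernE_comp {S S' : Type} (t : ℝ) (c : S → Pt ν) (e : S' → S) (p : Sym2 S') :
    kernE ω t (c ∘ e) p = kernE ω t c (Sym2.map e p) := by
  induction p with | _ j k => rfl

theorem linForm_comp {S S' : Type} [Fintype S] [Fintype S'] (t : ℝ) (x y : Fin ν → ℂ)
    (c : S → Pt ν) (e : S' ≃ S) : linForm ω t x y (c ∘ e) = linForm ω t x y c :=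
  Equiv.sum_comp e fun j => path ω t x y (c j)

theorem diagExp_comp {S S' : Type} [Fintype S] [Fintype S'] (t : ℝ) (x y : Fin ν → ℂ) (h : ℂ)
    (c : S → Pt ν) (e : S' ≃ S) : diagExp ω t x y h (c ∘ e) = diagExp ω t x y h c := by
  have h1 : ∑ j, t * kern ω t ((c ∘ e) j) ((c ∘ e) j) = ∑ j, t * kern ω t (c j) (c j) :=
    Equiv.sum_comp e fun j => t * kern ω t (c j) (c j)
  rw [diagExp, diagExp, linForm_comp, h1]

theorem treeTotal_comp {S S' : Type} [Fintype S] [Fintype S'] (t : ℝ) (x y : Fin ν → ℂ) (h : ℂ)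
    (c : S → Pt ν) (e : S' ≃ S) : treeTotal ω t x y h (c ∘ e) = treeTotal ω t x y h c := by
  rw [treeTotal, treeTotal, diagExp_comp, treeSum_equiv e]
  congr 2 <;> ext p <;> simp [kernE_comp]

variable {m : ℕ} {s : Fin m → ℝ} (ξ : Fin m → EuclideanSpace ℝ (Fin ν))

theorem pairing_eq_kern (hs : Monotone s) (t : ℝ) {j k : Fin m} (hjk : j ≤ k) :
    pairing ω t s ξ j k = kern ω t (conf s ξ j) (conf s ξ k) := by
  simp only [pairing, kern, conf, min_eq_left (hs hjk), max_eq_right (hs hjk)]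

theorem treeProduct_eq (hs : Monotone s) (t : ℝ) (g : SimpleGraph (Fin m)) :
    (treeProduct ω t g s ξ : ℂ) = ∏ e ∈ edges g, (kernE ω t (conf s ξ) e : ℂ) := by
  rw [prod_edges_fin, treeProduct]
  push_cast
  refine Finset.prod_congr rfl fun p hp => ?_
  rw [pairing_eq_kern ω ξ hs t (Finset.mem_filter.1 hp).2.1.le]
  rfl

theorem treeForm_eq (hs : Monotone s) (t : ℝ) (g : SimpleGraph (Fin m)) (θ : g.edgeSet → ℝ) :
    treeForm ω t g θ s ξ = quadForm ω t g θ (conf s ξ) := by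
  rw [treeForm, quadForm, sum_offPairs_fin]
  congr 1
  · exact Finset.sum_congr rfl fun j _ => by rw [pairing_eq_kern ω ξ hs t le_rfl]
  · congr 1
    refine Finset.sum_congr rfl fun p hp => ?_
    rw [pairing_eq_kern ω ξ hs t (Finset.mem_filter.1 hp).2.le]
    rfl

/-- At h = 0 the tree term does not depend on θ, and the cube has volume one; a θ-integration can
thus be inserted to treat φ and w alike. -/
theorem treeProduct_mul_exp_eq (hs : Monotone s) (t : ℝ) (x y : Fin ν → ℂ)
    (g : SimpleGraph (Fin m)) :
    (treeProduct ω t g s ξ : ℂ) * Complex.exp (Complex.I * qDot ω t x y s ξ) =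
      ∫ θ in Icc (0 : g.edgeSet → ℝ) 1, treeTerm ω t x y 0 g (conf s ξ) θ := by
  simp only [treeTerm, neg_zero, zero_mul, zero_add]
  rw [integral_const, measureReal_restrict_apply_univ, treeProduct_eq ω ξ hs]
  have : volume.real (Icc (0 : g.edgeSet → ℝ) 1) = 1 := by
    simp [Measure.real, Real.volume_Icc_pi]
  rw [this, one_smul]
  rfl

theorem integral_mul_exp_neg {h : ℂ} (hh : h ≠ 0) (Ω : ℂ) :
    ∫ ϑ in Icc (0 : ℝ) 1, Ω * Complex.exp (-h * ϑ * Ω) = h⁻¹ * (1 - Complex.exp (-h * Ω)) := by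
  rw [integral_Icc_eq_integral_Ioc, ← intervalIntegral.integral_of_le zero_le_one]
  have hd : ∀ ϑ : ℝ, HasDerivAt (fun ϑ : ℝ => -h⁻¹ * Complex.exp (-h * ϑ * Ω))
      (Ω * Complex.exp (-h * ϑ * Ω)) ϑ := fun ϑ => by
    have h1 : HasDerivAt (fun ϑ : ℝ => -h * (ϑ : ℂ) * Ω) (-h * 1 * Ω) ϑ :=
      (((hasDerivAt_id (ϑ : ℂ)).comp_ofReal).const_mul (-h)).mul_const Ω
    have h2 := h1.cexp.const_mul (-h⁻¹)
    have e : -h⁻¹ * (Complex.exp (-h * ϑ * Ω) * (-h * 1 * Ω)) =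
        Ω * Complex.exp (-h * ϑ * Ω) := by
      linear_combination (Complex.exp (-h * ϑ * Ω) * Ω) * inv_mul_cancel₀ hh
    rwa [e] at h2
  rw [intervalIntegral.integral_eq_sub_of_hasDerivAt (fun ϑ _ => hd ϑ)
    ((by fun_prop : Continuous fun ϑ : ℝ => Ω * Complex.exp (-h * ϑ * Ω)).intervalIntegrable _ _)]
  simp
  ring

/-- Integrating Ω e^{-hϑΩ} over ϑ in [0,1] gives (1 - e^{-hΩ})/h. The extra variable in w thus only
expresses the difference of the tree terms at 0 and at h. -/
theorem wTerm_integrand_eq (hs : Monotone s) (t : ℝ) (x y : Fin ν → ℂ) {h : ℂ} (hh : h ≠ 0)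
    (g : SimpleGraph (Fin m)) (θ : g.edgeSet → ℝ) :
    ∫ ϑ in Icc (0 : ℝ) 1, (treeProduct ω t g s ξ : ℂ) * (treeForm ω t g θ s ξ : ℂ) *
          Complex.exp (-h * ϑ * (treeForm ω t g θ s ξ : ℂ)) *
            Complex.exp (Complex.I * qDot ω t x y s ξ) =
      h⁻¹ * (treeTerm ω t x y 0 g (conf s ξ) θ - treeTerm ω t x y h g (conf s ξ) θ) := by
  have h1 : ∀ ϑ : ℝ, (treeProduct ω t g s ξ : ℂ) * (treeForm ω t g θ s ξ : ℂ) *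
          Complex.exp (-h * ϑ * (treeForm ω t g θ s ξ : ℂ)) *
            Complex.exp (Complex.I * qDot ω t x y s ξ) =
      (treeProduct ω t g s ξ : ℂ) * Complex.exp (Complex.I * qDot ω t x y s ξ) *
        ((treeForm ω t g θ s ξ : ℂ) * Complex.exp (-h * ϑ * (treeForm ω t g θ s ξ : ℂ))) :=
    fun ϑ => by ring
  simp only [h1]
  rw [integral_const_mul, integral_mul_exp_neg hh, treeProduct_eq ω ξ hs, treeForm_eq ω ξ hs]
  simp only [treeTerm, neg_zero, zero_mul, zero_add, Complex.exp_add]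
  change _ * Complex.exp (Complex.I * linForm ω t x y (conf s ξ)) * _ = _
  ring

end Identification

/-! ### The terms of φ and w as parts of the tree expansion -/

section Series

open scoped Classical

variable {ν : ℕ} {ω : Fin ν → ℝ} {μ : ComplexMeasure (EuclideanSpace ℝ (Fin ν))}
  {σ : EuclideanSpace ℝ (Fin ν) → ℂ}

/-- A density of `μ` with respect to its variation. -/
structure IsDensity (μ : ComplexMeasure (EuclideanSpace ℝ (Fin ν)))
    (σ : EuclideanSpace ℝ (Fin ν) → ℂ) : Prop where
  measurable : Measurable σ
  norm_le : ∀ x, ‖σ x‖ ≤ 1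
  cintegral_eq : ∀ f : EuclideanSpace ℝ (Fin ν) → ℂ, Integrable f (VectorMeasure.variation μ) →
    cintegral μ f = ∫ x, f x * σ x ∂(VectorMeasure.variation μ)

/-- The `n`-th term of the expansion. -/
def treePart (ω : Fin ν → ℝ) (ρ : Measure (EuclideanSpace ℝ (Fin ν)))
    (σ : EuclideanSpace ℝ (Fin ν) → ℂ) (t : ℝ) (x y : Fin ν → ℂ) (h : ℂ) (n : ℕ) : ℂ :=
  ((-2 : ℂ) ^ n / ((n + 1).factorial : ℂ)) * (t : ℂ) ^ (2 * n) *
    ∫ c, treeTotal ω t x y h c * ∏ j, σ (c j).2 ∂confMeasure ρ (Fin (n + 1))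

theorem integrable_integral_treeTerm {ρ : Measure (EuclideanSpace ℝ (Fin ν))} [IsFiniteMeasure ρ]
    (hω : ∀ υ, 0 < ω υ) (h5 : Integrable (fun ξ => Real.exp (5 * ‖ξ‖)) ρ)
    {t : ℝ} {x y : Fin ν → ℂ} {h : ℂ} (hh : h = 0 ∨ 0 ≤ t ∧ 0 ≤ h.re) (hx : x ∈ strip ν 2)
    (hy : y ∈ strip ν 2) {n : ℕ} {g : SimpleGraph (Fin (n + 1))} (hg : g.IsTree) :
    Integrable (fun c => ∫ θ in Icc (0 : g.edgeSet → ℝ) 1, treeTerm ω t x y h g c θ)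
      (confMeasure ρ (Fin (n + 1))) := by
  have h1 := (integrable_treeTerm hω h5 hh hx hy ⟨n, g, hg⟩).integral_prod_left
  exact h1

variable [IsFiniteMeasure (VectorMeasure.variation μ)]

theorem phiTerm_eq (hσ : IsDensity μ σ) (hω : ∀ υ, 0 < ω υ)
    (h5 : Integrable (fun ξ => Real.exp (5 * ‖ξ‖)) (VectorMeasure.variation μ))
    {t : ℝ} {x y : Fin ν → ℂ} (hx : x ∈ strip ν 2) (hy : y ∈ strip ν 2) (n : ℕ) :
    phiTerm ω μ t x y n = treePart ω (VectorMeasure.variation μ) σ t x y 0 n := by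
  have h1 := sum_setIntegral_simplex_iterIntegral hσ.measurable hσ.norm_le hσ.cintegral_eq
    (m := n + 1) (Finset.univ.filter fun g : SimpleGraph (Fin (n + 1)) => g.IsTree)
    (fun g c => ∫ θ in Icc (0 : g.edgeSet → ℝ) 1, treeTerm ω t x y 0 g c θ)
    (fun g hg => integrable_integral_treeTerm hω h5 (Or.inl rfl) hx hy (Finset.mem_filter.1 hg).2)
    (fun π c => by simp only [sum_integral_treeTerm_fin, treeTotal_comp])
  simp only [sum_integral_treeTerm_fin] at h1
  rw [phiTerm, Q, treePart, Nat.add_sub_cancel]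
  have h2 : ∀ g : SimpleGraph (Fin (n + 1)), ∫ s in simplex (n + 1), iterIntegral μ (n + 1)
      (fun ξ => (treeProduct ω t g s ξ : ℂ) * Complex.exp (Complex.I * qDot ω t x y s ξ)) =
      ∫ s in simplex (n + 1), iterIntegral μ (n + 1)
        (fun ξ => ∫ θ in Icc (0 : g.edgeSet → ℝ) 1, treeTerm ω t x y 0 g (conf s ξ) θ) := fun g => by
    refine setIntegral_congr_fun (measurableSet_simplex _) fun s hs => ?_
    congr 1
    funext ξ
    exact treeProduct_mul_exp_eq ω ξ hs.1.monotone t x y g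
  have h3 := (Finset.sum_congr rfl fun g _ => h2 g).trans h1
  rw [h3]
  ring

/-- With m = n+1 the prefactor 2^{m-1}(-1)^m t^{2m-1} equals -t (-2)^n t^{2n}. The minus sign
reverses the difference coming from the ϑ-integral, and t combines with 1/h. -/
theorem wTerm_eq (hσ : IsDensity μ σ) (hω : ∀ υ, 0 < ω υ)
    (h5 : Integrable (fun ξ => Real.exp (5 * ‖ξ‖)) (VectorMeasure.variation μ))
    {t : ℝ} (ht : 0 ≤ t) {x y : Fin ν → ℂ} (hx : x ∈ strip ν 2) (hy : y ∈ strip ν 2) {h : ℂ}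
    (hh : h ∈ rightHalfPlane) (n : ℕ) :
    wTerm ω μ (n + 1) t x y h = t / h * (treePart ω (VectorMeasure.variation μ) σ t x y h n -
      treePart ω (VectorMeasure.variation μ) σ t x y 0 n) := by
  have hh' : 0 < h.re := hh
  have hh0 : h ≠ 0 := fun h0 => by simp [h0] at hh'
  set ρ := VectorMeasure.variation μ with hρ
  have hi : ∀ k : ℂ, k = 0 ∨ 0 ≤ t ∧ 0 ≤ k.re → ∀ g : SimpleGraph (Fin (n + 1)), g.IsTree →
      Integrable (fun c => ∫ θ in Icc (0 : g.edgeSet → ℝ) 1, treeTerm ω t x y k g c θ)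
      (confMeasure ρ (Fin (n + 1))) := fun k hk g hg =>
    integrable_integral_treeTerm hω h5 hk hx hy hg
  have hc : h = 0 ∨ 0 ≤ t ∧ 0 ≤ h.re := Or.inr ⟨ht, hh'.le⟩
  have hs : ∀ k : ℂ, k = 0 ∨ 0 ≤ t ∧ 0 ≤ k.re →
      Integrable (fun c => treeTotal ω t x y k c * ∏ j, σ (c j).2) (confMeasure ρ (Fin (n + 1))) :=
    fun k hk => by
      refine Integrable.mul_bdd (c := 1) ?_ (Finset.measurable_fun_prod _ fun j _ =>
        hσ.measurable.comp (by fun_prop)).aestronglyMeasurable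
        (Eventually.of_forall fun c => norm_prod_density_le hσ.norm_le c)
      exact (integrable_finsetSum _ fun g hg => hi k hk g (Finset.mem_filter.1 hg).2).congr
        (Eventually.of_forall fun c => sum_integral_treeTerm_fin ω t x y k c)
  have h1 := sum_setIntegral_simplex_iterIntegral hσ.measurable hσ.norm_le hσ.cintegral_eq
    (m := n + 1) (Finset.univ.filter fun g : SimpleGraph (Fin (n + 1)) => g.IsTree)
    (fun g c => h⁻¹ * ((∫ θ in Icc (0 : g.edgeSet → ℝ) 1, treeTerm ω t x y 0 g c θ) -
      ∫ θ in Icc (0 : g.edgeSet → ℝ) 1, treeTerm ω t x y h g c θ))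
    (fun g hg => ((hi 0 (Or.inl rfl) g (Finset.mem_filter.1 hg).2).sub
      (hi h hc g (Finset.mem_filter.1 hg).2)).const_mul _)
    (fun π c => by simp only [← Finset.mul_sum, Finset.sum_sub_distrib, sum_integral_treeTerm_fin,
      treeTotal_comp])
  simp only [← Finset.mul_sum, Finset.sum_sub_distrib, sum_integral_treeTerm_fin] at h1
  have h2 : ∀ g : SimpleGraph (Fin (n + 1)), ∫ s in simplex (n + 1), iterIntegral μ (n + 1)
      (fun ξ => ∫ θ in Icc (0 : g.edgeSet → ℝ) 1, ∫ ϑ in Icc (0 : ℝ) 1,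
        (treeProduct ω t g s ξ : ℂ) * (treeForm ω t g θ s ξ : ℂ) *
          Complex.exp (-h * ϑ * (treeForm ω t g θ s ξ : ℂ)) *
            Complex.exp (Complex.I * qDot ω t x y s ξ)) =
      ∫ s in simplex (n + 1), iterIntegral μ (n + 1) (fun ξ =>
        h⁻¹ * ((∫ θ in Icc (0 : g.edgeSet → ℝ) 1, treeTerm ω t x y 0 g (conf s ξ) θ) -
          ∫ θ in Icc (0 : g.edgeSet → ℝ) 1, treeTerm ω t x y h g (conf s ξ) θ)) := fun g => by
    refine setIntegral_congr_fun (measurableSet_simplex _) fun s hs => ?_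
    congr 1
    funext ξ
    simp only [wTerm_integrand_eq ω ξ hs.1.monotone t x y hh0 g]
    have hθ : ∀ k, IntegrableOn (fun θ => treeTerm ω t x y k g (conf s ξ) θ)
        (Icc (0 : g.edgeSet → ℝ) 1) := fun k =>
      (continuous_treeTerm ω continuous_const continuous_const continuous_const continuous_const
        continuous_const continuous_id).continuousOn.integrableOn_compact isCompact_Icc
    rw [integral_const_mul, integral_sub (hθ 0) (hθ h)]
  have h3 := (Finset.sum_congr rfl fun g _ => h2 g).trans h1
  rw [wTerm]
  refine (congrArg (fun z => 2 ^ (n + 1 - 1) * (-1) ^ (n + 1) * (t : ℂ) ^ (2 * (n + 1) - 1) * z)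
    h3).trans ?_
  · have h4 : ∫ c, h⁻¹ * (treeTotal ω t x y 0 c - treeTotal ω t x y h c) * ∏ j, σ (c j).2
        ∂confMeasure ρ (Fin (n + 1)) = h⁻¹ *
        ((∫ c, treeTotal ω t x y 0 c * ∏ j, σ (c j).2 ∂confMeasure ρ (Fin (n + 1))) -
          ∫ c, treeTotal ω t x y h c * ∏ j, σ (c j).2 ∂confMeasure ρ (Fin (n + 1))) := by
      rw [← integral_sub (hs 0 (Or.inl rfl)) (hs h hc), ← integral_const_mul]
      exact integral_congr_ae (Eventually.of_forall fun c => by simp only; ring)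
    rw [h4, treePart, treePart]
    have e1 : 2 * (n + 1) - 1 = 2 * n + 1 := by omega
    have e2 : (-2 : ℂ) ^ n = (-1) ^ n * 2 ^ n := by rw [← mul_pow]; norm_num
    rw [e1, Nat.add_sub_cancel, e2, pow_succ, pow_succ, div_eq_mul_inv, div_eq_mul_inv]
    ring

end Series

/-! ### Openness of the domains, and replacing a function by an equal one -/

theorem isOpen_strip (ν : ℕ) (R : ℝ) : IsOpen (strip ν R) := by
  refine isOpen_lt ?_ continuous_const
  have h : Continuous fun z : Fin ν → ℂ => (fun υ => (z υ).im : Fin ν → ℝ) :=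
    continuous_pi fun υ => Complex.continuous_im.comp (continuous_apply υ)
  exact ((PiLp.continuous_toLp 2 _).comp h).norm

theorem isOpen_rightHalfPlane : IsOpen rightHalfPlane :=
  isOpen_lt continuous_const Complex.continuous_re

theorem IsC1Analytic.congr {E : Type*} [NormedAddCommGroup E] [NormedSpace ℂ E] {I : Set ℝ}
    {Ω : Set E} {f g : ℝ → E → ℂ} (h : IsC1Analytic I Ω f) (hΩ : IsOpen Ω)
    (e : ∀ t ∈ I, ∀ p ∈ Ω, f t p = g t p) : IsC1Analytic I Ω g := by
  obtain ⟨h1, f', h2, h3⟩ := h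
  refine ⟨fun t ht => (h1 t ht).congr hΩ fun p hp => e t ht p hp, f', h2, fun t ht K hK hKc => ?_⟩
  obtain ⟨h4, h5, h6⟩ := h3 t ht K hK hKc
  refine ⟨(h4.congr ?_).congr_right fun p hp => e t ht p (hK hp), h5.congr ?_, h6⟩
  · filter_upwards [self_mem_nhdsWithin] with r hr p hp using e r hr p (hK hp)
  · filter_upwards [self_mem_nhdsWithin] with r hr p hp
    simp only [e r hr.1 p (hK hp), e t ht p (hK hp)]

/-! ### C¹ regularity of the tree expansion with analytic values -/

section Regularity

open scoped Classical

variable {ν : ℕ} {ω : Fin ν → ℝ} {ρ : Measure (EuclideanSpace ℝ (Fin ν))} [IsFiniteMeasure ρ]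
  {σ : EuclideanSpace ℝ (Fin ν) → ℂ}

/-- The sum of the expansion. -/
def treeSeries (ω : Fin ν → ℝ) (ρ : Measure (EuclideanSpace ℝ (Fin ν)))
    (σ : EuclideanSpace ℝ (Fin ν) → ℂ) (t : ℝ) (x y : Fin ν → ℂ) (h : ℂ) : ℂ :=
  ∫ a, treeFun ω σ t x y h a ∂sigmaMeasure (treeMeasure ρ)

variable (hω : ∀ υ, 0 < ω υ) (hσ : Measurable σ) (hσ1 : ∀ ξ, ‖σ ξ‖ ≤ 1)
  (h5 : Integrable (fun ξ => Real.exp (5 * ‖ξ‖)) ρ) {T : ℝ} (hT : 0 < T)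
  (hM : 2 * T ^ 2 * ∫ ξ, Real.exp (5 * ‖ξ‖) ∂ρ < 1)

include hω hσ hσ1 h5 hT hM

theorem integrable_treeFun {t : ℝ} (ht : t ∈ Icc (-T) T) {x y : Fin ν → ℂ} {h : ℂ}
    (hh : h = 0 ∨ 0 ≤ t ∧ 0 ≤ h.re) (hx : x ∈ strip ν 2) (hy : y ∈ strip ν 2) :
    Integrable (treeFun ω σ t x y h) (sigmaMeasure (treeMeasure ρ)) := by
  obtain ⟨C, hC, hb⟩ := exists_norm_treeFun_le (ρ := ρ) hω hσ1 hT (max ‖x‖ ‖y‖) ‖h‖ (norm_nonneg _)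
  refine ((integrable_treeDom h5 hM).const_mul C).mono'
    (aestronglyMeasurable_treeFun ω ρ hσ t x y h).1 ?_
  filter_upwards [hb] with a ha
  exact (ha ht hh le_rfl hx hy (le_max_left _ _) (le_max_right _ _)).1

/-- The integral over the disjoint union is grouped by the number n of edges; for fixed n there are
finitely many trees, and Fubini performs the θ-integration first. -/
theorem hasSum_treePart {t : ℝ} (ht : t ∈ Icc (-T) T) {x y : Fin ν → ℂ} {h : ℂ}
    (hh : h = 0 ∨ 0 ≤ t ∧ 0 ≤ h.re) (hx : x ∈ strip ν 2) (hy : y ∈ strip ν 2) :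
    HasSum (treePart ω ρ σ t x y h) (treeSeries ω ρ σ t x y h) := by
  have hi := integrable_treeFun hω hσ hσ1 h5 hT hM ht hh hx hy
  refine (hasSum_integral_sigmaMeasure hi).sigma fun n => ?_
  have hfs := hasSum_fintype (fun g : {g : SimpleGraph (Fin (n + 1)) // g.IsTree} =>
    ∫ a, treeFun ω σ t x y h ⟨⟨n, g⟩, a⟩ ∂treeMeasure ρ ⟨n, g⟩)
  convert hfs using 1
  have h1 : ∀ g : {g : SimpleGraph (Fin (n + 1)) // g.IsTree},
      ∫ a, treeFun ω σ t x y h ⟨⟨n, g⟩, a⟩ ∂treeMeasure ρ ⟨n, g⟩ =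
        ((-2 : ℂ) ^ n / ((n + 1).factorial : ℂ)) * (t : ℂ) ^ (2 * n) *
          ∫ c, (∫ θ in Icc (0 : g.1.edgeSet → ℝ) 1, treeTerm ω t x y h g.1 c θ) *
            ∏ j, σ (c j).2 ∂confMeasure ρ (Fin (n + 1)) := fun g => by
    have h2 : Integrable (fun a : TreeSp ν ⟨n, g⟩ =>
        treeTerm ω t x y h g.1 a.1 a.2 * ∏ j, σ (a.1 j).2) (treeMeasure ρ ⟨n, g⟩) :=
      (integrable_treeTerm hω h5 hh hx hy ⟨n, g⟩).mul_bdd (c := 1)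
        (Finset.measurable_fun_prod _ fun j _ => hσ.comp (by fun_prop)).aestronglyMeasurable
        (Eventually.of_forall fun a => norm_prod_density_le hσ1 a.1)
    simp only [treeFun]
    refine (integral_const_mul _ _).trans ?_
    congr 1
    refine (integral_prod _ h2).trans ?_
    refine integral_congr_ae (Eventually.of_forall fun c => ?_)
    exact integral_mul_const (∏ j, σ (c j).2) (fun θ => treeTerm ω t x y h g.1 c θ)
  rw [Finset.sum_congr rfl fun g _ => h1 g, ← Finset.mul_sum, treePart, ← integral_finsetSum]
  · congr 1
    refine integral_congr_ae (Eventually.of_forall fun c => ?_)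
    simp only
    rw [← Finset.sum_mul, ← sum_integral_treeTerm_fin]
    congr 1
    exact Finset.sum_subtype (Finset.univ.filter fun g : SimpleGraph (Fin (n + 1)) => g.IsTree)
      (p := fun g : SimpleGraph (Fin (n + 1)) => g.IsTree) (fun g => by
        simp only [Finset.mem_filter, Finset.mem_univ, true_and])
      fun g => ∫ θ in Icc (0 : g.edgeSet → ℝ) 1, treeTerm ω t x y h g c θ
  · intro g _
    exact (integrable_integral_treeTerm hω h5 hh hx hy g.2).mul_bdd (c := 1)
        (Finset.measurable_fun_prod _ fun j _ => hσ.comp (by fun_prop)).aestronglyMeasurable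
        (Eventually.of_forall fun a => norm_prod_density_le hσ1 a)

theorem c1Family_phi : C1Family (sigmaMeasure (treeMeasure ρ)) (Ioo (-T) T)
    (strip ν 2 ×ˢ strip ν 2) (fun t z a => treeFun ω σ t z.1 z.2 0 a)
    (fun t z a => treeFunD ω σ t z.1 z.2 0 a) where
  meas t _ z _ := aestronglyMeasurable_treeFun ω ρ hσ t z.1 z.2 0
  cont := Eventually.of_forall fun a => ((continuous_treeFun ω σ a continuous_fst
    continuous_snd.fst continuous_snd.snd continuous_const).2).continuousOn
  cont₀ := Eventually.of_forall fun a => ((continuous_treeFun ω σ a continuous_fst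
    continuous_snd.fst continuous_snd.snd continuous_const).1).continuousOn
  deriv := Eventually.of_forall fun a t _ z _ =>
    (hasDerivAt_treeFun ω σ t z.1 z.2 0 a).hasDerivWithinAt
  hol := Eventually.of_forall fun a t _ => (differentiable_treeFun ω σ a t differentiable_fst
    differentiable_snd (differentiable_const 0)).1.differentiableOn
  hol' := Eventually.of_forall fun a t _ => (differentiable_treeFun ω σ a t differentiable_fst
    differentiable_snd (differentiable_const 0)).2.differentiableOn
  bound z _ := by
    obtain ⟨C, hC, hb⟩ := exists_norm_treeFun_le (ρ := ρ) hω hσ1 hT (‖z‖ + 1) 0 le_rfl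
    refine ⟨Metric.ball z 1, Metric.ball_mem_nhds z one_pos, fun a => C * treeDom T a,
      (integrable_treeDom h5 hM).const_mul C, ?_⟩
    filter_upwards [hb] with a ha t ht y hy
    have hn : ‖y‖ ≤ ‖z‖ + 1 := by
      have := norm_sub_norm_le y z
      have h1 := mem_ball_iff_norm.1 hy.1
      linarith
    exact ha ⟨ht.1.le, ht.2.le⟩ (Or.inl rfl) (by simp) hy.2.1 hy.2.2
      ((norm_fst_le y).trans hn) ((norm_snd_le y).trans hn)

/-- The integrand is assembled from the tree functions at h and at 0 before integrating, so the
division by h is handled pointwise. The interval is [0,T[ because the bound at h requires t ≥ 0. -/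
theorem c1Family_w : C1Family (sigmaMeasure (treeMeasure ρ)) (Ico 0 T)
    (strip ν 2 ×ˢ strip ν 2 ×ˢ rightHalfPlane)
    (fun t z a => t / z.2.2 * (treeFun ω σ t z.1 z.2.1 z.2.2 a - treeFun ω σ t z.1 z.2.1 0 a))
    (fun t z a => 1 / z.2.2 * (treeFun ω σ t z.1 z.2.1 z.2.2 a - treeFun ω σ t z.1 z.2.1 0 a) +
      t / z.2.2 * (treeFunD ω σ t z.1 z.2.1 z.2.2 a - treeFunD ω σ t z.1 z.2.1 0 a)) := by
  have h0 : ∀ z ∈ strip ν 2 ×ˢ strip ν 2 ×ˢ rightHalfPlane, z.2.2 ≠ 0 := fun z hz hz0 => by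
    have h1 : 0 < z.2.2.re := hz.2.2
    simp [hz0] at h1
  have hcont : ∀ a : Σ i, TreeSp ν i,
      ContinuousOn (fun p : ℝ × (Fin ν → ℂ) × (Fin ν → ℂ) × ℂ => 1 / p.2.2.2 *
      (treeFun ω σ p.1 p.2.1 p.2.2.1 p.2.2.2 a - treeFun ω σ p.1 p.2.1 p.2.2.1 0 a))
      (Ico 0 T ×ˢ strip ν 2 ×ˢ strip ν 2 ×ˢ rightHalfPlane) ∧
      ContinuousOn (fun p : ℝ × (Fin ν → ℂ) × (Fin ν → ℂ) × ℂ => (p.1 : ℂ) / p.2.2.2 *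
      (treeFun ω σ p.1 p.2.1 p.2.2.1 p.2.2.2 a - treeFun ω σ p.1 p.2.1 p.2.2.1 0 a))
      (Ico 0 T ×ˢ strip ν 2 ×ˢ strip ν 2 ×ˢ rightHalfPlane) ∧
      ContinuousOn (fun p : ℝ × (Fin ν → ℂ) × (Fin ν → ℂ) × ℂ => (p.1 : ℂ) / p.2.2.2 *
      (treeFunD ω σ p.1 p.2.1 p.2.2.1 p.2.2.2 a - treeFunD ω σ p.1 p.2.1 p.2.2.1 0 a))
      (Ico 0 T ×ˢ strip ν 2 ×ˢ strip ν 2 ×ˢ rightHalfPlane) := fun a => by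
    have c1 := continuous_treeFun ω σ a (X := ℝ × (Fin ν → ℂ) × (Fin ν → ℂ) × ℂ) continuous_fst
      continuous_snd.fst continuous_snd.snd.fst continuous_snd.snd.snd
    have c2 := continuous_treeFun ω σ a (X := ℝ × (Fin ν → ℂ) × (Fin ν → ℂ) × ℂ) continuous_fst
      continuous_snd.fst continuous_snd.snd.fst (continuous_const (y := (0 : ℂ)))
    have ch : Continuous fun p : ℝ × (Fin ν → ℂ) × (Fin ν → ℂ) × ℂ => p.2.2.2 :=
      continuous_snd.snd.snd
    have ct : Continuous fun p : ℝ × (Fin ν → ℂ) × (Fin ν → ℂ) × ℂ => (p.1 : ℂ) :=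
      Complex.continuous_ofReal.comp continuous_fst
    exact ⟨(continuousOn_const.div ch.continuousOn fun p hp => h0 p.2 hp.2).mul
        (c1.1.sub c2.1).continuousOn,
      (ct.continuousOn.div ch.continuousOn fun p hp => h0 p.2 hp.2).mul
        (c1.1.sub c2.1).continuousOn,
      (ct.continuousOn.div ch.continuousOn fun p hp => h0 p.2 hp.2).mul
        (c1.2.sub c2.2).continuousOn⟩
  have hdiff : ∀ (a : Σ i, TreeSp ν i) (t : ℝ) (b : ℂ),
      DifferentiableOn ℂ (fun z : (Fin ν → ℂ) × (Fin ν → ℂ) × ℂ => b / z.2.2 *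
      (treeFun ω σ t z.1 z.2.1 z.2.2 a - treeFun ω σ t z.1 z.2.1 0 a))
      (strip ν 2 ×ˢ strip ν 2 ×ˢ rightHalfPlane) ∧
      DifferentiableOn ℂ (fun z : (Fin ν → ℂ) × (Fin ν → ℂ) × ℂ => b / z.2.2 *
      (treeFunD ω σ t z.1 z.2.1 z.2.2 a - treeFunD ω σ t z.1 z.2.1 0 a))
      (strip ν 2 ×ˢ strip ν 2 ×ˢ rightHalfPlane) := fun a t b => by
    have c1 := differentiable_treeFun ω σ a t (E := (Fin ν → ℂ) × (Fin ν → ℂ) × ℂ)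
      differentiable_fst differentiable_snd.fst differentiable_snd.snd
    have c2 := differentiable_treeFun ω σ a t (E := (Fin ν → ℂ) × (Fin ν → ℂ) × ℂ)
      differentiable_fst differentiable_snd.fst (differentiable_const (0 : ℂ))
    have ch : Differentiable ℂ fun z : (Fin ν → ℂ) × (Fin ν → ℂ) × ℂ => z.2.2 :=
      differentiable_snd.snd
    have hd : DifferentiableOn ℂ (fun z : (Fin ν → ℂ) × (Fin ν → ℂ) × ℂ => b / z.2.2)
        (strip ν 2 ×ˢ strip ν 2 ×ˢ rightHalfPlane) := fun z hz => by
      simp only [div_eq_mul_inv]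
      exact ((DifferentiableAt.comp z (differentiableAt_inv (h0 z hz)) (ch z)).const_mul
        b).differentiableWithinAt
    exact ⟨hd.mul (c1.1.sub c2.1).differentiableOn, hd.mul (c1.2.sub c2.2).differentiableOn⟩
  refine ⟨fun t _ z _ => ?_, Eventually.of_forall fun a => (hcont a).1.add (hcont a).2.2,
    Eventually.of_forall fun a => (hcont a).2.1, Eventually.of_forall fun a t _ z _ => ?_,
    Eventually.of_forall fun a t _ => (hdiff a t t).1,
    Eventually.of_forall fun a t _ => (hdiff a t 1).1.add (hdiff a t t).2, fun z hz => ?_⟩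
  · have m1 := aestronglyMeasurable_treeFun ω ρ hσ t z.1 z.2.1 z.2.2
    have m2 := aestronglyMeasurable_treeFun ω ρ hσ t z.1 z.2.1 0
    exact ⟨(m1.1.sub m2.1).const_mul _,
      ((m1.1.sub m2.1).const_mul _).add ((m1.2.sub m2.2).const_mul _)⟩
  · have d1 : HasDerivAt (fun r : ℝ => (r : ℂ) / z.2.2) (1 / z.2.2) t :=
      ((hasDerivAt_id (t : ℂ)).comp_ofReal).div_const _
    exact (d1.fun_mul ((hasDerivAt_treeFun ω σ t z.1 z.2.1 z.2.2 a).fun_sub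
      (hasDerivAt_treeFun ω σ t z.1 z.2.1 0 a))).hasDerivWithinAt
  · have hre : 0 < z.2.2.re := hz.2.2
    -- Within distance Re h / 2 the modulus of h stays at least Re h / 2, which bounds 1/h; the
    -- radius 1 keeps the norms of all coordinates bounded.
    set ε := min 1 (z.2.2.re / 2) with hε
    have hε0 : 0 < ε := lt_min one_pos (by positivity)
    obtain ⟨C, hC, hb⟩ := exists_norm_treeFun_le (ρ := ρ) hω hσ1 hT (‖z‖ + 1) (‖z‖ + 1)
      (by positivity)
    refine ⟨Metric.ball z ε, Metric.ball_mem_nhds z hε0,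
      fun a => (1 + T) * (2 / z.2.2.re) * (2 * (C * treeDom T a)),
      ((integrable_treeDom h5 hM).const_mul C).const_mul 2 |>.const_mul _, ?_⟩
    filter_upwards [hb] with a ha t ht y hy
    have h1 : ‖y - z‖ < ε := mem_ball_iff_norm.1 hy.1
    have hn : ‖y‖ ≤ ‖z‖ + 1 := by
      have := norm_sub_norm_le y z
      have := min_le_left 1 (z.2.2.re / 2)
      linarith
    have hn2 : ‖y.2‖ ≤ ‖z‖ + 1 := (norm_snd_le y).trans hn
    have hyh : z.2.2.re / 2 ≤ ‖y.2.2‖ := by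
      have h2 : ‖y.2.2 - z.2.2‖ ≤ ‖y - z‖ := (norm_snd_le (y - z).2).trans (norm_snd_le (y - z))
      have h3 := (Complex.abs_re_le_norm (y.2.2 - z.2.2))
      rw [Complex.sub_re] at h3
      have h4 := (abs_le.1 (h3.trans (h2.trans h1.le))).1
      have h5 := min_le_right 1 (z.2.2.re / 2)
      have h6 := Complex.re_le_norm y.2.2
      linarith
    have hinv : ‖(1 : ℂ) / y.2.2‖ ≤ 2 / z.2.2.re := by
      rw [norm_div, norm_one, div_le_div_iff₀ (by linarith) hre]
      linarith
    have htT : t ∈ Icc (-T) T := ⟨by linarith [ht.1], ht.2.le⟩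
    have hyre : 0 < y.2.2.re := hy.2.2.2
    have b1 := ha htT (Or.inr ⟨ht.1, hyre.le⟩) ((norm_snd_le y.2).trans hn2) hy.2.1 hy.2.2.1
      ((norm_fst_le y).trans hn) ((norm_fst_le y.2).trans hn2)
    have b2 := ha htT (Or.inl rfl) (by simp; positivity) hy.2.1 hy.2.2.1
      ((norm_fst_le y).trans hn) ((norm_fst_le y.2).trans hn2)
    have s1 : ‖treeFun ω σ t y.1 y.2.1 y.2.2 a - treeFun ω σ t y.1 y.2.1 0 a‖ ≤
        2 * (C * treeDom T a) := (norm_sub_le _ _).trans (by linarith [b1.1, b2.1])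
    have s2 : ‖treeFunD ω σ t y.1 y.2.1 y.2.2 a - treeFunD ω σ t y.1 y.2.1 0 a‖ ≤
        2 * (C * treeDom T a) := (norm_sub_le _ _).trans (by linarith [b1.2, b2.2])
    have hB : 0 ≤ 2 * (C * treeDom T a) := (norm_nonneg _).trans s1
    have ht' : ‖(t : ℂ) / y.2.2‖ ≤ T * (2 / z.2.2.re) := by
      rw [div_eq_mul_one_div, norm_mul, Complex.norm_real, Real.norm_of_nonneg ht.1]
      exact mul_le_mul ht.2.le hinv (norm_nonneg _) hT.le
    have hD : 0 < 2 / z.2.2.re := by positivity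
    have p1 : ‖(t : ℂ) / y.2.2 * (treeFun ω σ t y.1 y.2.1 y.2.2 a - treeFun ω σ t y.1 y.2.1 0 a)‖ ≤
        T * (2 / z.2.2.re) * (2 * (C * treeDom T a)) := by
      rw [norm_mul]; exact mul_le_mul ht' s1 (norm_nonneg _) (by positivity)
    have p2 : ‖(1 : ℂ) / y.2.2 * (treeFun ω σ t y.1 y.2.1 y.2.2 a - treeFun ω σ t y.1 y.2.1 0 a)‖ ≤
        (2 / z.2.2.re) * (2 * (C * treeDom T a)) := by
      rw [norm_mul]; exact mul_le_mul hinv s1 (norm_nonneg _) (by positivity)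
    have p3 : ‖(t : ℂ) / y.2.2 *
        (treeFunD ω σ t y.1 y.2.1 y.2.2 a - treeFunD ω σ t y.1 y.2.1 0 a)‖ ≤
        T * (2 / z.2.2.re) * (2 * (C * treeDom T a)) := by
      rw [norm_mul]; exact mul_le_mul ht' s2 (norm_nonneg _) (by positivity)
    have e : (1 + T) * (2 / z.2.2.re) * (2 * (C * treeDom T a)) =
      (2 / z.2.2.re) * (2 * (C * treeDom T a)) +
        T * (2 / z.2.2.re) * (2 * (C * treeDom T a)) := by ring
    constructor
    · refine p1.trans ?_
      rw [e]
      have := mul_nonneg hD.le hB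
      linarith
    · refine (norm_add_le _ _).trans ?_
      rw [e]
      linarith

end Regularity

/-! ### Convergence and regularity of φ and w -/

section SeriesRegularity

variable {ν : ℕ} {ω : Fin ν → ℝ} {μ : ComplexMeasure (EuclideanSpace ℝ (Fin ν))}
  [IsFiniteMeasure (VectorMeasure.variation μ)] {σ : EuclideanSpace ℝ (Fin ν) → ℂ}
  (hσ : IsDensity μ σ) (hω : ∀ υ, 0 < ω υ)
  (h5 : Integrable (fun ξ => Real.exp (5 * ‖ξ‖)) (VectorMeasure.variation μ))
  {T : ℝ} (hT : 0 < T)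
  (hM : 2 * T ^ 2 * ∫ ξ, Real.exp (5 * ‖ξ‖) ∂(VectorMeasure.variation μ) < 1)

include hσ hω h5 hT hM

theorem hasSum_phiTerm {t : ℝ} (ht : t ∈ Icc (-T) T) {x y : Fin ν → ℂ} (hx : x ∈ strip ν 2)
    (hy : y ∈ strip ν 2) : HasSum (phiTerm ω μ t x y)
      (treeSeries ω (VectorMeasure.variation μ) σ t x y 0) := by
  have h := hasSum_treePart hω hσ.measurable hσ.norm_le h5 hT hM ht (Or.inl rfl) hx hy
  have e : phiTerm ω μ t x y = treePart ω (VectorMeasure.variation μ) σ t x y 0 :=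
    funext fun n => phiTerm_eq hσ hω h5 hx hy n
  rwa [e]

theorem hasSum_wTerm {t : ℝ} (ht : t ∈ Icc 0 T) {x y : Fin ν → ℂ} (hx : x ∈ strip ν 2)
    (hy : y ∈ strip ν 2) {h : ℂ} (hh : h ∈ rightHalfPlane) :
    HasSum (fun n => wTerm ω μ (n + 1) t x y h)
      (t / h * (treeSeries ω (VectorMeasure.variation μ) σ t x y h -
        treeSeries ω (VectorMeasure.variation μ) σ t x y 0)) := by
  have ht' : t ∈ Icc (-T) T := ⟨by linarith [ht.1], ht.2⟩
  have h0 : 0 < h.re := hh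
  have h1 := hasSum_treePart hω hσ.measurable hσ.norm_le h5 hT hM ht' (Or.inl rfl) hx hy
  have h2 := hasSum_treePart hω hσ.measurable hσ.norm_le h5 hT hM ht' (Or.inr ⟨ht.1, h0.le⟩) hx hy
  simp only [fun n => wTerm_eq hσ hω h5 ht.1 hx hy hh n]
  exact (h2.sub h1).mul_left _

theorem isC1Analytic_phiSeries : IsC1Analytic (Ioo (-T) T) (strip ν 2 ×ˢ strip ν 2)
      (fun t (p : (Fin ν → ℂ) × (Fin ν → ℂ)) => phiSeries ω μ t p.1 p.2) := by
  have hf := c1Family_phi hω hσ.measurable hσ.norm_le h5 hT hM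
  have h := hf.isC1Analytic (convex_Ioo _ _) ((isOpen_strip ν 2).prod (isOpen_strip ν 2))
  refine h.congr ((isOpen_strip ν 2).prod (isOpen_strip ν 2)) fun t ht p hp => ?_
  exact (hasSum_phiTerm hσ hω h5 hT hM ⟨ht.1.le, ht.2.le⟩ hp.1 hp.2).tsum_eq.symm

theorem isC1Analytic_wSeries : IsC1Analytic (Ico 0 T) (strip ν 2 ×ˢ strip ν 2 ×ˢ rightHalfPlane)
      (fun t (p : (Fin ν → ℂ) × (Fin ν → ℂ) × ℂ) => wSeries ω μ t p.1 p.2.1 p.2.2) := by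
  have hf := c1Family_w hω hσ.measurable hσ.norm_le h5 hT hM
  have h := hf.isC1Analytic (convex_Ico _ _)
    ((isOpen_strip ν 2).prod ((isOpen_strip ν 2).prod isOpen_rightHalfPlane))
  refine h.congr ((isOpen_strip ν 2).prod ((isOpen_strip ν 2).prod isOpen_rightHalfPlane))
    fun t ht p hp => ?_
  have h0 : 0 < p.2.2.re := hp.2.2
  have ht' : t ∈ Icc (-T) T := ⟨by linarith [ht.1], ht.2.le⟩
  refine Eq.trans ?_ (hasSum_wTerm hσ hω h5 hT hM ⟨ht.1, ht.2.le⟩ hp.1 hp.2.1 hp.2.2).tsum_eq.symm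
  rw [integral_const_mul, integral_sub]
  · rfl
  · exact integrable_treeFun hω hσ.measurable hσ.norm_le h5 hT hM ht' (Or.inr ⟨ht.1, h0.le⟩)
      hp.1 hp.2.1
  · exact integrable_treeFun hω hσ.measurable hσ.norm_le h5 hT hM ht' (Or.inl rfl) hp.1 hp.2.1

end SeriesRegularity

/-! ### A recursion characterizing the exponential of a series -/

section ExpSeries

theorem norm_coeff_le {a : ℕ → ℂ} (ha : Summable a) : ∃ C, 0 ≤ C ∧ ∀ n, ‖a n‖ ≤ C := by
  obtain ⟨C, hC⟩ := ha.norm.tendsto_atTop_zero.bddAbove_range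
  exact ⟨C, (norm_nonneg _).trans (hC ⟨0, rfl⟩), fun n => hC ⟨n, rfl⟩⟩

/-- Summability at radius 1 bounds the coefficients, and the differentiated series is compared with
∑ (n+1) qⁿ for some q strictly between |r| and 1. -/
theorem hasDerivAt_powerSeries {a : ℕ → ℂ} (ha : Summable a) {r : ℝ} (hr : |r| < 1) :
    Summable (fun n : ℕ => ‖((n : ℂ) + 1) * a (n + 1) * (r : ℂ) ^ n‖) ∧
    HasDerivAt (fun r : ℝ => ∑' n, a n * (r : ℂ) ^ n)
      (∑' n : ℕ, ((n : ℂ) + 1) * a (n + 1) * (r : ℂ) ^ n) r := by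
  obtain ⟨C, hC0, hC⟩ := norm_coeff_le ha
  obtain ⟨q, hrq, hq⟩ := exists_between hr
  have hq0 : 0 < q := (abs_nonneg r).trans_lt hrq
  have hS : Summable fun n : ℕ => C * (((n : ℝ) + 1) * q ^ n) := by
    have h1 := summable_pow_mul_geometric_of_norm_lt_one 1 (r := q)
      (by rwa [Real.norm_of_nonneg hq0.le])
    have h2 := summable_geometric_of_lt_one hq0.le hq
    refine ((h1.add h2).mul_left C).congr fun n => ?_
    ring
  have hb : ∀ (n : ℕ) (s : ℝ), |s| ≤ q →
      ‖((n : ℂ) + 1) * a (n + 1) * (s : ℂ) ^ n‖ ≤ C * (((n : ℝ) + 1) * q ^ n) := fun n s hs => by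
    have e : ‖(n : ℂ) + 1‖ = (n : ℝ) + 1 := by exact_mod_cast Complex.norm_natCast (n + 1)
    rw [norm_mul, norm_mul, norm_pow, Complex.norm_real, e]
    calc ((n : ℝ) + 1) * ‖a (n + 1)‖ * ‖s‖ ^ n ≤ ((n : ℝ) + 1) * C * q ^ n := by
          gcongr
          · exact hC _
          · exact hs
      _ = _ := by ring
  have hsum : Summable (fun n : ℕ => ‖((n : ℂ) + 1) * a (n + 1) * (r : ℂ) ^ n‖) :=
    Summable.of_nonneg_of_le (fun _ => norm_nonneg _) (fun n => hb n r hrq.le) hS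
  refine ⟨hsum, ?_⟩
  have hu : Summable fun n : ℕ => ‖(0 : ℝ)‖ + (if n = 0 then 0 else C * ((n : ℝ) * q ^ (n - 1))) := by
    rw [← summable_nat_add_iff 1]
    refine hS.congr fun n => ?_
    simp
  have h1 := hasDerivAt_tsum_of_isPreconnected (t := Ioo (-q) q) (y₀ := 0) (y := r)
    (g := fun n (s : ℝ) => a n * (s : ℂ) ^ n)
    (g' := fun n (s : ℝ) => a n * ((n : ℂ) * (s : ℂ) ^ (n - 1))) hu isOpen_Ioo
    isPreconnected_Ioo (fun n s _ => (hasDerivAt_pow n (s : ℂ)).comp_ofReal.const_mul (a n))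
    (fun n s hs => ?_) ⟨by linarith, hq0⟩ ?_ (abs_lt.1 hrq)
  · have e : ∑' n : ℕ, a n * ((n : ℂ) * (r : ℂ) ^ (n - 1)) =
        ∑' n : ℕ, ((n : ℂ) + 1) * a (n + 1) * (r : ℂ) ^ n := by
      rw [Summable.tsum_eq_zero_add]
      · simp only [Nat.cast_zero, zero_mul, mul_zero, zero_add, Nat.add_sub_cancel]
        refine tsum_congr fun n => ?_
        push_cast
        ring
      · rw [← summable_nat_add_iff 1]
        refine hsum.of_norm.congr fun n => ?_
        simp only [Nat.add_sub_cancel]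
        push_cast
        ring
    rwa [e] at h1
  · rcases n with _ | n
    · simp
    · have := hb n s (abs_le.2 ⟨hs.1.le, hs.2.le⟩)
      simp only [norm_zero, zero_add, Nat.add_sub_cancel, Nat.add_eq_zero_iff, one_ne_zero, and_false,
        if_false]
      push_cast
      refine le_trans (le_of_eq ?_) this
      congr 1
      ring
  · refine summable_of_ne_finset_zero (s := {0}) fun n hn => ?_
    have : n ≠ 0 := by simpa using hn
    simp [this]

/-- For the generating functions f and g of e and v the recursion says f' = g'f, so f e^{-g} is
constant on [0,1[. The derivative need not exist at r = 1; there absolute summability gives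
continuity, which carries the identity over. -/
theorem tsum_eq_exp_tsum {e v : ℕ → ℂ} (he : Summable e) (hv : Summable v) (e0 : e 0 = 1)
    (hrec : ∀ n : ℕ, ((n : ℂ) + 1) * e (n + 1) =
      ∑ k ∈ Finset.range (n + 1), ((k : ℂ) + 1) * v (k + 1) * e (n - k)) (v0 : v 0 = 0) :
    ∑' n, e n = Complex.exp (∑' n, v n) := by
  set f : ℝ → ℂ := fun r => ∑' n, e n * (r : ℂ) ^ n with hf
  set g : ℝ → ℂ := fun r => ∑' n, v n * (r : ℂ) ^ n with hg
  have hcont : ∀ a : ℕ → ℂ, Summable a →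
      ContinuousOn (fun r : ℝ => ∑' n, a n * (r : ℂ) ^ n) (Icc 0 1) := fun a ha =>
    continuousOn_tsum (fun n => by fun_prop) ha.norm fun n r hr => by
      rw [norm_mul, norm_pow, Complex.norm_real]
      refine mul_le_of_le_one_right (norm_nonneg _) (pow_le_one₀ (norm_nonneg _) ?_)
      rw [Real.norm_of_nonneg hr.1]; exact hr.2
  have hd : ∀ r ∈ Ico (0 : ℝ) 1, HasDerivAt (fun r => f r * Complex.exp (-g r)) 0 r := fun r hr => by
    have hr1 : |r| < 1 := by rw [abs_of_nonneg hr.1]; exact hr.2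
    obtain ⟨_, d1⟩ := hasDerivAt_powerSeries he hr1
    obtain ⟨s2, d2⟩ := hasDerivAt_powerSeries hv hr1
    have s3 : Summable fun n => ‖e n * (r : ℂ) ^ n‖ :=
      Summable.of_nonneg_of_le (fun _ => norm_nonneg _) (fun n => by
        rw [norm_mul, norm_pow, Complex.norm_real]
        exact mul_le_of_le_one_right (norm_nonneg _) (pow_le_one₀ (norm_nonneg _) hr1.le)) he.norm
    have h1 : ∑' n : ℕ, ((n : ℂ) + 1) * e (n + 1) * (r : ℂ) ^ n =
        (∑' n : ℕ, ((n : ℂ) + 1) * v (n + 1) * (r : ℂ) ^ n) * f r := by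
      rw [hf]
      simp only
      rw [tsum_mul_tsum_eq_tsum_sum_range_of_summable_norm s2 s3]
      refine tsum_congr fun n => ?_
      rw [hrec, Finset.sum_mul]
      refine Finset.sum_congr rfl fun k hk => ?_
      have : n = k + (n - k) := by have := Finset.mem_range.1 hk; omega
      conv_lhs => rw [this, pow_add]
      have e1 : k + (n - k) - k = n - k := by omega
      rw [e1]
      ring
    have h2 := d1.fun_mul d2.fun_neg.cexp
    refine h2.congr_deriv ?_
    rw [h1]
    change _ * f r * Complex.exp (-g r) + f r * (Complex.exp (-g r) * _) = 0
    ring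
  have hfg : ContinuousOn (fun r => f r * Complex.exp (-g r)) (Icc 0 1) :=
    (hcont e he).mul (hcont v hv).neg.cexp
  have hc := constant_of_has_deriv_right_zero hfg (fun r hr => (hd r hr).hasDerivWithinAt) 1
    (right_mem_Icc.2 zero_le_one)
  have hz : ∀ a : ℕ → ℂ, ∑' n, a n * ((0 : ℝ) : ℂ) ^ n = a 0 := fun a => by
    rw [tsum_eq_single 0 fun n hn => by simp [hn]]
    simp
  have ho : ∀ a : ℕ → ℂ, ∑' n, a n * ((1 : ℝ) : ℂ) ^ n = ∑' n, a n := fun a => by simp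
  simp only [show f 0 = e 0 from hz e, show g 0 = v 0 from hz v, show f 1 = _ from ho e,
    show g 1 = _ from ho v, e0, v0, neg_zero, Complex.exp_zero, mul_one] at hc
  rw [← mul_one (Complex.exp _), ← hc, mul_left_comm, ← Complex.exp_add, add_neg_cancel,
    Complex.exp_zero, mul_one]

end ExpSeries

/-! ### The gas of particles and its cluster expansion -/

section Exponential

open scoped Classical

variable {ν : ℕ} (ω : Fin ν → ℝ) (ρ : Measure (EuclideanSpace ℝ (Fin ν))) [IsFiniteMeasure ρ]
  (σ : EuclideanSpace ℝ (Fin ν) → ℂ) (t : ℝ) (x y : Fin ν → ℂ) (h : ℂ)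

/-- The activity of a point. -/
def activity (p : Pt ν) : ℂ :=
  t / h * σ p.2 * Complex.exp (-h * ((t * kern ω t p p : ℝ) : ℂ) + Complex.I * path ω t x y p)

/-- The interaction of pairs of points. -/
def pairPot {S : Type} (c : S → Pt ν) (p : Sym2 S) : ℂ := 2 * h * t * (kernE ω t c p : ℂ)

variable {S S' : Type} [Fintype S] [Fintype S']

/-- The Boltzmann factor of a configuration. -/
def gasFun (c : S → Pt ν) : ℂ :=
  (∏ j, activity ω σ t x y h (c j)) * pairExp S (pairPot ω t h c)

/-- The connected part of the Boltzmann factor. -/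
def clusterFun (c : S → Pt ν) : ℂ :=
  (∏ j, activity ω σ t x y h (c j)) * treeSum S (-pairPot ω t h c) (pairPot ω t h c)

theorem pairPot_comp {S S' : Type} (c : S → Pt ν) (e : S' → S) :
    pairPot ω t h (c ∘ e) = pairPot ω t h c ∘ Sym2.map e := by
  funext p; simp [pairPot, kernE_comp]

theorem gasFun_comp (c : S → Pt ν) (e : S' ≃ S) :
    gasFun ω σ t x y h (c ∘ e) = gasFun ω σ t x y h c := by
  rw [gasFun, gasFun, pairExp_equiv e, pairPot_comp]
  congr 1
  exact Equiv.prod_comp e fun j => activity ω σ t x y h (c j)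

theorem clusterFun_comp (c : S → Pt ν) (e : S' ≃ S) :
    clusterFun ω σ t x y h (c ∘ e) = clusterFun ω σ t x y h c := by
  rw [clusterFun, clusterFun, treeSum_equiv e, pairPot_comp]
  congr 1
  exact Equiv.prod_comp e fun j => activity ω σ t x y h (c j)

/-- Activities are multiplicative over a partition of the particles, so splitting the pair factor
along the component of the marked particle i0 splits the whole Boltzmann factor into a cluster and a
smaller gas. -/
theorem gasFun_eq_sum (c : S → Pt ν) (i0 : S) :
    gasFun ω σ t x y h c = ∑ I : Finset S with i0 ∈ I,
      clusterFun ω σ t x y h (fun i : {i // i ∈ I} => c i) *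
        gasFun ω σ t x y h (fun i : {i // i ∉ I} => c i) := by
  rw [gasFun, pairExp_eq_sum_treeSum _ i0, Finset.mul_sum]
  refine Finset.sum_congr rfl fun I _ => ?_
  have h1 : pairPot ω t h (fun i : {i // i ∈ I} => c i) =
      pairPot ω t h c ∘ Sym2.map Subtype.val := pairPot_comp ω t h c Subtype.val
  have h2 : pairPot ω t h (fun i : {i // i ∉ I} => c i) =
      pairPot ω t h c ∘ Sym2.map Subtype.val := pairPot_comp ω t h c Subtype.val
  have h3 : ∏ j, activity ω σ t x y h (c j) =
      (∏ j : {i // i ∈ I}, activity ω σ t x y h (c j)) *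
        ∏ j : {i // i ∉ I}, activity ω σ t x y h (c j) := by
    convert (Fintype.prod_subtype_mul_prod_subtype (fun i => i ∈ I)
      fun j => activity ω σ t x y h (c j)).symm
  rw [clusterFun, gasFun, h1, h2, h3]
  have e1 : (-pairPot ω t h c) ∘ Sym2.map (Subtype.val : {i // i ∈ I} → S) =
    -(pairPot ω t h c ∘ Sym2.map Subtype.val) := rfl
  rw [← e1]
  ring

theorem sum_kern_eq (c : S → Pt ν) : ∑ j, ∑ k, t * kern ω t (c j) (c k) =
    ∑ j, t * kern ω t (c j) (c j) + 2 * ∑ p ∈ offPairs S, t * kernE ω t c p :=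
  sum_sum_eq_diag_add_offPairs _ _ _ (fun _ => rfl) fun _ _ _ => rfl

theorem prod_activity (c : S → Pt ν) : ∏ j, activity ω σ t x y h (c j) =
    ((t : ℂ) / h) ^ Fintype.card S * (∏ j, σ (c j).2) * diagExp ω t x y h c := by
  simp only [activity, Finset.prod_mul_distrib, Finset.prod_const, Finset.card_univ]
  rw [← Complex.exp_sum, diagExp, Finset.sum_add_distrib, ← Finset.mul_sum, ← Finset.mul_sum]
  push_cast
  rfl

/-- The diagonal terms in the activities and the pair terms recombine to the full quadratic form,
which is nonnegative for t ≥ 0. That is why the gas, unlike its logarithm, needs no smallness of t.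
-/
theorem gasFun_eq (c : S → Pt ν) : gasFun ω σ t x y h c =
    ((t : ℂ) / h) ^ Fintype.card S * (∏ j, σ (c j).2) *
      Complex.exp (Complex.I * linForm ω t x y c -
        h * ((∑ j, ∑ k, t * kern ω t (c j) (c k) : ℝ) : ℂ)) := by
  rw [gasFun, prod_activity, mul_assoc, diagExp, pairExp, ← Complex.exp_add, sum_kern_eq]
  congr 2
  simp only [pairPot]
  push_cast
  rw [Finset.mul_sum, Finset.mul_sum]
  have : ∀ p, 2 * h * t * (kernE ω t c p : ℂ) = h * (2 * (t * (kernE ω t c p : ℂ))) := fun p => by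
    ring
  simp only [this, ← Finset.mul_sum]
  ring

theorem treeSum_mul_left (a : ℂ) (K V : Sym2 S → ℂ) {n : ℕ}
    (hn : ∀ F : SimpleGraph S, F.IsTree → (edges F).card = n) :
    treeSum S (fun p => a * K p) V = a ^ n * treeSum S K V := by
  rw [treeSum, treeSum, Finset.mul_sum]
  refine Finset.sum_congr rfl fun F hF => ?_
  rw [Finset.prod_mul_distrib, Finset.prod_const, hn F (Finset.mem_filter.1 hF).2, mul_assoc]

/-- The n edges contribute (-2ht)^n and the n+1 activities (t/h)^{n+1}; all powers of h cancel but
one. -/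
theorem clusterFun_eq {n : ℕ} (c : Fin (n + 1) → Pt ν) (hh : h ≠ 0) : clusterFun ω σ t x y h c =
    (t / h * ((-2) ^ n * (t : ℂ) ^ (2 * n))) * (treeTotal ω t x y h c * ∏ j, σ (c j).2) := by
  have h1 := treeSum_mul_left (-2 * h * t) (fun p => (kernE ω t c p : ℂ)) (pairPot ω t h c)
    (n := n) fun F hF => card_edges_of_isTree hF
  have h3 : (fun p => -2 * h * t * (kernE ω t c p : ℂ)) = -pairPot ω t h c := by
    funext p; simp [pairPot]
  rw [h3] at h1
  rw [clusterFun, prod_activity, treeTotal, h1, Fintype.card_fin]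
  have h2 : ((t : ℂ) / h) ^ (n + 1) * (-2 * h * t) ^ n =
      t / h * ((-2) ^ n * (t : ℂ) ^ (2 * n)) := by
    rw [pow_succ, mul_right_comm, ← mul_pow, pow_mul, ← mul_pow, mul_comm]
    congr 2
    field_simp
  rw [← h2]
  change _ = _ * (_ * treeSum _ _ (pairPot ω t h c) * _)
  ring

/-- The integral of the Boltzmann factor. -/
def gasInt (S : Type) [Fintype S] : ℂ := ∫ c, gasFun ω σ t x y h c ∂confMeasure ρ S

/-- The integral of the connected part of the Boltzmann factor. -/
def clusterInt (S : Type) [Fintype S] : ℂ := ∫ c, clusterFun ω σ t x y h c ∂confMeasure ρ S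

theorem measurePreserving_confMeasure_comp (e : S' ≃ S) :
    MeasurePreserving (fun c : S → Pt ν => c ∘ e) (confMeasure ρ S) (confMeasure ρ S') :=
  (measurePreserving_piCongrLeft (fun _ : S => ptMeasure ρ) e).symm

theorem integral_confMeasure_comp (e : S' ≃ S) (f : (S' → Pt ν) → ℂ) :
    ∫ c, f (c ∘ e) ∂confMeasure ρ S = ∫ c, f c ∂confMeasure ρ S' :=
  (measurePreserving_confMeasure_comp ρ e).integral_comp
    (MeasurableEquiv.measurableEmbedding (MeasurableEquiv.piCongrLeft (fun _ : S => Pt ν) e).symm) f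

theorem gasInt_equiv (e : S' ≃ S) : gasInt ω ρ σ t x y h S = gasInt ω ρ σ t x y h S' := by
  rw [gasInt, gasInt, ← integral_confMeasure_comp ρ e]
  simp only [gasFun_comp]

theorem clusterInt_equiv (e : S' ≃ S) :
    clusterInt ω ρ σ t x y h S = clusterInt ω ρ σ t x y h S' := by
  rw [clusterInt, clusterInt, ← integral_confMeasure_comp ρ e]
  simp only [clusterFun_comp]

theorem measurePreserving_confMeasure_split (p : S → Prop) [Fintype {i // p i}]
    [Fintype {i // ¬ p i}] :
    MeasurePreserving (fun c : S → Pt ν => ((fun i : {i // p i} => c i), fun i : {i // ¬ p i} => c i))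
      (confMeasure ρ S) ((confMeasure ρ {i // p i}).prod (confMeasure ρ {i // ¬ p i})) := by
  have h1 : MeasurePreserving
      (fun c : S → Pt ν => ((fun i : {i // p i} => c i), fun i : {i // ¬ p i} => c i))
      (confMeasure ρ S) ((@confMeasure ν ρ {i // p i} (Subtype.fintype _)).prod
        (@confMeasure ν ρ {i // ¬ p i} (Subtype.fintype _))) :=
    measurePreserving_piEquivPiSubtypeProd (fun _ : S => ptMeasure ρ) p
  convert h1

theorem integral_confMeasure_split (p : S → Prop) [Fintype {i // p i}]
    [Fintype {i // ¬ p i}] (f : ({i // p i} → Pt ν) → ℂ)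
    (g : ({i // ¬ p i} → Pt ν) → ℂ) :
    ∫ c : S → Pt ν, f (fun i => c i) * g (fun i => c i) ∂confMeasure ρ S =
      (∫ c, f c ∂confMeasure ρ {i // p i}) * ∫ c, g c ∂confMeasure ρ {i // ¬ p i} := by
  rw [← integral_prod_mul]
  exact (measurePreserving_confMeasure_split ρ p).integral_comp
    (MeasurableEquiv.measurableEmbedding (MeasurableEquiv.piEquivPiSubtypeProd
      (fun _ : S => Pt ν) p)) fun z => f z.1 * g z.2

variable {ω ρ σ t x y h}

theorem gasInt_eq_sum (i0 : S)
    (hv : ∀ I : Finset S, i0 ∈ I →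
      Integrable (fun c : {i // i ∈ I} → Pt ν => clusterFun ω σ t x y h c) (confMeasure ρ _))
    (hg : ∀ I : Finset S,
      Integrable (fun c : {i // i ∉ I} → Pt ν => gasFun ω σ t x y h c) (confMeasure ρ _)) :
    gasInt ω ρ σ t x y h S = ∑ I : Finset S with i0 ∈ I,
      clusterInt ω ρ σ t x y h {i // i ∈ I} * gasInt ω ρ σ t x y h {i // i ∉ I} := by
  rw [gasInt]
  simp only [gasFun_eq_sum ω σ t x y h _ i0]
  rw [integral_finsetSum]
  · refine Finset.sum_congr rfl fun I _ => ?_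
    exact integral_confMeasure_split ρ (fun i => i ∈ I)
      (clusterFun ω σ t x y h) (gasFun ω σ t x y h)
  · intro I hI
    exact (measurePreserving_confMeasure_split ρ (fun i => i ∈ I)).integrable_comp_of_integrable
      ((hv I (Finset.mem_filter.1 hI).2).mul_prod (hg I))

theorem sum_finset_card_mem (i0 : S) {n : ℕ} (hS : Fintype.card S = n + 1) (f : ℕ → ℂ) :
    ∑ I : Finset S with i0 ∈ I, f I.card =
      ∑ m ∈ Finset.range (n + 1), (n.choose m : ℂ) * f (m + 1) := by
  have h1 := Finset.sum_powerset_apply_card (fun m => f (m + 1))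
    (x := (Finset.univ : Finset S).erase i0)
  have h2 : ((Finset.univ : Finset S).erase i0).card = n := by
    rw [Finset.card_erase_of_mem (Finset.mem_univ _), Finset.card_univ, hS]; rfl
  rw [h2] at h1
  simp only [nsmul_eq_mul] at h1
  rw [← h1]
  refine Finset.sum_bij' (fun I _ => I.erase i0) (fun J _ => insert i0 J) ?_ ?_ ?_ ?_ ?_
  · intro I _
    exact Finset.mem_powerset.2 (Finset.erase_subset_erase _ (Finset.subset_univ _))
  · intro J _
    simp
  · intro I hI
    exact Finset.insert_erase (Finset.mem_filter.1 hI).2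
  · intro J hJ
    refine Finset.erase_insert fun h0 => ?_
    exact absurd (Finset.mem_powerset.1 hJ h0) (Finset.notMem_erase _ _)
  · intro I hI
    rw [Finset.card_erase_of_mem (Finset.mem_filter.1 hI).2, Nat.sub_add_cancel]
    exact Finset.card_pos.2 ⟨i0, (Finset.mem_filter.1 hI).2⟩

omit [IsFiniteMeasure ρ] in
theorem measurable_gasFun (hσ : Measurable σ) (S : Type) [Fintype S] :
    Measurable (gasFun (S := S) ω σ t x y h) := by
  have h1 : gasFun (S := S) ω σ t x y h = fun c => ((t : ℂ) / h) ^ Fintype.card S *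
      (∏ j, σ (c j).2) * Complex.exp (Complex.I * linForm ω t x y c -
        h * ((∑ j, ∑ k, t * kern ω t (c j) (c k) : ℝ) : ℂ)) := by
    funext c; exact gasFun_eq ω σ t x y h c
  rw [h1]
  have m1 : Measurable fun c : S → Pt ν => ∏ j, σ (c j).2 :=
    Finset.measurable_fun_prod _ fun j _ => hσ.comp (by fun_prop)
  have m2 : Continuous fun c : S → Pt ν => linForm ω t x y c :=
    continuous_linForm ω continuous_const continuous_const continuous_const continuous_id
  have m3 : Continuous fun c : S → Pt ν => ∑ j, ∑ k, t * kern ω t (c j) (c k) :=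
    continuous_finsetSum _ fun j _ => continuous_finsetSum _ fun k _ =>
      continuous_const.mul (continuous_kern ω continuous_const (continuous_apply j)
        (continuous_apply k))
  have m4 : Continuous fun c : S → Pt ν => Complex.exp (Complex.I * linForm ω t x y c -
        h * ((∑ j, ∑ k, t * kern ω t (c j) (c k) : ℝ) : ℂ)) := by fun_prop
  exact (m1.const_mul _).mul m4.measurable

/-- The growth rate B of the phase is a parameter: B = 2 serves for points of the strips, B = 0 for
real points, where it yields the initial value. -/
theorem norm_gasFun_le (hω : ∀ υ, 0 < ω υ) (hσ1 : ∀ ξ, ‖σ ξ‖ ≤ 1) (ht : 0 ≤ t) (hh : 0 ≤ h.re)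
    {c : S → Pt ν} (hc : InBox c) {B : ℝ}
    (hB : ∀ j, |(path ω t x y (c j)).im| ≤ B * ‖(c j).2‖) :
    ‖gasFun ω σ t x y h c‖ ≤ ∏ j, (t / ‖h‖ * Real.exp (B * ‖(c j).2‖)) := by
  rw [gasFun_eq, norm_mul, Finset.prod_mul_distrib, Finset.prod_const, Finset.card_univ, norm_mul,
    norm_pow, norm_div, Complex.norm_real, Real.norm_of_nonneg ht, Complex.norm_exp,
    ← Real.exp_sum]
  have h1 : |(linForm ω t x y c).im| ≤ ∑ j, B * ‖(c j).2‖ := by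
    rw [linForm, Complex.im_sum]
    exact (Finset.abs_sum_le_sum_abs _ _).trans (Finset.sum_le_sum fun j _ => hB j)
  have h2 := mul_nonneg hh (kern_sum_nonneg Finset.univ hω ht hc)
  have h3 : (Complex.I * linForm ω t x y c -
      h * ((∑ j, ∑ k, t * kern ω t (c j) (c k) : ℝ) : ℂ)).re ≤ ∑ j, B * ‖(c j).2‖ := by
    rw [Complex.sub_re, Complex.I_mul_re, Complex.re_mul_ofReal]
    linarith [neg_abs_le (linForm ω t x y c).im]
  have h4 : 0 ≤ (t / ‖h‖) ^ Fintype.card S := by positivity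
  refine mul_le_mul ?_ (Real.exp_le_exp.2 h3) (Real.exp_pos _).le h4
  exact mul_le_of_le_one_right h4 (norm_prod_density_le hσ1 c)

variable (hω : ∀ υ, 0 < ω υ) (hσ : Measurable σ) (hσ1 : ∀ ξ, ‖σ ξ‖ ≤ 1)
  (h5 : Integrable (fun ξ => Real.exp (5 * ‖ξ‖)) ρ)

theorem integrable_exp_mul_norm (h5 : Integrable (fun ξ => Real.exp (5 * ‖ξ‖)) ρ) {B : ℝ}
    (hB : B ≤ 5) : Integrable (fun p : Pt ν => Real.exp (B * ‖p.2‖)) (ptMeasure ρ) := by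
  refine (integrable_expNorm h5).1.mono' (by fun_prop) (Eventually.of_forall fun p => ?_)
  rw [Real.norm_of_nonneg (Real.exp_pos _).le]
  exact Real.exp_le_exp.2 (mul_le_mul_of_nonneg_right hB (norm_nonneg _))

include hω hσ hσ1 h5

theorem integrable_gasFun (ht : 0 ≤ t) (hh : 0 ≤ h.re) (hx : x ∈ strip ν 2)
    (hy : y ∈ strip ν 2) (S : Type) [Fintype S] :
    Integrable (gasFun (S := S) ω σ t x y h) (confMeasure ρ S) := by
  have h1 : Integrable (fun c : S → Pt ν => ∏ j, (t / ‖h‖ * Real.exp (2 * ‖(c j).2‖)))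
      (confMeasure ρ S) := Integrable.fintype_prod fun _ =>
    (integrable_exp_mul_norm h5 (by norm_num)).const_mul _
  refine h1.mono' (measurable_gasFun hσ S).aestronglyMeasurable ?_
  filter_upwards [ae_inBox ρ] with c hc
  exact norm_gasFun_le hω hσ1 ht hh hc fun j => abs_im_path_le ω t hx hy (hc j)

omit hσ in
theorem norm_gasInt_le (ht : 0 ≤ t) (hh : 0 ≤ h.re) {B : ℝ} (hB5 : B ≤ 5)
    (hB : ∀ p : Pt ν, p.1 ∈ Icc (0 : ℝ) 1 → |(path ω t x y p).im| ≤ B * ‖p.2‖) (n : ℕ) :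
    ‖gasInt ω ρ σ t x y h (Fin n)‖ ≤
      (t / ‖h‖ * ∫ ξ, Real.exp (B * ‖ξ‖) ∂ρ) ^ n := by
  have e : ∫ c : Fin n → Pt ν, ∏ j, (t / ‖h‖ * Real.exp (B * ‖(c j).2‖)) ∂confMeasure ρ (Fin n) =
      (t / ‖h‖ * ∫ ξ, Real.exp (B * ‖ξ‖) ∂ρ) ^ n := by
    rw [confMeasure, integral_fintype_prod_eq_prod (𝕜 := ℝ)
      (fun (_ : Fin n) (p : Pt ν) => t / ‖h‖ * Real.exp (B * ‖p.2‖)), Finset.prod_const,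
      Finset.card_univ, Fintype.card_fin, integral_const_mul]
    congr 2
    have := integral_prod_mul (μ := (volume : Measure ℝ).restrict (Icc 0 1)) (ν := ρ)
      (fun _ => (1 : ℝ)) (fun ξ => Real.exp (B * ‖ξ‖))
    simpa [ptMeasure] using this
  rw [← e]
  refine norm_integral_le_of_norm_le (Integrable.fintype_prod fun _ =>
    (integrable_exp_mul_norm h5 hB5).const_mul _) ?_
  filter_upwards [ae_inBox ρ] with c hc
  exact norm_gasFun_le hω hσ1 ht hh hc fun j => hB _ (hc j)

theorem integrable_clusterFun (ht : 0 ≤ t) (hh : 0 < h.re) (hx : x ∈ strip ν 2)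
    (hy : y ∈ strip ν 2) (S : Type) [Fintype S] [Nonempty S] :
    Integrable (clusterFun (S := S) ω σ t x y h) (confMeasure ρ S) := by
  obtain ⟨n, hn⟩ := Nat.exists_eq_succ_of_ne_zero (Fintype.card_ne_zero (α := S))
  let e : Fin (n + 1) ≃ S := (Fintype.equivFinOfCardEq hn).symm
  have h0 : h ≠ 0 := fun h0 => by simp [h0] at hh
  have h1 : Integrable (clusterFun (S := Fin (n + 1)) ω σ t x y h)
      (confMeasure ρ (Fin (n + 1))) := by
    rw [funext fun c => clusterFun_eq ω σ t x y h c h0]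
    refine (Integrable.mul_bdd (c := 1) ?_ (Finset.measurable_fun_prod _ fun j _ =>
        hσ.comp (by fun_prop)).aestronglyMeasurable
        (Eventually.of_forall fun c => norm_prod_density_le hσ1 c)).const_mul _
    exact (integrable_finsetSum _ fun g hg => integrable_integral_treeTerm hω h5
      (Or.inr ⟨ht, hh.le⟩) hx hy (Finset.mem_filter.1 hg).2).congr
        (Eventually.of_forall fun c => sum_integral_treeTerm_fin ω t x y h c)
  have h2 := (measurePreserving_confMeasure_comp ρ e).integrable_comp_of_integrable h1
  refine h2.congr (Eventually.of_forall fun c => ?_)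
  exact clusterFun_comp ω σ t x y h c e

/-- The integral of a cluster times a gas depends only on the size of the cluster, and the binomial
coefficient counts the sets of size m+1 containing the marked point. -/
theorem gasInt_of_card (ht : 0 ≤ t) (hh : 0 < h.re) (hx : x ∈ strip ν 2) (hy : y ∈ strip ν 2)
    {n : ℕ} (i0 : S) (hS : Fintype.card S = n + 1) :
    gasInt ω ρ σ t x y h S = ∑ m ∈ Finset.range (n + 1), (n.choose m : ℂ) *
      (clusterInt ω ρ σ t x y h (Fin (m + 1)) * gasInt ω ρ σ t x y h (Fin (n - m))) := by
  rw [gasInt_eq_sum i0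
    (fun I hI => have : Nonempty {i // i ∈ I} := ⟨⟨i0, hI⟩⟩
      integrable_clusterFun hω hσ hσ1 h5 ht hh hx hy _)
    (fun I => integrable_gasFun hω hσ hσ1 h5 ht hh.le hx hy _)]
  have h1 := sum_finset_card_mem i0 hS fun m =>
    clusterInt ω ρ σ t x y h (Fin m) * gasInt ω ρ σ t x y h (Fin (n + 1 - m))
  have e : ∀ m, gasInt ω ρ σ t x y h (Fin (n + 1 - (m + 1))) =
      gasInt ω ρ σ t x y h (Fin (n - m)) := fun m => by rw [Nat.add_sub_add_right]
  simp only [e] at h1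
  rw [← h1]
  refine Finset.sum_congr rfl fun I _ => ?_
  have c2 : Fintype.card {i // i ∉ I} = n + 1 - I.card := by
    rw [Fintype.card_subtype_compl, hS, Fintype.card_coe]
  rw [clusterInt_equiv ω ρ σ t x y h (Fintype.equivFinOfCardEq (Fintype.card_coe I)).symm,
    gasInt_equiv ω ρ σ t x y h (Fintype.equivFinOfCardEq c2).symm]

/-- The sum of the integrals of the Boltzmann factors over all configurations. -/
def gasSum (ω : Fin ν → ℝ) (ρ : Measure (EuclideanSpace ℝ (Fin ν))) [IsFiniteMeasure ρ]
    (σ : EuclideanSpace ℝ (Fin ν) → ℂ) (t : ℝ) (x y : Fin ν → ℂ) (h : ℂ) : ℂ :=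
  ∑' n : ℕ, gasInt ω ρ σ t x y h (Fin n) / (n.factorial : ℂ)

omit hσ in
theorem summable_gasInt (ht : 0 ≤ t) (hh : 0 ≤ h.re) (hx : x ∈ strip ν 2) (hy : y ∈ strip ν 2) :
    Summable fun n : ℕ => gasInt ω ρ σ t x y h (Fin n) / (n.factorial : ℂ) := by
  refine Summable.of_norm_bounded (Real.summable_pow_div_factorial
    (t / ‖h‖ * ∫ ξ, Real.exp (2 * ‖ξ‖) ∂ρ)) fun n => ?_
  rw [norm_div, Complex.norm_natCast]
  exact div_le_div_of_nonneg_right (norm_gasInt_le hω hσ1 h5 ht hh (B := 2) (by norm_num)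
    (fun p hp => abs_im_path_le ω t hx hy hp) n) (Nat.cast_nonneg _)

omit [IsFiniteMeasure ρ] hω hσ hσ1 h5 in
theorem clusterInt_eq (hh : h ≠ 0) (n : ℕ) :
    clusterInt ω ρ σ t x y h (Fin (n + 1)) / ((n + 1).factorial : ℂ) =
      t / h * treePart ω ρ σ t x y h n := by
  rw [clusterInt]
  simp only [clusterFun_eq ω σ t x y h _ hh]
  rw [integral_const_mul, treePart]
  ring

/-- The integrals of the gas and of the clusters, each divided by n!, satisfy the recursion of an
exponential. The cluster series converges by the tree bound, the gas series by positivity. -/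
theorem exp_treeSeries {T : ℝ} (hT : 0 < T) (hM : 2 * T ^ 2 * ∫ ξ, Real.exp (5 * ‖ξ‖) ∂ρ < 1)
    (ht : t ∈ Icc 0 T) (hh : 0 < h.re) (hx : x ∈ strip ν 2) (hy : y ∈ strip ν 2) :
    Complex.exp (t / h * treeSeries ω ρ σ t x y h) = gasSum ω ρ σ t x y h := by
  have h0 : h ≠ 0 := fun h0 => by simp [h0] at hh
  have hs := (hasSum_treePart hω hσ hσ1 h5 hT hM ⟨by linarith [ht.1], ht.2⟩
    (Or.inr ⟨ht.1, hh.le⟩) hx hy).mul_left ((t : ℂ) / h)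
  -- The empty cluster is excluded by hand; the term n+1 of v is t/h times the n-th part of the tree
  -- expansion.
  set v : ℕ → ℂ := fun n => if n = 0 then 0 else
    clusterInt ω ρ σ t x y h (Fin n) / (n.factorial : ℂ) with hv
  have hvs : HasSum v (t / h * treeSeries ω ρ σ t x y h) := by
    rw [← hasSum_nat_add_iff' 1]
    simp only [Finset.range_one, Finset.sum_singleton, hv, if_true, sub_zero, Nat.add_eq_zero_iff,
      one_ne_zero, and_false, if_false]
    simp only [clusterInt_eq h0]
    exact hs
  rw [← hvs.tsum_eq, gasSum]
  refine (tsum_eq_exp_tsum (summable_gasInt hω hσ1 h5 ht.1 hh.le hx hy) hvs.summable ?_ ?_ ?_).symm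
  · rw [gasInt]
    have : ∀ c : Fin 0 → Pt ν, gasFun ω σ t x y h c = 1 := fun c => by
      rw [gasFun_eq]; simp [linForm]
    simp [this, confMeasure, Measure.real]
  · intro n
    rw [gasInt_of_card hω hσ hσ1 h5 ht.1 hh hx hy (0 : Fin (n + 1)) (Fintype.card_fin _), Nat.factorial_succ, Finset.sum_div,
      Finset.mul_sum]
    refine Finset.sum_congr rfl fun m hm => ?_
    have hm' : m ≤ n := Nat.lt_succ_iff.1 (Finset.mem_range.1 hm)
    have hc : (n.choose m : ℂ) = n.factorial / (m.factorial * (n - m).factorial) :=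
      Nat.cast_choose ℂ hm'
    have f1 : (n.factorial : ℂ) ≠ 0 := by exact_mod_cast n.factorial_ne_zero
    have f2 : (m.factorial : ℂ) ≠ 0 := by exact_mod_cast m.factorial_ne_zero
    have f3 : ((n - m).factorial : ℂ) ≠ 0 := by exact_mod_cast (n - m).factorial_ne_zero
    have f4 : (n : ℂ) + 1 ≠ 0 := by exact_mod_cast n.succ_ne_zero
    have f5 : (m : ℂ) + 1 ≠ 0 := by exact_mod_cast m.succ_ne_zero
    simp only [hv, Nat.add_eq_zero_iff, one_ne_zero, and_false, if_false]
    rw [hc, Nat.factorial_succ]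
    push_cast
    field_simp
  · simp [hv]

end Exponential

/-! ### Differentiation of integrals over a growing cube -/

section Leibniz

open scoped Pointwise

variable {ι : Type} [Fintype ι]

theorem setIntegral_cube_scale (k : (ι → ℝ) → ℂ) {t : ℝ} (ht : 0 < t) :
    ∫ τ in Icc (0 : ι → ℝ) (fun _ => t), k τ =
      (t : ℂ) ^ Fintype.card ι * ∫ s in Icc (0 : ι → ℝ) 1, k (t • s) := by
  have h := Measure.setIntegral_comp_smul_of_pos (volume : Measure (ι → ℝ)) k (Icc 0 1) ht
  have h1 : t • Icc (0 : ι → ℝ) 1 = Icc (0 : ι → ℝ) (fun _ => t) := by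
    ext τ
    rw [mem_smul_set_iff_inv_smul_mem₀ ht.ne']
    simp only [mem_Icc, Pi.le_def, Pi.zero_apply, Pi.one_apply, Pi.smul_apply, smul_eq_mul]
    refine and_congr (forall_congr' fun i => ?_) (forall_congr' fun i => ?_)
    · rw [mul_nonneg_iff_of_pos_left (inv_pos.2 ht)]
    · rw [inv_mul_le_iff₀ ht, mul_one]
  rw [h1, Module.finrank_fintype_fun_eq_card] at h
  rw [h, Complex.real_smul]
  push_cast
  rw [← mul_assoc, mul_inv_cancel₀, one_mul]
  exact pow_ne_zero _ (by exact_mod_cast ht.ne')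

theorem continuous_setIntegral_cube {X : Type} [TopologicalSpace X] [FirstCountableTopology X]
    [LocallyCompactSpace X] {k : X → (ι → ℝ) → ℂ} (hk : Continuous fun p : X × (ι → ℝ) => k p.1 p.2) :
    Continuous fun z => ∫ s in Icc (0 : ι → ℝ) 1, k z s :=
  continuous_parametric_integral_of_continuous hk isCompact_Icc

variable [DecidableEq ι]

omit [Fintype ι] in
theorem continuous_consAt {X : Type} [TopologicalSpace X] (e : ι) {r : X → ℝ}
    {η : X → {i // i ≠ e} → ℝ} (hr : Continuous r) (hη : Continuous η) :
    Continuous fun z => consAt e (r z) (η z) := by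
  refine continuous_pi fun i => ?_
  unfold consAt
  split_ifs with h
  · exact hr
  · exact (continuous_apply _).comp hη

/-- Split according to the largest coordinate, the integral over the cube is a sum of primitives in
the value of that coordinate, and the fundamental theorem of calculus gives one boundary face for
each coordinate. -/
theorem hasDerivAt_setIntegral_cube_const {k : (ι → ℝ) → ℂ} (hk : Continuous k) {t : ℝ}
    (ht : 0 < t) :
    HasDerivAt (fun r => ∫ τ in Icc (0 : ι → ℝ) (fun _ => r), k τ)
      (∑ e, ∫ η in Icc (0 : {i // i ≠ e} → ℝ) (fun _ => t), k (consAt e t η)) t := by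
  rcases isEmpty_or_nonempty ι with hι | hι
  · have h1 : ∀ r : ℝ, Icc (0 : ι → ℝ) (fun _ => r) = univ := fun r => by
      ext τ; simp
    simp only [h1, Finset.univ_eq_empty, Finset.sum_empty]
    exact hasDerivAt_const _ _
  · have hg : ∀ e : ι, Continuous fun r : ℝ => (r : ℂ) ^ Fintype.card {i // i ≠ e} *
        ∫ s in Icc (0 : {i // i ≠ e} → ℝ) 1, k (consAt e r (r • s)) := fun e =>
      (Complex.continuous_ofReal.pow _).mul (continuous_setIntegral_cube
        (hk.comp (continuous_consAt e continuous_fst (continuous_fst.smul continuous_snd))))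
    have h2 : ∀ r, 0 < r → ∫ τ in Icc (0 : ι → ℝ) (fun _ => r), k τ = ∑ e, ∫ ρ in (0 : ℝ)..r,
        (ρ : ℂ) ^ Fintype.card {i // i ≠ e} *
          ∫ s in Icc (0 : {i // i ≠ e} → ℝ) 1, k (consAt e ρ (ρ • s)) := fun r hr => by
      rw [setIntegral_cube_eq_sum_max hr.le (hk.continuousOn.integrableOn_compact isCompact_Icc)]
      refine Finset.sum_congr rfl fun e _ => ?_
      refine intervalIntegral.integral_congr_ae (Eventually.of_forall fun ρ hρ => ?_)
      rw [uIoc_of_le hr.le] at hρ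
      exact setIntegral_cube_scale _ hρ.1
    have h3 : HasDerivAt (fun r => ∑ e, ∫ ρ in (0 : ℝ)..r,
        (ρ : ℂ) ^ Fintype.card {i // i ≠ e} *
          ∫ s in Icc (0 : {i // i ≠ e} → ℝ) 1, k (consAt e ρ (ρ • s)))
        (∑ e, ∫ η in Icc (0 : {i // i ≠ e} → ℝ) (fun _ => t), k (consAt e t η)) t := by
      refine HasDerivAt.fun_sum fun e _ => ?_
      rw [setIntegral_cube_scale _ ht]
      exact intervalIntegral.integral_hasDerivAt_right ((hg e).intervalIntegrable _ _)
        ((hg e).stronglyMeasurableAtFilter _ _) (hg e).continuousAt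
    exact h3.congr_of_eventuallyEq (by
      filter_upwards [lt_mem_nhds ht] with r hr using h2 r hr)

/-- The increment from t to r is split into the change of the integrand over the cube of side r,
equal to (r - t)K(r) with K continuous, and the change of the domain for the fixed integrand at time
t. -/
theorem hasDerivAt_setIntegral_cube {f f' : ℝ → (ι → ℝ) → ℂ} {t : ℝ} (ht : 0 < t)
    (hf : ∀ r, 0 < r → Continuous (f r))
    (hf' : ContinuousOn (fun p : ℝ × (ι → ℝ) => f' p.1 p.2) (Ioi 0 ×ˢ univ))
    (hd : ∀ r, 0 < r → ∀ τ, HasDerivAt (fun r => f r τ) (f' r τ) r) :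
    HasDerivAt (fun r => ∫ τ in Icc (0 : ι → ℝ) (fun _ => r), f r τ)
      ((∫ τ in Icc (0 : ι → ℝ) (fun _ => t), f' t τ) +
        ∑ e, ∫ η in Icc (0 : {i // i ≠ e} → ℝ) (fun _ => t), f t (consAt e t η)) t := by
  have hcube : ∀ r q, 0 < r → IntegrableOn (f r) (Icc (0 : ι → ℝ) (fun _ => q)) := fun r q hr =>
    (hf r hr).continuousOn.integrableOn_compact isCompact_Icc
  -- The clamp at t/2 keeps all arguments in the region r > 0 where f' is continuous, so that K is
  -- continuous on the whole line; near t it changes nothing.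
  set π : ℝ → ℝ := fun r => max r (t / 2) with hπ
  have hπ0 : ∀ r, 0 < π r := fun r => lt_max_of_lt_right (by positivity)
  have hπc : Continuous π := continuous_id.max continuous_const
  have hG : Continuous fun p : ℝ × (ι → ℝ) => f' (π p.1) p.2 :=
    hf'.comp_continuous ((hπc.comp continuous_fst).prodMk continuous_snd)
      fun p => ⟨hπ0 p.1, mem_univ _⟩
  set K : ℝ → ℂ := fun r => (π r : ℂ) ^ Fintype.card ι *
    ∫ s in Icc (0 : ι → ℝ) 1, ∫ u in Icc (0 : ℝ) 1, f' (π (t + u * (π r - t))) (π r • s) with hK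
  have hKc : Continuous K := by
    refine ((Complex.continuous_ofReal.comp hπc).pow _).mul (continuous_setIntegral_cube ?_)
    refine continuous_parametric_integral_of_continuous (X := ℝ × (ι → ℝ)) (Y := ℝ)
      (f := fun p u => f' (π (t + u * (π p.1 - t))) (π p.1 • p.2)) ?_ isCompact_Icc
    exact hG.comp (f := fun q : (ℝ × (ι → ℝ)) × ℝ =>
      ((t + q.2 * (π q.1.1 - t), π q.1.1 • q.1.2) : ℝ × (ι → ℝ))) (by fun_prop)
  have hπt : π t = t := max_eq_left (by linarith)
  have hKt : K t = ∫ τ in Icc (0 : ι → ℝ) (fun _ => t), f' t τ := by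
    rw [hK]
    simp only [hπt, sub_self, mul_zero, add_zero]
    rw [setIntegral_cube_scale _ ht]
    simp
  have hdiff : ∀ r, t / 2 < r → (∫ τ in Icc (0 : ι → ℝ) (fun _ => r), f r τ) -
      ∫ τ in Icc (0 : ι → ℝ) (fun _ => r), f t τ = (r - t) * K r := fun r hr => by
    have hr0 : 0 < r := by linarith
    have hπr : π r = r := max_eq_left hr.le
    rw [← integral_sub (hcube r r hr0) (hcube t r ht), setIntegral_cube_scale _ hr0, hK]
    simp only [hπr]
    rw [mul_left_comm, ← integral_const_mul ((r : ℂ) - t)]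
    congr 1
    refine integral_congr_ae (Eventually.of_forall fun s => ?_)
    simp only
    rw [integral_Icc_eq_integral_Ioc, ← intervalIntegral.integral_of_le zero_le_one,
      ← intervalIntegral.integral_const_mul]
    have hpos : ∀ u ∈ uIcc (0 : ℝ) 1, t / 2 ≤ t + u * (r - t) := fun u hu => by
      rw [uIcc_of_le zero_le_one] at hu
      nlinarith [hu.1, hu.2]
    have hD : ∀ u ∈ uIcc (0 : ℝ) 1, HasDerivAt (fun u => f (t + u * (r - t)) (r • s))
        (((r : ℂ) - t) * f' (π (t + u * (r - t))) (r • s)) u := fun u hu => by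
      have h1 : π (t + u * (r - t)) = t + u * (r - t) := max_eq_left (hpos u hu)
      have h2 : HasDerivAt (fun u : ℝ => t + u * (r - t)) (1 * (r - t)) u :=
        ((hasDerivAt_id u).mul_const (r - t)).const_add t
      have h3 := (hd (t + u * (r - t)) (by linarith [hpos u hu]) (r • s)).scomp u h2
      rw [h1]
      refine h3.congr_deriv ?_
      rw [one_mul, Complex.real_smul]
      push_cast
      rfl
    have hci : Continuous fun u : ℝ => ((r : ℂ) - t) * f' (π (t + u * (r - t))) (r • s) :=
      continuous_const.mul (hG.comp (f := fun u : ℝ => ((t + u * (r - t), r • s) : ℝ × (ι → ℝ)))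
        (by fun_prop))
    rw [intervalIntegral.integral_eq_sub_of_hasDerivAt hD (hci.intervalIntegrable _ _)]
    simp
  have h1 : HasDerivAt (fun r : ℝ => ((r : ℂ) - t) * K r) (K t) t := by
    rw [hasDerivAt_iff_tendsto_slope]
    refine (hKc.tendsto t).mono_left nhdsWithin_le_nhds |>.congr' ?_
    filter_upwards [self_mem_nhdsWithin] with r hr
    have hrt : (r : ℂ) - t ≠ 0 := by
      rw [← Complex.ofReal_sub]
      exact_mod_cast sub_ne_zero.2 hr
    rw [slope_def_module, sub_self, zero_mul, sub_zero, Complex.real_smul]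
    push_cast
    rw [← mul_assoc, inv_mul_cancel₀ hrt, one_mul]
  have h2 := h1.fun_add (hasDerivAt_setIntegral_cube_const (hf t ht) ht)
  rw [hKt] at h2
  refine h2.congr_of_eventuallyEq ?_
  filter_upwards [lt_mem_nhds (show t / 2 < t by linarith)] with r hr
  rw [← hdiff r hr]
  ring

end Leibniz

/-! ### The Boltzmann factor in unscaled times -/

section Flow

open scoped Classical

variable {ν : ℕ} (ω : Fin ν → ℝ) {S : Type} [Fintype S]

/-- The linear form of the Boltzmann factor in the unscaled times `τ`. -/
def flowLin (r : ℝ) (x y : Fin ν → ℂ) (τ : S → ℝ) (ξ : S → EuclideanSpace ℝ (Fin ν)) : ℂ :=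
  ∑ j, ∑ υ, (((Real.sinh (ω υ * τ j) / Real.sinh (ω υ * r) : ℝ) : ℂ) * x υ +
    ((Real.sinh (ω υ * (r - τ j)) / Real.sinh (ω υ * r) : ℝ) : ℂ) * y υ) * (ξ j υ : ℂ)

/-- The quadratic form of the Boltzmann factor in the unscaled times `τ`. -/
def flowQuad (r : ℝ) (τ : S → ℝ) (ξ : S → EuclideanSpace ℝ (Fin ν)) : ℝ :=
  ∑ j, ∑ k, ∑ υ, green (ω υ) r (τ j) (τ k) * ξ j υ * ξ k υ

/-- The derivative of `flowLin` in `x υ`. -/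
def flowCoord (υ : Fin ν) (r : ℝ) (τ : S → ℝ) (ξ : S → EuclideanSpace ℝ (Fin ν)) : ℝ :=
  ∑ j, Real.sinh (ω υ * τ j) / Real.sinh (ω υ * r) * ξ j υ

/-- The Boltzmann factor in the unscaled times `τ`. -/
def flow (r : ℝ) (x y : Fin ν → ℂ) (h : ℂ) (τ : S → ℝ) (ξ : S → EuclideanSpace ℝ (Fin ν)) : ℂ :=
  Complex.exp (Complex.I * flowLin ω r x y τ ξ - h * (flowQuad ω r τ ξ : ℂ))

/-- Minus twice the gradient in `x` of the harmonic phase. -/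
def drift (r : ℝ) (x y : Fin ν → ℂ) (υ : Fin ν) : ℂ :=
  ((-(ω υ * Real.cosh (ω υ * r) / Real.sinh (ω υ * r)) : ℝ) : ℂ) * x υ +
    ((ω υ / Real.sinh (ω υ * r) : ℝ) : ℂ) * y υ

/-- The factor of the derivative of `flow` in `r`. -/
def flowGen (r : ℝ) (x y : Fin ν → ℂ) (h : ℂ) (τ : S → ℝ)
    (ξ : S → EuclideanSpace ℝ (Fin ν)) : ℂ :=
  ∑ υ, (drift ω r x y υ * (Complex.I * (flowCoord ω υ r τ ξ : ℂ)) +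
    h * (Complex.I * (flowCoord ω υ r τ ξ : ℂ)) ^ 2)

/-- The derivative of `linForm` in `x υ`. -/
def coordSum (υ : Fin ν) (t : ℝ) (c : S → Pt ν) : ℝ := ∑ j, shRatio (ω υ) t (c j).1 * (c j).2 υ

variable {ω}

theorem shRatio_of_pos {a t : ℝ} (ha : 0 < a) (ht : 0 < t) (s : ℝ) :
    shRatio a t s = Real.sinh (a * (t * s)) / Real.sinh (a * t) := by
  rw [shRatio, if_neg (mul_pos ha ht).ne', mul_assoc]

theorem flowLin_smul (hω : ∀ υ, 0 < ω υ) {t : ℝ} (ht : 0 < t) (x y : Fin ν → ℂ) (s : S → ℝ)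
    (ξ : S → EuclideanSpace ℝ (Fin ν)) :
    flowLin ω t x y (t • s) ξ = linForm ω t x y (conf s ξ) := by
  refine Finset.sum_congr rfl fun j _ => Finset.sum_congr rfl fun υ _ => ?_
  simp only [qPath, conf, shRatio_of_pos (hω υ) ht, Pi.smul_apply, smul_eq_mul]
  rw [show t * (1 - s j) = t - t * s j by ring]

theorem flowQuad_smul (hω : ∀ υ, 0 < ω υ) {t : ℝ} (ht : 0 < t) (s : S → ℝ)
    (ξ : S → EuclideanSpace ℝ (Fin ν)) :
    flowQuad ω t (t • s) ξ = ∑ j, ∑ k, t * kern ω t (conf s ξ j) (conf s ξ k) := by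
  refine Finset.sum_congr rfl fun j _ => Finset.sum_congr rfl fun k _ => ?_
  rw [kern, Finset.mul_sum]
  refine Finset.sum_congr rfl fun υ _ => ?_
  simp only [conf, Pi.smul_apply, smul_eq_mul]
  rw [← mul_shKernel_eq_green (hω υ) ht]
  ring

theorem flowCoord_smul (hω : ∀ υ, 0 < ω υ) {t : ℝ} (ht : 0 < t) (υ : Fin ν) (s : S → ℝ)
    (ξ : S → EuclideanSpace ℝ (Fin ν)) :
    flowCoord ω υ t (t • s) ξ = coordSum ω υ t (conf s ξ) := by
  refine Finset.sum_congr rfl fun j _ => ?_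
  simp only [conf, shRatio_of_pos (hω υ) ht, Pi.smul_apply, smul_eq_mul]

theorem gasFun_conf (hω : ∀ υ, 0 < ω υ) {t : ℝ} (ht : 0 < t)
    (σ : EuclideanSpace ℝ (Fin ν) → ℂ) (x y : Fin ν → ℂ) (h : ℂ) (s : S → ℝ)
    (ξ : S → EuclideanSpace ℝ (Fin ν)) :
    gasFun ω σ t x y h (conf s ξ) =
      ((t : ℂ) / h) ^ Fintype.card S * (∏ j, σ (ξ j)) * flow ω t x y h (t • s) ξ := by
  rw [gasFun_eq, flow, flowLin_smul hω ht, flowQuad_smul hω ht]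
  rfl

theorem hasDerivAt_sinh_div {a r : ℝ} (ha : 0 < a) (hr : 0 < r) (b : ℝ) :
    HasDerivAt (fun r => b / Real.sinh (a * r))
      (-(a * Real.cosh (a * r) / Real.sinh (a * r)) * (b / Real.sinh (a * r))) r := by
  have h0 := (sinh_pos_of_pos ha hr).ne'
  refine ((hasDerivAt_const r b).fun_div (((hasDerivAt_id r).const_mul a).sinh) h0).congr_deriv ?_
  simp only [id]
  field_simp
  ring

theorem hasDerivAt_sinh_sub_div {a r : ℝ} (ha : 0 < a) (hr : 0 < r) (τ : ℝ) :
    HasDerivAt (fun r => Real.sinh (a * (r - τ)) / Real.sinh (a * r))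
      (a / Real.sinh (a * r) * (Real.sinh (a * τ) / Real.sinh (a * r))) r := by
  have h0 := (sinh_pos_of_pos ha hr).ne'
  have h1 : HasDerivAt (fun r => Real.sinh (a * (r - τ))) (Real.cosh (a * (r - τ)) * (a * 1)) r :=
    (((hasDerivAt_id r).sub_const τ).const_mul a).sinh
  have h2 : HasDerivAt (fun r => Real.sinh (a * r)) (Real.cosh (a * r) * (a * 1)) r :=
    ((hasDerivAt_id r).const_mul a).sinh
  refine (h1.fun_div h2 h0).congr_deriv ?_
  have h3 : Real.sinh (a * τ) = Real.sinh (a * r) * Real.cosh (a * (r - τ)) -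
      Real.cosh (a * r) * Real.sinh (a * (r - τ)) := by
    rw [← Real.sinh_sub]; congr 1; ring
  rw [h3]
  field_simp

theorem hasDerivAt_flowLin (hω : ∀ υ, 0 < ω υ) {r : ℝ} (hr : 0 < r) (x y : Fin ν → ℂ) (τ : S → ℝ)
    (ξ : S → EuclideanSpace ℝ (Fin ν)) :
    HasDerivAt (fun r => flowLin ω r x y τ ξ)
      (∑ υ, drift ω r x y υ * (flowCoord ω υ r τ ξ : ℂ)) r := by
  refine (HasDerivAt.fun_sum (u := Finset.univ) fun j _ => HasDerivAt.fun_sum (u := Finset.univ)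
    fun υ _ => (((hasDerivAt_sinh_div (hω υ) hr (Real.sinh (ω υ * τ j))).ofReal_comp.mul_const
      (x υ)).fun_add ((hasDerivAt_sinh_sub_div (hω υ) hr (τ j)).ofReal_comp.mul_const
        (y υ))).mul_const (ξ j υ : ℂ)).congr_deriv ?_
  rw [Finset.sum_comm]
  refine Finset.sum_congr rfl fun υ _ => ?_
  rw [flowCoord, drift]
  push_cast
  rw [Finset.mul_sum]
  refine Finset.sum_congr rfl fun j _ => ?_
  ring

theorem hasDerivAt_flowQuad (hω : ∀ υ, 0 < ω υ) {r : ℝ} (hr : 0 < r) (τ : S → ℝ)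
    (ξ : S → EuclideanSpace ℝ (Fin ν)) :
    HasDerivAt (fun r => flowQuad ω r τ ξ) (∑ υ, flowCoord ω υ r τ ξ ^ 2) r := by
  refine (HasDerivAt.fun_sum (u := Finset.univ) fun j _ => HasDerivAt.fun_sum (u := Finset.univ)
    fun k _ => HasDerivAt.fun_sum (u := Finset.univ) fun υ _ =>
      ((hasDerivAt_green (hω υ) hr (τ j) (τ k)).mul_const (ξ j υ)).mul_const (ξ k υ)).congr_deriv ?_
  have e : ∀ υ, flowCoord ω υ r τ ξ ^ 2 = ∑ j, ∑ k, Real.sinh (ω υ * τ j) * Real.sinh (ω υ * τ k) /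
      Real.sinh (ω υ * r) ^ 2 * ξ j υ * ξ k υ := fun υ => by
    rw [flowCoord, sq, Finset.sum_mul_sum]
    refine Finset.sum_congr rfl fun j _ => Finset.sum_congr rfl fun k _ => ?_
    ring
  simp only [e]
  rw [Finset.sum_comm (s := (Finset.univ : Finset (Fin ν)))]
  refine Finset.sum_congr rfl fun j _ => ?_
  rw [Finset.sum_comm (s := (Finset.univ : Finset (Fin ν)))]

/-- At fixed τ the linear form changes by the drift times its x-gradient, and the quadratic form by
the square of that gradient, the rank-one derivative. Since -h a² = h (ia)², the factor `flowGen` is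
the symbol of drift·∂_x + h ∂_x² on the Boltzmann factor. -/
theorem hasDerivAt_flow (hω : ∀ υ, 0 < ω υ) {r : ℝ} (hr : 0 < r) (x y : Fin ν → ℂ) (h : ℂ)
    (τ : S → ℝ) (ξ : S → EuclideanSpace ℝ (Fin ν)) :
    HasDerivAt (fun r => flow ω r x y h τ ξ) (flowGen ω r x y h τ ξ * flow ω r x y h τ ξ) r := by
  refine (((hasDerivAt_flowLin hω hr x y τ ξ).const_mul Complex.I).fun_sub
    ((hasDerivAt_flowQuad hω hr τ ξ).ofReal_comp.const_mul h)).cexp.congr_deriv ?_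
  rw [mul_comm]
  congr 1
  rw [flowGen]
  push_cast
  rw [Finset.mul_sum, Finset.mul_sum, ← Finset.sum_sub_distrib]
  refine Finset.sum_congr rfl fun υ _ => ?_
  rw [mul_pow, Complex.I_sq]
  ring

theorem continuousOn_flow (hω : ∀ υ, 0 < ω υ) (x y : Fin ν → ℂ) (h : ℂ)
    (ξ : S → EuclideanSpace ℝ (Fin ν)) :
    ContinuousOn (fun p : ℝ × (S → ℝ) => flow ω p.1 x y h p.2 ξ) (Ioi 0 ×ˢ univ) := by
  have h0 : ∀ υ, ∀ p ∈ (Ioi 0 ×ˢ univ : Set (ℝ × (S → ℝ))), Real.sinh (ω υ * p.1) ≠ 0 :=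
    fun υ p hp => (sinh_pos_of_pos (hω υ) hp.1).ne'
  have h1 : ∀ υ, ∀ p ∈ (Ioi 0 ×ˢ univ : Set (ℝ × (S → ℝ))), ω υ * Real.sinh (ω υ * p.1) ≠ 0 :=
    fun υ p hp => mul_ne_zero (hω υ).ne' (h0 υ p hp)
  have hL : ContinuousOn (fun p : ℝ × (S → ℝ) => flowLin ω p.1 x y p.2 ξ) (Ioi 0 ×ˢ univ) := by
    refine continuousOn_finsetSum _ fun j _ => continuousOn_finsetSum _ fun υ _ => ?_
    refine ((((Complex.continuous_ofReal.comp_continuousOn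
      (ContinuousOn.div (by fun_prop) (by fun_prop) (h0 υ))).mul continuousOn_const).add
      ((Complex.continuous_ofReal.comp_continuousOn
      (ContinuousOn.div (by fun_prop) (by fun_prop) (h0 υ))).mul continuousOn_const)).mul
        continuousOn_const)
  have hQ : ContinuousOn (fun p : ℝ × (S → ℝ) => flowQuad ω p.1 p.2 ξ) (Ioi 0 ×ˢ univ) := by
    refine continuousOn_finsetSum _ fun j _ => continuousOn_finsetSum _ fun k _ =>
      continuousOn_finsetSum _ fun υ _ => ?_
    exact ((ContinuousOn.div (by fun_prop) (by fun_prop) (h1 υ)).mul continuousOn_const).mul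
      continuousOn_const
  exact ((continuousOn_const.mul hL).sub
    (continuousOn_const.mul (Complex.continuous_ofReal.comp_continuousOn hQ))).cexp

theorem continuousOn_drift (hω : ∀ υ, 0 < ω υ) (x y : Fin ν → ℂ) (υ : Fin ν) :
    ContinuousOn (fun r => drift ω r x y υ) (Ioi 0) := by
  have h0 : ∀ r ∈ Ioi (0 : ℝ), Real.sinh (ω υ * r) ≠ 0 :=
    fun r hr => (sinh_pos_of_pos (hω υ) hr).ne'
  exact ((Complex.continuous_ofReal.comp_continuousOn
      (ContinuousOn.div (by fun_prop) (by fun_prop) h0).neg).mul continuousOn_const).add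
      ((Complex.continuous_ofReal.comp_continuousOn
      (ContinuousOn.div (by fun_prop) (by fun_prop) h0)).mul continuousOn_const)

theorem continuousOn_flowGen (hω : ∀ υ, 0 < ω υ) (x y : Fin ν → ℂ) (h : ℂ)
    (ξ : S → EuclideanSpace ℝ (Fin ν)) :
    ContinuousOn (fun p : ℝ × (S → ℝ) => flowGen ω p.1 x y h p.2 ξ) (Ioi 0 ×ˢ univ) := by
  have h0 : ∀ υ, ∀ p ∈ (Ioi 0 ×ˢ univ : Set (ℝ × (S → ℝ))), Real.sinh (ω υ * p.1) ≠ 0 :=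
    fun υ p hp => (sinh_pos_of_pos (hω υ) hp.1).ne'
  refine continuousOn_finsetSum _ fun υ _ => ?_
  have hc : ContinuousOn (fun p : ℝ × (S → ℝ) => Complex.I * (flowCoord ω υ p.1 p.2 ξ : ℂ))
      (Ioi 0 ×ˢ univ) := continuousOn_const.mul (Complex.continuous_ofReal.comp_continuousOn
    (continuousOn_finsetSum _ fun j _ =>
      (ContinuousOn.div (by fun_prop) (by fun_prop) (h0 υ)).mul continuousOn_const))
  exact (((continuousOn_drift hω x y υ).comp continuousOn_fst fun p hp => hp.1).mul hc).add
    (continuousOn_const.mul (hc.pow 2))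

theorem continuous_flow (hω : ∀ υ, 0 < ω υ) {r : ℝ} (hr : 0 < r) (x y : Fin ν → ℂ) (h : ℂ)
    (ξ : S → EuclideanSpace ℝ (Fin ν)) : Continuous fun τ : S → ℝ => flow ω r x y h τ ξ :=
  (continuousOn_flow hω x y h ξ).comp_continuous (f := fun τ : S → ℝ => (r, τ)) (by fun_prop)
    fun _ => ⟨hr, mem_univ _⟩


theorem sum_eq_add_subtype {M : Type} [AddCommMonoid M] (e : S) (F : S → M) :
    ∑ j, F j = F e + ∑ j : {j // j ≠ e}, F j := by
  have := Fintype.sum_subtype_add_sum_subtype (fun j => j = e) F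
  rw [← this]
  congr 1
  simp only [Finset.univ_unique, Finset.sum_singleton]
  exact congrArg F (default : {j // j = e}).2.symm

omit [Fintype S] in
theorem consAt_self (e : S) (r : ℝ) (η : {j // j ≠ e} → ℝ) : consAt e r η e = r := by
  simp [consAt]

omit [Fintype S] in
theorem consAt_subtype (e : S) (r : ℝ) (η : {j // j ≠ e} → ℝ) (j : {j // j ≠ e}) :
    consAt e r η j = η j := by
  simp [consAt, j.2]

/-- A particle at time t sits at the end point x of the path and contributes e^{ix·ξ}; the Dirichlet
condition makes the Green function vanish there, so it interacts with no other particle. -/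
theorem flow_consAt (hω : ∀ υ, 0 < ω υ) {t : ℝ} (ht : 0 < t) (x y : Fin ν → ℂ) (h : ℂ) (e : S)
    {η : {j // j ≠ e} → ℝ} (hη : ∀ j, η j ≤ t) (ξ : S → EuclideanSpace ℝ (Fin ν)) :
    flow ω t x y h (consAt e t η) ξ = Complex.exp (Complex.I * ∑ υ, x υ * (ξ e υ : ℂ)) *
      flow ω t x y h η fun j : {j // j ≠ e} => ξ j := by
  have h0 : ∀ υ, Real.sinh (ω υ * t) ≠ 0 := fun υ => (sinh_pos_of_pos (hω υ) ht).ne'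
  have g1 : ∀ υ τ, τ ≤ t → green (ω υ) t t τ = 0 := fun υ τ hτ => by
    simp [green, max_eq_left hτ]
  have g2 : ∀ υ τ, τ ≤ t → green (ω υ) t τ t = 0 := fun υ τ hτ => by
    simp [green, max_eq_right hτ]
  rw [flow, flow, ← Complex.exp_add]
  congr 1
  have e1 : flowLin ω t x y (consAt e t η) ξ = (∑ υ, x υ * (ξ e υ : ℂ)) +
      flowLin ω t x y η fun j : {j // j ≠ e} => ξ j := by
    rw [flowLin, sum_eq_add_subtype e]
    simp only [consAt_self, consAt_subtype]
    congr 1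
    refine Finset.sum_congr rfl fun υ _ => ?_
    simp [div_self (h0 υ)]
  have e2 : flowQuad ω t (consAt e t η) ξ = flowQuad ω t η fun j : {j // j ≠ e} => ξ j := by
    rw [flowQuad, sum_eq_add_subtype e]
    have z1 : ∑ k, ∑ υ, green (ω υ) t (consAt e t η e) (consAt e t η k) * ξ e υ * ξ k υ = 0 := by
      refine Finset.sum_eq_zero fun k _ => Finset.sum_eq_zero fun υ _ => ?_
      rw [consAt_self, g1, zero_mul, zero_mul]
      by_cases hk : k = e
      · rw [hk, consAt_self]
      · exact (consAt_subtype e t η ⟨k, hk⟩).trans_le (hη _)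
    rw [z1, zero_add]
    refine Finset.sum_congr rfl fun j _ => ?_
    rw [sum_eq_add_subtype e]
    simp only [consAt_self, consAt_subtype, g2 _ _ (hη j), zero_mul, Finset.sum_const_zero, zero_add]
  rw [e1, e2]
  ring

end Flow

/-! ### Derivatives of the gas sum in x -/

section Moments

open scoped Classical

variable {ν : ℕ} (ω : Fin ν → ℝ) (ρ : Measure (EuclideanSpace ℝ (Fin ν))) [IsFiniteMeasure ρ]
  (σ : EuclideanSpace ℝ (Fin ν) → ℂ) (υ : Fin ν) (k : ℕ) (t : ℝ) (x y : Fin ν → ℂ) (h : ℂ)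
  {S : Type} [Fintype S]

/-- The `k`-th derivative of the Boltzmann factor in `x υ`. -/
def momFun (c : S → Pt ν) : ℂ :=
  (Complex.I * (coordSum ω υ t c : ℂ)) ^ k * gasFun ω σ t x y h c

/-- The integral of the `k`-th derivative of the Boltzmann factor in `x υ`. -/
def momInt (S : Type) [Fintype S] : ℂ := ∫ c, momFun ω σ υ k t x y h c ∂confMeasure ρ S

/-- The `k`-th derivative of `gasSum` in `x υ`. -/
def momSum (ω : Fin ν → ℝ) (ρ : Measure (EuclideanSpace ℝ (Fin ν))) [IsFiniteMeasure ρ]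
    (σ : EuclideanSpace ℝ (Fin ν) → ℂ) (υ : Fin ν) (k : ℕ) (t : ℝ) (x y : Fin ν → ℂ) (h : ℂ) : ℂ :=
  ∑' n : ℕ, momInt ω ρ σ υ k t x y h (Fin n) / (n.factorial : ℂ)

theorem momSum_zero : momSum ω ρ σ υ 0 t x y h = gasSum ω ρ σ t x y h := by
  simp [momSum, gasSum, momInt, momFun, gasInt]

/-- The terms of `momSum`, before integration. -/
def momTerm (a : Σ n : ℕ, Fin n → Pt ν) : ℂ :=
  momFun ω σ υ k t x y h a.2 / (a.1.factorial : ℂ)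

variable {ω ρ σ υ k t x y h}

theorem abs_coordSum_le {c : S → Pt ν} (hc : InBox c) : |coordSum ω υ t c| ≤ totalNorm c := by
  refine (Finset.abs_sum_le_sum_abs _ _).trans (Finset.sum_le_sum fun j _ => ?_)
  have h1 := shRatio_mem (ω υ) t (hc j)
  rw [abs_mul, abs_of_nonneg h1.1]
  refine (mul_le_of_le_one_left (abs_nonneg _) (h1.2.trans (hc j).2)).trans ?_
  exact PiLp.norm_apply_le (c j).2 υ

theorem continuous_coordSum : Continuous fun c : S → Pt ν => coordSum ω υ t c :=
  continuous_finsetSum _ fun j _ => (continuous_shRatio _ continuous_const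
    (continuous_apply j).fst).mul (continuous_coord (continuous_apply j))

omit [IsFiniteMeasure ρ] in
theorem measurable_momFun (hσ : Measurable σ) (S : Type) [Fintype S] :
    Measurable (momFun (S := S) ω σ υ k t x y h) :=
  (((Complex.continuous_ofReal.comp continuous_coordSum).measurable.const_mul _).pow_const k).mul
    (measurable_gasFun hσ S)

omit [IsFiniteMeasure ρ] in
theorem aestronglyMeasurable_momTerm (hσ : Measurable σ) (n : ℕ) :
    AEStronglyMeasurable (fun c : Fin n → Pt ν => momTerm ω σ υ k t x y h ⟨n, c⟩)
      (confMeasure ρ (Fin n)) :=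
  ((measurable_momFun hσ (Fin n)).div_const (n.factorial : ℂ)).aestronglyMeasurable

theorem prod_mul_exp_totalNorm (q B : ℝ) (c : S → Pt ν) :
    Real.exp (totalNorm c) * ∏ j, (q * Real.exp (B * ‖(c j).2‖)) =
      ∏ j, (q * Real.exp ((B + 1) * ‖(c j).2‖)) := by
  rw [totalNorm, Real.exp_sum, ← Finset.prod_mul_distrib]
  refine Finset.prod_congr rfl fun j _ => ?_
  rw [add_mul, Real.exp_add, one_mul]
  ring

/-- The dominating function of the derivatives of the Boltzmann factor. -/
def momDom (q : ℝ) (c : S → Pt ν) : ℝ := ∏ j, (q * Real.exp (3 * ‖(c j).2‖))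

/-- A power of the total norm is absorbed by N^k ≤ k! e^N. This raises the rate from 2 to 3, still
below the available exponent 5. -/
theorem norm_momFun_le (hω : ∀ υ, 0 < ω υ) (hσ1 : ∀ ξ, ‖σ ξ‖ ≤ 1) (ht : 0 ≤ t) (hh : 0 ≤ h.re)
    (hx : x ∈ strip ν 2) (hy : y ∈ strip ν 2) {c : S → Pt ν} (hc : InBox c) :
    ‖momFun ω σ υ k t x y h c‖ ≤ k.factorial * momDom (t / ‖h‖) c := by
  have h1 := norm_gasFun_le hω hσ1 ht hh hc (B := 2) fun j => abs_im_path_le ω t hx hy (hc j)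
  rw [momFun, norm_mul, norm_pow, norm_mul, Complex.norm_I, one_mul, Complex.norm_real]
  have h2 : ‖coordSum ω υ t c‖ ^ k ≤ k.factorial * Real.exp (totalNorm c) :=
    (pow_le_pow_left₀ (norm_nonneg _) (abs_coordSum_le hc) k).trans
      (pow_le_factorial_mul_exp k (totalNorm_nonneg c))
  refine (mul_le_mul h2 h1 (norm_nonneg _) (by positivity)).trans_eq ?_
  rw [mul_assoc, prod_mul_exp_totalNorm, momDom]
  norm_num

theorem integrable_momDom (h5 : Integrable (fun ξ => Real.exp (5 * ‖ξ‖)) ρ) (q : ℝ) (S : Type)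
    [Fintype S] : Integrable (fun c : S → Pt ν => momDom q c) (confMeasure ρ S) :=
  Integrable.fintype_prod fun _ => (integrable_exp_mul_norm h5 (by norm_num)).const_mul _

theorem integral_ptMeasure_snd (f : EuclideanSpace ℝ (Fin ν) → ℝ) :
    ∫ p, f p.2 ∂ptMeasure ρ = ∫ ξ, f ξ ∂ρ := by
  have := integral_prod_mul (μ := (volume : Measure ℝ).restrict (Icc 0 1)) (ν := ρ)
    (fun _ => (1 : ℝ)) f
  simpa [ptMeasure] using this

theorem integral_momDom (q : ℝ) (n : ℕ) : ∫ c : Fin n → Pt ν, momDom q c ∂confMeasure ρ (Fin n) =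
    (q * ∫ ξ, Real.exp (3 * ‖ξ‖) ∂ρ) ^ n := by
  simp only [momDom]
  rw [confMeasure, integral_fintype_prod_eq_prod (𝕜 := ℝ)
    (fun (_ : Fin n) (p : Pt ν) => q * Real.exp (3 * ‖p.2‖)), Finset.prod_const,
    Finset.card_univ, Fintype.card_fin, integral_const_mul,
    integral_ptMeasure_snd fun ξ => Real.exp (3 * ‖ξ‖)]

section

variable (hω : ∀ υ, 0 < ω υ) (hσ : Measurable σ) (hσ1 : ∀ ξ, ‖σ ξ‖ ≤ 1)
  (h5 : Integrable (fun ξ => Real.exp (5 * ‖ξ‖)) ρ)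

include hω hσ hσ1 h5

theorem integrable_momFun (ht : 0 ≤ t) (hh : 0 ≤ h.re) (hx : x ∈ strip ν 2)
    (hy : y ∈ strip ν 2) (S : Type) [Fintype S] :
    Integrable (momFun (S := S) ω σ υ k t x y h) (confMeasure ρ S) := by
  refine ((integrable_momDom h5 (t / ‖h‖) S).const_mul (k.factorial : ℝ)).mono'
    (measurable_momFun hσ S).aestronglyMeasurable ?_
  filter_upwards [ae_inBox ρ] with c hc using norm_momFun_le hω hσ1 ht hh hx hy hc

omit hω hσ hσ1 in
theorem integrable_sigma_momDom {q : ℝ} (hq : 0 ≤ q) (C : ℝ) :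
    Integrable (fun a : Σ n : ℕ, Fin n → Pt ν => C * (momDom q a.2 / (a.1.factorial : ℝ)))
      (sigmaMeasure fun n => confMeasure ρ (Fin n)) := by
  refine Integrable.const_mul (integrable_sigmaMeasure (fun n =>
    (integrable_momDom h5 q (Fin n)).div_const (n.factorial : ℝ)) ?_) C
  refine (Real.summable_pow_div_factorial (q * ∫ ξ, Real.exp (3 * ‖ξ‖) ∂ρ)).congr fun n => ?_
  have h1 : ∀ c : Fin n → Pt ν, ‖momDom q c / (n.factorial : ℝ)‖ =
      momDom q c / (n.factorial : ℝ) := fun c => by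
    refine Real.norm_of_nonneg (div_nonneg ?_ (Nat.cast_nonneg _))
    exact Finset.prod_nonneg fun j _ => mul_nonneg hq (Real.exp_pos _).le
  simp only [h1]
  rw [integral_div, integral_momDom]

theorem hasSum_momSum (ht : 0 ≤ t) (hh : 0 ≤ h.re) (hx : x ∈ strip ν 2) (hy : y ∈ strip ν 2) :
    Integrable (fun a : Σ n : ℕ, Fin n → Pt ν =>
      momTerm ω σ υ k t x y h a)
      (sigmaMeasure fun n => confMeasure ρ (Fin n)) ∧
    HasSum (fun n => momInt ω ρ σ υ k t x y h (Fin n) / (n.factorial : ℂ))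
      (∫ a : Σ n : ℕ, Fin n → Pt ν, momTerm ω σ υ k t x y h a
        ∂(sigmaMeasure fun n => confMeasure ρ (Fin n))) := by
  have h1 : Integrable (fun a : Σ n : ℕ, Fin n → Pt ν =>
      momTerm ω σ υ k t x y h a)
      (sigmaMeasure fun n => confMeasure ρ (Fin n)) := by
    refine (integrable_sigma_momDom h5 (q := t / ‖h‖) (by positivity) (k.factorial : ℝ)).mono'
      (aestronglyMeasurable_sigmaMeasure fun n =>
        aestronglyMeasurable_momTerm hσ n) ?_
    rw [ae_sigmaMeasure]
    intro n
    filter_upwards [ae_inBox ρ] with c hc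
    rw [momTerm, norm_div, Complex.norm_natCast, ← mul_div_assoc]
    exact div_le_div_of_nonneg_right (norm_momFun_le hω hσ1 ht hh hx hy hc) (Nat.cast_nonneg _)
  refine ⟨h1, ?_⟩
  have h2 := hasSum_integral_sigmaMeasure h1
  refine h2.congr_fun fun n => ?_
  exact (integral_div (n.factorial : ℂ) _).symm

theorem summable_momInt (ht : 0 ≤ t) (hh : 0 ≤ h.re) (hx : x ∈ strip ν 2) (hy : y ∈ strip ν 2) :
    HasSum (fun n => momInt ω ρ σ υ k t x y h (Fin n) / (n.factorial : ℂ))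
      (momSum ω ρ σ υ k t x y h) :=
  (hasSum_momSum hω hσ hσ1 h5 ht hh hx hy).2.summable.hasSum

omit [IsFiniteMeasure ρ] hω hσ hσ1 h5 in
theorem hasDerivAt_momFun_update (z : ℂ) (c : S → Pt ν) :
    HasDerivAt (fun z => momFun ω σ υ k t (Function.update x υ z) y h c)
      (momFun ω σ υ (k + 1) t (Function.update x υ z) y h c) z := by
  have h1 : HasDerivAt (fun z => linForm ω t (Function.update x υ z) y c)
      (coordSum ω υ t c : ℂ) z := by
    have h2 : ∀ z, linForm ω t (Function.update x υ z) y c = linForm ω t x y c +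
        (z - x υ) * (coordSum ω υ t c : ℂ) := fun z => by
      rw [linForm, linForm, coordSum]
      push_cast
      rw [Finset.mul_sum, ← Finset.sum_add_distrib]
      refine Finset.sum_congr rfl fun j _ => ?_
      rw [path, path, ← sub_eq_iff_eq_add', ← Finset.sum_sub_distrib,
        Finset.sum_eq_single υ (fun υ' _ hne => by simp [qPath, Function.update_of_ne hne])
          (fun hne => absurd (Finset.mem_univ _) hne)]
      simp only [qPath, Function.update_self]
      ring
    simp only [h2]
    refine (((hasDerivAt_id z).sub_const (x υ)).mul_const _).const_add _ |>.congr_deriv ?_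
    rw [one_mul]
  simp only [momFun, gasFun_eq]
  refine (((((h1.const_mul Complex.I).sub_const _).cexp).const_mul _).const_mul _).congr_deriv ?_
  rw [pow_succ]
  ring

/-- Each derivative in x_υ multiplies the Boltzmann factor by i times the coordinate sum, hence
passes from the moment k to k+1; the exponential bound at rate 3 is uniform over the strip and
dominates. -/
theorem hasDerivAt_momSum_update (ht : 0 ≤ t) (hh : 0 ≤ h.re) {z : ℂ}
    (hx : Function.update x υ z ∈ strip ν 2) (hy : y ∈ strip ν 2) :
    HasDerivAt (fun z => momSum ω ρ σ υ k t (Function.update x υ z) y h)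
      (momSum ω ρ σ υ (k + 1) t (Function.update x υ z) y h) z := by
  have hopen : {z | Function.update x υ z ∈ strip ν 2} ∈ 𝓝 z :=
    ((isOpen_strip ν 2).preimage (by fun_prop : Continuous fun z => Function.update x υ z)).mem_nhds hx
  have h1 := hasDerivAt_integral_of_dominated_loc_of_deriv_le
    (μ := sigmaMeasure fun n => confMeasure ρ (Fin n))
    (F := fun z (a : Σ n : ℕ, Fin n → Pt ν) =>
      momTerm ω σ υ k t (Function.update x υ z) y h a)
    (F' := fun z (a : Σ n : ℕ, Fin n → Pt ν) =>
      momTerm ω σ υ (k + 1) t (Function.update x υ z) y h a)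
    (bound := fun a => ((k + 1).factorial : ℝ) * (momDom (t / ‖h‖) a.2 / (a.1.factorial : ℝ)))
    hopen (Eventually.of_forall fun z => aestronglyMeasurable_sigmaMeasure fun n =>
        aestronglyMeasurable_momTerm hσ n)
    (hasSum_momSum hω hσ hσ1 h5 ht hh hx hy).1
    (hasSum_momSum hω hσ hσ1 h5 ht hh hx hy).1.aestronglyMeasurable
    (by
      rw [ae_sigmaMeasure]
      intro n
      filter_upwards [ae_inBox ρ] with c hc z hz
      rw [momTerm, norm_div, Complex.norm_natCast, ← mul_div_assoc]
      exact div_le_div_of_nonneg_right (norm_momFun_le hω hσ1 ht hh hz hy hc) (Nat.cast_nonneg _))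
    (integrable_sigma_momDom h5 (by positivity) _)
    (Eventually.of_forall fun a z _ => (hasDerivAt_momFun_update z a.2).div_const (a.1.factorial : ℂ))
  have h2 := h1.2
  rw [(hasSum_momSum hω hσ hσ1 h5 ht hh hx hy).2.tsum_eq.symm] at h2
  refine h2.congr_of_eventuallyEq ?_
  filter_upwards [hopen] with z hz
  exact (hasSum_momSum hω hσ hσ1 h5 ht hh hz hy).2.tsum_eq

end

end Moments

/-! ### Integrals over times in [0,t] and their derivative in t -/

section CubeIntegral

open scoped Classical

variable {ν : ℕ} (ω : Fin ν → ℝ) {ρ : Measure (EuclideanSpace ℝ (Fin ν))} [IsFiniteMeasure ρ]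
  {σ : EuclideanSpace ℝ (Fin ν) → ℂ} (t : ℝ) (x y : Fin ν → ℂ) (h : ℂ)
  {S : Type} [Fintype S]

/-- The integral of the Boltzmann factor over the times in `[0, t]`. -/
def cubeInt (ξ : S → EuclideanSpace ℝ (Fin ν)) : ℂ :=
  ∫ τ in Icc (0 : S → ℝ) (fun _ => t), flow ω t x y h τ ξ

/-- The part of the derivative of `cubeInt` from the boundary of the cube. -/
def cubeBdry (ξ : S → EuclideanSpace ℝ (Fin ν)) : ℂ :=
  ∑ e, Complex.exp (Complex.I * ∑ υ, x υ * (ξ e υ : ℂ)) *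
    cubeInt ω t x y h fun j : {j // j ≠ e} => ξ j

/-- The part of the derivative of `cubeInt` from the interior of the cube. -/
def cubeBulk (ξ : S → EuclideanSpace ℝ (Fin ν)) : ℂ :=
  ∫ τ in Icc (0 : S → ℝ) (fun _ => t), flowGen ω t x y h τ ξ * flow ω t x y h τ ξ

variable {ω t x y h}

theorem hasDerivAt_cubeInt (hω : ∀ υ, 0 < ω υ) (ht : 0 < t) (ξ : S → EuclideanSpace ℝ (Fin ν)) :
    HasDerivAt (fun r => cubeInt ω r x y h ξ) (cubeBulk ω t x y h ξ + cubeBdry ω t x y h ξ) t := by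
  have h1 := hasDerivAt_setIntegral_cube (f := fun r τ => flow ω r x y h τ ξ)
    (f' := fun r τ => flowGen ω r x y h τ ξ * flow ω r x y h τ ξ) ht
    (fun r hr => continuous_flow hω hr x y h ξ)
    ((continuousOn_flowGen hω x y h ξ).mul (continuousOn_flow hω x y h ξ))
    fun r hr τ => hasDerivAt_flow hω hr x y h τ ξ
  refine h1.congr_deriv ?_
  rw [cubeBulk, cubeBdry]
  congr 1
  refine Finset.sum_congr rfl fun e _ => ?_
  rw [cubeInt, ← integral_const_mul]
  exact setIntegral_congr_fun measurableSet_Icc fun η hη => flow_consAt hω ht x y h e hη.2 ξ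

theorem norm_flow_le (hω : ∀ υ, 0 < ω υ) (ht : 0 < t) (hh : 0 ≤ h.re) (hx : x ∈ strip ν 2)
    (hy : y ∈ strip ν 2) {τ : S → ℝ} (hτ : τ ∈ Icc (0 : S → ℝ) (fun _ => t))
    (ξ : S → EuclideanSpace ℝ (Fin ν)) :
    ‖flow ω t x y h τ ξ‖ ≤ Real.exp (2 * ∑ j, ‖ξ j‖) ∧
      ∀ υ, |flowCoord ω υ t τ ξ| ≤ ∑ j, ‖ξ j‖ := by
  obtain ⟨s, hs⟩ : ∃ s : S → ℝ, t • s = τ := ⟨t⁻¹ • τ, by rw [smul_inv_smul₀ ht.ne']⟩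
  have hc : InBox (conf s ξ) := fun j => by
    have h1 := hτ.1 j
    have h2 := hτ.2 j
    rw [← hs] at h1 h2
    simp only [Pi.smul_apply, smul_eq_mul, Pi.zero_apply] at h1 h2
    exact ⟨by simpa [conf] using nonneg_of_mul_nonneg_right h1 ht,
      by simpa [conf] using (mul_le_iff_le_one_right ht).1 h2⟩
  rw [← hs]
  constructor
  · rw [flow, Complex.norm_exp, flowLin_smul hω ht, flowQuad_smul hω ht, Real.exp_le_exp,
      Complex.sub_re, Complex.I_mul_re, Complex.re_mul_ofReal]
    have h2 := mul_nonneg hh (kern_sum_nonneg Finset.univ hω ht.le hc)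
    have h1 : |(linForm ω t x y (conf s ξ)).im| ≤ 2 * ∑ j, ‖ξ j‖ := by
      rw [linForm, Complex.im_sum, Finset.mul_sum]
      exact (Finset.abs_sum_le_sum_abs _ _).trans (Finset.sum_le_sum fun j _ =>
        abs_im_path_le ω t hx hy (hc j))
    linarith [neg_abs_le (linForm ω t x y (conf s ξ)).im]
  · intro υ
    rw [flowCoord_smul hω ht]
    exact abs_coordSum_le hc

theorem norm_setIntegral_cube_le (ht : 0 ≤ t) {f : (S → ℝ) → ℂ} {C : ℝ}
    (hf : ∀ τ ∈ Icc (0 : S → ℝ) (fun _ => t), ‖f τ‖ ≤ C) :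
    ‖∫ τ in Icc (0 : S → ℝ) (fun _ => t), f τ‖ ≤ C * t ^ Fintype.card S := by
  have h1 := norm_setIntegral_le_of_norm_le_const (μ := volume) (C := C)
    isCompact_Icc.measure_lt_top hf
  refine h1.trans_eq ?_
  rw [Measure.real, show (0 : S → ℝ) = fun _ => 0 from rfl, Real.volume_Icc_pi_toReal fun _ => ht]
  simp

theorem norm_cubeInt_le (hω : ∀ υ, 0 < ω υ) (ht : 0 < t) (hh : 0 ≤ h.re) (hx : x ∈ strip ν 2)
    (hy : y ∈ strip ν 2) (ξ : S → EuclideanSpace ℝ (Fin ν)) :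
    ‖cubeInt ω t x y h ξ‖ ≤ Real.exp (2 * ∑ j, ‖ξ j‖) * t ^ Fintype.card S :=
  norm_setIntegral_cube_le ht.le fun _ hτ => (norm_flow_le hω ht hh hx hy hτ ξ).1

theorem norm_flowGen_le {D : ℝ} (hD : ∀ υ, ‖drift ω t x y υ‖ ≤ D) {τ : S → ℝ}
    {ξ : S → EuclideanSpace ℝ (Fin ν)} {N : ℝ} (hN : ∀ υ, |flowCoord ω υ t τ ξ| ≤ N) (hN0 : 0 ≤ N) :
    ‖flowGen ω t x y h τ ξ‖ ≤ (ν * (|D| + 2 * ‖h‖)) * Real.exp N := by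
  have h1 : N ≤ Real.exp N := by linarith [Real.add_one_le_exp N]
  have h2 : N ^ 2 ≤ 2 * Real.exp N := by simpa using pow_le_factorial_mul_exp 2 hN0
  have h3 : ∀ υ ∈ Finset.univ, ‖drift ω t x y υ * (Complex.I * (flowCoord ω υ t τ ξ : ℂ)) +
      h * (Complex.I * (flowCoord ω υ t τ ξ : ℂ)) ^ 2‖ ≤ (|D| + 2 * ‖h‖) * Real.exp N := by
    intro υ _
    refine (norm_add_le _ _).trans ?_
    rw [norm_mul, norm_mul, norm_mul, norm_pow, norm_mul, Complex.norm_I, one_mul,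
      Complex.norm_real, Real.norm_eq_abs, add_mul]
    refine add_le_add (mul_le_mul ((hD υ).trans (le_abs_self _)) ((hN υ).trans h1)
      (abs_nonneg _) (abs_nonneg _)) ?_
    rw [mul_comm 2 ‖h‖, mul_assoc]
    exact mul_le_mul_of_nonneg_left ((pow_le_pow_left₀ (abs_nonneg _) (hN υ) 2).trans h2)
      (norm_nonneg _)
  refine (norm_sum_le_of_le _ h3).trans_eq ?_
  simp [mul_assoc]

/-- At t = 0 and s = 1 the path is the point x itself, so the bound for paths applies with any
frequencies ω. -/
theorem norm_exp_potential_le (hx : x ∈ strip ν 2) (ξ : EuclideanSpace ℝ (Fin ν)) :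
    ‖Complex.exp (Complex.I * ∑ υ, x υ * (ξ υ : ℂ))‖ ≤ Real.exp (2 * ‖ξ‖) := by
  have h1 := abs_im_path_le (fun _ => (1 : ℝ)) (0 : ℝ) hx hx (p := (1, ξ)) ⟨zero_le_one, le_rfl⟩
  have h2 : path (fun _ => (1 : ℝ)) 0 x x (1, ξ) = ∑ υ, x υ * (ξ υ : ℂ) := by
    simp [path, qPath, shRatio]
  rw [h2] at h1
  rw [Complex.norm_exp, Complex.I_mul_re, Real.exp_le_exp]
  linarith [neg_abs_le (∑ υ, x υ * (ξ υ : ℂ)).im]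

theorem natCast_mul_pow_le {r b : ℝ} (hr : 0 ≤ r) (hb : 0 < b) (hrb : r ≤ b) (n : ℕ) :
    n * r ^ (n - 1) ≤ b⁻¹ * (2 * b) ^ n := by
  rcases n with _ | n
  · simpa using hb.le
  · have h1 : ((n + 1 : ℕ) : ℝ) ≤ 2 ^ (n + 1) := by exact_mod_cast (Nat.lt_two_pow_self).le
    rw [Nat.add_sub_cancel]
    calc ((n + 1 : ℕ) : ℝ) * r ^ n ≤ 2 ^ (n + 1) * b ^ n :=
          mul_le_mul h1 (pow_le_pow_left₀ hr hrb n) (by positivity) (by positivity)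
      _ = _ := by rw [mul_pow, pow_succ b]; field_simp

theorem norm_cubeBdry_le (hω : ∀ υ, 0 < ω υ) (ht : 0 < t) (hh : 0 ≤ h.re) (hx : x ∈ strip ν 2)
    (hy : y ∈ strip ν 2) (ξ : S → EuclideanSpace ℝ (Fin ν)) :
    ‖cubeBdry ω t x y h ξ‖ ≤
      (Fintype.card S) * t ^ (Fintype.card S - 1) * Real.exp (2 * ∑ j, ‖ξ j‖) := by
  have h3 : ∀ e ∈ Finset.univ, ‖Complex.exp (Complex.I * ∑ υ, x υ * (ξ e υ : ℂ)) *
      cubeInt ω t x y h fun j : {j // j ≠ e} => ξ j‖ ≤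
      t ^ (Fintype.card S - 1) * Real.exp (2 * ∑ j, ‖ξ j‖) := by
    intro e _
    rw [norm_mul]
    have h4 := norm_cubeInt_le hω ht hh hx hy fun j : {j // j ≠ e} => ξ j
    refine (mul_le_mul (norm_exp_potential_le hx (ξ e)) h4 (norm_nonneg _)
      (Real.exp_pos _).le).trans_eq ?_
    rw [sum_eq_add_subtype e, mul_add, Real.exp_add]
    have h5 : Fintype.card {j // j ≠ e} = Fintype.card S - 1 := by simp
    rw [h5]
    ring
  refine (norm_sum_le_of_le _ h3).trans_eq ?_
  simp [mul_assoc]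

/-- The bound for the derivative of `cubeInt`. -/
theorem exists_norm_deriv_cubeInt_le (hω : ∀ υ, 0 < ω υ) (ht : 0 < t) (hh : 0 ≤ h.re)
    (hx : x ∈ strip ν 2) (hy : y ∈ strip ν 2) :
    ∃ C, 0 ≤ C ∧ ∀ r ∈ Icc (t / 2) (2 * t), ∀ (n : ℕ) (ξ : Fin n → EuclideanSpace ℝ (Fin ν)),
      ‖cubeInt ω r x y h ξ‖ ≤ C * (4 * t) ^ n * Real.exp (3 * ∑ j, ‖ξ j‖) ∧
      ‖cubeBulk ω r x y h ξ + cubeBdry ω r x y h ξ‖ ≤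
        C * (4 * t) ^ n * Real.exp (3 * ∑ j, ‖ξ j‖) := by
  have hD : ∀ υ, ∃ D, ∀ r ∈ Icc (t / 2) (2 * t), ‖drift ω r x y υ‖ ≤ D := fun υ =>
    isCompact_Icc.exists_bound_of_continuousOn ((continuousOn_drift hω x y υ).mono fun r hr =>
      (half_pos ht).trans_le hr.1)
  choose D hD using hD
  set D0 : ℝ := ∑ υ, |D υ| with hD0
  have hD1 : ∀ r ∈ Icc (t / 2) (2 * t), ∀ υ, ‖drift ω r x y υ‖ ≤ D0 := fun r hr υ =>
    ((hD υ r hr).trans (le_abs_self _)).trans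
      (Finset.single_le_sum (f := fun υ => |D υ|) (fun _ _ => abs_nonneg _) (Finset.mem_univ υ))
  set C0 : ℝ := ν * (|D0| + 2 * ‖h‖) with hC0
  have hC0' : 0 ≤ C0 := by positivity
  have hexp : ∀ N : ℝ, 0 ≤ N → Real.exp (2 * N) ≤ Real.exp (3 * N) := fun N hN =>
    Real.exp_le_exp.2 (by linarith)
  -- The terms are for the integral itself, the bulk and the boundary. The boundary has n faces, and
  -- n r^{n-1} ≤ (2t)⁻¹ (4t)^n for r ≤ 2t because n ≤ 2^n.
  refine ⟨1 + C0 + (2 * t)⁻¹, by positivity, fun r hr n ξ => ?_⟩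
  have hr0 : 0 < r := (half_pos ht).trans_le hr.1
  set N : ℝ := ∑ j, ‖ξ j‖ with hN
  have hN0 : 0 ≤ N := Finset.sum_nonneg fun _ _ => norm_nonneg _
  have hpow : r ^ n ≤ (4 * t) ^ n := pow_le_pow_left₀ hr0.le (by linarith [hr.2]) n
  have hone : (1 : ℝ) ≤ 1 + C0 + (2 * t)⁻¹ := by
    have : 0 < (2 * t)⁻¹ := by positivity
    linarith
  constructor
  · refine (norm_cubeInt_le hω hr0 hh hx hy ξ).trans ?_
    rw [Fintype.card_fin, mul_comm]
    refine mul_le_mul (hpow.trans (le_mul_of_one_le_left (by positivity) hone)) (hexp N hN0)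
      (Real.exp_pos _).le (by positivity)
  · have h1 : ‖cubeBulk ω r x y h ξ‖ ≤ C0 * (4 * t) ^ n * Real.exp (3 * N) := by
      have h2 : ‖cubeBulk ω r x y h ξ‖ ≤ (C0 * Real.exp (3 * N)) * r ^ Fintype.card (Fin n) := by
        refine norm_setIntegral_cube_le hr0.le fun τ hτ => ?_
        have h3 := norm_flow_le hω hr0 hh hx hy hτ ξ
        rw [norm_mul]
        refine (mul_le_mul (norm_flowGen_le (hD1 r hr) h3.2 hN0) h3.1 (norm_nonneg _)
          (by positivity)).trans_eq ?_
        rw [mul_assoc, ← Real.exp_add]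
        congr 2
        ring
      refine h2.trans ?_
      rw [Fintype.card_fin, mul_right_comm]
      gcongr
    have h4 : ‖cubeBdry ω r x y h ξ‖ ≤ (2 * t)⁻¹ * (4 * t) ^ n * Real.exp (3 * N) := by
      refine (norm_cubeBdry_le hω hr0 hh hx hy ξ).trans ?_
      rw [Fintype.card_fin]
      refine mul_le_mul ?_ (hexp N hN0) (Real.exp_pos _).le (by positivity)
      refine (natCast_mul_pow_le hr0.le (by positivity) hr.2 n).trans_eq ?_
      ring
    have h5 : 0 ≤ (4 * t) ^ n * Real.exp (3 * N) := by positivity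
    refine (norm_add_le _ _).trans ?_
    nlinarith

end CubeIntegral

/-! ### Fubini with the times inside and the frequencies outside -/

section CubeFubini

open scoped Classical

variable {ν : ℕ} {ω : Fin ν → ℝ} {ρ : Measure (EuclideanSpace ℝ (Fin ν))} [IsFiniteMeasure ρ]
  {σ : EuclideanSpace ℝ (Fin ν) → ℂ} {t : ℝ} {x y : Fin ν → ℂ} {h : ℂ}
  {S : Type} [Fintype S]

/-- The weight of the frequencies. -/
def freqWeight (σ : EuclideanSpace ℝ (Fin ν) → ℂ) (h : ℂ) (ξ : S → EuclideanSpace ℝ (Fin ν)) : ℂ :=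
  (h ^ Fintype.card S)⁻¹ * ∏ j, σ (ξ j)

/-- The substitution τ = ts absorbs the t^n of the activities. The remaining weight of the
frequencies does not depend on t, so the time derivative falls on the cube integral alone. -/
theorem integral_conf_smul {Φ : (S → Pt ν) → ℂ} {G : (S → ℝ) → (S → EuclideanSpace ℝ (Fin ν)) → ℂ}
    (ht : 0 < t) (hΦ : Integrable Φ (confMeasure ρ S)) (hG : ∀ s ξ, Φ (conf s ξ) =
      ((t : ℂ) / h) ^ Fintype.card S * (∏ j, σ (ξ j)) * G (t • s) ξ) :
    Integrable (fun ξ : S → EuclideanSpace ℝ (Fin ν) => freqWeight σ h ξ * ∫ τ in Icc (0 : S → ℝ) (fun _ => t), G τ ξ)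
      (Measure.pi fun _ => ρ) ∧
    ∫ ξ : S → EuclideanSpace ℝ (Fin ν), freqWeight σ h ξ *
        (∫ τ in Icc (0 : S → ℝ) (fun _ => t), G τ ξ) ∂(Measure.pi fun _ => ρ) =
      ∫ c, Φ c ∂confMeasure ρ S := by
  have hm := measurePreserving_conf ρ S
  have key : (fun ξ : S → EuclideanSpace ℝ (Fin ν) => freqWeight σ h ξ *
      ∫ τ in Icc (0 : S → ℝ) (fun _ => t), G τ ξ) =
      fun ξ => ∫ s in Icc (0 : S → ℝ) 1, Φ (conf s ξ) := by
    funext ξ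
    simp only [hG]
    rw [integral_const_mul, setIntegral_cube_scale _ ht, freqWeight, div_pow]
    ring
  have hi := hm.integrable_comp_of_integrable hΦ
  rw [key]
  refine ⟨hi.integral_prod_right, ?_⟩
  have h1 := integral_prod_symm _ hi
  refine h1.symm.trans ?_
  have h2 : AEStronglyMeasurable Φ
      (Measure.map (fun p : (S → ℝ) × (S → EuclideanSpace ℝ (Fin ν)) => conf p.1 p.2)
        ((volume.restrict (Icc 0 1)).prod (Measure.pi fun _ => ρ))) := by
    rw [hm.map_eq]; exact hΦ.1
  rw [← hm.map_eq, integral_map hm.measurable.aemeasurable h2]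
  rfl

theorem measurePreserving_pi_split (p : S → Prop) [Fintype {i // p i}] [Fintype {i // ¬ p i}] :
    MeasurePreserving (fun ξ : S → EuclideanSpace ℝ (Fin ν) =>
      ((fun i : {i // p i} => ξ i), fun i : {i // ¬ p i} => ξ i)) (Measure.pi fun _ => ρ)
      ((Measure.pi fun _ => ρ).prod (Measure.pi fun _ => ρ)) := by
  have h1 : MeasurePreserving (fun ξ : S → EuclideanSpace ℝ (Fin ν) =>
      ((fun i : {i // p i} => ξ i), fun i : {i // ¬ p i} => ξ i)) (Measure.pi fun _ => ρ)
      ((@Measure.pi {i // p i} _ (Subtype.fintype _) _ fun _ => ρ).prod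
        (@Measure.pi {i // ¬ p i} _ (Subtype.fintype _) _ fun _ => ρ)) :=
    measurePreserving_piEquivPiSubtypeProd (fun _ : S => ρ) p
  convert h1

variable (hω : ∀ υ, 0 < ω υ) (hσ : Measurable σ) (hσ1 : ∀ ξ, ‖σ ξ‖ ≤ 1)
  (h5 : Integrable (fun ξ => Real.exp (5 * ‖ξ‖)) ρ) (ht : 0 < t) (hh : 0 < h.re)
  (hx : x ∈ strip ν 2) (hy : y ∈ strip ν 2)

include hω hσ hσ1 h5 ht hh hx hy

theorem integral_cubeInt (S : Type) [Fintype S] :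
    Integrable (fun ξ : S → EuclideanSpace ℝ (Fin ν) => freqWeight σ h ξ * cubeInt ω t x y h ξ)
      (Measure.pi fun _ => ρ) ∧
    ∫ ξ : S → EuclideanSpace ℝ (Fin ν), freqWeight σ h ξ * cubeInt ω t x y h ξ
      ∂(Measure.pi fun _ => ρ) = gasInt ω ρ σ t x y h S :=
  integral_conf_smul ht (integrable_gasFun hω hσ hσ1 h5 ht.le hh.le hx hy S)
    fun s ξ => gasFun_conf hω ht σ x y h s ξ

/-- The generator is a polynomial of degree two in the coordinate sums, so the bulk integrates to
first and second moments, that is, to x-derivatives of the gas. -/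
theorem integral_cubeBulk (S : Type) [Fintype S] :
    Integrable (fun ξ : S → EuclideanSpace ℝ (Fin ν) => freqWeight σ h ξ * cubeBulk ω t x y h ξ)
      (Measure.pi fun _ => ρ) ∧
    ∫ ξ : S → EuclideanSpace ℝ (Fin ν), freqWeight σ h ξ * cubeBulk ω t x y h ξ
      ∂(Measure.pi fun _ => ρ) = ∑ υ, (drift ω t x y υ * momInt ω ρ σ υ 1 t x y h S +
        h * momInt ω ρ σ υ 2 t x y h S) := by
  have hm : ∀ υ k, Integrable (momFun (S := S) ω σ υ k t x y h) (confMeasure ρ S) := fun υ k =>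
    integrable_momFun hω hσ hσ1 h5 ht.le hh.le hx hy S
  have hi : ∀ υ, Integrable (fun c : S → Pt ν => drift ω t x y υ * momFun ω σ υ 1 t x y h c +
      h * momFun ω σ υ 2 t x y h c) (confMeasure ρ S) := fun υ =>
    ((hm υ 1).const_mul _).fun_add ((hm υ 2).const_mul _)
  have h1 := integral_conf_smul (σ := σ) (h := h) (G := fun τ ξ =>
      flowGen ω t x y h τ ξ * flow ω t x y h τ ξ) ht
    (integrable_finsetSum Finset.univ fun υ _ => hi υ) fun s ξ => by
      simp only [momFun, gasFun_conf hω ht, flowGen, flowCoord_smul hω ht]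
      rw [← mul_assoc, Finset.mul_sum, Finset.sum_mul]
      refine Finset.sum_congr rfl fun υ _ => ?_
      ring
  refine ⟨h1.1, h1.2.trans ?_⟩
  rw [integral_finsetSum _ fun υ _ => hi υ]
  refine Finset.sum_congr rfl fun υ _ => ?_
  rw [integral_add ((hm υ 1).const_mul _) ((hm υ 2).const_mul _), integral_const_mul,
    integral_const_mul]
  rfl

/-- The particle on the face is independent of the others. Its frequency integral is the potential
at x written with the density, and the remaining particles form a gas with one particle fewer. -/
theorem integral_cubeBdry_term (S : Type) [Fintype S] (e : S) :
    Integrable (fun ξ : S → EuclideanSpace ℝ (Fin ν) => freqWeight σ h ξ *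
      (Complex.exp (Complex.I * ∑ υ, x υ * (ξ e υ : ℂ)) *
        cubeInt ω t x y h fun j : {j // j ≠ e} => ξ j)) (Measure.pi fun _ => ρ) ∧
    ∫ ξ : S → EuclideanSpace ℝ (Fin ν), freqWeight σ h ξ *
      (Complex.exp (Complex.I * ∑ υ, x υ * (ξ e υ : ℂ)) *
        cubeInt ω t x y h fun j : {j // j ≠ e} => ξ j) ∂(Measure.pi fun _ => ρ) =
      h⁻¹ * (∫ ξ, Complex.exp (Complex.I * ∑ υ, x υ * (ξ υ : ℂ)) * σ ξ ∂ρ) *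
        gasInt ω ρ σ t x y h (Fin (Fintype.card S - 1)) := by
  set g : EuclideanSpace ℝ (Fin ν) → ℂ := fun ξ =>
    Complex.exp (Complex.I * ∑ υ, x υ * (ξ υ : ℂ)) * σ ξ with hg
  have hgi : Integrable g ρ := by
    refine h5.mono' ((Continuous.measurable (by fun_prop)).mul hσ).aestronglyMeasurable
      (Eventually.of_forall fun ξ => ?_)
    rw [hg, norm_mul]
    refine (mul_le_of_le_one_right (norm_nonneg _) (hσ1 ξ)).trans
      ((norm_exp_potential_le hx ξ).trans (Real.exp_le_exp.2 ?_))
    nlinarith [norm_nonneg ξ]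
  have hc : Fintype.card {j // ¬ j = e} = Fintype.card S - 1 := by simp
  have hpos : 0 < Fintype.card S := Fintype.card_pos_iff.2 ⟨e⟩
  have hmp := measurePreserving_pi_split (ρ := ρ) (fun j : S => j = e)
  have hI := integral_cubeInt hω hσ hσ1 h5 ht hh hx hy {j // ¬ j = e}
  have key : (fun ξ : S → EuclideanSpace ℝ (Fin ν) => freqWeight σ h ξ *
      (Complex.exp (Complex.I * ∑ υ, x υ * (ξ e υ : ℂ)) *
        cubeInt ω t x y h fun j : {j // j ≠ e} => ξ j)) = fun ξ => h⁻¹ *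
      ((∏ j : {j // j = e}, g (ξ j)) * (freqWeight σ h (fun j : {j // ¬ j = e} => ξ j) *
        cubeInt ω t x y h fun j : {j // ¬ j = e} => ξ j)) := by
    funext ξ
    have e1 : ∏ j : {j // j = e}, g (ξ j) = g (ξ e) := by
      rw [Fintype.prod_unique]
      exact congrArg (fun j => g (ξ j)) (default : {j // j = e}).2
    have e2 : ∏ j, σ (ξ j) = σ (ξ e) * ∏ j : {j // ¬ j = e}, σ (ξ j) := by
      rw [← Fintype.prod_subtype_mul_prod_subtype (fun j => j = e) fun j => σ (ξ j)]
      congr 1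
      simp only [Finset.univ_unique, Finset.prod_singleton]
      exact congrArg (fun j => σ (ξ j)) (default : {j // j = e}).2
    have e3 : (h ^ Fintype.card S)⁻¹ = h⁻¹ * (h ^ Fintype.card {j // ¬ j = e})⁻¹ := by
      rw [hc, ← mul_inv, ← pow_succ', Nat.sub_add_cancel hpos]
    rw [e1, freqWeight, freqWeight, e2, e3, hg]
    ring
  have hprod : Integrable (fun z : ({j // j = e} → EuclideanSpace ℝ (Fin ν)) ×
      ({j // ¬ j = e} → EuclideanSpace ℝ (Fin ν)) => (∏ j, g (z.1 j)) *
        (freqWeight σ h z.2 * cubeInt ω t x y h z.2))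
      ((Measure.pi fun _ => ρ).prod (Measure.pi fun _ => ρ)) :=
    (Integrable.fintype_prod (f := fun _ => g) fun _ => hgi).mul_prod hI.1
  rw [key]
  refine ⟨(hmp.integrable_comp_of_integrable hprod).const_mul _, ?_⟩
  rw [integral_const_mul, mul_assoc]
  congr 1
  have h2 := hmp.integral_comp (MeasurableEquiv.measurableEmbedding
    (MeasurableEquiv.piEquivPiSubtypeProd (fun _ : S => EuclideanSpace ℝ (Fin ν)) fun j => j = e))
    fun z : ({j // j = e} → EuclideanSpace ℝ (Fin ν)) ×
      ({j // ¬ j = e} → EuclideanSpace ℝ (Fin ν)) => (∏ j, g (z.1 j)) *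
        (freqWeight σ h z.2 * cubeInt ω t x y h z.2)
  refine h2.trans ?_
  have h3 := integral_prod_mul (μ := Measure.pi fun _ : {j // j = e} => ρ)
    (ν := Measure.pi fun _ : {j // ¬ j = e} => ρ) (fun ξ => ∏ j, g (ξ j))
    fun ξ => freqWeight σ h ξ * cubeInt ω t x y h ξ
  refine h3.trans ?_
  rw [integral_fintype_prod_eq_prod (fun _ : {j // j = e} => g), hI.2,
    gasInt_equiv ω ρ σ t x y h (Fintype.equivFinOfCardEq hc).symm]
  simp

theorem integral_cubeBdry (S : Type) [Fintype S] :
    Integrable (fun ξ : S → EuclideanSpace ℝ (Fin ν) => freqWeight σ h ξ * cubeBdry ω t x y h ξ)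
      (Measure.pi fun _ => ρ) ∧
    ∫ ξ : S → EuclideanSpace ℝ (Fin ν), freqWeight σ h ξ * cubeBdry ω t x y h ξ
      ∂(Measure.pi fun _ => ρ) = Fintype.card S *
      (h⁻¹ * (∫ ξ, Complex.exp (Complex.I * ∑ υ, x υ * (ξ υ : ℂ)) * σ ξ ∂ρ) *
        gasInt ω ρ σ t x y h (Fin (Fintype.card S - 1))) := by
  have hi := fun e : S => integral_cubeBdry_term hω hσ hσ1 h5 ht hh hx hy S e
  have e1 : ∀ ξ : S → EuclideanSpace ℝ (Fin ν), freqWeight σ h ξ * cubeBdry ω t x y h ξ =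
      ∑ e, freqWeight σ h ξ * (Complex.exp (Complex.I * ∑ υ, x υ * (ξ e υ : ℂ)) *
        cubeInt ω t x y h fun j : {j // j ≠ e} => ξ j) := fun ξ => Finset.mul_sum _ _ _
  simp only [e1]
  refine ⟨integrable_finsetSum _ fun e _ => (hi e).1, ?_⟩
  rw [integral_finsetSum _ fun e _ => (hi e).1, Finset.sum_congr rfl fun e _ => (hi e).2]
  simp

end CubeFubini

/-! ### The evolution equation of the gas sum -/

section TimeDerivative

open scoped Classical

variable {ν : ℕ} {ω : Fin ν → ℝ} {ρ : Measure (EuclideanSpace ℝ (Fin ν))} [IsFiniteMeasure ρ]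
  {σ : EuclideanSpace ℝ (Fin ν) → ℂ} {t : ℝ} {x y : Fin ν → ℂ} {h : ℂ}

/-- The terms of `gasSum`, after integration over the times. -/
def cubeTerm (ω : Fin ν → ℝ) (σ : EuclideanSpace ℝ (Fin ν) → ℂ) (x y : Fin ν → ℂ) (h : ℂ) (t : ℝ)
    (a : Σ n : ℕ, Fin n → EuclideanSpace ℝ (Fin ν)) : ℂ :=
  freqWeight σ h a.2 * cubeInt ω t x y h a.2 / (a.1.factorial : ℂ)

/-- The derivative of `cubeTerm`. -/
def cubeTermD (ω : Fin ν → ℝ) (σ : EuclideanSpace ℝ (Fin ν) → ℂ) (x y : Fin ν → ℂ) (h : ℂ) (t : ℝ)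
    (a : Σ n : ℕ, Fin n → EuclideanSpace ℝ (Fin ν)) : ℂ :=
  freqWeight σ h a.2 * (cubeBulk ω t x y h a.2 + cubeBdry ω t x y h a.2) / (a.1.factorial : ℂ)

/-- The product measures on the frequencies. -/
def freqMeasure (ρ : Measure (EuclideanSpace ℝ (Fin ν))) [IsFiniteMeasure ρ] :
    Measure (Σ n : ℕ, Fin n → EuclideanSpace ℝ (Fin ν)) :=
  sigmaMeasure fun n => Measure.pi fun _ : Fin n => ρ

/-- The dominating function for `cubeTerm` and `cubeTermD`. -/
def freqDom (q : ℝ) (a : Σ n : ℕ, Fin n → EuclideanSpace ℝ (Fin ν)) : ℝ :=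
  (∏ j, (q * Real.exp (3 * ‖a.2 j‖))) / (a.1.factorial : ℝ)

theorem integrable_freqDom (h5 : Integrable (fun ξ => Real.exp (5 * ‖ξ‖)) ρ) {q : ℝ} (hq : 0 ≤ q) :
    Integrable (freqDom (ν := ν) q) (freqMeasure ρ) := by
  have h3 : Integrable (fun ξ : EuclideanSpace ℝ (Fin ν) => q * Real.exp (3 * ‖ξ‖)) ρ := by
    refine (h5.mono' (by fun_prop) (Eventually.of_forall fun ξ => ?_)).const_mul q
    rw [Real.norm_of_nonneg (Real.exp_pos _).le, Real.exp_le_exp]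
    nlinarith [norm_nonneg ξ]
  refine integrable_sigmaMeasure (fun n => (Integrable.fintype_prod
    (f := fun (_ : Fin n) (ξ : EuclideanSpace ℝ (Fin ν)) => q * Real.exp (3 * ‖ξ‖))
    fun _ => h3).div_const (n.factorial : ℝ)) ?_
  refine (Real.summable_pow_div_factorial (∫ ξ, q * Real.exp (3 * ‖ξ‖) ∂ρ)).congr fun n => ?_
  have h1 : ∀ ξ : Fin n → EuclideanSpace ℝ (Fin ν), ‖freqDom q ⟨n, ξ⟩‖ =
      (∏ j, (q * Real.exp (3 * ‖ξ j‖))) / (n.factorial : ℝ) := fun ξ =>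
    Real.norm_of_nonneg (div_nonneg (Finset.prod_nonneg fun j _ =>
      mul_nonneg hq (Real.exp_pos _).le) (Nat.cast_nonneg _))
  simp only [h1]
  rw [integral_div, integral_fintype_prod_eq_prod (𝕜 := ℝ)
    (fun (_ : Fin n) (ξ : EuclideanSpace ℝ (Fin ν)) => q * Real.exp (3 * ‖ξ‖)), Finset.prod_const,
    Finset.card_univ, Fintype.card_fin]

theorem norm_freqWeight_mul_le (hσ1 : ∀ ξ, ‖σ ξ‖ ≤ 1) {n : ℕ}
    (ξ : Fin n → EuclideanSpace ℝ (Fin ν)) {z : ℂ} {C q : ℝ}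
    (hz : ‖z‖ ≤ C * q ^ n * Real.exp (3 * ∑ j, ‖ξ j‖)) :
    ‖freqWeight σ h ξ * z / (n.factorial : ℂ)‖ ≤ C * freqDom (q / ‖h‖) ⟨n, ξ⟩ := by
  rw [norm_div, Complex.norm_natCast, freqDom, ← mul_div_assoc]
  refine div_le_div_of_nonneg_right ?_ (Nat.cast_nonneg _)
  have h1 : ‖freqWeight σ h ξ‖ ≤ (‖h‖ ^ n)⁻¹ := by
    rw [freqWeight, norm_mul, norm_inv, norm_pow, Fintype.card_fin]
    refine mul_le_of_le_one_right (by positivity) ?_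
    rw [norm_prod]
    exact Finset.prod_le_one (fun _ _ => norm_nonneg _) fun j _ => hσ1 _
  rw [norm_mul]
  refine (mul_le_mul h1 hz (norm_nonneg _) (by positivity)).trans_eq ?_
  rw [Finset.prod_mul_distrib, Finset.prod_const, Finset.card_univ, Fintype.card_fin,
    ← Real.exp_sum, ← Finset.mul_sum, div_pow]
  ring

variable (hω : ∀ υ, 0 < ω υ) (hσ : Measurable σ) (hσ1 : ∀ ξ, ‖σ ξ‖ ≤ 1)
  (h5 : Integrable (fun ξ => Real.exp (5 * ‖ξ‖)) ρ) (ht : 0 < t) (hh : 0 < h.re)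
  (hx : x ∈ strip ν 2) (hy : y ∈ strip ν 2)

include hω hσ hσ1 h5 ht hh hx hy

theorem aestronglyMeasurable_cubeTerm :
    AEStronglyMeasurable (cubeTerm ω σ x y h t) (freqMeasure ρ) :=
  aestronglyMeasurable_sigmaMeasure fun n =>
    ((integral_cubeInt hω hσ hσ1 h5 ht hh hx hy (Fin n)).1.div_const
      (n.factorial : ℂ)).aestronglyMeasurable

theorem integral_cubeTermD (n : ℕ) :
    Integrable (fun ξ => cubeTermD ω σ x y h t ⟨n, ξ⟩) (Measure.pi fun _ : Fin n => ρ) ∧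
    ∫ ξ, cubeTermD ω σ x y h t ⟨n, ξ⟩ ∂(Measure.pi fun _ : Fin n => ρ) =
      ∑ υ, (drift ω t x y υ * (momInt ω ρ σ υ 1 t x y h (Fin n) / (n.factorial : ℂ)) +
        h * (momInt ω ρ σ υ 2 t x y h (Fin n) / (n.factorial : ℂ))) +
      (h⁻¹ * (∫ ξ, Complex.exp (Complex.I * ∑ υ, x υ * (ξ υ : ℂ)) * σ ξ ∂ρ)) *
        ((n : ℂ) * gasInt ω ρ σ t x y h (Fin (n - 1)) / (n.factorial : ℂ)) := by
  have h1 := integral_cubeBulk hω hσ hσ1 h5 ht hh hx hy (Fin n)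
  have h2 := integral_cubeBdry hω hσ hσ1 h5 ht hh hx hy (Fin n)
  have e : (fun ξ : Fin n → EuclideanSpace ℝ (Fin ν) => cubeTermD ω σ x y h t ⟨n, ξ⟩) = fun ξ =>
      (freqWeight σ h ξ * cubeBulk ω t x y h ξ + freqWeight σ h ξ * cubeBdry ω t x y h ξ) /
        (n.factorial : ℂ) := by
    funext ξ
    rw [← mul_add]
    rfl
  rw [e]
  refine ⟨(h1.1.fun_add h2.1).div_const _, ?_⟩
  rw [integral_div, integral_add h1.1 h2.1, h1.2, h2.2, Fintype.card_fin, add_div, Finset.sum_div]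
  congr 1
  · refine Finset.sum_congr rfl fun υ _ => ?_
    ring
  · ring

theorem hasDerivAt_integral_cubeTerm :
    Integrable (cubeTerm ω σ x y h t) (freqMeasure ρ) ∧
    Integrable (cubeTermD ω σ x y h t) (freqMeasure ρ) ∧
    HasDerivAt (fun r => ∫ a, cubeTerm ω σ x y h r a ∂freqMeasure ρ)
      (∫ a, cubeTermD ω σ x y h t a ∂freqMeasure ρ) t := by
  obtain ⟨C, hC0, hC⟩ := exists_norm_deriv_cubeInt_le hω ht hh.le hx hy
  have hs : Icc (t / 2) (2 * t) ∈ 𝓝 t := Icc_mem_nhds (by linarith) (by linarith)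
  have hdom := (integrable_freqDom h5 (q := 4 * t / ‖h‖) (by positivity)).const_mul C
  have hi : Integrable (cubeTerm ω σ x y h t) (freqMeasure ρ) := by
    refine hdom.mono' (aestronglyMeasurable_cubeTerm hω hσ hσ1 h5 ht hh hx hy)
      (Eventually.of_forall ?_)
    rintro ⟨n, ξ⟩
    exact norm_freqWeight_mul_le hσ1 ξ (hC t ⟨by linarith, by linarith⟩ n ξ).1
  refine ⟨hi, ?_⟩
  refine hasDerivAt_integral_of_dominated_loc_of_deriv_le hs ?_ hi ?_ ?_ hdom ?_
  · filter_upwards [hs] with r hr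
    exact aestronglyMeasurable_cubeTerm hω hσ hσ1 h5 ((half_pos ht).trans_le hr.1) hh hx hy
  · exact aestronglyMeasurable_sigmaMeasure fun n =>
      (integral_cubeTermD hω hσ hσ1 h5 ht hh hx hy n).1.aestronglyMeasurable
  · refine Eventually.of_forall ?_
    rintro ⟨n, ξ⟩ r hr
    exact norm_freqWeight_mul_le hσ1 ξ (hC r hr n ξ).2
  · refine Eventually.of_forall ?_
    rintro ⟨n, ξ⟩ r hr
    exact ((hasDerivAt_cubeInt hω ((half_pos ht).trans_le hr.1) ξ).const_mul _).div_const _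

theorem gasSum_eq_integral :
    gasSum ω ρ σ t x y h = ∫ a, cubeTerm ω σ x y h t a ∂freqMeasure ρ := by
  have h1 := hasSum_integral_sigmaMeasure
    (hasDerivAt_integral_cubeTerm hω hσ hσ1 h5 ht hh hx hy).1
  rw [gasSum]
  refine HasSum.tsum_eq (h1.congr_fun fun n => ?_)
  rw [← (integral_cubeInt hω hσ hσ1 h5 ht hh hx hy (Fin n)).2]
  exact (integral_div (n.factorial : ℂ) _).symm

/-- The equation satisfied by `gasSum`. -/
theorem hasDerivAt_gasSum :
    HasDerivAt (fun r => gasSum ω ρ σ r x y h)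
      (∑ υ, (drift ω t x y υ * momSum ω ρ σ υ 1 t x y h + h * momSum ω ρ σ υ 2 t x y h) +
        h⁻¹ * (∫ ξ, Complex.exp (Complex.I * ∑ υ, x υ * (ξ υ : ℂ)) * σ ξ ∂ρ) *
          gasSum ω ρ σ t x y h) t := by
  obtain ⟨_, h1, h2⟩ := hasDerivAt_integral_cubeTerm hω hσ hσ1 h5 ht hh hx hy
  have h3 := hasSum_integral_sigmaMeasure h1
  have hm : ∀ υ k, HasSum (fun n => momInt ω ρ σ υ k t x y h (Fin n) / (n.factorial : ℂ))
      (momSum ω ρ σ υ k t x y h) := fun υ k => summable_momInt hω hσ hσ1 h5 ht.le hh.le hx hy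
  -- Since n/n! = 1/(n-1)!, the boundary terms sum to the gas sum again after a shift of the index;
  -- the term n = 0 is zero, so the truncated n - 1 there is harmless.
  have h4 : HasSum (fun n : ℕ => (n : ℂ) * gasInt ω ρ σ t x y h (Fin (n - 1)) / (n.factorial : ℂ))
      (gasSum ω ρ σ t x y h) := by
    rw [← hasSum_nat_add_iff' 1]
    simp only [Finset.range_one, Finset.sum_singleton, Nat.cast_zero, zero_mul, zero_div, sub_zero]
    refine (summable_gasInt hω hσ1 h5 ht.le hh.le hx hy).hasSum.congr_fun fun n => ?_
    rw [Nat.add_sub_cancel, Nat.factorial_succ]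
    have : (n : ℂ) + 1 ≠ 0 := by exact_mod_cast n.succ_ne_zero
    push_cast
    rw [mul_div_mul_left _ _ this]
  have h5' := (hasSum_sum (s := Finset.univ) fun υ (_ : υ ∈ Finset.univ) =>
      ((hm υ 1).mul_left (drift ω t x y υ)).add ((hm υ 2).mul_left h)).add
    (h4.mul_left (h⁻¹ * (∫ ξ, Complex.exp (Complex.I * ∑ υ, x υ * (ξ υ : ℂ)) * σ ξ ∂ρ)))
  have h6 := h3.unique (h5'.congr_fun fun n =>
    (integral_cubeTermD hω hσ hσ1 h5 ht hh hx hy n).2)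
  refine (h2.congr_deriv h6).congr_of_eventuallyEq ?_
  filter_upwards [lt_mem_nhds ht] with r hr
  exact gasSum_eq_integral hω hσ hσ1 h5 hr hh hx hy

end TimeDerivative

/-! ### The harmonic phase and amplitude -/

section Harmonic

variable {ν : ℕ} (ω : Fin ν → ℝ) (t : ℝ) (x y : Fin ν → ℂ)

/-- The phase of the harmonic oscillator. -/
def harmPhase : ℂ :=
  (1 / 4) * ∑ υ, ((ω υ / Real.sinh (ω υ * t) : ℝ) : ℂ) *
    ((Real.cosh (ω υ * t) : ℂ) * (x υ ^ 2 + y υ ^ 2) - 2 * x υ * y υ)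

/-- The amplitude of the harmonic oscillator. -/
def harmAmp : ℂ := ∏ υ, ((Real.sqrt (ω υ) / Real.sqrt (Real.sinh (ω υ * t)) : ℝ) : ℂ)

variable {ω t x y}

theorem hasDerivAt_prod_of_logDeriv {ι : Type} (s : Finset ι) {f : ι → ℝ → ℂ} {c : ι → ℂ} {t : ℝ}
    (hf : ∀ i ∈ s, HasDerivAt (f i) (c i * f i t) t) :
    HasDerivAt (fun r => ∏ i ∈ s, f i r) ((∑ i ∈ s, c i) * ∏ i ∈ s, f i t) t := by
  classical
  induction s using Finset.induction_on with
  | empty => simpa using hasDerivAt_const t (1 : ℂ)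
  | insert i s hi ih =>
    simp only [Finset.prod_insert hi, Finset.sum_insert hi]
    refine ((hf i (Finset.mem_insert_self _ _)).fun_mul
      (ih fun j hj => hf j (Finset.mem_insert_of_mem hj))).congr_deriv ?_
    ring

/-- The transport equation: the logarithmic derivative of the amplitude is minus the Laplacian of
the harmonic phase, whose gradient is -drift/2. -/
theorem hasDerivAt_harmAmp (hω : ∀ υ, 0 < ω υ) (ht : 0 < t) :
    HasDerivAt (fun r => harmAmp ω r)
      ((∑ υ, ((-(ω υ * Real.cosh (ω υ * t) / Real.sinh (ω υ * t)) : ℝ) : ℂ) / 2) *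
        harmAmp ω t) t := by
  refine hasDerivAt_prod_of_logDeriv _ fun υ _ => ?_
  have h0 := sinh_pos_of_pos (hω υ) ht
  have h1 : HasDerivAt (fun r => Real.sinh (ω υ * r)) (Real.cosh (ω υ * t) * (ω υ * 1)) t :=
    ((hasDerivAt_id t).const_mul (ω υ)).sinh
  have hs := Real.sqrt_pos.2 h0
  have h2 := ((hasDerivAt_const t (Real.sqrt (ω υ))).fun_div (h1.sqrt h0.ne') hs.ne').ofReal_comp
  refine h2.congr_deriv ?_
  rw [← Complex.ofReal_ofNat, ← Complex.ofReal_div, ← Complex.ofReal_mul]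
  congr 1
  have hss : Real.sinh (ω υ * t) = Real.sqrt (Real.sinh (ω υ * t)) ^ 2 := (Real.sq_sqrt h0.le).symm
  set q := Real.sqrt (Real.sinh (ω υ * t)) with hq
  rw [hss]
  field_simp
  ring

/-- The Hamilton–Jacobi equation ∂_t S = ω²x²/4 - |∇S|², with ∇S = -drift/2; it reduces to cosh² -
sinh² = 1. -/
theorem hasDerivAt_harmPhase (hω : ∀ υ, 0 < ω υ) (ht : 0 < t) :
    HasDerivAt (fun r => harmPhase ω r x y)
      ((1 / 4) * ∑ υ, ((ω υ : ℂ) ^ 2 * x υ ^ 2 - drift ω t x y υ ^ 2)) t := by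
  refine (HasDerivAt.fun_sum fun υ _ => ?_).const_mul _
  have h0 := sinh_pos_of_pos (hω υ) ht
  have h1 := (hasDerivAt_sinh_div (hω υ) ht (ω υ)).ofReal_comp
  have h2 : HasDerivAt (fun r => Real.cosh (ω υ * r)) (Real.sinh (ω υ * t) * (ω υ * 1)) t :=
    ((hasDerivAt_id t).const_mul (ω υ)).cosh
  refine (h1.fun_mul ((h2.ofReal_comp.mul_const (x υ ^ 2 + y υ ^ 2)).fun_sub
    (hasDerivAt_const t (2 * x υ * y υ)))).congr_deriv ?_
  have h3 : ((Real.cosh (ω υ * t) : ℝ) : ℂ) ^ 2 = ((Real.sinh (ω υ * t) : ℝ) : ℂ) ^ 2 + 1 := by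
    exact_mod_cast Real.cosh_sq (ω υ * t)
  have h4 : ((Real.sinh (ω υ * t) : ℝ) : ℂ) ≠ 0 := by exact_mod_cast h0.ne'
  rw [drift]
  simp only [Complex.ofReal_neg, Complex.ofReal_mul, Complex.ofReal_div, mul_one]
  generalize ((Real.cosh (ω υ * t) : ℝ) : ℂ) = b at *
  generalize ((Real.sinh (ω υ * t) : ℝ) : ℂ) = s at *
  field_simp
  linear_combination (-((ω υ : ℂ) ^ 2 * y υ ^ 2)) * h3

theorem hasDerivAt_update (υ υ' : Fin ν) (z : ℂ) :
    HasDerivAt (fun z => Function.update x υ z υ') (if υ' = υ then 1 else 0) z := by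
  split_ifs with h
  · subst h
    simpa using hasDerivAt_id' z
  · simpa [Function.update_of_ne h] using hasDerivAt_const z (x υ')

theorem hasDerivAt_drift_update (υ : Fin ν) (z : ℂ) :
    HasDerivAt (fun z => drift ω t (Function.update x υ z) y υ)
      ((-(ω υ * Real.cosh (ω υ * t) / Real.sinh (ω υ * t)) : ℝ) : ℂ) z := by
  have h1 : HasDerivAt (fun z => Function.update x υ z υ) 1 z := by
    simpa using hasDerivAt_update (x := x) υ υ z
  exact ((h1.const_mul _).add_const _).congr_deriv (mul_one _)

theorem hasDerivAt_harmPhase_update (υ : Fin ν) (z : ℂ) :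
    HasDerivAt (fun z => harmPhase ω t (Function.update x υ z) y)
      (-drift ω t (Function.update x υ z) y υ / 2) z := by
  have h1 := (HasDerivAt.fun_sum (u := Finset.univ) fun υ' _ =>
    ((((((hasDerivAt_update (x := x) υ υ' z).pow 2).add_const (y υ' ^ 2)).const_mul
      ((Real.cosh (ω υ' * t) : ℝ) : ℂ)).fun_sub
        (((hasDerivAt_update (x := x) υ υ' z).const_mul 2).mul_const (y υ'))).const_mul
          ((ω υ' / Real.sinh (ω υ' * t) : ℝ) : ℂ))).const_mul (1 / 4 : ℂ)
  refine h1.congr_deriv ?_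
  simp only [drift, mul_ite, mul_one, mul_zero, ite_mul, zero_mul]
  rw [Finset.sum_eq_single υ (fun υ' _ hne => by simp [hne])
    (fun hne => absurd (Finset.mem_univ _) hne)]
  simp only [if_true]
  push_cast
  ring

theorem iteratedDeriv_two_eq {f g : ℂ → ℂ} {b z : ℂ} (h1 : ∀ᶠ w in 𝓝 z, HasDerivAt f (g w) w)
    (h2 : HasDerivAt g b z) : iteratedDeriv 2 f z = b := by
  rw [iteratedDeriv_succ, iteratedDeriv_one]
  refine (h2.congr_of_eventuallyEq ?_).deriv
  filter_upwards [h1] with w hw using hw.deriv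

end Harmonic

/-! ### The heat equation for the kernel -/

section Equation

variable {ν : ℕ} {ω : Fin ν → ℝ} {μ : ComplexMeasure (EuclideanSpace ℝ (Fin ν))}
  [IsFiniteMeasure (VectorMeasure.variation μ)] {σ : EuclideanSpace ℝ (Fin ν) → ℂ}
  (hσ : IsDensity μ σ) (hω : ∀ υ, 0 < ω υ)
  (h5 : Integrable (fun ξ => Real.exp (5 * ‖ξ‖)) (VectorMeasure.variation μ))
  {T : ℝ} (hT : 0 < T)
  (hM : 2 * T ^ 2 * ∫ ξ, Real.exp (5 * ‖ξ‖) ∂(VectorMeasure.variation μ) < 1)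

/-- The amplitude of `kernelU`. -/
def kernelAmp (ω : Fin ν → ℝ) (t : ℝ) (h : ℂ) : ℂ :=
  (4 * (Real.pi : ℂ) * h) ^ (-(ν : ℂ) / 2) * harmAmp ω t

include hσ hω h5

omit hω [IsFiniteMeasure (VectorMeasure.variation μ)] in
theorem potential_eq {x : Fin ν → ℂ} (hx : x ∈ strip ν 2) : potential μ x =
    ∫ ξ, Complex.exp (Complex.I * ∑ υ, x υ * (ξ υ : ℂ)) * σ ξ ∂(VectorMeasure.variation μ) := by
  refine hσ.cintegral_eq _ (h5.mono' (Continuous.aestronglyMeasurable (by fun_prop))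
    (Eventually.of_forall fun ξ => ?_))
  refine (norm_exp_potential_le hx ξ).trans (Real.exp_le_exp.2 ?_)
  nlinarith [norm_nonneg ξ]

include hT hM

/-- The tree series at h = 0 enters the phase through φ and w with opposite signs and cancels; what
remains is exp((t/h) times the tree series at h), which is the gas sum. All later statements use
this factorization, which contains no trees. -/
theorem kernelU_eq {t : ℝ} (ht : t ∈ Icc 0 T) {x y : Fin ν → ℂ} (hx : x ∈ strip ν 2)
    (hy : y ∈ strip ν 2) {h : ℂ} (hh : h ∈ rightHalfPlane) : kernelU ω μ t x y h =
      kernelAmp ω t h * (Complex.exp (-harmPhase ω t x y / h) *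
        gasSum ω (VectorMeasure.variation μ) σ t x y h) := by
  rw [← exp_treeSeries hω hσ.measurable hσ.norm_le h5 hT hM ht hh hx hy, ← Complex.exp_add, kernelU,
    kernelAmp, harmAmp]
  congr 2
  rw [phase, wSeries, (hasSum_wTerm hσ hω h5 hT hM ht hx hy hh).tsum_eq, phiSeries,
    (hasSum_phiTerm hσ hω h5 hT hM ⟨by linarith [ht.1], ht.2⟩ hx hy).tsum_eq, harmPhase]
  ring

theorem analyticOnNhd_kernelU {t : ℝ} (ht : t ∈ Ioo 0 T) {y : Fin ν → ℂ}
    (hy : y ∈ strip ν 2) {h : ℂ} (hh : h ∈ rightHalfPlane) :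
    AnalyticOnNhd ℂ (fun x => kernelU ω μ t x y h) (strip ν 2) := by
  intro x hx
  have a1 : AnalyticAt ℂ (fun x => phiSeries ω μ t x y) x :=
    AnalyticAt.comp₂ (h := fun p : (Fin ν → ℂ) × (Fin ν → ℂ) => phiSeries ω μ t p.1 p.2)
      ((isC1Analytic_phiSeries hσ hω h5 hT hM).1 t ⟨by linarith [ht.1], ht.2⟩ (x, y) ⟨hx, hy⟩)
      analyticAt_id analyticAt_const
  have a2 : AnalyticAt ℂ (fun x => wSeries ω μ t x y h) x :=
    AnalyticAt.comp₂ (h := fun p : (Fin ν → ℂ) × (Fin ν → ℂ) × ℂ => wSeries ω μ t p.1 p.2.1 p.2.2)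
      (f := fun x => x) (g := fun _ => (y, h))
      ((isC1Analytic_wSeries hσ hω h5 hT hM).1 t ⟨ht.1.le, ht.2⟩ (x, y, h) ⟨hx, hy, hh⟩)
      analyticAt_id analyticAt_const
  have a3 : ∀ υ, AnalyticAt ℂ (fun x : Fin ν → ℂ => x υ) x := fun υ =>
    (ContinuousLinearMap.proj (R := ℂ) (φ := fun _ : Fin ν => ℂ) υ).analyticAt x
  have a4 : AnalyticAt ℂ (fun x => phase ω μ t x y) x := by
    unfold phase
    refine AnalyticAt.fun_sub (analyticAt_const.fun_mul (Finset.analyticAt_fun_sum _ fun υ _ => ?_))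
      (analyticAt_const.fun_mul a1)
    exact analyticAt_const.fun_mul ((analyticAt_const.fun_mul
      (((a3 υ).fun_pow 2).fun_add analyticAt_const)).fun_sub
        ((analyticAt_const.fun_mul (a3 υ)).fun_mul analyticAt_const))
  unfold kernelU
  have h0 : h ≠ 0 := fun h0 => by simp [h0, rightHalfPlane] at hh
  exact analyticAt_const.fun_mul
    ((a4.fun_neg.fun_div analyticAt_const h0).fun_add a2).cexp'

theorem solvesHeatEquation_kernelU : SolvesHeatEquation ω μ T (kernelU ω μ) := by
  intro t ht y hy h hh
  refine ⟨analyticOnNhd_kernelU hσ hω h5 hT hM ht hy hh, fun x hx => ?_⟩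
  have h0 : h ≠ 0 := fun h0 => by simp [h0, rightHalfPlane] at hh
  have hh' : 0 < h.re := hh
  set ρ := VectorMeasure.variation μ with hρ
  set E := gasSum ω ρ σ t x y h with hE
  set A := kernelAmp ω t h with hA
  set e := Complex.exp (-harmPhase ω t x y / h) with he
  set l : Fin ν → ℂ := fun υ => ((-(ω υ * Real.cosh (ω υ * t) / Real.sinh (ω υ * t)) : ℝ) : ℂ) with hl
  have hu : kernelU ω μ t x y h = A * (e * E) := kernelU_eq hσ hω h5 hT hM ⟨ht.1.le, ht.2.le⟩ hx hy hh
  -- the time derivative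
  have hAt : HasDerivAt (fun r => kernelAmp ω r h) ((∑ υ, l υ / 2) * A) t := by
    refine ((hasDerivAt_harmAmp hω ht.1).const_mul ((4 * (Real.pi : ℂ) * h) ^ (-(ν : ℂ) / 2))).congr_deriv ?_
    rw [hA, kernelAmp]
    ring
  have het : HasDerivAt (fun r => Complex.exp (-harmPhase ω r x y / h))
      (e * (-((1 / 4) * ∑ υ, ((ω υ : ℂ) ^ 2 * x υ ^ 2 - drift ω t x y υ ^ 2)) / h)) t :=
    ((hasDerivAt_harmPhase hω ht.1).fun_neg.div_const h).cexp
  have hEt := hasDerivAt_gasSum hω hσ.measurable hσ.norm_le h5 ht.1 hh' hx hy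
  have hut := (hAt.fun_mul (het.fun_mul hEt)).congr_of_eventuallyEq
    (f₁ := fun r => kernelU ω μ r x y h) (by
      filter_upwards [isOpen_Ioo.mem_nhds ht] with r hr
      exact kernelU_eq hσ hω h5 hT hM ⟨hr.1.le, hr.2.le⟩ hx hy hh)
  refine ⟨hut.differentiableAt, ?_⟩
  rw [hut.deriv, ← potential_eq hσ h5 hx]
  -- the space derivatives
  have hx2 : ∀ υ, iteratedDeriv 2 (fun z => kernelU ω μ t (Function.update x υ z) y h) (x υ) =
      A * (e * ((drift ω t x y υ / (2 * h)) ^ 2 * E +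
        drift ω t x y υ / h * momSum ω ρ σ υ 1 t x y h + momSum ω ρ σ υ 2 t x y h +
          l υ / (2 * h) * E)) := fun υ => by
    have hup : Function.update x υ (x υ) = x := Function.update_eq_self υ x
    have hopen : ∀ᶠ z in 𝓝 (x υ), Function.update x υ z ∈ strip ν 2 :=
      ((isOpen_strip ν 2).preimage
        (by fun_prop : Continuous fun z => Function.update x υ z)).mem_nhds (by simpa [hup] using hx)
    have hex : ∀ z, HasDerivAt (fun z => Complex.exp (-harmPhase ω t (Function.update x υ z) y / h))
        (Complex.exp (-harmPhase ω t (Function.update x υ z) y / h) *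
          (drift ω t (Function.update x υ z) y υ / (2 * h))) z := fun z => by
      refine ((hasDerivAt_harmPhase_update υ z).fun_neg.div_const h).cexp.congr_deriv ?_
      congr 1
      field_simp
    have hmx : ∀ k z, Function.update x υ z ∈ strip ν 2 →
        HasDerivAt (fun z => momSum ω ρ σ υ k t (Function.update x υ z) y h)
          (momSum ω ρ σ υ (k + 1) t (Function.update x υ z) y h) z := fun k z hz =>
      hasDerivAt_momSum_update hω hσ.measurable hσ.norm_le h5 ht.1.le hh'.le hz hy
    refine iteratedDeriv_two_eq (g := fun z => A *
      (Complex.exp (-harmPhase ω t (Function.update x υ z) y / h) *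
        (drift ω t (Function.update x υ z) y υ / (2 * h) *
          momSum ω ρ σ υ 0 t (Function.update x υ z) y h +
            momSum ω ρ σ υ 1 t (Function.update x υ z) y h))) ?_ ?_
    · filter_upwards [hopen.eventually_nhds] with z hz
      refine ((((hex z).fun_mul (hmx 0 z hz.self_of_nhds)).const_mul A).congr_of_eventuallyEq
        ?_).congr_deriv ?_
      · filter_upwards [hz] with w hw
        rw [momSum_zero]
        exact kernelU_eq hσ hω h5 hT hM ⟨ht.1.le, ht.2.le⟩ hw hy hh
      · rw [zero_add]
        ring
    · have hz := hopen.self_of_nhds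
      refine (((hex (x υ)).fun_mul ((((hasDerivAt_drift_update υ (x υ)).div_const
        (2 * h)).fun_mul (hmx 0 (x υ) hz)).fun_add (hmx 1 (x υ) hz))).const_mul A).congr_deriv ?_
      simp only [hup, momSum_zero, zero_add, Nat.reduceAdd]
      rw [← hE, ← he]
      field_simp
      ring
  simp only [hx2]
  rw [hu, ← Finset.mul_sum, ← Finset.mul_sum]
  -- The three groups match the time derivative: the squared drift belongs to Hamilton–Jacobi, the
  -- moments to the evolution of the gas sum, and the terms l to the transport equation of the
  -- amplitude.
  have hsplit : h ^ 2 * ∑ υ, ((drift ω t x y υ / (2 * h)) ^ 2 * E +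
        drift ω t x y υ / h * momSum ω ρ σ υ 1 t x y h + momSum ω ρ σ υ 2 t x y h +
          l υ / (2 * h) * E) =
      (1 / 4) * (∑ υ, drift ω t x y υ ^ 2) * E + h * (∑ υ, (drift ω t x y υ *
        momSum ω ρ σ υ 1 t x y h + h * momSum ω ρ σ υ 2 t x y h)) + h * (∑ υ, l υ / 2) * E := by
    rw [Finset.mul_sum, Finset.mul_sum, Finset.mul_sum, Finset.mul_sum, Finset.sum_mul, Finset.sum_mul,
      ← Finset.sum_add_distrib, ← Finset.sum_add_distrib]
    refine Finset.sum_congr rfl fun υ _ => ?_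
    field_simp
    ring
  have e1 : h ^ 2 * (A * (e * ∑ υ, ((drift ω t x y υ / (2 * h)) ^ 2 * E +
        drift ω t x y υ / h * momSum ω ρ σ υ 1 t x y h + momSum ω ρ σ υ 2 t x y h +
          l υ / (2 * h) * E))) = A * e * (h ^ 2 * ∑ υ, ((drift ω t x y υ / (2 * h)) ^ 2 * E +
        drift ω t x y υ / h * momSum ω ρ σ υ 1 t x y h + momSum ω ρ σ υ 2 t x y h +
          l υ / (2 * h) * E)) := by ring
  rw [e1, hsplit, Finset.sum_sub_distrib]
  generalize ∑ υ, drift ω t x y υ ^ 2 = s1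
  generalize ∑ υ, (drift ω t x y υ * momSum ω ρ σ υ 1 t x y h +
    h * momSum ω ρ σ υ 2 t x y h) = s2
  generalize ∑ υ, (ω υ : ℂ) ^ 2 * x υ ^ 2 = s3
  generalize ∑ υ, l υ / 2 = s4
  rw [← hE, ← he]
  field_simp
  ring

end Equation

/-! ### Gaussian integrals and rescaling -/

section Gaussian

variable {ν : ℕ}

theorem integrable_exp_neg_mul_sum_sq {b : ℝ} (hb : 0 < b) :
    Integrable fun z : Fin ν → ℝ => Real.exp (-b * ∑ υ, z υ ^ 2) := by
  have h1 : Integrable (fun z : Fin ν → ℝ => ∏ υ, Real.exp (-b * z υ ^ 2)) :=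
    Integrable.fintype_prod (f := fun (_ : Fin ν) (z : ℝ) => Real.exp (-b * z ^ 2))
      fun _ => integrable_exp_neg_mul_sq hb
  refine h1.congr (Eventually.of_forall fun z => ?_)
  simp only
  rw [← Real.exp_sum, Finset.mul_sum]

theorem inv_re_pos {h : ℂ} (hh : 0 < h.re) : 0 < (h⁻¹).re := by
  rw [Complex.inv_re]
  exact div_pos hh (Complex.normSq_pos.2 fun h0 => by simp [h0] at hh)

theorem integral_heatKernel {h : ℂ} (hh : 0 < h.re) :
    ∫ z : Fin ν → ℝ, (4 * (Real.pi : ℂ) * h) ^ (-(ν : ℂ) / 2) *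
      Complex.exp (-((1 / 4) * ∑ υ, (z υ : ℂ) ^ 2) / h) = 1 := by
  have h0 : h ≠ 0 := fun h0 => by simp [h0] at hh
  have hb : 0 < ((4 * h)⁻¹).re := inv_re_pos (by simpa using hh)
  have h1 : ∀ z : Fin ν → ℝ, Complex.exp (-((1 / 4) * ∑ υ, (z υ : ℂ) ^ 2) / h) =
      ∏ υ, Complex.exp (-(4 * h)⁻¹ * (z υ : ℂ) ^ 2) := fun z => by
    rw [← Complex.exp_sum, ← Finset.mul_sum]
    congr 1
    field_simp
  simp only [h1]
  rw [integral_const_mul, integral_fintype_prod_volume_eq_prod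
    (fun (_ : Fin ν) (z : ℝ) => Complex.exp (-(4 * h)⁻¹ * (z : ℂ) ^ 2)), Finset.prod_const,
    Finset.card_univ, Fintype.card_fin, integral_gaussian_complex hb]
  have h2 : (Real.pi : ℂ) / (4 * h)⁻¹ = 4 * (Real.pi : ℂ) * h := by
    rw [div_inv_eq_mul]; ring
  have h3 : 4 * (Real.pi : ℂ) * h ≠ 0 :=
    mul_ne_zero (mul_ne_zero (by norm_num) (by exact_mod_cast Real.pi_ne_zero)) h0
  rw [h2, ← Complex.cpow_nat_mul, ← Complex.cpow_add _ _ h3]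
  ring_nf
  exact Complex.cpow_zero _

theorem integral_eq_integral_add_smul {F : Type} [NormedAddCommGroup F] [NormedSpace ℝ F]
    (g : (Fin ν → ℝ) → F) (y : Fin ν → ℝ) {r : ℝ} (hr : 0 < r) :
    ∫ x, g x = r ^ ν • ∫ z, g (y + r • z) := by
  have h1 := Measure.integral_comp_smul (volume : Measure (Fin ν → ℝ)) (fun x => g (y + x)) r
  rw [h1, integral_add_left_eq_self (μ := (volume : Measure (Fin ν → ℝ))) g y, Module.finrank_fin_fun,
    abs_of_pos (by positivity), smul_smul, mul_inv_cancel₀ (by positivity), one_smul]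

end Gaussian

/-! ### The harmonic kernel at real points, rescaled about y -/

section HarmonicKernel

variable {ν : ℕ} {ω : Fin ν → ℝ} {t : ℝ} {h : ℂ} {x y z : Fin ν → ℝ}

theorem harmPhase_comm (x y : Fin ν → ℂ) : harmPhase ω t x y = harmPhase ω t y x := by
  rw [harmPhase, harmPhase]
  congr 1
  exact Finset.sum_congr rfl fun υ _ => by ring

/-- The phase of the harmonic oscillator at real points. -/
def harmPhaseR (ω : Fin ν → ℝ) (t : ℝ) (x y : Fin ν → ℝ) : ℝ :=
  (1 / 4) * ∑ υ, (ω υ / Real.sinh (ω υ * t) * (x υ - y υ) ^ 2 +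
    ω υ * ((Real.cosh (ω υ * t) - 1) / Real.sinh (ω υ * t)) * (x υ ^ 2 + y υ ^ 2))

theorem harmPhase_toComplex (x y : Fin ν → ℝ) :
    harmPhase ω t (toComplex x) (toComplex y) = (harmPhaseR ω t x y : ℂ) := by
  rw [harmPhase, harmPhaseR]
  push_cast
  congr 1
  refine Finset.sum_congr rfl fun υ _ => ?_
  simp only [toComplex]
  ring

/-- The heat kernel of the harmonic oscillator, at real points. -/
def harmKernel (ω : Fin ν → ℝ) (t : ℝ) (h : ℂ) (x y : Fin ν → ℝ) : ℂ :=
  kernelAmp ω t h * Complex.exp (-harmPhase ω t (toComplex x) (toComplex y) / h)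

theorem harmKernel_comm (x y : Fin ν → ℝ) : harmKernel ω t h x y = harmKernel ω t h y x := by
  rw [harmKernel, harmPhase_comm, harmKernel]

/-- The right-hand side is continuous at a = 0 with value 0; the confining part of the phase
therefore vanishes as t → 0. -/
theorem cosh_sub_one_div_sinh {a : ℝ} (ha : a ≠ 0) :
    (Real.cosh a - 1) / Real.sinh a = Real.sinh a / (Real.cosh a + 1) := by
  have h1 : Real.sinh a ≠ 0 := Real.sinh_ne_zero.2 ha
  have h2 : Real.cosh a + 1 ≠ 0 := by linarith [Real.cosh_pos a] |> ne_of_gt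
  rw [div_eq_div_iff h1 h2]
  linear_combination Real.cosh_sq a

/-- The contraction factor `ωt / sh(ωt)`. -/
def sinhFactor (ω t : ℝ) : ℝ := t * (ω / Real.sinh (ω * t))

theorem sinhFactor_eq {a t : ℝ} (ha : 0 < a) (ht : 0 < t) : sinhFactor a t = (sinhc (a * t))⁻¹ := by
  rw [sinhFactor, sinhc_of_ne (mul_pos ha ht).ne', inv_div]
  ring

theorem sinhFactor_pos {a t : ℝ} (ha : 0 < a) (ht : 0 < t) : 0 < sinhFactor a t :=
  mul_pos ht (div_pos ha (sinh_pos_of_pos ha ht))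

theorem sinhFactor_le_one {a t : ℝ} (ha : 0 < a) (ht : 0 < t) : sinhFactor a t ≤ 1 := by
  rw [sinhFactor, mul_div_assoc', div_le_one (sinh_pos_of_pos ha ht), mul_comm]
  exact Real.self_le_sinh_iff.2 (mul_pos ha ht).le

theorem tendsto_sinhFactor {a : ℝ} (ha : 0 < a) :
    Tendsto (fun t => sinhFactor a t) (𝓝[>] 0) (𝓝 1) := by
  have h1 : Continuous fun t => (sinhc (a * t))⁻¹ :=
    (contDiff_sinhc.continuous.comp (continuous_const.mul continuous_id)).inv₀
      fun t => (sinhc_pos _).ne'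
  have h2 : Tendsto (fun t => (sinhc (a * t))⁻¹) (𝓝[>] 0) (𝓝 1) := by
    have := h1.tendsto 0
    simp only [mul_zero, sinhc_zero, inv_one] at this
    exact this.mono_left nhdsWithin_le_nhds
  refine h2.congr' ?_
  filter_upwards [self_mem_nhdsWithin] with t ht using (sinhFactor_eq ha ht).symm

theorem norm_exp_harmPhase (x y : Fin ν → ℝ) :
    ‖Complex.exp (-harmPhase ω t (toComplex x) (toComplex y) / h)‖ =
      Real.exp (-(h⁻¹).re * harmPhaseR ω t x y) := by
  rw [harmPhase_toComplex, Complex.norm_exp, div_eq_mul_inv, ← Complex.ofReal_neg,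
    Complex.re_ofReal_mul]
  congr 1
  ring

/-- For x = y + √t z the coupling part of the phase is a quarter of ∑ (ωt / sh(ωt)) z², and the
confining part is nonnegative. This gives a Gaussian bound in z independent of y. -/
theorem le_harmPhaseR (hω : ∀ υ, 0 < ω υ) (ht : 0 < t) {c : ℝ} (hc : ∀ υ, c ≤ sinhFactor (ω υ) t)
    (y z : Fin ν → ℝ) : c / 4 * ∑ υ, z υ ^ 2 ≤ harmPhaseR ω t (y + Real.sqrt t • z) y := by
  rw [harmPhaseR, div_mul_eq_mul_div, Finset.mul_sum, div_eq_inv_mul, one_div]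
  refine mul_le_mul_of_nonneg_left (Finset.sum_le_sum fun υ _ => ?_) (by norm_num)
  have h1 : ω υ / Real.sinh (ω υ * t) * ((y + Real.sqrt t • z) υ - y υ) ^ 2 =
      sinhFactor (ω υ) t * z υ ^ 2 := by
    simp only [Pi.add_apply, Pi.smul_apply, smul_eq_mul, add_sub_cancel_left, mul_pow,
      Real.sq_sqrt ht.le, sinhFactor]
    ring
  rw [h1]
  have h2 : 0 ≤ ω υ * ((Real.cosh (ω υ * t) - 1) / Real.sinh (ω υ * t)) *
      ((y + Real.sqrt t • z) υ ^ 2 + y υ ^ 2) :=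
    mul_nonneg (mul_nonneg (hω υ).le (div_nonneg (by linarith [Real.one_le_cosh (ω υ * t)])
      (sinh_pos_of_pos (hω υ) ht).le)) (by positivity)
  have h3 := mul_le_mul_of_nonneg_right (hc υ) (sq_nonneg (z υ))
  linarith

theorem sqrt_pow_mul_harmAmp (hω : ∀ υ, 0 < ω υ) (ht : 0 < t) :
    ((Real.sqrt t ^ ν : ℝ) : ℂ) * harmAmp ω t =
      ((∏ υ, Real.sqrt (sinhFactor (ω υ) t) : ℝ) : ℂ) := by
  rw [harmAmp]
  have h1 : Real.sqrt t ^ ν = ∏ _υ : Fin ν, Real.sqrt t := by simp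
  rw [h1]
  push_cast
  rw [← Finset.prod_mul_distrib]
  refine Finset.prod_congr rfl fun υ _ => ?_
  rw [sinhFactor, Real.sqrt_mul ht.le, Real.sqrt_div (hω υ).le]
  push_cast
  rfl

theorem norm_scaled_harmKernel_le (hω : ∀ υ, 0 < ω υ) (ht : 0 < t) (hh : 0 < h.re) {c : ℝ}
    (hc : ∀ υ, c ≤ sinhFactor (ω υ) t) (y z : Fin ν → ℝ) :
    Real.sqrt t ^ ν * ‖harmKernel ω t h (y + Real.sqrt t • z) y‖ ≤
      ‖(4 * (Real.pi : ℂ) * h) ^ (-(ν : ℂ) / 2)‖ *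
        Real.exp (-((h⁻¹).re * (c / 4)) * ∑ υ, z υ ^ 2) := by
  have h1 : ‖((Real.sqrt t ^ ν : ℝ) : ℂ) * harmAmp ω t‖ ≤ 1 := by
    rw [sqrt_pow_mul_harmAmp hω ht, Complex.norm_real, Real.norm_of_nonneg
      (Finset.prod_nonneg fun _ _ => Real.sqrt_nonneg _)]
    exact Finset.prod_le_one (fun _ _ => Real.sqrt_nonneg _) fun υ _ =>
      Real.sqrt_le_one.2 (sinhFactor_le_one (hω υ) ht)
  rw [norm_mul, Complex.norm_real, Real.norm_of_nonneg (by positivity)] at h1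
  rw [harmKernel, norm_mul, norm_exp_harmPhase, kernelAmp, norm_mul]
  have h2 := mul_le_mul_of_nonneg_left (le_harmPhaseR hω ht hc y z) (inv_re_pos hh).le
  have h3 : Real.exp (-(h⁻¹).re * harmPhaseR ω t (y + Real.sqrt t • z) y) ≤
      Real.exp (-((h⁻¹).re * (c / 4)) * ∑ υ, z υ ^ 2) := Real.exp_le_exp.2 (by linarith)
  calc _ = ‖(4 * (Real.pi : ℂ) * h) ^ (-(ν : ℂ) / 2)‖ * ((Real.sqrt t ^ ν * ‖harmAmp ω t‖) *
        Real.exp (-(h⁻¹).re * harmPhaseR ω t (y + Real.sqrt t • z) y)) := by ring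
    _ ≤ _ := mul_le_mul_of_nonneg_left ((mul_le_of_le_one_left (Real.exp_pos _).le h1).trans h3)
        (norm_nonneg _)

theorem tendsto_scaled_harmKernel (hω : ∀ υ, 0 < ω υ) (y z : Fin ν → ℝ) :
    Tendsto (fun t => ((Real.sqrt t ^ ν : ℝ) : ℂ) * harmKernel ω t h (y + Real.sqrt t • z) y)
      (𝓝[>] 0) (𝓝 ((4 * (Real.pi : ℂ) * h) ^ (-(ν : ℂ) / 2) *
        Complex.exp (-((1 / 4) * ∑ υ, (z υ : ℂ) ^ 2) / h))) := by
  have h1 : Tendsto (fun t => ∏ υ, Real.sqrt (sinhFactor (ω υ) t)) (𝓝[>] 0) (𝓝 1) := by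
    have : Tendsto (fun t => ∏ υ, Real.sqrt (sinhFactor (ω υ) t)) (𝓝[>] 0)
        (𝓝 (∏ _υ : Fin ν, Real.sqrt 1)) :=
      tendsto_finsetProd _ fun υ _ => (tendsto_sinhFactor (hω υ)).sqrt
    simpa using this
  have h2 : Tendsto (fun t => harmPhaseR ω t (y + Real.sqrt t • z) y) (𝓝[>] 0)
      (𝓝 ((1 / 4) * ∑ υ, z υ ^ 2)) := by
    have h3 : ∀ υ, Tendsto (fun t => sinhFactor (ω υ) t * z υ ^ 2 +
        ω υ * (Real.sinh (ω υ * t) / (Real.cosh (ω υ * t) + 1)) *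
          ((y υ + Real.sqrt t * z υ) ^ 2 + y υ ^ 2)) (𝓝[>] 0) (𝓝 (1 * z υ ^ 2 + 0)) := fun υ => by
      refine ((tendsto_sinhFactor (hω υ)).mul_const _).add ?_
      have hc : Continuous fun t => ω υ * (Real.sinh (ω υ * t) / (Real.cosh (ω υ * t) + 1)) *
          ((y υ + Real.sqrt t * z υ) ^ 2 + y υ ^ 2) := by
        have : ∀ t, Real.cosh (ω υ * t) + 1 ≠ 0 := fun t =>
          ne_of_gt (by linarith [Real.cosh_pos (ω υ * t)])
        fun_prop (disch := exact this _)
      have h4 := hc.tendsto 0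
      simp only [mul_zero, Real.sinh_zero, zero_div, zero_mul] at h4
      exact h4.mono_left nhdsWithin_le_nhds
    have h5 := (tendsto_finsetSum Finset.univ fun υ _ => h3 υ).const_mul (1 / 4 : ℝ)
    simp only [one_mul, add_zero] at h5
    refine h5.congr' ?_
    filter_upwards [self_mem_nhdsWithin] with t ht
    have ht' : 0 < t := ht
    rw [harmPhaseR]
    congr 1
    refine Finset.sum_congr rfl fun υ _ => ?_
    rw [cosh_sub_one_div_sinh (mul_pos (hω υ) ht').ne']
    simp only [Pi.add_apply, Pi.smul_apply, smul_eq_mul, add_sub_cancel_left, mul_pow,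
      Real.sq_sqrt ht'.le, sinhFactor]
    ring
  have h6 : Tendsto (fun t => (4 * (Real.pi : ℂ) * h) ^ (-(ν : ℂ) / 2) *
      (((∏ υ, Real.sqrt (sinhFactor (ω υ) t) : ℝ) : ℂ) *
        Complex.exp (-(harmPhaseR ω t (y + Real.sqrt t • z) y : ℂ) / h))) (𝓝[>] 0)
      (𝓝 ((4 * (Real.pi : ℂ) * h) ^ (-(ν : ℂ) / 2) * (((1 : ℝ) : ℂ) *
        Complex.exp (-(((1 / 4) * ∑ υ, z υ ^ 2 : ℝ) : ℂ) / h)))) :=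
    (((Complex.continuous_ofReal.tendsto _).comp h1).mul
      ((((Complex.continuous_ofReal.tendsto _).comp h2).neg.div_const h).cexp)).const_mul _
  have e : (((1 : ℝ) : ℂ) * Complex.exp (-(((1 / 4) * ∑ υ, z υ ^ 2 : ℝ) : ℂ) / h)) =
      Complex.exp (-((1 / 4) * ∑ υ, (z υ : ℂ) ^ 2) / h) := by
    push_cast
    rw [one_mul]
  rw [e] at h6
  refine h6.congr' ?_
  filter_upwards [self_mem_nhdsWithin] with t ht
  rw [← sqrt_pow_mul_harmAmp hω ht, harmKernel, harmPhase_toComplex, kernelAmp]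
  ring

end HarmonicKernel

/-! ### Kernels close to the harmonic one are approximate identities -/

section ApproximateIdentity

variable {ν : ℕ} {ω : Fin ν → ℝ} {h : ℂ}

theorem exists_le_sinhFactor (hω : ∀ υ, 0 < ω υ) {t : ℝ} (ht : 0 < t) :
    ∃ c, 0 < c ∧ ∀ υ, c ≤ sinhFactor (ω υ) t := by
  have h1 : ∀ᶠ c in 𝓝[>] (0 : ℝ), ∀ υ, c ≤ sinhFactor (ω υ) t := eventually_all.2 fun υ =>
    (eventually_le_nhds (sinhFactor_pos (hω υ) ht)).filter_mono nhdsWithin_le_nhds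
  obtain ⟨c, hc, hc0⟩ := (h1.and self_mem_nhdsWithin).exists
  exact ⟨c, hc0, hc⟩

theorem eventually_le_sinhFactor (hω : ∀ υ, 0 < ω υ) :
    ∀ᶠ t in 𝓝[>] (0 : ℝ), ∀ υ, 1 / 2 ≤ sinhFactor (ω υ) t :=
  eventually_all.2 fun υ => (tendsto_sinhFactor (hω υ)).eventually (eventually_ge_nhds (by norm_num))

theorem integrable_of_norm_le_harmKernel (hω : ∀ υ, 0 < ω υ) {t : ℝ} (ht : 0 < t) (hh : 0 < h.re)
    {y : Fin ν → ℝ} {k : (Fin ν → ℝ) → ℂ} (hk : Continuous k) {C : ℝ}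
    (hC : ∀ x, ‖k x‖ ≤ C * ‖harmKernel ω t h x y‖) : Integrable k := by
  obtain ⟨c, hc0, hc⟩ := exists_le_sinhFactor hω ht
  have hr : 0 < Real.sqrt t := Real.sqrt_pos.2 ht
  have hb : 0 < (h⁻¹).re * (c / 4) := mul_pos (inv_re_pos hh) (by positivity)
  have h1 : Integrable fun z => k (y + Real.sqrt t • z) := by
    refine (((integrable_exp_neg_mul_sum_sq hb).const_mul
      ‖(4 * (Real.pi : ℂ) * h) ^ (-(ν : ℂ) / 2)‖).const_mul (|C| / Real.sqrt t ^ ν)).mono'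
      (by fun_prop) (Eventually.of_forall fun z => ?_)
    have h2 := norm_scaled_harmKernel_le hω ht hh hc y z
    rw [div_mul_eq_mul_div, le_div_iff₀ (by positivity)]
    have h3 : ‖k (y + Real.sqrt t • z)‖ ≤ |C| * ‖harmKernel ω t h (y + Real.sqrt t • z) y‖ :=
      (hC _).trans (mul_le_mul_of_nonneg_right (le_abs_self C) (norm_nonneg _))
    calc _ ≤ |C| * ‖harmKernel ω t h (y + Real.sqrt t • z) y‖ * Real.sqrt t ^ ν :=
          mul_le_mul_of_nonneg_right h3 (by positivity)
      _ = |C| * (Real.sqrt t ^ ν * ‖harmKernel ω t h (y + Real.sqrt t • z) y‖) := by ring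
      _ ≤ _ := mul_le_mul_of_nonneg_left h2 (abs_nonneg _)
  have h4 : Integrable fun x => k (y + x) :=
    (integrable_comp_smul_iff (volume : Measure (Fin ν → ℝ)) (fun x => k (y + x)) hr.ne').1 h1
  simpa using h4.comp_add_left (-y)

/-- The bound for the integrals of the harmonic kernel. -/
def heatMass (ν : ℕ) (h : ℂ) : ℝ :=
  ∫ z : Fin ν → ℝ, ‖(4 * (Real.pi : ℂ) * h) ^ (-(ν : ℂ) / 2)‖ *
    Real.exp (-((h⁻¹).re * (1 / 2 / 4)) * ∑ υ, z υ ^ 2)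

theorem integral_norm_le_heatMass (hω : ∀ υ, 0 < ω υ) {t : ℝ} (ht : 0 < t) (hh : 0 < h.re)
    (hc : ∀ υ, 1 / 2 ≤ sinhFactor (ω υ) t) {y : Fin ν → ℝ} {k : (Fin ν → ℝ) → ℂ} {C : ℝ} (hC0 : 0 ≤ C)
    (hC : ∀ x, ‖k x‖ ≤ C * ‖harmKernel ω t h x y‖) : ∫ x, ‖k x‖ ≤ C * heatMass ν h := by
  have hr : 0 < Real.sqrt t := Real.sqrt_pos.2 ht
  have hb : 0 < (h⁻¹).re * (1 / 2 / 4) := mul_pos (inv_re_pos hh) (by positivity)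
  rw [integral_eq_integral_add_smul (fun x => ‖k x‖) y hr, smul_eq_mul, heatMass,
    ← integral_const_mul, ← integral_const_mul]
  refine integral_mono_of_nonneg (Eventually.of_forall fun z => by positivity)
    (((integrable_exp_neg_mul_sum_sq hb).const_mul _).const_mul C) (Eventually.of_forall fun z => ?_)
  have h2 := norm_scaled_harmKernel_le hω ht hh hc y z
  calc _ ≤ Real.sqrt t ^ ν * (C * ‖harmKernel ω t h (y + Real.sqrt t • z) y‖) :=
        mul_le_mul_of_nonneg_left (hC _) (by positivity)
    _ = C * (Real.sqrt t ^ ν * ‖harmKernel ω t h (y + Real.sqrt t • z) y‖) := by ring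
    _ ≤ _ := mul_le_mul_of_nonneg_left h2 hC0

/-- A kernel close to the harmonic one is an approximate identity. -/
theorem tendsto_integral_of_norm_sub_le (hω : ∀ υ, 0 < ω υ) (hh : 0 < h.re) {T : ℝ} (hT : 0 < T)
    {K : ℝ → (Fin ν → ℝ) → ℂ} {δ : ℝ → ℝ} (y : Fin ν → ℝ) (hK : ∀ t ∈ Ioo 0 T, Continuous (K t))
    (hδ : Tendsto δ (𝓝[>] 0) (𝓝 0)) (hδ1 : ∀ᶠ t in 𝓝[>] 0, δ t ≤ 1)
    (hb : ∀ t ∈ Ioo 0 T, ∀ x, ‖K t x - harmKernel ω t h x y‖ ≤ δ t * ‖harmKernel ω t h x y‖)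
    {f : (Fin ν → ℝ) → ℂ} (hf : Continuous f) {B : ℝ} (hB : ∀ x, ‖f x‖ ≤ B) :
    Tendsto (fun t => ∫ x, K t x * f x) (𝓝[>] 0) (𝓝 (f y)) := by
  have hIoo : Ioo 0 T ∈ 𝓝[>] (0 : ℝ) := Ioo_mem_nhdsGT hT
  set G : (Fin ν → ℝ) → ℝ := fun z => ‖(4 * (Real.pi : ℂ) * h) ^ (-(ν : ℂ) / 2)‖ *
    Real.exp (-((h⁻¹).re * (1 / 2 / 4)) * ∑ υ, z υ ^ 2) with hG
  have hGi : Integrable G := (integrable_exp_neg_mul_sum_sq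
    (mul_pos (inv_re_pos hh) (by positivity))).const_mul _
  have hdiff : ∀ t ∈ Ioo 0 T, (∀ υ, 1 / 2 ≤ sinhFactor (ω υ) t) → 0 ≤ δ t → ∀ z,
      ‖((Real.sqrt t ^ ν : ℝ) : ℂ) * K t (y + Real.sqrt t • z) -
        ((Real.sqrt t ^ ν : ℝ) : ℂ) * harmKernel ω t h (y + Real.sqrt t • z) y‖ ≤ δ t * G z :=
    fun t ht hc hδ0 z => by
      rw [← mul_sub, norm_mul, Complex.norm_real, Real.norm_of_nonneg (by positivity)]
      calc _ ≤ Real.sqrt t ^ ν * (δ t * ‖harmKernel ω t h (y + Real.sqrt t • z) y‖) :=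
            mul_le_mul_of_nonneg_left (hb t ht _) (by positivity)
        _ = δ t * (Real.sqrt t ^ ν * ‖harmKernel ω t h (y + Real.sqrt t • z) y‖) := by ring
        _ ≤ _ := mul_le_mul_of_nonneg_left (norm_scaled_harmKernel_le hω ht.1 hh hc y z) hδ0
  -- The harmonic kernel never vanishes, so the assumed bound at x = y forces δ t ≥ 0.
  have hδ0 : ∀ t ∈ Ioo 0 T, 0 ≤ δ t := fun t ht => by
    have h1 : 0 < ‖harmKernel ω t h y y‖ := by
      rw [norm_pos_iff, harmKernel, kernelAmp, harmAmp]
      have h3 : 4 * (Real.pi : ℂ) * h ≠ 0 :=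
        mul_ne_zero (mul_ne_zero (by norm_num) (by exact_mod_cast Real.pi_ne_zero))
          fun h0 => by simp [h0] at hh
      refine mul_ne_zero (mul_ne_zero ?_ (Finset.prod_ne_zero_iff.2 fun υ _ => ?_))
        (Complex.exp_ne_zero _)
      · rw [Complex.cpow_def_of_ne_zero h3]
        exact Complex.exp_ne_zero _
      · exact_mod_cast (div_pos (Real.sqrt_pos.2 (hω υ))
          (Real.sqrt_pos.2 (sinh_pos_of_pos (hω υ) ht.1))).ne'
    exact nonneg_of_mul_nonneg_left ((norm_nonneg _).trans (hb t ht y)) h1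
  have hlim : Tendsto (fun t => ∫ z, ((Real.sqrt t ^ ν : ℝ) : ℂ) * K t (y + Real.sqrt t • z) *
      f (y + Real.sqrt t • z)) (𝓝[>] 0) (𝓝 (∫ z : Fin ν → ℝ,
        (4 * (Real.pi : ℂ) * h) ^ (-(ν : ℂ) / 2) *
          Complex.exp (-((1 / 4) * ∑ υ, (z υ : ℂ) ^ 2) / h) * f y)) := by
    -- After x = y + √t z the rescaled harmonic kernel is at most G once all factors ωt / sh(ωt) are
    -- at least 1/2. The kernel K differs from it by at most δ t G ≤ G, which explains the 2.
    refine tendsto_integral_filter_of_dominated_convergence (fun z => 2 * G z * B) ?_ ?_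
      ((hGi.const_mul 2).mul_const B) (Eventually.of_forall fun z => ?_)
    · filter_upwards [hIoo] with t ht
      have := hK t ht
      exact Continuous.aestronglyMeasurable (by fun_prop)
    · filter_upwards [hIoo, eventually_le_sinhFactor hω, hδ1] with t ht hc h1
      refine Eventually.of_forall fun z => ?_
      rw [norm_mul]
      have hG0 : 0 ≤ G z := by positivity
      refine mul_le_mul ?_ (hB _) (norm_nonneg _) (by positivity)
      have h2 := hdiff t ht hc (hδ0 t ht) z
      have h3 := norm_scaled_harmKernel_le hω ht.1 hh hc y z
      have h4 : ‖((Real.sqrt t ^ ν : ℝ) : ℂ) * harmKernel ω t h (y + Real.sqrt t • z) y‖ ≤ G z := by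
        rw [norm_mul, Complex.norm_real, Real.norm_of_nonneg (by positivity)]
        exact h3
      have h5 := norm_le_norm_add_norm_sub'
        (((Real.sqrt t ^ ν : ℝ) : ℂ) * K t (y + Real.sqrt t • z))
        (((Real.sqrt t ^ ν : ℝ) : ℂ) * harmKernel ω t h (y + Real.sqrt t • z) y)
      nlinarith
    · have h1 : Tendsto (fun t => ((Real.sqrt t ^ ν : ℝ) : ℂ) * K t (y + Real.sqrt t • z) -
          ((Real.sqrt t ^ ν : ℝ) : ℂ) * harmKernel ω t h (y + Real.sqrt t • z) y) (𝓝[>] 0)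
          (𝓝 0) := by
        refine squeeze_zero_norm' (a := fun t => δ t * G z) ?_ (by simpa using hδ.mul_const (G z))
        filter_upwards [hIoo, eventually_le_sinhFactor hω] with t ht hc
        exact hdiff t ht hc (hδ0 t ht) z
      have h2 := h1.add (tendsto_scaled_harmKernel (h := h) hω y z)
      simp only [sub_add_cancel, zero_add] at h2
      have h3 : Tendsto (fun t => f (y + Real.sqrt t • z)) (𝓝[>] 0) (𝓝 (f y)) := by
        have hc : Continuous fun t => f (y + Real.sqrt t • z) := by fun_prop
        have h4 := hc.tendsto 0
        simp only [Real.sqrt_zero, zero_smul, add_zero] at h4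
        exact h4.mono_left nhdsWithin_le_nhds
      exact h2.mul h3
  rw [integral_mul_const, integral_heatKernel hh, one_mul] at hlim
  refine hlim.congr' ?_
  filter_upwards [hIoo] with t ht
  rw [integral_eq_integral_add_smul (fun x => K t x * f x) y (Real.sqrt_pos.2 ht.1),
    Complex.real_smul, ← integral_const_mul]
  refine integral_congr_ae (Eventually.of_forall fun z => ?_)
  simp only [mul_assoc]

end ApproximateIdentity

/-! ### The gas sum at real points -/

section RealPoints

variable {ν : ℕ} {ω : Fin ν → ℝ} {ρ : Measure (EuclideanSpace ℝ (Fin ν))} [IsFiniteMeasure ρ]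
  {σ : EuclideanSpace ℝ (Fin ν) → ℂ} {t : ℝ} {h : ℂ}

theorem toComplex_mem_strip (x : Fin ν → ℝ) : toComplex x ∈ strip ν 2 := by
  have h1 : (fun υ => (toComplex x υ).im) = (0 : Fin ν → ℝ) := by
    funext υ
    simp [toComplex]
  change ‖(WithLp.toLp 2 fun υ => (toComplex x υ).im : EuclideanSpace ℝ (Fin ν))‖ < 2
  rw [h1]
  simp

theorem continuous_toComplex : Continuous (toComplex (ν := ν)) := by
  unfold toComplex
  fun_prop

theorem im_path_toComplex (x y : Fin ν → ℝ) (p : Pt ν) :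
    (path ω t (toComplex x) (toComplex y) p).im = 0 := by
  simp [path, qPath, toComplex, ← Complex.ofReal_mul, ← Complex.ofReal_add]

/-- At real points the path is real, so the rate B = 0 is allowed and the n-th term is at most
r^n/n!. The term n = 0 is 1, and the rest is bounded by e^r - 1. The integral of exp(0·‖ξ‖) is the
total mass, written in the form that the bound with rate B produces. -/
theorem norm_gasSum_sub_one_le (hω : ∀ υ, 0 < ω υ) (hσ1 : ∀ ξ, ‖σ ξ‖ ≤ 1)
    (h5 : Integrable (fun ξ => Real.exp (5 * ‖ξ‖)) ρ) (ht : 0 ≤ t) (hh : 0 ≤ h.re)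
    (x y : Fin ν → ℝ) : ‖gasSum ω ρ σ t (toComplex x) (toComplex y) h - 1‖ ≤
      Real.exp (t / ‖h‖ * ∫ ξ, Real.exp (0 * ‖ξ‖) ∂ρ) - 1 := by
  set r := t / ‖h‖ * ∫ ξ, Real.exp (0 * ‖ξ‖) ∂ρ with hr
  have h1 := summable_gasInt hω hσ1 h5 ht hh (toComplex_mem_strip x) (toComplex_mem_strip y)
  have h2 : HasSum (fun n : ℕ => r ^ n / (n.factorial : ℝ)) (Real.exp r) := by
    rw [Real.exp_eq_exp_ℝ]
    exact NormedSpace.expSeries_div_hasSum_exp r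
  have h3 : HasSum (fun n : ℕ => r ^ (n + 1) / ((n + 1).factorial : ℝ)) (Real.exp r - 1) := by
    have := (hasSum_nat_add_iff' 1).2 h2
    simpa using this
  have h4 := (hasSum_nat_add_iff' 1).2 h1.hasSum
  have h0 : gasInt ω ρ σ t (toComplex x) (toComplex y) h (Fin 0) = 1 := by
    rw [gasInt]
    have : ∀ c : Fin 0 → Pt ν, gasFun ω σ t (toComplex x) (toComplex y) h c = 1 := fun c => by
      rw [gasFun_eq]; simp [linForm]
    simp [this, confMeasure, Measure.real]
  simp only [Finset.range_one, Finset.sum_singleton, h0, Nat.factorial_zero, Nat.cast_one,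
    div_one] at h4
  rw [gasSum, ← h4.tsum_eq]
  refine tsum_of_norm_bounded h3 fun n => ?_
  rw [norm_div, Complex.norm_natCast]
  refine div_le_div_of_nonneg_right (norm_gasInt_le hω hσ1 h5 ht hh (by norm_num)
    (fun p _ => ?_) (n + 1)) (Nat.cast_nonneg _)
  rw [im_path_toComplex]
  simp

end RealPoints

/-! ### The initial value of the kernel -/

section InitialValue

variable {ν : ℕ} {ω : Fin ν → ℝ} {μ : ComplexMeasure (EuclideanSpace ℝ (Fin ν))}
  [IsFiniteMeasure (VectorMeasure.variation μ)] {σ : EuclideanSpace ℝ (Fin ν) → ℂ}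
  (hσ : IsDensity μ σ) (hω : ∀ υ, 0 < ω υ)
  (h5 : Integrable (fun ξ => Real.exp (5 * ‖ξ‖)) (VectorMeasure.variation μ))
  {T : ℝ} (hT : 0 < T)
  (hM : 2 * T ^ 2 * ∫ ξ, Real.exp (5 * ‖ξ‖) ∂(VectorMeasure.variation μ) < 1)

include hσ hω h5 hT hM

theorem continuous_kernelU {t : ℝ} (ht : t ∈ Ioo 0 T) {h : ℂ} (hh : h ∈ rightHalfPlane) :
    Continuous fun p : (Fin ν → ℝ) × (Fin ν → ℝ) =>
      kernelU ω μ t (toComplex p.1) (toComplex p.2) h := by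
  have c1 : Continuous fun p : (Fin ν → ℝ) × (Fin ν → ℝ) =>
      phiSeries ω μ t (toComplex p.1) (toComplex p.2) :=
    ((isC1Analytic_phiSeries hσ hω h5 hT hM).1 t ⟨by linarith [ht.1], ht.2⟩).continuousOn.comp_continuous
      (f := fun p : (Fin ν → ℝ) × (Fin ν → ℝ) => (toComplex p.1, toComplex p.2))
      ((continuous_toComplex.comp continuous_fst).prodMk (continuous_toComplex.comp continuous_snd))
      fun p => ⟨toComplex_mem_strip _, toComplex_mem_strip _⟩
  have c2 : Continuous fun p : (Fin ν → ℝ) × (Fin ν → ℝ) =>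
      wSeries ω μ t (toComplex p.1) (toComplex p.2) h :=
    ((isC1Analytic_wSeries hσ hω h5 hT hM).1 t ⟨ht.1.le, ht.2⟩).continuousOn.comp_continuous
      (f := fun p : (Fin ν → ℝ) × (Fin ν → ℝ) => (toComplex p.1, toComplex p.2, h))
      ((continuous_toComplex.comp continuous_fst).prodMk
        ((continuous_toComplex.comp continuous_snd).prodMk continuous_const))
      fun p => ⟨toComplex_mem_strip _, toComplex_mem_strip _, hh⟩
  unfold kernelU phase
  have c3 : ∀ υ, Continuous fun p : (Fin ν → ℝ) × (Fin ν → ℝ) => toComplex p.1 υ := fun υ =>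
    (continuous_apply υ).comp (continuous_toComplex.comp continuous_fst)
  have c4 : ∀ υ, Continuous fun p : (Fin ν → ℝ) × (Fin ν → ℝ) => toComplex p.2 υ := fun υ =>
    (continuous_apply υ).comp (continuous_toComplex.comp continuous_snd)
  fun_prop

theorem continuous_kernelU_left {t : ℝ} (ht : t ∈ Ioo 0 T) {h : ℂ} (hh : h ∈ rightHalfPlane)
    (y : Fin ν → ℝ) :
    Continuous fun x : Fin ν → ℝ => kernelU ω μ t (toComplex x) (toComplex y) h :=
  Continuous.comp (g := fun p : (Fin ν → ℝ) × (Fin ν → ℝ) =>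
      kernelU ω μ t (toComplex p.1) (toComplex p.2) h) (f := fun x : Fin ν → ℝ => (x, y))
    (continuous_kernelU hσ hω h5 hT hM ht hh) (by fun_prop)

theorem continuous_kernelU_right {t : ℝ} (ht : t ∈ Ioo 0 T) {h : ℂ} (hh : h ∈ rightHalfPlane)
    (x : Fin ν → ℝ) :
    Continuous fun y : Fin ν → ℝ => kernelU ω μ t (toComplex x) (toComplex y) h :=
  Continuous.comp (g := fun p : (Fin ν → ℝ) × (Fin ν → ℝ) =>
      kernelU ω μ t (toComplex p.1) (toComplex p.2) h) (f := fun y : Fin ν → ℝ => (x, y))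
    (continuous_kernelU hσ hω h5 hT hM ht hh) (by fun_prop)

/-- The relative distance of `kernelU` to the harmonic kernel. -/
def kernelErr (μ : ComplexMeasure (EuclideanSpace ℝ (Fin ν))) (h : ℂ) (t : ℝ) : ℝ :=
  Real.exp (t / ‖h‖ * ∫ ξ, Real.exp (0 * ‖ξ‖) ∂(VectorMeasure.variation μ)) - 1

omit hσ hω h5 hT hM [IsFiniteMeasure (VectorMeasure.variation μ)] in
theorem tendsto_kernelErr (h : ℂ) : Tendsto (kernelErr μ h) (𝓝[>] 0) (𝓝 0) := by
  have hc : Continuous (kernelErr μ h) := by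
    unfold kernelErr
    fun_prop
  have h1 := hc.tendsto 0
  simp only [kernelErr, zero_div, zero_mul, Real.exp_zero, sub_self] at h1
  exact h1.mono_left nhdsWithin_le_nhds

theorem norm_kernelU_sub_le {t : ℝ} (ht : t ∈ Ioo 0 T) {h : ℂ} (hh : h ∈ rightHalfPlane)
    (x y : Fin ν → ℝ) :
    ‖kernelU ω μ t (toComplex x) (toComplex y) h - harmKernel ω t h x y‖ ≤
      kernelErr μ h t * ‖harmKernel ω t h x y‖ := by
  have hh' : 0 < h.re := hh
  rw [kernelU_eq hσ hω h5 hT hM ⟨ht.1.le, ht.2.le⟩ (toComplex_mem_strip x) (toComplex_mem_strip y) hh,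
    ← mul_assoc, ← harmKernel, ← mul_sub_one, norm_mul, mul_comm]
  exact mul_le_mul_of_nonneg_right (norm_gasSum_sub_one_le hω hσ.norm_le h5 ht.1.le hh'.le x y)
    (norm_nonneg _)

theorem norm_kernelU_le {t : ℝ} (ht : t ∈ Ioo 0 T) {h : ℂ} (hh : h ∈ rightHalfPlane)
    (x y : Fin ν → ℝ) : ‖kernelU ω μ t (toComplex x) (toComplex y) h‖ ≤
      (1 + kernelErr μ h t) * ‖harmKernel ω t h x y‖ := by
  have h1 := norm_kernelU_sub_le hσ hω h5 hT hM ht hh x y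
  have h2 := norm_le_norm_add_norm_sub' (kernelU ω μ t (toComplex x) (toComplex y) h)
    (harmKernel ω t h x y)
  linarith

theorem tendsto_integral_kernelU {h : ℂ} (hh : h ∈ rightHalfPlane) (y : Fin ν → ℝ)
    {f : (Fin ν → ℝ) → ℂ} (hf : Continuous f) {B : ℝ} (hB : ∀ x, ‖f x‖ ≤ B) :
    Tendsto (fun t => ∫ x : Fin ν → ℝ, kernelU ω μ t (toComplex x) (toComplex y) h * f x)
      (𝓝[>] 0) (𝓝 (f y)) :=
  tendsto_integral_of_norm_sub_le hω hh hT y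
    (K := fun t x => kernelU ω μ t (toComplex x) (toComplex y) h)
    (fun t ht => continuous_kernelU_left hσ hω h5 hT hM ht hh y) (tendsto_kernelErr h)
    ((tendsto_kernelErr h).eventually (eventually_le_nhds zero_lt_one))
    (fun t ht x => norm_kernelU_sub_le hσ hω h5 hT hM ht hh x y) hf hB

/-- By Fubini the x-integral is done first; for each y it tends to F(y, y). It is bounded by a
constant times `heatMass`, uniformly in y and in small t, and vanishes for y outside the compact
projection of the support, so dominated convergence in y applies. -/
theorem tendsto_integral_prod_kernelU {h : ℂ} (hh : h ∈ rightHalfPlane)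
    {F : (Fin ν → ℝ) × (Fin ν → ℝ) → ℂ} (hF : Continuous F) (hFc : HasCompactSupport F) :
    (∀ t ∈ Ioo 0 T, Integrable fun p : (Fin ν → ℝ) × (Fin ν → ℝ) =>
        kernelU ω μ t (toComplex p.1) (toComplex p.2) h * F p) ∧
      Tendsto (fun t => ∫ p : (Fin ν → ℝ) × (Fin ν → ℝ),
          kernelU ω μ t (toComplex p.1) (toComplex p.2) h * F p)
        (𝓝[>] 0) (𝓝 (∫ x : Fin ν → ℝ, F (x, x))) := by
  have hh' : 0 < h.re := hh
  have hint : ∀ t ∈ Ioo 0 T, Integrable fun p : (Fin ν → ℝ) × (Fin ν → ℝ) =>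
        kernelU ω μ t (toComplex p.1) (toComplex p.2) h * F p := fun t ht =>
    ((continuous_kernelU hσ hω h5 hT hM ht hh).mul hF).integrable_of_hasCompactSupport
      hFc.mul_left
  refine ⟨hint, ?_⟩
  obtain ⟨B, hB⟩ := hFc.exists_bound_of_continuous hF
  have hB0 : 0 ≤ B := (norm_nonneg _).trans (hB 0)
  have hIoo : Ioo 0 T ∈ 𝓝[>] (0 : ℝ) := Ioo_mem_nhdsGT hT
  set L : Set (Fin ν → ℝ) := Prod.snd '' tsupport F with hL
  have hLc : IsCompact L := hFc.isCompact.image continuous_snd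
  have hFL : ∀ x y, y ∉ L → F (x, y) = 0 := fun x y hy => by
    refine image_eq_zero_of_notMem_tsupport fun hxy => hy ⟨(x, y), hxy, rfl⟩
  have hdom : Integrable (L.indicator fun _ => 2 * B * heatMass ν h) :=
    (integrable_indicator_iff hLc.measurableSet).2 (integrableOn_const hLc.measure_lt_top.ne)
  have hlim : Tendsto (fun t => ∫ y : Fin ν → ℝ, ∫ x : Fin ν → ℝ,
      kernelU ω μ t (toComplex x) (toComplex y) h * F (x, y)) (𝓝[>] 0)
      (𝓝 (∫ y : Fin ν → ℝ, F (y, y))) := by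
    refine tendsto_integral_filter_of_dominated_convergence _ ?_ ?_ hdom
      (Eventually.of_forall fun y => ?_)
    · filter_upwards [hIoo] with t ht
      exact (hint t ht).integral_prod_right.aestronglyMeasurable
    · filter_upwards [hIoo, eventually_le_sinhFactor hω,
        (tendsto_kernelErr (μ := μ) h).eventually (eventually_le_nhds zero_lt_one)] with t ht hc h1
      refine Eventually.of_forall fun y => ?_
      by_cases hy : y ∈ L
      · rw [indicator_of_mem hy]
        refine (norm_integral_le_integral_norm _).trans (integral_norm_le_heatMass hω ht.1 hh' hc
          (y := y) (by positivity) fun x => ?_)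
        rw [norm_mul]
        have h2 := norm_kernelU_le hσ hω h5 hT hM ht hh x y
        calc _ ≤ ((1 + kernelErr μ h t) * ‖harmKernel ω t h x y‖) * B :=
              mul_le_mul h2 (hB _) (norm_nonneg _) ((norm_nonneg _).trans h2)
          _ ≤ (2 * ‖harmKernel ω t h x y‖) * B := by gcongr; linarith
          _ = _ := by ring
      · rw [indicator_of_notMem hy]
        simp [hFL _ y hy]
    · exact tendsto_integral_kernelU hσ hω h5 hT hM hh y (f := fun x => F (x, y)) (by fun_prop)
        fun x => hB _
  refine hlim.congr' ?_
  filter_upwards [hIoo] with t ht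
  exact (integral_prod_symm _ (hint t ht)).symm

theorem hasDeltaInitialValue_kernelU : HasDeltaInitialValue T (kernelU ω μ) := by
  intro h hh
  have hh' : 0 < h.re := hh
  refine ⟨fun y => ⟨fun t ht => ?_, fun f => ?_⟩, fun x => ⟨fun t ht => ?_, fun f => ?_⟩,
    fun F hF hFc => tendsto_integral_prod_kernelU hσ hω h5 hT hM hh hF hFc⟩
  · exact integrable_of_norm_le_harmKernel hω ht.1 hh' (y := y)
      (continuous_kernelU_left hσ hω h5 hT hM ht hh y)
      fun x => norm_kernelU_le hσ hω h5 hT hM ht hh x y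
  · exact tendsto_integral_kernelU hσ hω h5 hT hM hh y f.continuous f.norm_coe_le_norm
  · exact integrable_of_norm_le_harmKernel hω ht.1 hh' (y := x)
      (continuous_kernelU_right hσ hω h5 hT hM ht hh x)
      fun y => (norm_kernelU_le hσ hω h5 hT hM ht hh x y).trans_eq (by rw [harmKernel_comm])
  · exact tendsto_integral_of_norm_sub_le hω hh hT x
      (K := fun t y => kernelU ω μ t (toComplex x) (toComplex y) h)
      (fun t ht => continuous_kernelU_right hσ hω h5 hT hM ht hh x) (tendsto_kernelErr h)
      ((tendsto_kernelErr h).eventually (eventually_le_nhds zero_lt_one))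
      (fun t ht y => by
        rw [harmKernel_comm]
        exact norm_kernelU_sub_le hσ hω h5 hT hM ht hh x y) f.continuous f.norm_coe_le_norm

end InitialValue

end HeatKernelExpansion

end

/-! ### The main theorem -/

open HeatKernelExpansion in
theorem mainTheorem7 (ν : ℕ) (hν : 1 ≤ ν) (ω : Fin ν → ℝ) (hω : ∀ υ, 0 < ω υ)
    (T : ℝ) (hT : 0 < T) (μ : ComplexMeasure (EuclideanSpace ℝ (Fin ν)))
    (hμ : ∀ R : ℝ, 0 < R → Integrable (fun ξ => Real.exp (R * ‖ξ‖)) (VectorMeasure.variation μ))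
    (hM : 4 * T ^ 2 * Mnorm μ < 1) :
    (∀ t ∈ Ioo (-T) T, ∀ x ∈ strip ν 2, ∀ y ∈ strip ν 2,
      Summable (phiTerm ω μ t x y)) ∧
    (∀ t ∈ Ico 0 T, ∀ x ∈ strip ν 2, ∀ y ∈ strip ν 2, ∀ h ∈ rightHalfPlane,
      Summable fun n : ℕ => wTerm ω μ (n + 1) t x y h) ∧
    IsC1Analytic (Ioo (-T) T) (strip ν 2 ×ˢ strip ν 2)
      (fun t (p : (Fin ν → ℂ) × (Fin ν → ℂ)) => phiSeries ω μ t p.1 p.2) ∧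
    IsC1Analytic (Ico 0 T) (strip ν 2 ×ˢ strip ν 2 ×ˢ rightHalfPlane)
      (fun t (p : (Fin ν → ℂ) × (Fin ν → ℂ) × ℂ) => wSeries ω μ t p.1 p.2.1 p.2.2) ∧
    SolvesHeatEquation ω μ T (kernelU ω μ) ∧
    HasDeltaInitialValue T (kernelU ω μ) := by
  have h5 := hμ 5 (by norm_num)
  have hfin : IsFiniteMeasure (VectorMeasure.variation μ) := by
    have h1 : Integrable (fun _ : EuclideanSpace ℝ (Fin ν) => (1 : ℝ))
        (VectorMeasure.variation μ) := by
      refine h5.mono' aestronglyMeasurable_const (Eventually.of_forall fun ξ => ?_)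
      rw [norm_one]
      exact Real.one_le_exp (by positivity)
    exact (integrable_const_iff_isFiniteMeasure one_ne_zero).1 h1
  obtain ⟨σ, hσm, hσ1, hσc⟩ := exists_density μ
  have hσ : IsDensity μ σ := ⟨hσm, hσ1, hσc⟩
  -- The tree estimates require only 2T²M < 1, which is weaker than the assumed bound since T²M ≥ 0.
  have hM' : 2 * T ^ 2 * ∫ ξ, Real.exp (5 * ‖ξ‖) ∂(VectorMeasure.variation μ) < 1 := by
    have h0 : 0 ≤ T ^ 2 * Mnorm μ :=
      mul_nonneg (sq_nonneg T) (integral_nonneg fun ξ => (Real.exp_pos _).le)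
    rw [Mnorm] at h0 hM
    linarith
  exact ⟨fun t ht x hx y hy => (hasSum_phiTerm hσ hω h5 hT hM' ⟨ht.1.le, ht.2.le⟩ hx hy).summable,
    fun t ht x hx y hy h hh =>
      (hasSum_wTerm hσ hω h5 hT hM' ⟨ht.1, ht.2.le⟩ hx hy hh).summable,
    isC1Analytic_phiSeries hσ hω h5 hT hM', isC1Analytic_wSeries hσ hω h5 hT hM',
    solvesHeatEquation_kernelU hσ hω h5 hT hM', hasDeltaInitialValue_kernelU hσ hω h5 hT hM'⟩
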